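/- Let $n\ge 2$ be an integer and consider the radial Euler equations in $n$ dimensions for $U(t,r),\rho(t,r),S(t,r)$ ($r>0$, $\rho>0$), $$U_t+UU_r+\tfrac1\rho(p_SS_r+p_\rho\rho_r)=0,\qquad \rho_t+(U\rho)_r+\tfrac{n-1}{r}U\rho=0,\qquad S_t+US_r=0,$$ with a smooth equation of state $p=p(\rho,S)$ on a domain $I\times J$ (open intervals, $I\subset(0,\infty)$), not constant on any open part of it. A (Lie) point symmetry is a smooth vector field $X=\tau\partial_t+\xi\partial_r+\eta^\rho\partial_\rho+\eta^S\partial_S+\eta^U\partial_U$, with coefficients depending on $(t,r,\rho,S,U)$ in an open box over $I\times J$, whose prolongation applied to the equations vanishes on the solution manifold in jet space. Below, $\kappa=\kappa(S)$ is smooth with $\kappa'\neq0$, the function $f$ (except the arbitrary $f(\rho,S)$ of case 1) is smooth and non-constant, $F=F(S)$ is an arbitrary smooth function, $k,q$ are constants, and $p$ is always understood modulo an additive constant. Put $X_1=\partial_t$, $X_2=t\partial_t+r\partial_r$. (i) For a general equation of state, namely one that is not of a form listed in (ii) on any sub-domain, the point symmetries are exactly the linear combinations of $X_1$ and $X_2$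 (which are symmetries for every $p$). (ii) Additional point symmetries exist for the equations of state $\kappa(S)f(\rho)$; $f(\rho)+\kappa(S)$; $f(\kappa(S)\rho)\rho^{1+q}$ with $q\ne-1$; $f(\kappa(S)\rho)+k\ln\rho$; $f(\rho)$; $\kappa(S)\rho^{1+2/n}$; $\kappa(S)$; and they exist only if $p$ is of one of these forms (or a specialization) on some sub-domain. (iii) Consider the following cases, with $Y_1=r\partial_r+U\partial_U+\frac{2\kappa}{\kappa'}\partial_S$, $Y_2=\frac1{\kappa'}\partial_S$, $Y_3=qr\partial_r+qU\partial_U+2\rho\partial_\rho$, $Y_4=r\partial_r+U\partial_U-2\rho\partial_\rho$, $Y_5=r\partial_r+U\partial_U+n\rho\partial_\rho$, $Y_6=t^2\partial_t+rt\partial_r+(r-tU)\partial_U-nt\rho\partial_\rho$, $Y_F=F(S)\partial_S$. The listed generators are in addition to $X_1,X_2$; $A_{2,1}$ is the non-abelian two-dimensional Lie algebra, $A_1$ the one-dimensional one, and $A_\infty$ is the Lie algebra of smooth vector fields on the interval $J$. 1. $f(\rho,S)$: none; $A_{2,1}$. 2. $\kappa(S)f(\rho)$: $Y_1$; $A_{2,1}\oplus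 A_1$. 3. $\kappa(S)+f(\rho)$: $Y_2$; $A_{2,1}\oplus A_1$. 4. $f(\kappa(S)\rho)\rho^{1+q}$, $q\ne-1$: $qr\partial_r+qU\partial_U+2\rho\partial_\rho-\frac{2\kappa}{\kappa'}\partial_S$; $A_{2,1}\oplus A_1$. 5. $f(\kappa(S)\rho)+k\ln\rho$: $r\partial_r+U\partial_U-2\rho\partial_\rho+\frac{2\kappa}{\kappa'}\partial_S$; $A_{2,1}\oplus A_1$. 6. $\kappa(S)\rho^{1+q}$, $q\neq-1$: $Y_1,Y_3$; $A_{2,1}\oplus2A_1$. 7. $\kappa(S)+k\ln\rho$, $k\ne0$: $Y_2,Y_4$; $A_{2,1}\oplus2A_1$. 8. $\kappa(S)\rho^{1+2/n}$: $Y_1,Y_5,Y_6$; $\mathfrak{sl}(2,\mathbb R)\oplus2A_1$. 9. $f(\rho)$, where on no subinterval $(\rho f')'=0$ or $(\rho f'/(f+C))'=0$ for a constant $C$: all $Y_F$; $A_{2,1}\oplus A_\infty$. 10. $\kappa(S)$: $Y_4$ and all $\frac{(F\kappa')'}{\kappa'}\rho\partial_\rho+F\partial_S$; $A_{2,1}\oplus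 A_1\oplus A_\infty$. 11. $k\ln\rho$, $k\ne0$: $Y_4$ and all $Y_F$; $A_{2,1}\oplus A_1\oplus A_\infty$. 12. $k\rho^{1+q}$, $k\ne0$, $q\neq-1$: $Y_3$ and all $Y_F$; $A_{2,1}\oplus A_1\oplus A_\infty$. 13. $k\rho^{1+2/n}$, $k\ne0$: $Y_5,Y_6$ and all $Y_F$; $\mathfrak{sl}(2,\mathbb R)\oplus A_1\oplus A_\infty$. In each case the listed vector fields are point symmetries; their commutators are $[X_1,X_2]=X_1$ and, in cases 8 and 13, $[X_1,Y_6]=2X_2-Y_5$, $[X_2,Y_6]=Y_6$, all others being zero (a family depending on $F$ counting as one entry); and their linear span is a Lie algebra isomorphic to the stated one. This span consists of all point symmetries of $p$, unless $p$ on some sub-domain is also an instance of another of the cases with at least as many listed generators (a family counting as one). Each of the thirteen cases does occur with the listed algebra as the maximal one. The classification is complete in the following sense: for every equation of state, every domain contains a sub-domain over which the point symmetries are exactly the linear combinations of the generators listed for those cases of which $p$ is an instance there. (There may be several such cases: for instance $p=\kappa(S)+k\rho^{1+q}$, with $k\neq0$, $q\neq-1$, belongs to cases 3 and 4, and its symmetry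 algebra is spanned by the generators of both.) -/

import Mathlib

open Set
open scoped ContDiff

noncomputable section

namespace RadialEuler

/-! ### Domains -/

/-- A non-empty open interval of the real line, bounded or not. -/
structure OpenInterval where
  carrier : Set ℝ
  isOpen : IsOpen carrier
  nonempty : carrier.Nonempty
  ordConnected : carrier.OrdConnected

/-- A box in the half-plane of thermodynamic variables `(ρ, S)`, `ρ > 0`. -/
structure EosDomain where
  I : OpenInterval
  J : OpenInterval
  pos : I.carrier ⊆ Ioi 0

/-- `D'` is a sub-box of `D`. -/
def EosDomain.Sub (D' D : EosDomain) : Prop :=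
  D'.I.carrier ⊆ D.I.carrier ∧ D'.J.carrier ⊆ D.J.carrier

/-- A box of values of `(t, r, U)`, with `r > 0`. -/
structure KinDomain where
  T : OpenInterval
  R : OpenInterval
  V : OpenInterval
  pos : R.carrier ⊆ Ioi 0

/-- Points `(t, r, ρ, S, U)`. -/
abbrev Pt := ℝ × ℝ × ℝ × ℝ × ℝ

/-- The open box of points `(t, r, ρ, S, U)` given by the two kinds of domains. -/
def box (K : KinDomain) (D : EosDomain) : Set Pt :=
  {z | z.1 ∈ K.T.carrier ∧ z.2.1 ∈ K.R.carrier ∧ z.2.2.1 ∈ D.I.carrier ∧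
    z.2.2.2.1 ∈ D.J.carrier ∧ z.2.2.2.2 ∈ K.V.carrier}

/-- `p` is an equation of state on `D`: it is smooth, and it is not constant
(on any piece of `D`). -/
def IsEos (D : EosDomain) (p : ℝ → ℝ → ℝ) : Prop :=
  ContDiffOn ℝ ∞ (fun x : ℝ × ℝ => p x.1 x.2) (D.I.carrier ×ˢ D.J.carrier) ∧
  ∀ D' : EosDomain, D'.Sub D →
    ∃ ρ ∈ D'.I.carrier, ∃ S ∈ D'.J.carrier, ∃ ρ' ∈ D'.I.carrier, ∃ S' ∈ D'.J.carrier,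
      p ρ S ≠ p ρ' S'

/-! ### Jet space, radial Euler equations, point symmetries -/

/-- The first-order jet space: `(z, v, w)` with `z = (t, r, ρ, S, U)`,
`v = (ρ_t, S_t, U_t)`, `w = (ρ_r, S_r, U_r)`. -/
abbrev Jet := Pt × (ℝ × ℝ × ℝ) × (ℝ × ℝ × ℝ)

/-- The left-hand sides of the radial Euler equations in `n` dimensions (velocity, density,
entropy), as functions on the jet space. -/
def euler (n : ℕ) (p : ℝ → ℝ → ℝ) : Jet → ℝ × ℝ × ℝ :=
  fun ((_, r, ρ, S, U), (ρ_t, S_t, U_t), (ρ_r, S_r, U_r)) =>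
    (U_t + U * U_r + (deriv (fun s => p ρ s) S * S_r + deriv (fun x => p x S) ρ * ρ_r) / ρ,
      ρ_t + (U_r * ρ + U * ρ_r) + ((n : ℝ) - 1) / r * U * ρ,
      S_t + U * S_r)

/-- Vector fields `τ ∂_t + ξ ∂_r + η^ρ ∂_ρ + η^S ∂_S + η^U ∂_U`, as the functions
`(τ, ξ, η^ρ, η^S, η^U)` of `(t, r, ρ, S, U)`. -/
abbrev VField := Pt → Pt

/-- The total `t`-derivative of the coefficients of a vector field. -/
def totalDt (X : VField) (j : Jet) : Pt := fderiv ℝ X j.1 (1, 0, j.2.1)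

/-- The total `r`-derivative of the coefficients of a vector field. -/
def totalDr (X : VField) (j : Jet) : Pt := fderiv ℝ X j.1 (0, 1, j.2.2)

/-- The first prolongation of a vector field to the jet space, with the coefficients
`D_t η - (D_t τ) u_t - (D_t ξ) u_r` of `∂_{u_t}` and
`D_r η - (D_r τ) u_t - (D_r ξ) u_r` of `∂_{u_r}`, for `u = ρ, S, U`. -/
def prolong (X : VField) : Jet → Jet := fun j =>
  (X j.1,
    (totalDt X j).2.2 - (totalDt X j).1 • j.2.1 - (totalDt X j).2.1 • j.2.2,
    (totalDr X j).2.2 - (totalDr X j).1 • j.2.1 - (totalDr X j).2.1 • j.2.2)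

/-- `X` generates a (local) Lie point symmetry on `Ω`: its coefficients are smooth, and its
prolongation applied to the equations vanishes on the solution manifold. -/
def IsPointSymmetry (n : ℕ) (p : ℝ → ℝ → ℝ) (Ω : Set Pt) (X : VField) : Prop :=
  ContDiffOn ℝ ∞ X Ω ∧
  ∀ j : Jet, j.1 ∈ Ω → euler n p j = 0 → fderiv ℝ (euler n p) j (prolong X j) = 0

/-- On `Ω`, `X` is a finite linear combination of members of `G`, with constant coefficients. -/
def InSpan (Ω : Set Pt) (G : Set VField) (X : VField) : Prop :=
  ∃ Y ∈ Submodule.span ℝ G, EqOn X Y Ω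

/-- The set of all point symmetries on `Ω` is the linear span of `G`. -/
def SymmetriesAre (n : ℕ) (p : ℝ → ℝ → ℝ) (Ω : Set Pt) (G : Set VField) : Prop :=
  ∀ X : VField, IsPointSymmetry n p Ω X ↔ InSpan Ω G X

/-! ### The generators -/

/-- `∂_t` -/
def X1 : VField := fun _ => (1, 0, 0, 0, 0)

/-- `t ∂_t + r ∂_r` -/
def X2 : VField := fun (t, r, _, _, _) => (t, r, 0, 0, 0)

/-- `q r ∂_r + q U ∂_U + 2 ρ ∂_ρ - (2 κ / κ') ∂_S` -/
def Xscal (κ : ℝ → ℝ) (q : ℝ) : VField :=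
  fun (_, r, ρ, S, U) => (0, q * r, 2 * ρ, -(2 * κ S / deriv κ S), q * U)

/-- `r ∂_r + U ∂_U - 2 ρ ∂_ρ + (2 κ / κ') ∂_S` -/
def XlogScal (κ : ℝ → ℝ) : VField :=
  fun (_, r, ρ, S, U) => (0, r, -(2 * ρ), 2 * κ S / deriv κ S, U)

/-- `r ∂_r + U ∂_U + (2 κ / κ') ∂_S` -/
def Xprod (κ : ℝ → ℝ) : VField :=
  fun (_, r, _, S, U) => (0, r, 0, 2 * κ S / deriv κ S, U)

/-- `(1 / κ') ∂_S` -/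
def Xsum (κ : ℝ → ℝ) : VField := fun (_, _, _, S, _) => (0, 0, 0, 1 / deriv κ S, 0)

/-- `q r ∂_r + q U ∂_U + 2 ρ ∂_ρ` -/
def Xpow (q : ℝ) : VField := fun (_, r, ρ, _, U) => (0, q * r, 2 * ρ, 0, q * U)

/-- `r ∂_r + U ∂_U - 2 ρ ∂_ρ` -/
def Xlog : VField := fun (_, r, ρ, _, U) => (0, r, -(2 * ρ), 0, U)

/-- `r ∂_r + U ∂_U + n ρ ∂_ρ` -/
def Xpow' (n : ℕ) : VField := fun (_, r, ρ, _, U) => (0, r, n * ρ, 0, U)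

/-- `t² ∂_t + r t ∂_r + (r - t U) ∂_U - n t ρ ∂_ρ` -/
def Xconf (n : ℕ) : VField :=
  fun (t, r, ρ, _, U) => (t ^ 2, r * t, -(n * t * ρ), 0, r - t * U)

/-- `F(S) ∂_S` -/
def Xent (F : ℝ → ℝ) : VField := fun (_, _, _, S, _) => (0, 0, 0, F S, 0)

/-- `((F κ')' / κ') ρ ∂_ρ + F(S) ∂_S` -/
def XentW (κ F : ℝ → ℝ) : VField := fun (_, _, ρ, S, _) =>
  (0, 0, deriv (fun s => F s * deriv κ s) S / deriv κ S * ρ, F S, 0)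

/-- The smooth functions on an interval. -/
def SmoothFun (J : OpenInterval) : Set (ℝ → ℝ) := {F | ContDiffOn ℝ ∞ F J.carrier}

/-! ### The cases -/

/-- The thirteen kinds of equations of state, with their free functions and constants. -/
inductive EosCase
  | c1 (f : ℝ → ℝ → ℝ)
  | c2 (κ f : ℝ → ℝ)
  | c3 (κ f : ℝ → ℝ)
  | c4 (κ f : ℝ → ℝ) (q : ℝ)
  | c5 (κ f : ℝ → ℝ) (k : ℝ)
  | c6 (κ : ℝ → ℝ) (q : ℝ)
  | c7 (κ : ℝ → ℝ) (k : ℝ)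
  | c8 (κ : ℝ → ℝ)
  | c9 (f : ℝ → ℝ)
  | c10 (κ : ℝ → ℝ)
  | c11 (k : ℝ)
  | c12 (k q : ℝ)
  | c13 (k : ℝ)

/-- The number of the case. -/
def EosCase.number : EosCase → ℕ
  | c1 _ => 1
  | c2 _ _ => 2
  | c3 _ _ => 3
  | c4 _ _ _ => 4
  | c5 _ _ _ => 5
  | c6 _ _ => 6
  | c7 _ _ => 7
  | c8 _ => 8
  | c9 _ => 9
  | c10 _ => 10
  | c11 _ => 11
  | c12 _ _ => 12
  | c13 _ => 13

/-- The number of listed generators; a family depending on a free function counts as one. -/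
def EosCase.size : EosCase → ℕ
  | c1 _ => 2
  | c2 _ _ => 3
  | c3 _ _ => 3
  | c4 _ _ _ => 3
  | c5 _ _ _ => 3
  | c6 _ _ => 4
  | c7 _ _ => 4
  | c8 _ => 5
  | c9 _ => 3
  | c10 _ => 4
  | c11 _ => 4
  | c12 _ _ => 4
  | c13 _ => 5

/-- The equation of state `p(ρ, S)` of a case. -/
def EosCase.eos (n : ℕ) : EosCase → ℝ → ℝ → ℝ
  | c1 f => fun ρ S => f ρ S
  | c2 κ f => fun ρ S => κ S * f ρ
  | c3 κ f => fun ρ S => κ S + f ρ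
  | c4 κ f q => fun ρ S => f (κ S * ρ) * ρ ^ (1 + q)
  | c5 κ f k => fun ρ S => f (κ S * ρ) + k * Real.log ρ
  | c6 κ q => fun ρ S => κ S * ρ ^ (1 + q)
  | c7 κ k => fun ρ S => κ S + k * Real.log ρ
  | c8 κ => fun ρ S => κ S * ρ ^ (1 + 2 / (n : ℝ))
  | c9 f => fun ρ _ => f ρ
  | c10 κ => fun _ S => κ S
  | c11 k => fun ρ _ => k * Real.log ρ
  | c12 k q => fun ρ _ => k * ρ ^ (1 + q)
  | c13 k => fun ρ _ => k * ρ ^ (1 + 2 / (n : ℝ))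

/-- `f` is smooth and non-constant on the set `s`. -/
def NonconstSmooth (f : ℝ → ℝ) (s : Set ℝ) : Prop :=
  ContDiffOn ℝ ∞ f s ∧ ∃ x ∈ s, ∃ y ∈ s, f x ≠ f y

/-- `κ` is smooth with nowhere vanishing derivative on the interval `J`. -/
def Regular (κ : ℝ → ℝ) (J : OpenInterval) : Prop :=
  ContDiffOn ℝ ∞ κ J.carrier ∧ ∀ S ∈ J.carrier, deriv κ S ≠ 0

/-- The set of values of `κ(S) ρ`. -/
def EosDomain.values (D : EosDomain) (κ : ℝ → ℝ) : Set ℝ :=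
  {x | ∃ ρ ∈ D.I.carrier, ∃ S ∈ D.J.carrier, x = κ S * ρ}

/-- The conditions on the free functions and constants of a case, on the domain `D`. In the
barotropic case 9 they say that, on no subinterval, `(ρ f')' = 0` or
`(ρ f' / (f + C))' = 0` for a constant `C`. -/
def EosCase.Admissible (D : EosDomain) : EosCase → Prop
  | c1 f => ContDiffOn ℝ ∞ (fun x : ℝ × ℝ => f x.1 x.2) (D.I.carrier ×ˢ D.J.carrier)
  | c2 κ f => Regular κ D.J ∧ NonconstSmooth f D.I.carrier
  | c3 κ f => Regular κ D.J ∧ NonconstSmooth f D.I.carrier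
  | c4 κ f q => Regular κ D.J ∧ NonconstSmooth f (D.values κ) ∧ q ≠ -1
  | c5 κ f _ => Regular κ D.J ∧ NonconstSmooth f (D.values κ)
  | c6 κ q => Regular κ D.J ∧ q ≠ -1
  | c7 κ k => Regular κ D.J ∧ k ≠ 0
  | c8 κ => Regular κ D.J
  | c9 f => NonconstSmooth f D.I.carrier ∧
      ∀ I' : OpenInterval, I'.carrier ⊆ D.I.carrier →
        (∃ ρ ∈ I'.carrier, deriv (fun x => x * deriv f x) ρ ≠ 0) ∧
        ∀ C : ℝ, (∀ ρ ∈ I'.carrier, f ρ + C ≠ 0) →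
          ∃ ρ ∈ I'.carrier, deriv (fun x => x * deriv f x / (f x + C)) ρ ≠ 0
  | c10 κ => Regular κ D.J
  | c11 k => k ≠ 0
  | c12 k q => k ≠ 0 ∧ q ≠ -1
  | c13 k => k ≠ 0

/-- The listed generators of a case. -/
def EosCase.generators (n : ℕ) (D : EosDomain) : EosCase → Set VField
  | c1 _ => {X1, X2}
  | c2 κ _ => {X1, X2, Xprod κ}
  | c3 κ _ => {X1, X2, Xsum κ}
  | c4 κ _ q => {X1, X2, Xscal κ q}
  | c5 κ _ _ => {X1, X2, XlogScal κ}
  | c6 κ q => {X1, X2, Xprod κ, Xpow q}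
  | c7 κ _ => {X1, X2, Xsum κ, Xlog}
  | c8 κ => {X1, X2, Xprod κ, Xpow' n, Xconf n}
  | c9 _ => {X1, X2} ∪ Xent '' SmoothFun D.J
  | c10 κ => {X1, X2, Xlog} ∪ XentW κ '' SmoothFun D.J
  | c11 _ => {X1, X2, Xlog} ∪ Xent '' SmoothFun D.J
  | c12 _ q => {X1, X2, Xpow q} ∪ Xent '' SmoothFun D.J
  | c13 _ => {X1, X2, Xconf n, Xpow' n} ∪ Xent '' SmoothFun D.J

/-- On `D`, `p` is an equation of state of the case `c`, modulo an additive constant. -/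
def IsInstance (n : ℕ) (D : EosDomain) (c : EosCase) (p : ℝ → ℝ → ℝ) : Prop :=
  c.Admissible D ∧
  ∃ p₀ : ℝ, ∀ ρ ∈ D.I.carrier, ∀ S ∈ D.J.carrier, p ρ S = c.eos n ρ S + p₀

/-- On every sub-domain of `D`, every case other than `c` of which `p` is an instance has fewer
listed generators than `c`; that is, `p` does not specialize to a case with as many symmetries. -/
def IsGenericInstance (n : ℕ) (D : EosDomain) (c : EosCase) (p : ℝ → ℝ → ℝ) : Prop :=
  IsInstance n D c p ∧
  ∀ D' : EosDomain, D'.Sub D → ∀ c' : EosCase, IsInstance n D' c' p →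
    c'.number ≠ c.number → c'.size < c.size

/-- On `D`, `p` is modulo an additive constant one of the seven equations of state of maximal
generality that admit extra symmetries. -/
def IsExceptional (n : ℕ) (D : EosDomain) (p : ℝ → ℝ → ℝ) : Prop :=
  ∃ p₀ : ℝ, ∃ g : ℝ → ℝ → ℝ,
    (∀ ρ ∈ D.I.carrier, ∀ S ∈ D.J.carrier, p ρ S = g ρ S + p₀) ∧
    ((∃ κ f : ℝ → ℝ, Regular κ D.J ∧ NonconstSmooth f D.I.carrier ∧
        g = fun ρ S => κ S * f ρ) ∨
      (∃ κ f : ℝ → ℝ, Regular κ D.J ∧ NonconstSmooth f D.I.carrier ∧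
        g = fun ρ S => f ρ + κ S) ∨
      (∃ κ f : ℝ → ℝ, ∃ q : ℝ, Regular κ D.J ∧ NonconstSmooth f (D.values κ) ∧ q ≠ -1 ∧
        g = fun ρ S => f (κ S * ρ) * ρ ^ (1 + q)) ∨
      (∃ κ f : ℝ → ℝ, ∃ k : ℝ, Regular κ D.J ∧ NonconstSmooth f (D.values κ) ∧
        g = fun ρ S => f (κ S * ρ) + k * Real.log ρ) ∨
      (∃ f : ℝ → ℝ, NonconstSmooth f D.I.carrier ∧ g = fun ρ _ => f ρ) ∨
      (∃ κ : ℝ → ℝ, Regular κ D.J ∧ g = fun ρ S => κ S * ρ ^ (1 + 2 / (n : ℝ))) ∨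
      (∃ κ : ℝ → ℝ, Regular κ D.J ∧ g = fun _ S => κ S))

/-! ### Commutators -/

/-- `[X, Y] = Z` on `Ω` -/
def BracketOn (Ω : Set Pt) (X Y Z : VField) : Prop :=
  EqOn (VectorField.lieBracket ℝ X Y) Z Ω

/-- `X` commutes on `Ω` with all members of `G`. -/
def CommutesWith (Ω : Set Pt) (X : VField) (G : Set VField) : Prop :=
  ∀ Y ∈ G, BracketOn Ω X Y 0

/-- The commutators of the listed generators of a case: those that are non-zero, and the
vanishing of the others (a family that depends on a free function is one entry of the list). -/
def EosCase.Commutators (n : ℕ) (D : EosDomain) (Ω : Set Pt) (c : EosCase) : Prop :=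
  BracketOn Ω X1 X2 X1 ∧
  match c with
  | c1 _ => True
  | c2 κ _ => CommutesWith Ω (Xprod κ) {X1, X2}
  | c3 κ _ => CommutesWith Ω (Xsum κ) {X1, X2}
  | c4 κ _ q => CommutesWith Ω (Xscal κ q) {X1, X2}
  | c5 κ _ _ => CommutesWith Ω (XlogScal κ) {X1, X2}
  | c6 κ q => CommutesWith Ω (Xprod κ) {X1, X2} ∧ CommutesWith Ω (Xpow q) {X1, X2, Xprod κ}
  | c7 κ _ => CommutesWith Ω (Xsum κ) {X1, X2} ∧ CommutesWith Ω Xlog {X1, X2, Xsum κ}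
  | c8 κ =>
      BracketOn Ω X1 (Xconf n) ((2 : ℝ) • X2 - Xpow' n) ∧ BracketOn Ω X2 (Xconf n) (Xconf n) ∧
      CommutesWith Ω (Xpow' n) {X1, X2, Xconf n} ∧
      CommutesWith Ω (Xprod κ) {X1, X2, Xconf n, Xpow' n}
  | c9 _ => ∀ F ∈ SmoothFun D.J, CommutesWith Ω (Xent F) {X1, X2}
  | c10 κ => CommutesWith Ω Xlog {X1, X2} ∧
      ∀ F ∈ SmoothFun D.J, CommutesWith Ω (XentW κ F) {X1, X2, Xlog}
  | c11 _ => CommutesWith Ω Xlog {X1, X2} ∧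
      ∀ F ∈ SmoothFun D.J, CommutesWith Ω (Xent F) {X1, X2, Xlog}
  | c12 _ q => CommutesWith Ω (Xpow q) {X1, X2} ∧
      ∀ F ∈ SmoothFun D.J, CommutesWith Ω (Xent F) {X1, X2, Xpow q}
  | c13 _ =>
      BracketOn Ω X1 (Xconf n) ((2 : ℝ) • X2 - Xpow' n) ∧ BracketOn Ω X2 (Xconf n) (Xconf n) ∧
      CommutesWith Ω (Xpow' n) {X1, X2, Xconf n} ∧
      ∀ F ∈ SmoothFun D.J, CommutesWith Ω (Xent F) {X1, X2, Xconf n, Xpow' n}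

/-! ### The abstract Lie algebras -/

/-- The non-abelian two-dimensional Lie algebra, with basis `e₁, e₂` and `[e₁, e₂] = e₁`. -/
def A21 : Type := ℝ × ℝ

instance : AddCommGroup A21 := inferInstanceAs (AddCommGroup (ℝ × ℝ))
instance : Module ℝ A21 := inferInstanceAs (Module ℝ (ℝ × ℝ))

theorem A21.add_fst (x y : A21) : (x + y).1 = x.1 + y.1 := rfl
theorem A21.add_snd (x y : A21) : (x + y).2 = x.2 + y.2 := rfl
theorem A21.smul_fst (a : ℝ) (x : A21) : (a • x).1 = a * x.1 := rfl
theorem A21.smul_snd (a : ℝ) (x : A21) : (a • x).2 = a * x.2 := rfl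
theorem A21.zero_fst : (0 : A21).1 = 0 := rfl
theorem A21.zero_snd : (0 : A21).2 = 0 := rfl

@[ext] theorem A21.ext {x y : A21} (h₁ : x.1 = y.1) (h₂ : x.2 = y.2) : x = y := Prod.ext h₁ h₂

instance : Bracket A21 A21 where
  bracket x y := (x.1 * y.2 - y.1 * x.2, 0)

theorem A21.lie_fst (x y : A21) : ⁅x, y⁆.1 = x.1 * y.2 - y.1 * x.2 := rfl
theorem A21.lie_snd (x y : A21) : ⁅x, y⁆.2 = 0 := rfl

instance : LieRing A21 where
  add_lie x y z := by
    ext <;> simp only [A21.add_fst, A21.add_snd, A21.lie_fst, A21.lie_snd] <;> ring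
  lie_add x y z := by
    ext <;> simp only [A21.add_fst, A21.add_snd, A21.lie_fst, A21.lie_snd] <;> ring
  lie_self x := by
    ext <;> simp only [A21.zero_fst, A21.zero_snd, A21.lie_fst, A21.lie_snd, sub_self]
  leibniz_lie x y z := by
    ext <;> simp only [A21.add_fst, A21.add_snd, A21.lie_fst, A21.lie_snd] <;> ring

instance : LieAlgebra ℝ A21 where
  lie_smul a x y := by
    ext <;> simp only [A21.smul_fst, A21.smul_snd, A21.lie_fst, A21.lie_snd] <;> ring

/-- The one-dimensional Lie algebra. -/
def A1 : Type := ℝ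

instance : AddCommGroup A1 := inferInstanceAs (AddCommGroup ℝ)
instance : Module ℝ A1 := inferInstanceAs (Module ℝ ℝ)

instance : LieRing A1 where
  bracket _ _ := 0
  add_lie _ _ _ := (add_zero 0).symm
  lie_add _ _ _ := (add_zero 0).symm
  lie_self _ := rfl
  leibniz_lie _ _ _ := (add_zero 0).symm

instance : LieAlgebra ℝ A1 where
  lie_smul a _ _ := (smul_zero a).symm

/-- The Lie algebra of smooth vector fields `F ∂_S` on an interval, as the functions `F` (extended
by zero outside the interval), with the bracket `F G' - F' G`. -/
def lineFieldSpace (J : OpenInterval) : Submodule ℝ (ℝ → ℝ) where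
  carrier := {F | ContDiffOn ℝ ∞ F J.carrier ∧ ∀ x, x ∉ J.carrier → F x = 0}
  add_mem' hF hG := ⟨hF.1.add hG.1, fun x hx => by simp [hF.2 x hx, hG.2 x hx]⟩
  zero_mem' := ⟨contDiffOn_const, fun _ _ => rfl⟩
  smul_mem' a F hF := ⟨hF.1.const_smul a, fun x hx => by simp [hF.2 x hx]⟩

/-- The type of elements of `lineFieldSpace`. -/
def LineFields (J : OpenInterval) : Type := lineFieldSpace J

instance (J : OpenInterval) : AddCommGroup (LineFields J) :=
  inferInstanceAs (AddCommGroup (lineFieldSpace J))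
instance (J : OpenInterval) : Module ℝ (LineFields J) :=
  inferInstanceAs (Module ℝ (lineFieldSpace J))

/-- The function `F G' - F' G`, cut off outside the interval. -/
def wronskian (J : OpenInterval) (F G : ℝ → ℝ) : ℝ → ℝ :=
  J.carrier.indicator fun x => F x * deriv G x - deriv F x * G x

theorem smooth_deriv {J : OpenInterval} {F : ℝ → ℝ} (hF : ContDiffOn ℝ ∞ F J.carrier) :
    ContDiffOn ℝ ∞ (deriv F) J.carrier :=
  hF.deriv_of_isOpen J.isOpen (by simp)

theorem smooth_differentiableAt {J : OpenInterval} {F : ℝ → ℝ}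
    (hF : ContDiffOn ℝ ∞ F J.carrier) {x : ℝ} (hx : x ∈ J.carrier) : DifferentiableAt ℝ F x :=
  (hF.differentiableOn (by simp)).differentiableAt (J.isOpen.mem_nhds hx)

theorem wronskian_apply {J : OpenInterval} {F G : ℝ → ℝ} {x : ℝ} (hx : x ∈ J.carrier) :
    wronskian J F G x = F x * deriv G x - deriv F x * G x := indicator_of_mem hx _

theorem wronskian_mem {J : OpenInterval} {F G : ℝ → ℝ} (hF : ContDiffOn ℝ ∞ F J.carrier)
    (hG : ContDiffOn ℝ ∞ G J.carrier) : wronskian J F G ∈ lineFieldSpace J :=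
  ⟨((hF.mul (smooth_deriv hG)).sub ((smooth_deriv hF).mul hG)).congr
    fun _ hx => wronskian_apply hx, fun _ hx => indicator_of_notMem hx _⟩

theorem deriv_wronskian {J : OpenInterval} {F G : ℝ → ℝ} (hF : ContDiffOn ℝ ∞ F J.carrier)
    (hG : ContDiffOn ℝ ∞ G J.carrier) {x : ℝ} (hx : x ∈ J.carrier) :
    deriv (wronskian J F G) x = F x * deriv (deriv G) x - deriv (deriv F) x * G x := by
  have h : wronskian J F G =ᶠ[nhds x] fun y => F y * deriv G y - deriv F y * G y := by
    filter_upwards [J.isOpen.mem_nhds hx] with y hy using wronskian_apply hy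
  have h1 := smooth_differentiableAt hF hx
  have h2 := smooth_differentiableAt hG hx
  have h3 := smooth_differentiableAt (smooth_deriv hF) hx
  have h4 := smooth_differentiableAt (smooth_deriv hG) hx
  rw [h.deriv_eq]
  have := (h1.hasDerivAt.mul h4.hasDerivAt).sub (h3.hasDerivAt.mul h2.hasDerivAt)
  refine (HasDerivAt.deriv this).trans ?_
  ring

theorem LineFields.ext_on {J : OpenInterval} {F G : LineFields J}
    (h : ∀ x ∈ J.carrier, F.1 x = G.1 x) : F = G := by
  apply Subtype.ext
  funext x
  by_cases hx : x ∈ J.carrier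
  · exact h x hx
  · rw [F.2.2 x hx, G.2.2 x hx]

theorem LineFields.add_val {J : OpenInterval} (F G : LineFields J) :
    (F + G).1 = F.1 + G.1 := rfl
theorem LineFields.smul_val {J : OpenInterval} (a : ℝ) (F : LineFields J) :
    (a • F).1 = a • F.1 := rfl
theorem LineFields.zero_val {J : OpenInterval} : (0 : LineFields J).1 = 0 := rfl

instance (J : OpenInterval) : Bracket (LineFields J) (LineFields J) where
  bracket F G := ⟨wronskian J F.1 G.1, wronskian_mem F.2.1 G.2.1⟩

theorem LineFields.lie_val {J : OpenInterval} (F G : LineFields J) :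
    ⁅F, G⁆.1 = wronskian J F.1 G.1 := rfl

theorem LineFields.deriv_add {J : OpenInterval} (F G : LineFields J) {x : ℝ}
    (hx : x ∈ J.carrier) : deriv (F.1 + G.1) x = deriv F.1 x + deriv G.1 x :=
  _root_.deriv_add (smooth_differentiableAt F.2.1 hx) (smooth_differentiableAt G.2.1 hx)

instance (J : OpenInterval) : LieRing (LineFields J) where
  add_lie F G H := LineFields.ext_on fun x hx => by
    simp only [LineFields.add_val, LineFields.lie_val, Pi.add_apply, wronskian_apply hx,
      LineFields.deriv_add _ _ hx]
    ring
  lie_add F G H := LineFields.ext_on fun x hx => by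
    simp only [LineFields.add_val, LineFields.lie_val, Pi.add_apply, wronskian_apply hx,
      LineFields.deriv_add _ _ hx]
    ring
  lie_self F := LineFields.ext_on fun x hx => by
    simp only [LineFields.zero_val, LineFields.lie_val, Pi.zero_apply, wronskian_apply hx]
    ring
  leibniz_lie F G H := LineFields.ext_on fun x hx => by
    simp only [LineFields.add_val, LineFields.lie_val, Pi.add_apply, wronskian_apply hx,
      deriv_wronskian G.2.1 H.2.1 hx, deriv_wronskian F.2.1 G.2.1 hx,
      deriv_wronskian F.2.1 H.2.1 hx]
    ring

instance (J : OpenInterval) : LieAlgebra ℝ (LineFields J) where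
  lie_smul a F G := LineFields.ext_on fun x hx => by
    have h : deriv (a • G.1) x = a * deriv G.1 x :=
      deriv_const_smul a (smooth_differentiableAt G.2.1 hx)
    simp only [LineFields.smul_val, LineFields.lie_val, Pi.smul_apply, smul_eq_mul,
      wronskian_apply hx, h]
    ring

/-- On `Ω`, the linear span of `G` is closed under the bracket of vector fields, and it is
isomorphic to the Lie algebra `L`. -/
def SpanIsAlgebra (Ω : Set Pt) (G : Set VField) (L : Type) [LieRing L] [LieAlgebra ℝ L] : Prop :=
  ∃ Φ : L →ₗ[ℝ] VField,
    (∀ a b : L, BracketOn Ω (Φ a) (Φ b) (Φ ⁅a, b⁆)) ∧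
    (∀ a : L, EqOn (Φ a) 0 Ω → a = 0) ∧
    ∀ X : VField, InSpan Ω G X ↔ ∃ a : L, EqOn X (Φ a) Ω

/-- The real Lie algebra of real `2 × 2` matrices of trace zero. -/
abbrev Sl2 := LieAlgebra.SpecialLinear.sl (Fin 2) ℝ

/-- The Lie algebra spanned by the generators of a case, up to isomorphism. The infinite-dimensional
factor is the Lie algebra of vector fields on the interval of values of `S`. -/
def EosCase.Algebra (n : ℕ) (D : EosDomain) (Ω : Set Pt) (c : EosCase) : Prop :=
  match c with
  | c1 _ => SpanIsAlgebra Ω (c.generators n D) A21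
  | c2 _ _ => SpanIsAlgebra Ω (c.generators n D) (A21 × A1)
  | c3 _ _ => SpanIsAlgebra Ω (c.generators n D) (A21 × A1)
  | c4 _ _ _ => SpanIsAlgebra Ω (c.generators n D) (A21 × A1)
  | c5 _ _ _ => SpanIsAlgebra Ω (c.generators n D) (A21 × A1)
  | c6 _ _ => SpanIsAlgebra Ω (c.generators n D) (A21 × A1 × A1)
  | c7 _ _ => SpanIsAlgebra Ω (c.generators n D) (A21 × A1 × A1)
  | c8 _ => SpanIsAlgebra Ω (c.generators n D) (Sl2 × A1 × A1)
  | c9 _ => SpanIsAlgebra Ω (c.generators n D) (A21 × LineFields D.J)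
  | c10 _ => SpanIsAlgebra Ω (c.generators n D) (A21 × A1 × LineFields D.J)
  | c11 _ => SpanIsAlgebra Ω (c.generators n D) (A21 × A1 × LineFields D.J)
  | c12 _ _ => SpanIsAlgebra Ω (c.generators n D) (A21 × A1 × LineFields D.J)
  | c13 _ => SpanIsAlgebra Ω (c.generators n D) (Sl2 × A1 × LineFields D.J)

end RadialEuler

end

/-!
The proof computes all point symmetries of a given equation of state, up to one pair of equations
in the two thermodynamic variables, and then analyses that pair.

On the solution manifold the `t`-derivatives are determined by `ρ_r`, `S_r`, `U_r`, which are free;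
hence a vector field is a symmetry if and only if a vector of polynomials in these three variables
vanishes identically (`isPointSymmetry_iff`). The coefficients of the polynomials are linear
differential equations for the components of the field. They are integrated in the commutative ring
of smooth functions on the box, with its directional derivatives as derivations
(`integrate_linear`). Non-constancy of `p` on every sub-domain enters in one way only: a function
annihilated by both `p_ρ` and `p_S` is zero (`mkE_annihilator`). The outcome is `exists_symField`,
with the converse `isPointSymmetry_symField`: the symmetries are the fields
`(c₁ + c₂ t + a t²) ∂_t + (c₂ + μ + a t) r ∂_r + (g(S) - n a t) ρ ∂_ρ + F(S) ∂_S
+ (a (r - t U) + μ U) ∂_U` such that `(μ, F, g)` and `(a, 0, n a)` both satisfy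
`d(F p_S + g ρ p_ρ) = (g + 2 μ) dp`, which is the predicate `IsReduced`.

Cross-differentiation of that equation gives `g' p_ρ = 0`. Where `p_ρ` and `p_S` vanish nowhere, `g`
is therefore a constant, and the equation integrates to `F p_S + g ρ p_ρ = (g + 2 μ) p + C`. Solving
this first-order equation for `p` gives the normal forms: products and sums for `g = 0`
(`IsReduced.captures_isopycnic`), the scaling forms for `g ≠ 0` (`IsReduced.captures_scaling`), and
`κ(S) ρ ^ (1 + 2 / n)` for `a ≠ 0` (`captures_conf`). Each of these statements also says that the
symmetry at hand is a multiple of the listed generator of the normal form.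

Completeness follows by shrinking the domain until `p_ρ` and `p_S` are each nowhere zero or
identically zero. In the non-degenerate case all symmetries with `g = 0` are accounted for on the
whole domain, and one symmetry with `g ≠ 0`, if there is one on some sub-domain, accounts for the
rest. Otherwise `p` depends on one variable, and is of one of the cases `9` to `13`, in which the
equation `d(F p_S + g ρ p_ρ) = (g + 2 μ) dp` is solved outright (`symmetriesAre_of_six_le`).
Maximality in the cases `1` to `5` is indirect: a symmetry outside the listed span, corrected by a
multiple of the listed generator, would force a normal form of another case on a sub-domain.

The abstract Lie algebras are recognized through `Realization`s: the fields
`μ (r ∂_r + U ∂_U) + F ∂_S + g ρ ∂_ρ` commute with `X1` and `X2` and, for constant `g`, with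
`Xconf n`, so that in every case `A21`, or `Sl2` spanned by `X1`, `2 X2 - Xpow' n`, `Xconf n`, splits
off as a direct factor.
-/

noncomputable section

namespace RadialEuler

theorem two_le_infty : (2 : WithTop ℕ∞) ≤ ∞ := WithTop.coe_le_coe.2 le_top

/-! ### Smooth functions of density and entropy -/

/-- The partial derivative with respect to the density. -/
def dρ (h : ℝ → ℝ → ℝ) : ℝ → ℝ → ℝ := fun ρ S => deriv (fun x => h x S) ρ

/-- The partial derivative with respect to the entropy. -/
def dS (h : ℝ → ℝ → ℝ) : ℝ → ℝ → ℝ := fun ρ S => deriv (fun s => h ρ s) S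

/-- The open rectangle of values of `(ρ, S)`. -/
def EosDomain.rect (D : EosDomain) : Set (ℝ × ℝ) := D.I.carrier ×ˢ D.J.carrier

/-- Smoothness on the rectangle, for functions of density and entropy in curried form. -/
def Smooth2 (D : EosDomain) (h : ℝ → ℝ → ℝ) : Prop :=
  ContDiffOn ℝ ∞ (fun x : ℝ × ℝ => h x.1 x.2) D.rect

theorem EosDomain.isOpen_rect (D : EosDomain) : IsOpen D.rect := D.I.isOpen.prod D.J.isOpen

theorem OpenInterval.convex (A : OpenInterval) : Convex ℝ A.carrier := A.ordConnected.convex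

theorem EosDomain.Sub.rect_subset {D' D : EosDomain} (h : D'.Sub D) : D'.rect ⊆ D.rect :=
  prod_mono h.1 h.2

theorem EosDomain.Sub.refl (D : EosDomain) : D.Sub D := ⟨Subset.rfl, Subset.rfl⟩

theorem EosDomain.Sub.trans {D'' D' D : EosDomain} (h : D''.Sub D') (h' : D'.Sub D) : D''.Sub D :=
  ⟨h.1.trans h'.1, h.2.trans h'.2⟩

theorem EosDomain.ρ_pos (D : EosDomain) {ρ : ℝ} (h : ρ ∈ D.I.carrier) : 0 < ρ := D.pos h

theorem Smooth2.mono {D' D : EosDomain} {h : ℝ → ℝ → ℝ} (hh : Smooth2 D h) (hD : D'.Sub D) :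
    Smooth2 D' h := ContDiffOn.mono hh hD.rect_subset

section
variable {D : EosDomain} {h k : ℝ → ℝ → ℝ} {ρ S : ℝ}

theorem Smooth2.contDiffAt (hh : Smooth2 D h) (hρ : ρ ∈ D.I.carrier) (hS : S ∈ D.J.carrier) :
    ContDiffAt ℝ ∞ (fun x : ℝ × ℝ => h x.1 x.2) (ρ, S) :=
  ContDiffOn.contDiffAt hh (D.isOpen_rect.mem_nhds ⟨hρ, hS⟩)

theorem Smooth2.differentiableAt (hh : Smooth2 D h) (hρ : ρ ∈ D.I.carrier)
    (hS : S ∈ D.J.carrier) : DifferentiableAt ℝ (fun x : ℝ × ℝ => h x.1 x.2) (ρ, S) :=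
  (hh.contDiffAt hρ hS).differentiableAt (by simp)

theorem Smooth2.hasDerivAt_fderiv_ρ (hh : Smooth2 D h) (hρ : ρ ∈ D.I.carrier)
    (hS : S ∈ D.J.carrier) :
    HasDerivAt (fun x => h x S) (fderiv ℝ (fun x : ℝ × ℝ => h x.1 x.2) (ρ, S) (1, 0)) ρ :=
  (hh.differentiableAt hρ hS).hasFDerivAt.comp_hasDerivAt (f := fun x => (x, S)) ρ
    ((hasDerivAt_id ρ).prodMk (hasDerivAt_const ρ S))

theorem Smooth2.hasDerivAt_fderiv_S (hh : Smooth2 D h) (hρ : ρ ∈ D.I.carrier)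
    (hS : S ∈ D.J.carrier) :
    HasDerivAt (fun s => h ρ s) (fderiv ℝ (fun x : ℝ × ℝ => h x.1 x.2) (ρ, S) (0, 1)) S :=
  (hh.differentiableAt hρ hS).hasFDerivAt.comp_hasDerivAt (f := fun s => (ρ, s)) S
    ((hasDerivAt_const S ρ).prodMk (hasDerivAt_id S))

theorem Smooth2.dρ_eq (hh : Smooth2 D h) (hρ : ρ ∈ D.I.carrier) (hS : S ∈ D.J.carrier) :
    dρ h ρ S = fderiv ℝ (fun x : ℝ × ℝ => h x.1 x.2) (ρ, S) (1, 0) :=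
  (hh.hasDerivAt_fderiv_ρ hρ hS).deriv

theorem Smooth2.dS_eq (hh : Smooth2 D h) (hρ : ρ ∈ D.I.carrier) (hS : S ∈ D.J.carrier) :
    dS h ρ S = fderiv ℝ (fun x : ℝ × ℝ => h x.1 x.2) (ρ, S) (0, 1) :=
  (hh.hasDerivAt_fderiv_S hρ hS).deriv

theorem Smooth2.hasDerivAt_ρ (hh : Smooth2 D h) (hρ : ρ ∈ D.I.carrier) (hS : S ∈ D.J.carrier) :
    HasDerivAt (fun x => h x S) (dρ h ρ S) ρ :=
  (hh.hasDerivAt_fderiv_ρ hρ hS).differentiableAt.hasDerivAt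

theorem Smooth2.hasDerivAt_S (hh : Smooth2 D h) (hρ : ρ ∈ D.I.carrier) (hS : S ∈ D.J.carrier) :
    HasDerivAt (fun s => h ρ s) (dS h ρ S) S :=
  (hh.hasDerivAt_fderiv_S hρ hS).differentiableAt.hasDerivAt

theorem Smooth2.fderiv_apply (hh : Smooth2 D h) (hρ : ρ ∈ D.I.carrier) (hS : S ∈ D.J.carrier)
    (v : ℝ × ℝ) : fderiv ℝ (fun x : ℝ × ℝ => h x.1 x.2) (ρ, S) v =
      dρ h ρ S * v.1 + dS h ρ S * v.2 := by
  have : v = v.1 • ((1, 0) : ℝ × ℝ) + v.2 • ((0, 1) : ℝ × ℝ) := by ext <;> simp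
  conv_lhs => rw [this]
  rw [map_add, map_smul, map_smul, ← hh.dρ_eq hρ hS, ← hh.dS_eq hρ hS]
  simp only [smul_eq_mul]; ring

theorem Smooth2.fderiv_contDiffOn (hh : Smooth2 D h) :
    ContDiffOn ℝ ∞ (fderiv ℝ (fun x : ℝ × ℝ => h x.1 x.2)) D.rect :=
  ContDiffOn.fderiv_of_isOpen hh D.isOpen_rect (by simp)

theorem Smooth2.dρ (hh : Smooth2 D h) : Smooth2 D (dρ h) :=
  (hh.fderiv_contDiffOn.clm_apply (contDiffOn_const (c := ((1 : ℝ), (0 : ℝ))))).congr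
    fun _ hx => hh.dρ_eq hx.1 hx.2

theorem Smooth2.dS (hh : Smooth2 D h) : Smooth2 D (dS h) :=
  (hh.fderiv_contDiffOn.clm_apply (contDiffOn_const (c := ((0 : ℝ), (1 : ℝ))))).congr
    fun _ hx => hh.dS_eq hx.1 hx.2

theorem dρ_congr (hhk : ∀ ρ ∈ D.I.carrier, ∀ S ∈ D.J.carrier, h ρ S = k ρ S)
    (hρ : ρ ∈ D.I.carrier) (hS : S ∈ D.J.carrier) : dρ h ρ S = dρ k ρ S := by
  apply Filter.EventuallyEq.deriv_eq
  filter_upwards [D.I.isOpen.mem_nhds hρ] with x hx using hhk x hx S hS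

theorem dS_congr (hhk : ∀ ρ ∈ D.I.carrier, ∀ S ∈ D.J.carrier, h ρ S = k ρ S)
    (hρ : ρ ∈ D.I.carrier) (hS : S ∈ D.J.carrier) : dS h ρ S = dS k ρ S := by
  apply Filter.EventuallyEq.deriv_eq
  filter_upwards [D.J.isOpen.mem_nhds hS] with x hx using hhk ρ hρ x hx

theorem Smooth2.congr (hh : Smooth2 D h)
    (hhk : ∀ ρ ∈ D.I.carrier, ∀ S ∈ D.J.carrier, k ρ S = h ρ S) : Smooth2 D k :=
  ContDiffOn.congr hh fun x hx => hhk x.1 hx.1 x.2 hx.2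

theorem Smooth2.dS_dρ (hh : Smooth2 D h) (hρ : ρ ∈ D.I.carrier) (hS : S ∈ D.J.carrier) :
    RadialEuler.dS (RadialEuler.dρ h) ρ S = RadialEuler.dρ (RadialEuler.dS h) ρ S := by
  have hsymm : IsSymmSndFDerivAt ℝ (fun x : ℝ × ℝ => h x.1 x.2) (ρ, S) :=
    (hh.contDiffAt hρ hS).isSymmSndFDerivAt (by simpa using two_le_infty)
  have hd : DifferentiableAt ℝ (fderiv ℝ (fun x : ℝ × ℝ => h x.1 x.2)) (ρ, S) :=
    ((hh.fderiv_contDiffOn.contDiffAt (D.isOpen_rect.mem_nhds ⟨hρ, hS⟩)).differentiableAt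
      (by simp))
  have key : ∀ v w : ℝ × ℝ, fderiv ℝ (fun x => fderiv ℝ (fun x : ℝ × ℝ => h x.1 x.2) x v)
      (ρ, S) w = fderiv ℝ (fderiv ℝ (fun x : ℝ × ℝ => h x.1 x.2)) (ρ, S) w v := by
    intro v w
    rw [fderiv_clm_apply hd (differentiableAt_const v)]
    simp
  rw [hh.dρ.dS_eq hρ hS, hh.dS.dρ_eq hρ hS]
  have e1 : (fun x : ℝ × ℝ => RadialEuler.dρ h x.1 x.2) =ᶠ[nhds (ρ, S)]
      fun x => fderiv ℝ (fun x : ℝ × ℝ => h x.1 x.2) x (1, 0) := by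
    filter_upwards [D.isOpen_rect.mem_nhds (show (ρ, S) ∈ D.rect from ⟨hρ, hS⟩)] with x hx
      using hh.dρ_eq hx.1 hx.2
  have e2 : (fun x : ℝ × ℝ => RadialEuler.dS h x.1 x.2) =ᶠ[nhds (ρ, S)]
      fun x => fderiv ℝ (fun x : ℝ × ℝ => h x.1 x.2) x (0, 1) := by
    filter_upwards [D.isOpen_rect.mem_nhds (show (ρ, S) ∈ D.rect from ⟨hρ, hS⟩)] with x hx
      using hh.dS_eq hx.1 hx.2
  rw [e1.fderiv_eq, e2.fderiv_eq, key, key]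
  exact hsymm _ _

theorem Smooth2.eq_of_dρ_eq_zero (hh : Smooth2 D h)
    (h0 : ∀ ρ ∈ D.I.carrier, ∀ S ∈ D.J.carrier, RadialEuler.dρ h ρ S = 0)
    {ρ' : ℝ} (hρ : ρ ∈ D.I.carrier) (hρ' : ρ' ∈ D.I.carrier) (hS : S ∈ D.J.carrier) :
    h ρ S = h ρ' S := by
  refine D.I.isOpen.is_const_of_deriv_eq_zero (f := fun x => h x S)
    D.I.convex.isPreconnected (fun x hx => ?_) (fun x hx => h0 x hx S hS) hρ hρ'
  exact (hh.hasDerivAt_ρ hx hS).differentiableAt.differentiableWithinAt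

theorem Smooth2.eq_of_dS_eq_zero (hh : Smooth2 D h)
    (h0 : ∀ ρ ∈ D.I.carrier, ∀ S ∈ D.J.carrier, RadialEuler.dS h ρ S = 0)
    {S' : ℝ} (hρ : ρ ∈ D.I.carrier) (hS : S ∈ D.J.carrier) (hS' : S' ∈ D.J.carrier) :
    h ρ S = h ρ S' := by
  refine D.J.isOpen.is_const_of_deriv_eq_zero (f := fun x => h ρ x)
    D.J.convex.isPreconnected (fun x hx => ?_) (fun x hx => h0 ρ hρ x hx) hS hS'
  exact (hh.hasDerivAt_S hρ hx).differentiableAt.differentiableWithinAt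

theorem Smooth2.exists_const (hh : Smooth2 D h)
    (h1 : ∀ ρ ∈ D.I.carrier, ∀ S ∈ D.J.carrier, RadialEuler.dρ h ρ S = 0)
    (h2 : ∀ ρ ∈ D.I.carrier, ∀ S ∈ D.J.carrier, RadialEuler.dS h ρ S = 0) :
    ∃ C, ∀ ρ ∈ D.I.carrier, ∀ S ∈ D.J.carrier, h ρ S = C := by
  obtain ⟨ρ₀, hρ₀⟩ := D.I.nonempty
  obtain ⟨S₀, hS₀⟩ := D.J.nonempty
  exact ⟨h ρ₀ S₀, fun ρ hρ S hS =>
    (hh.eq_of_dρ_eq_zero h1 hρ hρ₀ hS).trans (hh.eq_of_dS_eq_zero h2 hρ₀ hS hS₀)⟩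

theorem Smooth2.add (hh : Smooth2 D h) (hk : Smooth2 D k) :
    Smooth2 D (fun ρ S => h ρ S + k ρ S) := ContDiffOn.add hh hk

theorem Smooth2.sub (hh : Smooth2 D h) (hk : Smooth2 D k) :
    Smooth2 D (fun ρ S => h ρ S - k ρ S) := ContDiffOn.sub hh hk

theorem Smooth2.mul (hh : Smooth2 D h) (hk : Smooth2 D k) :
    Smooth2 D (fun ρ S => h ρ S * k ρ S) := ContDiffOn.mul hh hk

theorem smooth2_const (c : ℝ) : Smooth2 D (fun _ _ => c) := contDiffOn_const

theorem smooth2_of_ρ {f : ℝ → ℝ} (hf : ContDiffOn ℝ ∞ f D.I.carrier) :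
    Smooth2 D (fun ρ _ => f ρ) :=
  hf.comp contDiffOn_fst fun _ hx => hx.1

theorem smooth2_of_S {f : ℝ → ℝ} (hf : ContDiffOn ℝ ∞ f D.J.carrier) :
    Smooth2 D (fun _ S => f S) :=
  hf.comp contDiffOn_snd fun _ hx => hx.2

theorem smooth2_ρ : Smooth2 D (fun ρ _ => ρ) := smooth2_of_ρ contDiffOn_id

theorem Smooth2.slice_ρ (hh : Smooth2 D h) (hS : S ∈ D.J.carrier) :
    ContDiffOn ℝ ∞ (fun ρ => h ρ S) D.I.carrier :=
  ContDiffOn.comp (f := fun ρ : ℝ => (ρ, S)) hh (contDiffOn_id.prodMk contDiffOn_const)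
    fun _ hx => ⟨hx, hS⟩

theorem Smooth2.slice_S (hh : Smooth2 D h) (hρ : ρ ∈ D.I.carrier) :
    ContDiffOn ℝ ∞ (fun S => h ρ S) D.J.carrier :=
  ContDiffOn.comp (f := fun S : ℝ => (ρ, S)) hh (contDiffOn_const.prodMk contDiffOn_id)
    fun _ hx => ⟨hρ, hx⟩

theorem Smooth2.continuousOn (hh : Smooth2 D h) :
    ContinuousOn (fun x : ℝ × ℝ => h x.1 x.2) D.rect := ContDiffOn.continuousOn hh

end

/-! ### Sub-domains -/

/-- The open interval of radius `ε` around a point. -/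
def OpenInterval.around (x ε : ℝ) (hε : 0 < ε) : OpenInterval where
  carrier := Metric.ball x ε
  isOpen := Metric.isOpen_ball
  nonempty := ⟨x, Metric.mem_ball_self hε⟩
  ordConnected := by rw [Real.ball_eq_Ioo]; exact ordConnected_Ioo

/-- Every neighbourhood of a point of an interval contains a subinterval around that point. -/
theorem OpenInterval.exists_around (A : OpenInterval) {x : ℝ} (hx : x ∈ A.carrier) {N : Set ℝ}
    (hN : N ∈ nhds x) :
    ∃ B : OpenInterval, x ∈ B.carrier ∧ B.carrier ⊆ A.carrier ∧ B.carrier ⊆ N := by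
  obtain ⟨ε, hε, h⟩ := Metric.mem_nhds_iff.1 (Filter.inter_mem (A.isOpen.mem_nhds hx) hN)
  exact ⟨.around x ε hε, Metric.mem_ball_self hε, h.trans inter_subset_left,
    h.trans inter_subset_right⟩

theorem EosDomain.exists_sub_mem (D : EosDomain) {ρ S : ℝ} (hρ : ρ ∈ D.I.carrier)
    (hS : S ∈ D.J.carrier) {N : Set (ℝ × ℝ)} (hN : N ∈ nhds (ρ, S)) :
    ∃ D' : EosDomain, D'.Sub D ∧ ρ ∈ D'.I.carrier ∧ S ∈ D'.J.carrier ∧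
      ∀ x ∈ D'.I.carrier, ∀ s ∈ D'.J.carrier, (x, s) ∈ N := by
  obtain ⟨A, hA, B, hB, hAB⟩ := mem_nhds_prod_iff.1 hN
  obtain ⟨I', h1, h2, h3⟩ := D.I.exists_around hρ hA
  obtain ⟨J', h4, h5, h6⟩ := D.J.exists_around hS hB
  exact ⟨⟨I', J', h2.trans D.pos⟩, ⟨h2, h5⟩, h1, h4, fun x hx s hs => hAB ⟨h3 hx, h6 hs⟩⟩

/-- A smooth function that does not vanish at a point vanishes nowhere on a sub-domain. -/
theorem Smooth2.exists_sub_ne_zero {D : EosDomain} {h : ℝ → ℝ → ℝ} (hh : Smooth2 D h) {ρ S : ℝ}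
    (hρ : ρ ∈ D.I.carrier) (hS : S ∈ D.J.carrier) (h0 : h ρ S ≠ 0) :
    ∃ D' : EosDomain, D'.Sub D ∧ ρ ∈ D'.I.carrier ∧ S ∈ D'.J.carrier ∧
      ∀ x ∈ D'.I.carrier, ∀ s ∈ D'.J.carrier, h x s ≠ 0 :=
  D.exists_sub_mem hρ hS
    ((hh.continuousOn.continuousAt (D.isOpen_rect.mem_nhds ⟨hρ, hS⟩)).eventually_ne h0)

theorem Smooth2.exists_sub_ne_zero_or {D : EosDomain} {h : ℝ → ℝ → ℝ} (hh : Smooth2 D h) :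
    (∃ D' : EosDomain, D'.Sub D ∧ ∀ x ∈ D'.I.carrier, ∀ s ∈ D'.J.carrier, h x s ≠ 0) ∨
      ∀ x ∈ D.I.carrier, ∀ s ∈ D.J.carrier, h x s = 0 := by
  by_cases hc : ∃ x ∈ D.I.carrier, ∃ s ∈ D.J.carrier, h x s ≠ 0
  · obtain ⟨x, hx, s, hs, h0⟩ := hc
    obtain ⟨D', h1, -, -, h2⟩ := hh.exists_sub_ne_zero hx hs h0
    exact .inl ⟨D', h1, h2⟩
  · push Not at hc
    exact .inr hc

/-- The sub-domain with the same densities and fewer entropies. -/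
def EosDomain.withJ (D : EosDomain) (J : OpenInterval) : EosDomain := ⟨D.I, J, D.pos⟩

theorem EosDomain.withJ_sub (D : EosDomain) {J : OpenInterval} (h : J.carrier ⊆ D.J.carrier) :
    (D.withJ J).Sub D := ⟨Subset.rfl, h⟩

theorem IsEos.smooth2 {D : EosDomain} {p : ℝ → ℝ → ℝ} (hp : IsEos D p) : Smooth2 D p := hp.1

theorem IsEos.mono {D' D : EosDomain} {p : ℝ → ℝ → ℝ} (hp : IsEos D p) (h : D'.Sub D) :
    IsEos D' p := ⟨hp.smooth2.mono h, fun D'' h'' => hp.2 D'' (h''.trans h)⟩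

/-- On no domain do both partial derivatives of an equation of state vanish. -/
theorem IsEos.exists_deriv_ne_zero {D : EosDomain} {p : ℝ → ℝ → ℝ} (hp : IsEos D p) :
    ∃ ρ ∈ D.I.carrier, ∃ S ∈ D.J.carrier, dρ p ρ S ≠ 0 ∨ dS p ρ S ≠ 0 := by
  by_contra! hc
  obtain ⟨C, hC⟩ := hp.smooth2.exists_const (fun ρ hρ S hS => (hc ρ hρ S hS).1)
    fun ρ hρ S hS => (hc ρ hρ S hS).2
  obtain ⟨ρ, hρ, S, hS, ρ', hρ', S', hS', hne⟩ := hp.2 D (.refl D)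
  exact hne ((hC ρ hρ S hS).trans (hC ρ' hρ' S' hS').symm)

/-! ### The differential ring of smooth functions on a box -/

section
variable (Ω : Set Pt)

/-- The extension by zero of a function on a set of points `(t, r, ρ, S, U)`. -/
def ext0 {Ω : Set Pt} (f : Ω → ℝ) : Pt → ℝ := by
  classical exact fun z => if h : z ∈ Ω then f ⟨z, h⟩ else 0

theorem ext0_apply {Ω : Set Pt} (f : Ω → ℝ) (z : Ω) : ext0 f z = f z := by
  simp [ext0]

theorem ext0_of_mem {Ω : Set Pt} (f : Ω → ℝ) {z : Pt} (hz : z ∈ Ω) : ext0 f z = f ⟨z, hz⟩ := by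
  simp [ext0, hz]

/-- The algebra of smooth functions on `Ω`. Working with functions whose domain is `Ω` itself
turns equality on `Ω` into equality, so that identities between symmetry coefficients become
identities in a commutative ring. -/
def smoothAlg : Subalgebra ℝ (Ω → ℝ) where
  carrier := {f | ContDiffOn ℝ ∞ (ext0 f) Ω}
  mul_mem' {a b} ha hb := (ContDiffOn.mul ha hb).congr fun z hz => by
    simp [ext0_of_mem _ hz]
  add_mem' {a b} ha hb := (ContDiffOn.add ha hb).congr fun z hz => by
    simp [ext0_of_mem _ hz]
  algebraMap_mem' c := (contDiffOn_const (c := c)).congr fun z hz => by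
    simp [ext0_of_mem _ hz]

variable {Ω}

/-- The restriction to `Ω` of a function that is smooth on `Ω`. -/
def mkSm (f : Pt → ℝ) (hf : ContDiffOn ℝ ∞ f Ω) : smoothAlg Ω :=
  ⟨fun z => f z, hf.congr fun z hz => by rw [ext0_of_mem _ hz]⟩

theorem mkSm_apply {f : Pt → ℝ} (hf : ContDiffOn ℝ ∞ f Ω) (z : Ω) : (mkSm f hf).1 z = f z := rfl

theorem smoothAlg_ext {f g : smoothAlg Ω} (h : ∀ z, f.1 z = g.1 z) : f = g :=
  Subtype.ext (funext h)

theorem ext0_mkSm {f : Pt → ℝ} (hf : ContDiffOn ℝ ∞ f Ω) : EqOn (ext0 (mkSm f hf).1) f Ω :=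
  fun z hz => by rw [ext0_of_mem _ hz]; rfl

theorem smoothAlg_differentiableAt (hΩ : IsOpen Ω) (f : smoothAlg Ω) (z : Ω) :
    DifferentiableAt ℝ (ext0 f.1) z :=
  ((f.2 : ContDiffOn ℝ ∞ _ _).contDiffAt (hΩ.mem_nhds z.2)).differentiableAt (by simp)

theorem ext0_eventuallyEq (hΩ : IsOpen Ω) {f g : Pt → ℝ} (h : EqOn f g Ω) (z : Ω) :
    f =ᶠ[nhds z.1] g := by
  filter_upwards [hΩ.mem_nhds z.2] with x hx using h hx

/-- The derivation of `smoothAlg Ω` given by the directional derivative. -/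
def dirD (hΩ : IsOpen Ω) (v : Pt) : Derivation ℝ (smoothAlg Ω) (smoothAlg Ω) :=
  Derivation.mk'
    { toFun := fun f => mkSm (fun z => fderiv ℝ (ext0 f.1) z v)
        (((f.2 : ContDiffOn ℝ ∞ _ _).fderiv_of_isOpen hΩ (by simp)).clm_apply contDiffOn_const)
      map_add' := fun f g => smoothAlg_ext fun z => by
        have h : EqOn (ext0 (f + g).1) (ext0 f.1 + ext0 g.1) Ω := fun z hz => by
          simp [ext0_of_mem _ hz]
        simp only [mkSm_apply]
        rw [(ext0_eventuallyEq hΩ h z).fderiv_eq, fderiv_add (smoothAlg_differentiableAt hΩ f z)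
          (smoothAlg_differentiableAt hΩ g z)]
        rfl
      map_smul' := fun c f => smoothAlg_ext fun z => by
        have h : EqOn (ext0 (c • f).1) (c • ext0 f.1) Ω := fun z hz => by
          simp [ext0_of_mem _ hz]
        simp only [mkSm_apply]
        rw [(ext0_eventuallyEq hΩ h z).fderiv_eq,
          fderiv_const_smul (smoothAlg_differentiableAt hΩ f z)]
        rfl }
    fun f g => smoothAlg_ext fun z => by
      have h : EqOn (ext0 (f * g).1) (ext0 f.1 * ext0 g.1) Ω := fun z hz => by
        simp [ext0_of_mem _ hz]
      simp only [LinearMap.coe_mk, AddHom.coe_mk, mkSm_apply]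
      rw [(ext0_eventuallyEq hΩ h z).fderiv_eq, fderiv_mul (smoothAlg_differentiableAt hΩ f z)
          (smoothAlg_differentiableAt hΩ g z)]
      simp [ext0_apply, mkSm]

theorem dirD_apply (hΩ : IsOpen Ω) (v : Pt) (f : smoothAlg Ω) (z : Ω) :
    (dirD hΩ v f).1 z = fderiv ℝ (ext0 f.1) z v := rfl

theorem dirD_mkSm (hΩ : IsOpen Ω) (v : Pt) {f : Pt → ℝ} (hf : ContDiffOn ℝ ∞ f Ω) (z : Ω) :
    (dirD hΩ v (mkSm f hf)).1 z = fderiv ℝ f z v := by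
  rw [dirD_apply, (ext0_eventuallyEq hΩ (ext0_mkSm hf) z).fderiv_eq]

theorem dirD_comm (hΩ : IsOpen Ω) (v w : Pt) (f : smoothAlg Ω) :
    dirD hΩ v (dirD hΩ w f) = dirD hΩ w (dirD hΩ v f) := by
  have hf : ContDiffOn ℝ ∞ (ext0 f.1) Ω := f.2
  have hf' : ContDiffOn ℝ ∞ (fderiv ℝ (ext0 f.1)) Ω := hf.fderiv_of_isOpen hΩ (by simp)
  refine smoothAlg_ext fun z => ?_
  have hd : DifferentiableAt ℝ (fderiv ℝ (ext0 f.1)) z :=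
    (hf'.contDiffAt (hΩ.mem_nhds z.2)).differentiableAt (by simp)
  have hsymm : IsSymmSndFDerivAt ℝ (ext0 f.1) z :=
    (hf.contDiffAt (hΩ.mem_nhds z.2)).isSymmSndFDerivAt
      (by simpa using two_le_infty)
  have key : ∀ v w : Pt, (dirD hΩ v (dirD hΩ w f)).1 z =
      fderiv ℝ (fderiv ℝ (ext0 f.1)) z v w := by
    intro v w
    rw [show dirD hΩ w f = mkSm (fun z => fderiv ℝ (ext0 f.1) z w)
      (hf'.clm_apply contDiffOn_const) from rfl, dirD_mkSm,
      fderiv_clm_apply hd (differentiableAt_const w)]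
    simp
  rw [key, key]
  exact hsymm _ _

theorem smoothAlg_eq_zero_of_sq {f : smoothAlg Ω} (h : f * f = 0) : f = 0 :=
  smoothAlg_ext fun z => by
    have := congrFun (congrArg Subtype.val h) z
    simpa using this

end

/-! ### The linearized Euler equations -/

theorem box_isOpen (K : KinDomain) (D : EosDomain) : IsOpen (box K D) := by
  have : box K D = K.T.carrier ×ˢ K.R.carrier ×ˢ D.I.carrier ×ˢ D.J.carrier ×ˢ K.V.carrier := by
    ext z; simp [box, mem_prod]
  rw [this]
  exact K.T.isOpen.prod (K.R.isOpen.prod (D.I.isOpen.prod (D.J.isOpen.prod K.V.isOpen)))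

theorem hasFDerivAt_comp_eos {D : EosDomain} {h : ℝ → ℝ → ℝ} (hh : Smooth2 D h) {E : Type*}
    [NormedAddCommGroup E] [NormedSpace ℝ E] (l m : E →L[ℝ] ℝ) {j : E}
    (hl : l j ∈ D.I.carrier) (hm : m j ∈ D.J.carrier) :
    HasFDerivAt (fun j => h (l j) (m j)) (dρ h (l j) (m j) • l + dS h (l j) (m j) • m) j := by
  have := (hh.differentiableAt hl hm).hasFDerivAt.comp (f := fun j => (l j, m j)) j
    (l.hasFDerivAt.prodMk m.hasFDerivAt)
  refine this.congr_fderiv ?_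
  ext v
  simp [hh.fderiv_apply hl hm]

/-- The differential of the Euler equations, applied to a tangent vector of the jet space. -/
theorem euler_fderiv (n : ℕ) {D : EosDomain} {p : ℝ → ℝ → ℝ} (hp : Smooth2 D p)
    {t r ρ S U ρ_t S_t U_t ρ_r S_r U_r : ℝ} (hr : 0 < r) (hρ : ρ ∈ D.I.carrier)
    (hS : S ∈ D.J.carrier) (τ ξ h σ η hh_t σ_t η_t hh_r σ_r η_r : ℝ) :
    fderiv ℝ (euler n p) ((t, r, ρ, S, U), (ρ_t, S_t, U_t), (ρ_r, S_r, U_r))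
      ((τ, ξ, h, σ, η), (hh_t, σ_t, η_t), (hh_r, σ_r, η_r)) =
    (η_t + (η * U_r + U * η_r) +
        (((dρ (dS p) ρ S * h + dS (dS p) ρ S * σ) * S_r + dS p ρ S * σ_r +
          ((dρ (dρ p) ρ S * h + dS (dρ p) ρ S * σ) * ρ_r + dρ p ρ S * hh_r)) / ρ -
          (dS p ρ S * S_r + dρ p ρ S * ρ_r) * h / ρ ^ 2),
      hh_t + (η_r * ρ + U_r * h + (η * ρ_r + U * hh_r)) +
        ((n : ℝ) - 1) * (η * ρ / r + U * h / r - U * ρ * ξ / r ^ 2),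
      σ_t + (η * S_r + U * σ_r)) := by
  have hρ0 : ρ ≠ 0 := (D.ρ_pos hρ).ne'
  have hr0 : r ≠ 0 := hr.ne'
  let c1 : Jet →L[ℝ] Pt := .fst ℝ _ _
  let c2 : Jet →L[ℝ] ℝ × ℝ × ℝ := (ContinuousLinearMap.fst ℝ _ _).comp (.snd ℝ _ _)
  let c3 : Jet →L[ℝ] ℝ × ℝ × ℝ := (ContinuousLinearMap.snd ℝ _ _).comp (.snd ℝ _ _)
  let l1 : ℝ × ℝ × ℝ →L[ℝ] ℝ := .fst ℝ _ _
  let l2 : ℝ × ℝ × ℝ →L[ℝ] ℝ := (ContinuousLinearMap.fst ℝ _ _).comp (.snd ℝ _ _)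
  let l3 : ℝ × ℝ × ℝ →L[ℝ] ℝ := (ContinuousLinearMap.snd ℝ _ _).comp (.snd ℝ _ _)
  let c4 : Jet →L[ℝ] ℝ × ℝ × ℝ := (ContinuousLinearMap.snd ℝ _ _).comp
    ((ContinuousLinearMap.snd ℝ _ _).comp c1)
  let jr : Jet →L[ℝ] ℝ := (ContinuousLinearMap.fst ℝ _ _).comp
    ((ContinuousLinearMap.snd ℝ _ _).comp c1)
  let jρ := l1.comp c4
  let jS := l2.comp c4
  let jU := l3.comp c4
  let jρt := l1.comp c2
  let jSt := l2.comp c2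
  let jUt := l3.comp c2
  let jρr := l1.comp c3
  let jSr := l2.comp c3
  let jUr := l3.comp c3
  set j : Jet := ((t, r, ρ, S, U), (ρ_t, S_t, U_t), (ρ_r, S_r, U_r)) with hj
  have qS := hasFDerivAt_comp_eos hp.dS jρ jS (j := j) hρ hS
  have qρ := hasFDerivAt_comp_eos hp.dρ jρ jS (j := j) hρ hS
  have e1 := (jUt.hasFDerivAt (x := j)).add (jU.hasFDerivAt.mul jUr.hasFDerivAt) |>.add
    (((qS.mul jSr.hasFDerivAt).add (qρ.mul jρr.hasFDerivAt)).mul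
      ((hasFDerivAt_inv (𝕜 := ℝ) (x := jρ j) hρ0).comp j jρ.hasFDerivAt))
  have e2 := ((jρt.hasFDerivAt (x := j)).add ((jUr.hasFDerivAt.mul jρ.hasFDerivAt).add
    (jU.hasFDerivAt.mul jρr.hasFDerivAt))).add
      ((((hasFDerivAt_inv (𝕜 := ℝ) (x := jr j) hr0).comp j jr.hasFDerivAt).const_mul
        ((n : ℝ) - 1)).mul jU.hasFDerivAt |>.mul jρ.hasFDerivAt)
  have e3 := (jSt.hasFDerivAt (x := j)).add (jU.hasFDerivAt.mul jSr.hasFDerivAt)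
  have e := e1.prodMk (e2.prodMk e3)
  have : HasFDerivAt (euler n p) _ j := e
  rw [this.fderiv]
  simp only [hj, jUt, jU, jUr, jSr, jρr, jρ, jr, jρt, jSt, jS, c1, c2, c3, c4, l1, l2, l3,
    ContinuousLinearMap.prod_apply, add_apply, smul_apply,
    ContinuousLinearMap.comp_apply, ContinuousLinearMap.coe_fst', ContinuousLinearMap.coe_snd',
    smul_eq_mul, Function.comp, Prod.mk.injEq]
  refine ⟨?_, ?_, ?_⟩
  · simp; field_simp; ring
  · simp; field_simp; ring
  · ring

/-- The values at a point of the coefficients of a vector field (`h`, `σ`, `η` are those of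
`∂_ρ`, `∂_S`, `∂_U`) and of their partial derivatives, which are indicated by the last letter. -/
structure FieldJet where
  (τ ξ h σ η τt ξt ht σt ηt τr ξr hr σr ηr τρ ξρ hρ σρ ηρ τS ξS hS σS ηS τU ξU hU σU ηU : ℝ)

/-- The values at a point of the first and second partial derivatives of an equation of state. -/
structure EosJet where
  (pρ pS pρρ pρS pSS : ℝ)

/-- The prolongation of a vector field applied to the Euler equations, at the jet over the solution
manifold with `(ρ_r, S_r, U_r) = (x, y, w)`; here `m = n - 1`. -/
def FieldJet.defect (c : FieldJet) (e : EosJet) (m r ρ U x y w : ℝ) : ℝ × ℝ × ℝ :=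
  let vρ := -(w * ρ + U * x) - m / r * U * ρ
  let vS := -(U * y)
  let vU := -(U * w) - (e.pS * y + e.pρ * x) / ρ
  let Dtτ := c.τt + vρ * c.τρ + vS * c.τS + vU * c.τU
  let Dtξ := c.ξt + vρ * c.ξρ + vS * c.ξS + vU * c.ξU
  let Drτ := c.τr + x * c.τρ + y * c.τS + w * c.τU
  let Drξ := c.ξr + x * c.ξρ + y * c.ξS + w * c.ξU
  let ht := c.ht + vρ * c.hρ + vS * c.hS + vU * c.hU - Dtτ * vρ - Dtξ * x
  let σt := c.σt + vρ * c.σρ + vS * c.σS + vU * c.σU - Dtτ * vS - Dtξ * y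
  let ηt := c.ηt + vρ * c.ηρ + vS * c.ηS + vU * c.ηU - Dtτ * vU - Dtξ * w
  let hr := c.hr + x * c.hρ + y * c.hS + w * c.hU - Drτ * vρ - Drξ * x
  let σr := c.σr + x * c.σρ + y * c.σS + w * c.σU - Drτ * vS - Drξ * y
  let ηr := c.ηr + x * c.ηρ + y * c.ηS + w * c.ηU - Drτ * vU - Drξ * w
  (ηt + (c.η * w + U * ηr) +
      (((e.pρS * c.h + e.pSS * c.σ) * y + e.pS * σr +
        ((e.pρρ * c.h + e.pρS * c.σ) * x + e.pρ * hr)) / ρ -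
        (e.pS * y + e.pρ * x) * c.h / ρ ^ 2),
    ht + (ηr * ρ + w * c.h + (c.η * x + U * hr)) +
      m * (c.η * ρ / r + U * c.h / r - U * ρ * c.ξ / r ^ 2),
    σt + (c.η * y + U * σr))

/-- The `t`-direction in the space of points `(t, r, ρ, S, U)`. -/
def et : Pt := (1, 0, 0, 0, 0)

/-- The `r`-direction. -/
def er : Pt := (0, 1, 0, 0, 0)

/-- The `ρ`-direction. -/
def eρ : Pt := (0, 0, 1, 0, 0)

/-- The `S`-direction. -/
def eS : Pt := (0, 0, 0, 1, 0)

/-- The `U`-direction. -/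
def eU : Pt := (0, 0, 0, 0, 1)

/-- The first-order jet of a vector field at a point. -/
def fieldJet (X : VField) (z : Pt) : FieldJet :=
  let D := fderiv ℝ X z
  ⟨(X z).1, (X z).2.1, (X z).2.2.1, (X z).2.2.2.1, (X z).2.2.2.2,
    (D et).1, (D et).2.1, (D et).2.2.1, (D et).2.2.2.1, (D et).2.2.2.2,
    (D er).1, (D er).2.1, (D er).2.2.1, (D er).2.2.2.1, (D er).2.2.2.2,
    (D eρ).1, (D eρ).2.1, (D eρ).2.2.1, (D eρ).2.2.2.1, (D eρ).2.2.2.2,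
    (D eS).1, (D eS).2.1, (D eS).2.2.1, (D eS).2.2.2.1, (D eS).2.2.2.2,
    (D eU).1, (D eU).2.1, (D eU).2.2.1, (D eU).2.2.2.1, (D eU).2.2.2.2⟩

/-- The second-order jet of an equation of state at a point. -/
def eosJet (p : ℝ → ℝ → ℝ) (ρ S : ℝ) : EosJet :=
  ⟨dρ p ρ S, dS p ρ S, dρ (dρ p) ρ S, dS (dρ p) ρ S, dS (dS p) ρ S⟩

theorem pt_eq (v : Pt) : v = v.1 • et + v.2.1 • er + v.2.2.1 • eρ + v.2.2.2.1 • eS +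
    v.2.2.2.2 • eU := by
  ext <;> simp [et, er, eρ, eS, eU]

theorem clm_pt_apply {E : Type*} [NormedAddCommGroup E] [NormedSpace ℝ E] (L : Pt →L[ℝ] E)
    (v : Pt) : L v = v.1 • L et + v.2.1 • L er + v.2.2.1 • L eρ + v.2.2.2.1 • L eS +
    v.2.2.2.2 • L eU := by
  conv_lhs => rw [pt_eq v]
  simp only [map_add, map_smul]

theorem euler_eq_zero_iff (n : ℕ) (p : ℝ → ℝ → ℝ) (t r ρ S U vρ vS vU x y w : ℝ) :
    euler n p ((t, r, ρ, S, U), (vρ, vS, vU), (x, y, w)) = 0 ↔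
      vρ = -(w * ρ + U * x) - ((n : ℝ) - 1) / r * U * ρ ∧ vS = -(U * y) ∧
      vU = -(U * w) - (dS p ρ S * y + dρ p ρ S * x) / ρ := by
  simp only [euler, dS, dρ, Prod.mk_eq_zero]
  constructor
  · rintro ⟨h1, h2, h3⟩
    exact ⟨by linear_combination h2, by linear_combination h3, by linear_combination h1⟩
  · rintro ⟨h1, h2, h3⟩
    exact ⟨by linear_combination h3, by linear_combination h1, by linear_combination h2⟩

/-- The linearized symmetry condition. On the solution manifold the `t`-derivatives are functions
of the `r`-derivatives `x`, `y`, `w`, which are arbitrary. -/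
theorem isPointSymmetry_iff (n : ℕ) {D : EosDomain} {p : ℝ → ℝ → ℝ} (hp : Smooth2 D p)
    (K : KinDomain) (X : VField) :
    IsPointSymmetry n p (box K D) X ↔ ContDiffOn ℝ ∞ X (box K D) ∧ ∀ z ∈ box K D, ∀ x y w : ℝ,
      (fieldJet X z).defect (eosJet p z.2.2.1 z.2.2.2.1) ((n : ℝ) - 1) z.2.1 z.2.2.1 z.2.2.2.2
        x y w = 0 := by
  have key : ∀ z ∈ box K D, ∀ vρ vS vU x y w : ℝ, euler n p (z, (vρ, vS, vU), (x, y, w)) = 0 →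
      fderiv ℝ (euler n p) (z, (vρ, vS, vU), (x, y, w))
        (prolong X (z, (vρ, vS, vU), (x, y, w))) =
      (fieldJet X z).defect (eosJet p z.2.2.1 z.2.2.2.1) ((n : ℝ) - 1) z.2.1 z.2.2.1 z.2.2.2.2
        x y w := by
    rintro ⟨t, r, ρ, S, U⟩ ⟨-, hr, hρ, hS, -⟩ vρ vS vU x y w h
    dsimp only at hr hρ hS
    rw [euler_eq_zero_iff] at h
    rw [prolong]
    refine (euler_fderiv n hp (K.pos hr) hρ hS _ _ _ _ _ _ _ _ _ _ _).trans ?_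
    simp only [FieldJet.defect, fieldJet, eosJet, totalDt, totalDr, ← h.1, ← h.2.1, ← h.2.2]
    rw [clm_pt_apply _ (1, 0, vρ, vS, vU), clm_pt_apply _ (0, 1, x, y, w)]
    simp only [hp.dS_dρ hρ hS, Prod.fst_add, Prod.snd_add, Prod.smul_fst, Prod.smul_snd,
      smul_eq_mul, Prod.fst_sub, Prod.snd_sub, Prod.mk.injEq]
    refine ⟨?_, ?_, ?_⟩ <;> ring
  constructor
  · rintro ⟨h1, h2⟩
    refine ⟨h1, fun z hz x y w => ?_⟩
    have h := (euler_eq_zero_iff n p z.1 z.2.1 z.2.2.1 z.2.2.2.1 z.2.2.2.2 _ _ _ x y w).2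
      ⟨rfl, rfl, rfl⟩
    rw [← key z hz _ _ _ x y w h]
    exact h2 _ hz h
  · rintro ⟨h1, h2⟩
    refine ⟨h1, ?_⟩
    rintro ⟨z, ⟨vρ, vS, vU⟩, ⟨x, y, w⟩⟩ hz h
    rw [key z hz _ _ _ x y w h]
    exact h2 z hz x y w

/-! ### The determining equations -/

set_option maxHeartbeats 1000000 in
/-- The coefficients of the quadratic monomials in `(ρ_r, S_r, U_r)`. -/
theorem FieldJet.quadratic_coeffs {c : FieldJet} {e : EosJet} {m r ρ U : ℝ} (hρ : ρ ≠ 0)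
    (hr : r ≠ 0) (H : ∀ x y w, c.defect e m r ρ U x y w = 0) :
    c.σρ = 0 ∧ U * c.τρ = c.ξρ ∧ e.pρ * (U * c.τU - c.ξU) = 0 ∧ e.pS * (U * c.τU - c.ξU) = 0 ∧
    ρ * c.τρ = U * c.τU - c.ξU ∧ U * c.τS = c.ξS ∧
    -e.pS * (U * c.τU - c.ξU) + ρ * c.τρ * e.pS + ρ * c.τS * e.pρ = 0 ∧ e.pS * c.τS = 0 ∧
    -e.pρ ^ 2 * c.τU + ρ * e.pρ * (U * c.τρ - c.ξρ) = 0 ∧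
    -e.pS ^ 2 * c.τU + ρ * e.pS * (U * c.τS - c.ξS) = 0 := by
  have H1 := fun x y w => congrArg (fun q : ℝ × ℝ × ℝ => q.1) (H x y w)
  have H2 := fun x y w => congrArg (fun q : ℝ × ℝ × ℝ => q.2.1) (H x y w)
  have H3 := fun x y w => congrArg (fun q : ℝ × ℝ × ℝ => q.2.2) (H x y w)
  simp only [FieldJet.defect, Prod.fst_zero, Prod.snd_zero] at H1 H2 H3
  refine ⟨?_, ?_, ?_, ?_, ?_, ?_, ?_, ?_, ?_, ?_⟩
  · linear_combination (norm := (field_simp; ring)) -(H3 0 0 1 - H3 0 0 (-1)) / (2 * ρ)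
  · linear_combination (norm := (field_simp; ring))
      -(H3 0 1 1 - H3 0 1 0 - H3 0 0 1 + H3 0 0 0) / ρ
  · linear_combination (norm := (field_simp; ring))
      -(H3 1 1 0 - H3 1 0 0 - H3 0 1 0 + H3 0 0 0) * ρ
  · linear_combination (norm := (field_simp; ring))
      -(H3 0 1 0 + H3 0 (-1) 0 - 2 * H3 0 0 0) * ρ / 2
  · linear_combination (norm := (field_simp; ring))
      -(H2 0 0 1 + H2 0 0 (-1) - 2 * H2 0 0 0) / (2 * ρ)
  · linear_combination (norm := (field_simp; ring))
      (H2 0 1 1 - H2 0 1 0 - H2 0 0 1 + H2 0 0 0) / ρ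
  · linear_combination (norm := (field_simp; ring))
      (H2 1 1 0 - H2 1 0 0 - H2 0 1 0 + H2 0 0 0) * ρ
  · linear_combination (norm := (field_simp; ring))
      (H2 0 1 0 + H2 0 (-1) 0 - 2 * H2 0 0 0) / 2
  · linear_combination (norm := (field_simp; ring))
      (H1 1 0 0 + H1 (-1) 0 0 - 2 * H1 0 0 0) * ρ ^ 2 / 2
  · linear_combination (norm := (field_simp; ring))
      (H1 0 1 0 + H1 0 (-1) 0 - 2 * H1 0 0 0) * ρ ^ 2 / 2

/-- The remaining coefficients, for `τ` and `ξ` that depend on `t` and `r` only. -/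
theorem FieldJet.linear_coeffs {c : FieldJet} {e : EosJet} {m r ρ U : ℝ} (hρ : ρ ≠ 0)
    (hr : r ≠ 0) (H : ∀ x y w, c.defect e m r ρ U x y w = 0) (h1 : c.τρ = 0) (h2 : c.τS = 0)
    (h3 : c.τU = 0) (h4 : c.ξρ = 0) (h5 : c.ξS = 0) (h6 : c.ξU = 0) (h7 : c.σρ = 0) :
    (c.σt + U * c.σr = 0 ∧ e.pρ * c.σU = 0 ∧
      -e.pS * c.σU + ρ * (U * (c.τt + U * c.τr) - c.ξt - U * c.ξr + c.η) = 0) ∧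
    (-e.pρ * c.hU + ρ * (c.η + U * (c.τt + U * c.τr) - c.ξt - U * c.ξr) + ρ ^ 2 * c.ηρ +
        ρ * c.τr * e.pρ = 0 ∧
      -e.pS * c.hU + ρ ^ 2 * c.ηS + ρ * c.τr * e.pS = 0 ∧
      -ρ * c.hρ + c.h + ρ * c.ηU + ρ * (c.τt + U * c.τr) + ρ * (U * c.τr - c.ξr) = 0 ∧
      r ^ 2 * (c.ht + U * c.hr) - r * m * U * ρ * c.hρ + r ^ 2 * ρ * c.ηr +
        (c.τt + U * c.τr) * r * m * U * ρ + m * (c.η * ρ * r + U * c.h * r - U * ρ * c.ξ) = 0) ∧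
    (-ρ ^ 2 * c.ηρ + ρ * (c.η + U * (c.τt + U * c.τr) - c.ξt - U * c.ξr) + e.pS * c.σU +
        e.pρ * c.hU + ρ * e.pρ * c.τr = 0 ∧
      ρ * (-e.pρ * c.ηU + (c.τt + U * c.τr) * e.pρ + e.pρ * c.hρ + e.pρ * (U * c.τr - c.ξr) +
        e.pρS * c.σ + e.pρρ * c.h) - c.h * e.pρ = 0 ∧
      ρ * (-e.pS * c.ηU + (c.τt + U * c.τr) * e.pS + e.pS * c.σS + e.pρ * c.hS +
        e.pS * (U * c.τr - c.ξr) + e.pSS * c.σ + e.pρS * c.h) - c.h * e.pS = 0 ∧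
      r * ρ * (c.ηt + U * c.ηr) - m * U * ρ ^ 2 * c.ηρ + r * (e.pS * c.σr + e.pρ * c.hr) +
        e.pρ * c.τr * m * U * ρ = 0) := by
  have H1 := fun x y w => congrArg (fun q : ℝ × ℝ × ℝ => q.1) (H x y w)
  have H2 := fun x y w => congrArg (fun q : ℝ × ℝ × ℝ => q.2.1) (H x y w)
  have H3 := fun x y w => congrArg (fun q : ℝ × ℝ × ℝ => q.2.2) (H x y w)
  simp only [FieldJet.defect, Prod.fst_zero, Prod.snd_zero, h1, h2, h3, h4, h5, h6, h7]
    at H1 H2 H3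
  refine ⟨⟨?_, ?_, ?_⟩, ⟨?_, ?_, ?_, ?_⟩, ⟨?_, ?_, ?_, ?_⟩⟩
  · linear_combination (norm := (field_simp; ring)) H3 0 0 0
  · linear_combination (norm := (field_simp; ring)) -(H3 1 0 0 - H3 (-1) 0 0) * ρ / 2
  · linear_combination (norm := (field_simp; ring)) (H3 0 1 0 - H3 0 (-1) 0) * ρ / 2
  · linear_combination (norm := (field_simp; ring)) (H2 1 0 0 - H2 (-1) 0 0) * ρ / 2
  · linear_combination (norm := (field_simp; ring)) (H2 0 1 0 - H2 0 (-1) 0) * ρ / 2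
  · linear_combination (norm := (field_simp; ring)) (H2 0 0 1 - H2 0 0 (-1)) / 2
  · linear_combination (norm := (field_simp; ring)) H2 0 0 0 * r ^ 2
  · linear_combination (norm := (field_simp; ring)) (H1 0 0 1 - H1 0 0 (-1)) * ρ / 2
  · linear_combination (norm := (field_simp; ring)) (H1 1 0 0 - H1 (-1) 0 0) * ρ ^ 2 / 2
  · linear_combination (norm := (field_simp; ring)) (H1 0 1 0 - H1 0 (-1) 0) * ρ ^ 2 / 2
  · linear_combination (norm := (field_simp; ring)) H1 0 0 0 * ρ * r

/-! ### Integration of the determining equations in a differential ring -/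

section
variable {A : Type*} [CommRing A]

/-- `τ` and `ξ` do not depend on `ρ`, `S`, `U`. Here `a`, `b` stand for `p_ρ`, `p_S`, and the
equations for the coefficients given by `FieldJet.quadratic_coeffs`. -/
theorem tau_xi_of_quadratic {a b ρ U τρ τS τU ξρ ξS ξU : A} (hρ : IsUnit ρ)
    (hab : ∀ x, a * x = 0 → b * x = 0 → x = 0) (hred : ∀ x : A, x * x = 0 → x = 0)
    (e1 : U * τρ = ξρ) (e2 : a * (U * τU - ξU) = 0) (e3 : b * (U * τU - ξU) = 0)
    (e4 : ρ * τρ = U * τU - ξU) (e5 : U * τS = ξS)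
    (e6 : -b * (U * τU - ξU) + ρ * τρ * b + ρ * τS * a = 0) (e7 : b * τS = 0)
    (e8 : -a ^ 2 * τU + ρ * a * (U * τρ - ξρ) = 0) (e9 : -b ^ 2 * τU + ρ * b * (U * τS - ξS) = 0) :
    τρ = 0 ∧ τS = 0 ∧ τU = 0 ∧ ξρ = 0 ∧ ξS = 0 ∧ ξU = 0 := by
  have f1 : U * τU - ξU = 0 := hab _ e2 e3
  have f2 : τρ = 0 := hρ.mul_right_eq_zero.1 (e4.trans f1)
  have f3 : τS = 0 := hab _ (hρ.mul_right_eq_zero.1 (by 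
    linear_combination e6 + b * f1 - ρ * b * f2)) e7
  have f4 : a * τU = 0 := hred _ (by
    linear_combination -τU * e8 + ρ * a * τU * e1)
  have f5 : b * τU = 0 := hred _ (by
    linear_combination -τU * e9 + ρ * b * τU * e5)
  have f6 : τU = 0 := hab _ f4 f5
  refine ⟨f2, f3, f6, ?_, ?_, ?_⟩
  · linear_combination U * f2 - e1
  · linear_combination U * f3 - e5
  · linear_combination U * f6 - f1

end

/-- The determining equations, solved as far as differentiation in `t`, `r`, `U` goes. The letters
`a`, `b` stand for `p_ρ`, `p_S`, and `c`, `d`, `e` for `p_ρρ`, `p_ρS`, `p_SS`; `m` is `n - 1`, which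
has to be invertible: for `n = 1` there are further symmetries. The hypotheses from `s1` on are the
equations for the coefficients given by `FieldJet.linear_coeffs`. Since `a` and `b` may have zeros,
one cannot divide by either of them; `hab` replaces this. -/
theorem integrate_linear {A : Type*} [CommRing A] [Algebra ℝ A] (D : Pt → Derivation ℝ A A)
    (hD : ∀ v w f, D v (D w f) = D w (D v f)) {a b c d e ρ r U m τ ξ h σ η : A}
    (hρ : IsUnit ρ) (hr : IsUnit r) (hm : IsUnit m)
    (hab : ∀ x, a * x = 0 → b * x = 0 → x = 0) (hred : ∀ x : A, x * x = 0 → x = 0)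
    (hmD : ∀ v, D v m = 0)
    (hrt : D et r = 0) (hrr : D er r = 1) (hrU : D eU r = 0) (hrS : D eS r = 0)
    (hρt : D et ρ = 0) (hρr : D er ρ = 0) (hρU : D eU ρ = 0) (hρS : D eS ρ = 0)
    (hUt : D et U = 0) (hUr : D er U = 0) (hUU : D eU U = 1) (hUS : D eS U = 0)
    (hUρ : D eρ U = 0)
    (hat : D et a = 0) (har : D er a = 0) (haU : D eU a = 0) (haS : D eS a = d)
    (hbt : D et b = 0) (hbr : D er b = 0) (hbU : D eU b = 0)
    (hct : D et c = 0) (hdt : D et d = 0)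
    (het : D et e = 0) (her : D er e = 0) (heU : D eU e = 0)
    (hτρ : D eρ τ = 0) (hτS : D eS τ = 0) (hτU : D eU τ = 0)
    (hξρ : D eρ ξ = 0) (hξS : D eS ξ = 0) (hξU : D eU ξ = 0)
    (s1 : D et σ + U * D er σ = 0) (sa : a * D eU σ = 0)
    (sb : -b * D eU σ + ρ * (U * (D et τ + U * D er τ) - D et ξ - U * D er ξ + η) = 0)
    (ra : -a * D eU h + ρ * (η + U * (D et τ + U * D er τ) - D et ξ - U * D er ξ) +
      ρ ^ 2 * D eρ η + ρ * D er τ * a = 0)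
    (rb : -b * D eU h + ρ ^ 2 * D eS η + ρ * D er τ * b = 0)
    (rc : -ρ * D eρ h + h + ρ * D eU η + ρ * (D et τ + U * D er τ) +
      ρ * (U * D er τ - D er ξ) = 0)
    (r1 : r ^ 2 * (D et h + U * D er h) - r * m * U * ρ * D eρ h + r ^ 2 * ρ * D er η +
        (D et τ + U * D er τ) * r * m * U * ρ + m * (η * ρ * r + U * h * r - U * ρ * ξ) = 0)
    (uc : -ρ ^ 2 * D eρ η + ρ * (η + U * (D et τ + U * D er τ) - D et ξ - U * D er ξ) +
      b * D eU σ + a * D eU h + ρ * a * D er τ = 0)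
    (ua : ρ * (-a * D eU η + (D et τ + U * D er τ) * a + a * D eρ h + a * (U * D er τ - D er ξ) +
        d * σ + c * h) - h * a = 0)
    (ub : ρ * (-b * D eU η + (D et τ + U * D er τ) * b + b * D eS σ + a * D eS h +
        b * (U * D er τ - D er ξ) + e * σ + d * h) - h * b = 0)
    (u1 : r * ρ * (D et η + U * D er η) - m * U * ρ ^ 2 * D eρ η + r * (b * D er σ + a * D er h) +
        a * D er τ * m * U * ρ = 0) :
    (D er τ = 0 ∧ D et (D et τ) = 2 * D et (D er ξ)) ∧
    (ξ = r * D er ξ ∧ D er (D er ξ) = 0 ∧ D et (D et (D er ξ)) = 0) ∧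
    (D et σ = 0 ∧ D er σ = 0 ∧ D eU σ = 0) ∧
    (h = ρ * D eρ h ∧ D eU h = 0 ∧ D er h = 0 ∧ D et h = -((1 + m) * ρ * D et (D er ξ))) ∧
    η = D et ξ + U * (D er ξ - D et τ) ∧
    (2 * (D et τ - D er ξ) * a + d * σ + c * h = 0 ∧
      ρ * (2 * (D et τ - D er ξ) * b + b * D eS σ + a * D eS h + e * σ + d * h) - h * b = 0) ∧
    D et (D er ξ) * (2 * a - (1 + m) * ρ * c) = 0 ∧
    D et (D er ξ) * ((3 + m) * b - (1 + m) * ρ * d) = 0 := by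
  have h2 : IsUnit (2 : A) := by
    have := (IsUnit.mk0 (2 : ℝ) two_ne_zero).map (algebraMap ℝ A)
    rwa [map_ofNat] at this
  have h3 : IsUnit (3 : A) := by
    have := (IsUnit.mk0 (3 : ℝ) three_ne_zero).map (algebraMap ℝ A)
    rwa [map_ofNat] at this
  have hD2 : ∀ v, D v 2 = 0 := fun v => by
    have := (D v).map_natCast 2
    exact_mod_cast this
  have hD4 : ∀ v, D v 4 = 0 := fun v => by
    have := (D v).map_natCast 4
    exact_mod_cast this
  have lz : ∀ v x y, D v (x * y) = x * D v y + y * D v x := fun v x y => by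
    rw [Derivation.leibniz]; rfl
  -- `η` is determined by `τ` and `ξ`, as for a transformation that acts on `t` and `r` only
  have k0 : 3 * (b * D eU σ) + 2 * (ρ * (a * D er τ)) = 0 := by
    linear_combination ra + uc - 2 * sb
  have k1 : a * D er τ = 0 := hred _ <| h2.mul_right_eq_zero.1 <| hρ.mul_right_eq_zero.1 (by
    linear_combination a * D er τ * k0 - 3 * b * D er τ * sa)
  have k2 : D eU σ = 0 := hab _ sa (h3.mul_right_eq_zero.1 (by
    linear_combination k0 - 2 * ρ * k1))
  have k3 : U * (D et τ + U * D er τ) - D et ξ - U * D er ξ + η = 0 :=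
    hρ.mul_right_eq_zero.1 (by linear_combination sb + b * k2)
  have hη : η = D et ξ + U * (D er ξ - D et τ) - U * (U * D er τ) := by linear_combination k3
  have τtρ : D eρ (D et τ) = 0 := by rw [hD, hτρ, map_zero]
  have τtS : D eS (D et τ) = 0 := by rw [hD, hτS, map_zero]
  have τtU : D eU (D et τ) = 0 := by rw [hD, hτU, map_zero]
  have τrρ : D eρ (D er τ) = 0 := by rw [hD, hτρ, map_zero]
  have τrS : D eS (D er τ) = 0 := by rw [hD, hτS, map_zero]
  have τrU : D eU (D er τ) = 0 := by rw [hD, hτU, map_zero]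
  have ξtρ : D eρ (D et ξ) = 0 := by rw [hD, hξρ, map_zero]
  have ξtS : D eS (D et ξ) = 0 := by rw [hD, hξS, map_zero]
  have ξtU : D eU (D et ξ) = 0 := by rw [hD, hξU, map_zero]
  have ξrρ : D eρ (D er ξ) = 0 := by rw [hD, hξρ, map_zero]
  have ξrS : D eS (D er ξ) = 0 := by rw [hD, hξS, map_zero]
  have ξrU : D eU (D er ξ) = 0 := by rw [hD, hξU, map_zero]
  have ηρ : D eρ η = 0 := by
    rw [hη]; simp only [map_add, map_sub, lz, τtρ, τrρ, ξtρ, ξrρ, hUρ]; ring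
  have ηS : D eS η = 0 := by
    rw [hη]; simp only [map_add, map_sub, lz, τtS, τrS, ξtS, ξrS, hUS]; ring
  have ηU : D eU η = D er ξ - D et τ - 2 * (U * D er τ) := by
    rw [hη]; simp only [map_add, map_sub, lz, τtU, τrU, ξtU, ξrU, hUU]; ring
  have k4 : a * D eU h = 0 := by
    linear_combination -ra + ρ * k3 + ρ ^ 2 * ηρ + ρ * k1
  have k5 : b * D eU h = ρ * (b * D er τ) := by linear_combination -rb + ρ ^ 2 * ηS
  have σSU : D eU (D eS σ) = 0 := by rw [hD, k2, map_zero]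
  -- `τ` depends on `t` only: multiply the last equation by `τ_r` and differentiate it in `U`
  have k6 : d * D er τ = 0 := by
    have := congrArg (D eS) k1
    simp only [lz, τrS, haS, map_zero] at this
    linear_combination this
  have k7 : D er τ = 0 := by
    have hub : ρ * (D er τ * (b * (2 * (D et τ - D er ξ) + D eS σ) + e * σ)) +
        ρ * (4 * (D er τ * (D er τ * (b * U)))) - D er τ * (h * b) = 0 := by
      linear_combination D er τ * ub + D er τ * ρ * b * ηU - ρ * D eS h * k1 - ρ * h * k6
    have := congrArg (D eU) hub
    simp only [lz, map_add, map_sub, map_zero, τrU, τtU, ξrU, σSU, k2, hUU,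
      hbU, heU, hρU, hD2, hD4] at this
    have k8 : D er τ * D er τ = 0 := hab _ (by linear_combination D er τ * k1)
      (h3.mul_right_eq_zero.1 <| hρ.mul_right_eq_zero.1 (by
        linear_combination this + D er τ * k5))
    exact hred _ k8
  have hU0 : D eU h = 0 := hab _ k4 (by rw [k5, k7]; ring)
  have hρh : h = ρ * D eρ h := by linear_combination rc - ρ * ηU
  -- the entropy component
  have σr : D er σ = 0 := by
    have := congrArg (D eU) s1
    simp only [lz, map_add, map_zero, hUU, hD eU et, hD eU er, k2] at this
    linear_combination this
  have σt : D et σ = 0 := by linear_combination s1 - U * σr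
  have hη' : η = D et ξ + U * (D er ξ - D et τ) := by rw [hη, k7]; ring
  have τtr : D er (D et τ) = 0 := by rw [hD, k7, map_zero]
  have ηt : D et η = D et (D et ξ) + U * (D et (D er ξ) - D et (D et τ)) := by
    rw [hη']; simp only [map_add, map_sub, lz, hUt]; ring
  have ηr : D er η = D et (D er ξ) + U * D er (D er ξ) := by
    rw [hη']; simp only [map_add, map_sub, lz, hUr, τtr, hD er et]; ring
  have ξttU : D eU (D et (D et ξ)) = 0 := by rw [hD, ξtU, map_zero]
  have ξtrU : D eU (D et (D er ξ)) = 0 := by rw [hD, ξrU, map_zero]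
  have ξrrU : D eU (D er (D er ξ)) = 0 := by rw [hD, ξrU, map_zero]
  have τttU : D eU (D et (D et τ)) = 0 := by rw [hD, τtU, map_zero]
  have hrU' : D eU (D er h) = 0 := by rw [hD, hU0, map_zero]
  have htU' : D eU (D et h) = 0 := by rw [hD, hU0, map_zero]
  -- the velocity equation is a polynomial in `U`
  have u2 : ρ * (D et (D et ξ) + U * (2 * D et (D er ξ) - D et (D et τ)) +
      U * (U * D er (D er ξ))) + a * D er h = 0 := hr.mul_right_eq_zero.1 (by
    linear_combination u1 - r * ρ * ηt - r * ρ * U * ηr + m * U * ρ ^ 2 * ηρ - r * b * σr -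
      m * U * ρ * k1)
  have u3 : 2 * D et (D er ξ) - D et (D et τ) + 2 * (U * D er (D er ξ)) = 0 :=
    hρ.mul_right_eq_zero.1 (by
      have := congrArg (D eU) u2
      simp only [lz, map_add, map_sub, map_zero, ξttU, ξtrU, ξrrU, τttU, hrU', haU, hUU, hρU, hD2]
        at this
      linear_combination this)
  have ξrr : D er (D er ξ) = 0 := h2.mul_right_eq_zero.1 (by
    have := congrArg (D eU) u3
    simp only [lz, map_add, map_sub, map_zero, ξtrU, ξrrU, τttU, hUU, hD2] at this
    linear_combination this)
  have τtt : D et (D et τ) = 2 * D et (D er ξ) := by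
    linear_combination -u3 + 2 * U * ξrr
  have u4 : ρ * D et (D et ξ) + a * D er h = 0 := by
    linear_combination u2 - ρ * U * u3 + ρ * U * U * ξrr
  -- and so is the continuity equation
  have r2 : (r * r * D et h + r * r * ρ * D et (D er ξ) + m * ρ * r * D et ξ) +
      U * (r * r * D er h + m * ρ * (r * D er ξ - ξ)) = 0 := by
    linear_combination r1 - r * m * U * hρh - r ^ 2 * ρ * ηr - m * ρ * r * hη' -
      U * r * m * U * ρ * k7 - r ^ 2 * ρ * U * ξrr
  have r3 : r * r * D er h + m * ρ * (r * D er ξ - ξ) = 0 := by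
    have := congrArg (D eU) r2
    simp only [lz, map_add, map_sub, map_zero, htU', hrU', ξtrU, ξtU, ξrU, hξU, hUU, hρU, hrU, hmD]
      at this
    linear_combination this
  have r4 : r * D et h + r * ρ * D et (D er ξ) + m * ρ * D et ξ = 0 :=
    hr.mul_right_eq_zero.1 (by linear_combination r2 - U * r3)
  -- `β = ξ - r ξ_r` vanishes
  obtain ⟨β, hβ⟩ : ∃ β, β = ξ - r * D er ξ := ⟨_, rfl⟩
  have βr : D er β = 0 := by
    rw [hβ]; simp only [map_sub, lz, hrr, ξrr]; ring
  have βS : D eS β = 0 := by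
    rw [hβ]; simp only [map_sub, lz, hrS, hξS, ξrS]; ring
  have b1 : r * r * D et (D et ξ) + m * (a * β) = 0 := hρ.mul_right_eq_zero.1 (by
    linear_combination r * r * u4 - a * r3 + a * m * ρ * hβ)
  have ξttr : D er (D et (D et ξ)) = D et (D et (D er ξ)) := by rw [hD er et, hD er et]
  have ξttrr : D er (D et (D et (D er ξ))) = 0 := by
    rw [hD er et, hD er et, ξrr, map_zero, map_zero]
  have b2 : 2 * D et (D et ξ) + r * D et (D et (D er ξ)) = 0 := hr.mul_right_eq_zero.1 (by
    have := congrArg (D er) b1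
    simp only [lz, map_add, map_zero, hrr, hmD, har, βr, ξttr] at this
    linear_combination this)
  have b3 : D et (D et (D er ξ)) = 0 := h3.mul_right_eq_zero.1 (by
    have := congrArg (D er) b2
    simp only [lz, map_add, map_zero, hrr, hD2, ξttr, ξttrr] at this
    linear_combination this)
  have ξtt : D et (D et ξ) = 0 := h2.mul_right_eq_zero.1 (by linear_combination b2 - r * b3)
  have b4 : a * β = 0 := hm.mul_right_eq_zero.1 (by linear_combination b1 - r * r * ξtt)
  have b5 : d * β = 0 := by
    have := congrArg (D eS) b4
    simp only [lz, βS, haS, map_zero] at this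
    linear_combination this
  have ub' : ρ * (2 * (D et τ - D er ξ) * b + b * D eS σ + a * D eS h + e * σ + d * h) -
      h * b = 0 := by
    linear_combination ub + ρ * b * ηU - 4 * ρ * b * U * k7
  have β0 : β = 0 := by
    have hub : ρ * (β * (2 * (b * (D et τ - D er ξ)) + b * D eS σ + e * σ)) - β * (h * b) = 0 := by
      linear_combination β * ub' - ρ * D eS h * b4 - ρ * h * b5
    have σSr : D er (D eS σ) = 0 := by rw [hD, σr, map_zero]
    have := congrArg (D er) hub
    simp only [lz, map_add, map_sub, map_zero, τtr, ξrr, σSr, σr, hbr, her, hρr, hD2, βr] at this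
    have b6 : b * (β * β) = 0 := hm.mul_right_eq_zero.1 <| hρ.mul_right_eq_zero.1 (by
      linear_combination -r * r * this - β * b * r3 + β * b * m * ρ * hβ)
    exact hred _ (hab _ (by linear_combination β * b4) b6)
  have hξ : ξ = r * D er ξ := by linear_combination β0 - hβ
  have hr0 : D er h = 0 := hr.mul_right_eq_zero.1 <| hr.mul_right_eq_zero.1 (by
    linear_combination r3 + m * ρ * hξ)
  have ξt : D et ξ = r * D et (D er ξ) := by
    have := congrArg (D et) hξ
    rw [lz, hrt] at this
    linear_combination this
  have ht0 : D et h = -((1 + m) * ρ * D et (D er ξ)) := by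
    have : D et h + (1 + m) * ρ * D et (D er ξ) = 0 := hr.mul_right_eq_zero.1 (by
      linear_combination r4 - m * ρ * ξt)
    linear_combination this
  have ua' : 2 * (D et τ - D er ξ) * a + d * σ + c * h = 0 := hρ.mul_right_eq_zero.1 (by
    linear_combination ua + ρ * a * ηU - 4 * ρ * U * k1 + a * hρh)
  -- the terms linear in `t`
  have c1 : D et (D er ξ) * (2 * a - (1 + m) * ρ * c) = 0 := by
    have := congrArg (D et) ua'
    simp only [lz, map_add, map_sub, map_zero, hD2, hat, hct, hdt, σt, ht0, τtt] at this
    linear_combination this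
  have hSt : D et (D eS h) = 0 := by
    rw [hD, ht0]
    have ξtrS : D eS (D et (D er ξ)) = 0 := by rw [hD, ξrS, map_zero]
    simp only [map_neg, lz, map_add, hmD, hρS, ξtrS, Derivation.map_one_eq_zero]
    ring
  have c2 : D et (D er ξ) * ((3 + m) * b - (1 + m) * ρ * d) = 0 := hρ.mul_right_eq_zero.1 (by
    have σSt : D et (D eS σ) = 0 := by rw [hD, σt, map_zero]
    have := congrArg (D et) ub'
    simp only [lz, map_add, map_sub, map_zero, hD2, hat, hbt, hdt, het, hρt, σt, ht0, hSt, σSt, τtt]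
      at this
    linear_combination this)
  exact ⟨⟨k7, τtt⟩, ⟨hξ, ξrr, b3⟩, ⟨σt, σr, k2⟩, ⟨hρh, hU0, hr0, ht0⟩, hη', ⟨ua', ub'⟩, c1, c2⟩

/-! ### The general form of a point symmetry -/

/-- The conditions on `μ`, `F` and `g` under which
`μ (r ∂_r + U ∂_U) + F(S) ∂_S + g(S) ρ ∂_ρ` is a symmetry. They say that
`d(F p_S + g ρ p_ρ) = (g + 2 μ) dp`. -/
structure IsReduced (D : EosDomain) (p : ℝ → ℝ → ℝ) (μ : ℝ) (F g : ℝ → ℝ) : Prop where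
  smoothF : ContDiffOn ℝ ∞ F D.J.carrier
  smoothg : ContDiffOn ℝ ∞ g D.J.carrier
  eqρ : ∀ ρ ∈ D.I.carrier, ∀ S ∈ D.J.carrier,
    -2 * μ * dρ p ρ S + F S * dS (dρ p) ρ S + g S * ρ * dρ (dρ p) ρ S = 0
  eqS : ∀ ρ ∈ D.I.carrier, ∀ S ∈ D.J.carrier,
    -2 * μ * dS p ρ S + deriv F S * dS p ρ S + F S * dS (dS p) ρ S +
      deriv g S * ρ * dρ p ρ S + g S * ρ * dS (dρ p) ρ S - g S * dS p ρ S = 0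

/-- The vector field
`(c₁ + c₂ t + a t²) ∂_t + (c₂ + μ + a t) r ∂_r + (g(S) - n a t) ρ ∂_ρ + F(S) ∂_S
  + (a (r - t U) + μ U) ∂_U`. -/
def symField (n : ℕ) (c₁ c₂ a μ : ℝ) (F g : ℝ → ℝ) : VField := fun (t, r, ρ, S, U) =>
  (c₁ + c₂ * t + a * t ^ 2, (c₂ + μ) * r + a * (r * t), g S * ρ - n * a * (t * ρ), F S,
    a * (r - t * U) + μ * U)

/-- The restriction to the box of a smooth function of density and entropy. -/
def mkE {D : EosDomain} (K : KinDomain) {h : ℝ → ℝ → ℝ} (hh : Smooth2 D h) :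
    smoothAlg (box K D) :=
  mkSm (fun z => h z.2.2.1 z.2.2.2.1) (ContDiffOn.comp
    (f := fun z : Pt => (z.2.2.1, z.2.2.2.1)) hh (ContDiff.contDiffOn (by fun_prop))
    fun _ hz => ⟨hz.2.2.1, hz.2.2.2.1⟩)

/-- The density, as a linear functional on the space of points. -/
def prρ : Pt →L[ℝ] ℝ := (ContinuousLinearMap.fst ℝ _ _).comp
  ((ContinuousLinearMap.snd ℝ _ _).comp (.snd ℝ _ _))
/-- The entropy, as a linear functional on the space of points. -/
def prS : Pt →L[ℝ] ℝ := (ContinuousLinearMap.fst ℝ _ _).comp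
  ((ContinuousLinearMap.snd ℝ _ _).comp ((ContinuousLinearMap.snd ℝ _ _).comp (.snd ℝ _ _)))
/-- The velocity, as a linear functional on the space of points. -/
def prU : Pt →L[ℝ] ℝ := (ContinuousLinearMap.snd ℝ _ _).comp
  ((ContinuousLinearMap.snd ℝ _ _).comp ((ContinuousLinearMap.snd ℝ _ _).comp (.snd ℝ _ _)))
/-- The time, as a linear functional on the space of points. -/
def prt : Pt →L[ℝ] ℝ := .fst ℝ _ _
/-- The radius, as a linear functional on the space of points. -/
def prr : Pt →L[ℝ] ℝ := (ContinuousLinearMap.fst ℝ _ _).comp (.snd ℝ _ _)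

theorem symField_hasFDerivAt (n : ℕ) {J : OpenInterval} (c₁ c₂ a μ : ℝ) {F g : ℝ → ℝ}
    (hF : ContDiffOn ℝ ∞ F J.carrier) (hg : ContDiffOn ℝ ∞ g J.carrier)
    (t r ρ S U : ℝ) (hS : S ∈ J.carrier) (v : Pt) :
    fderiv ℝ (symField n c₁ c₂ a μ F g) (t, r, ρ, S, U) v =
      (c₂ * v.1 + 2 * a * t * v.1, (c₂ + μ) * v.2.1 + a * (r * v.1 + t * v.2.1),
        g S * v.2.2.1 + deriv g S * ρ * v.2.2.2.1 - n * a * (t * v.2.2.1 + ρ * v.1),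
        deriv F S * v.2.2.2.1,
        a * (v.2.1 - t * v.2.2.2.2 - U * v.1) + μ * v.2.2.2.2) := by
  set z : Pt := (t, r, ρ, S, U) with hz
  have dt := prt.hasFDerivAt (x := z)
  have dr := prr.hasFDerivAt (x := z)
  have dρ := prρ.hasFDerivAt (x := z)
  have dU := prU.hasFDerivAt (x := z)
  have dF := (smooth_differentiableAt hF hS).hasDerivAt.comp_hasFDerivAt (f := prS) z
    prS.hasFDerivAt
  have dg := (smooth_differentiableAt hg hS).hasDerivAt.comp_hasFDerivAt (f := prS) z
    prS.hasFDerivAt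
  have e1 := ((hasFDerivAt_const c₁ z).add (dt.const_mul c₂)).add ((dt.pow 2).const_mul a)
  have e2 := (dr.const_mul (c₂ + μ)).add ((dr.mul dt).const_mul a)
  have e3 := (dg.mul dρ).sub ((dt.mul dρ).const_mul ((n : ℝ) * a))
  have e5 := ((dr.sub (dt.mul dU)).const_mul a).add (dU.const_mul μ)
  have e : HasFDerivAt (symField n c₁ c₂ a μ F g) _ z :=
    e1.prodMk (e2.prodMk (e3.prodMk (dF.prodMk e5)))
  rw [e.fderiv]
  simp only [hz, prt, prr, prρ, prS, prU, ContinuousLinearMap.prod_apply, add_apply, sub_apply,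
    smul_apply, ContinuousLinearMap.comp_apply, ContinuousLinearMap.coe_fst', zero_apply,
    ContinuousLinearMap.coe_snd', smul_eq_mul, nsmul_eq_mul, Function.comp, Prod.mk.injEq]
  exact ⟨by norm_num; ring, trivial, by ring, trivial, by ring⟩

theorem contDiffOn_symField (n : ℕ) {D : EosDomain} (K : KinDomain) (c₁ c₂ a μ : ℝ) {F g : ℝ → ℝ}
    (hF : ContDiffOn ℝ ∞ F D.J.carrier) (hg : ContDiffOn ℝ ∞ g D.J.carrier) :
    ContDiffOn ℝ ∞ (symField n c₁ c₂ a μ F g) (box K D) := by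
  have hS : ContDiffOn ℝ ∞ (fun z : Pt => z.2.2.2.1) (box K D) :=
    ContDiff.contDiffOn (by fun_prop)
  have hF' := hF.comp hS fun z hz => hz.2.2.2.1
  have hg' := hg.comp hS fun z hz => hz.2.2.2.1
  refine ContDiffOn.prodMk (ContDiff.contDiffOn (by fun_prop)) (ContDiffOn.prodMk
    (ContDiff.contDiffOn (by fun_prop)) (ContDiffOn.prodMk (ContDiffOn.sub (hg'.mul
    (ContDiff.contDiffOn (by fun_prop))) (ContDiff.contDiffOn (by fun_prop)))
    (ContDiffOn.prodMk hF' (ContDiff.contDiffOn (by fun_prop)))))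

/-- The two instances of `IsReduced` belong to the part of the field that does not depend on `t`,
and to the part that is multiplied by `t`, which comes from the conformal symmetry. -/
theorem isPointSymmetry_symField {n : ℕ} {D : EosDomain} {p : ℝ → ℝ → ℝ} (hp : Smooth2 D p)
    (K : KinDomain) (c₁ c₂ : ℝ) {a μ : ℝ} {F g : ℝ → ℝ} (h : IsReduced D p μ F g)
    (ha : IsReduced D p a (fun _ => 0) (fun _ => n * a)) :
    IsPointSymmetry n p (box K D) (symField n c₁ c₂ a μ F g) := by
  rw [isPointSymmetry_iff n hp]
  refine ⟨contDiffOn_symField n K c₁ c₂ a μ h.smoothF h.smoothg, ?_⟩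
  rintro ⟨t, r, ρ, S, U⟩ ⟨-, hr, hρ, hS, -⟩ x y w
  dsimp only at hr hρ hS
  have hρ0 := (D.ρ_pos hρ).ne'
  have hr0 : r ≠ 0 := (K.pos hr).ne'
  have h1 := h.eqρ ρ hρ S hS
  have h2 := h.eqS ρ hρ S hS
  have h3 := ha.eqρ ρ hρ S hS
  have h4 := ha.eqS ρ hρ S hS
  simp only [deriv_const] at h4
  simp only [FieldJet.defect, fieldJet, eosJet, symField_hasFDerivAt n c₁ c₂ a μ h.smoothF
    h.smoothg t r ρ S U hS, et, er, eρ, eS, eU, symField, Prod.mk_eq_zero]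
  refine ⟨?_, ?_, ?_⟩
  · linear_combination (norm := (field_simp; ring)) (h1 - t * h3) * x / ρ + (h2 - t * h4) * y / ρ
  · field_simp; ring
  · ring

theorem IsPointSymmetry.congr {n : ℕ} {D : EosDomain} {p : ℝ → ℝ → ℝ} (hp : Smooth2 D p)
    {K : KinDomain} {X Y : VField} (h : IsPointSymmetry n p (box K D) X)
    (hXY : EqOn Y X (box K D)) : IsPointSymmetry n p (box K D) Y := by
  rw [isPointSymmetry_iff n hp] at h ⊢
  refine ⟨h.1.congr hXY, fun z hz x y w => ?_⟩
  have : fderiv ℝ Y z = fderiv ℝ X z := by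
    apply Filter.EventuallyEq.fderiv_eq
    filter_upwards [(box_isOpen K D).mem_nhds hz] with z' hz' using hXY hz'
  rw [show fieldJet Y z = fieldJet X z by simp only [fieldJet, this, hXY hz]]
  exact h.2 z hz x y w

section
variable {Ω : Set Pt}

/-- Evaluation at a point, as a homomorphism of algebras. -/
def evalAt (z : Ω) : smoothAlg Ω →ₐ[ℝ] ℝ := (Pi.evalAlgHom ℝ (fun _ : Ω => ℝ) z).comp
  (smoothAlg Ω).val

theorem evalAt_ext {f g : smoothAlg Ω} (h : ∀ z, evalAt z f = evalAt z g) : f = g :=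
  smoothAlg_ext h

theorem evalAt_mkSm {f : Pt → ℝ} (hf : ContDiffOn ℝ ∞ f Ω) (z : Ω) :
    evalAt z (mkSm f hf) = f z := rfl

theorem evalAt_dirD_mkSm (hΩ : IsOpen Ω) {f : Pt → ℝ} (hf : ContDiffOn ℝ ∞ f Ω) (v : Pt) (z : Ω) :
    evalAt z (dirD hΩ v (mkSm f hf)) = fderiv ℝ f z v := dirD_mkSm hΩ v hf z

theorem isUnit_mkSm {f : Pt → ℝ} (hf : ContDiffOn ℝ ∞ f Ω) (h0 : ∀ z ∈ Ω, f z ≠ 0) :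
    IsUnit (mkSm f hf) :=
  IsUnit.of_mul_eq_one (mkSm (fun z => (f z)⁻¹) (hf.inv h0)) (evalAt_ext fun z => by
    rw [map_mul, map_one, evalAt_mkSm, evalAt_mkSm, mul_inv_cancel₀ (h0 z z.2)])

theorem dirD_mkSm_clm (hΩ : IsOpen Ω) (l : Pt →L[ℝ] ℝ) (v : Pt) :
    dirD hΩ v (mkSm (fun z => l z) l.contDiff.contDiffOn) = algebraMap ℝ _ (l v) :=
  evalAt_ext fun z => by
    rw [evalAt_dirD_mkSm, AlgHom.commutes, l.fderiv]; rfl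

end

section
variable {K : KinDomain} {D : EosDomain}

theorem box_convex (K : KinDomain) (D : EosDomain) : Convex ℝ (box K D) := by
  have : box K D = K.T.carrier ×ˢ K.R.carrier ×ˢ D.I.carrier ×ˢ D.J.carrier ×ˢ K.V.carrier := by
    ext z; simp [box, mem_prod]
  rw [this]
  exact K.T.convex.prod (K.R.convex.prod (D.I.convex.prod (D.J.convex.prod K.V.convex)))

/-- The directional derivatives of the smooth functions on a box. -/
abbrev bD (K : KinDomain) (D : EosDomain) (v : Pt) :
    Derivation ℝ (smoothAlg (box K D)) (smoothAlg (box K D)) := dirD (box_isOpen K D) v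

theorem bD_mkE {h : ℝ → ℝ → ℝ} (hh : Smooth2 D h) (v : Pt) : bD K D v (mkE K hh) =
    algebraMap ℝ _ v.2.2.1 * mkE K hh.dρ + algebraMap ℝ _ v.2.2.2.1 * mkE K hh.dS :=
  evalAt_ext fun z => by
    have := hasFDerivAt_comp_eos hh prρ prS (j := z.1) z.2.2.2.1 z.2.2.2.2.1
    rw [bD, mkE, evalAt_dirD_mkSm]
    refine (congrArg (fun L : Pt →L[ℝ] ℝ => L v) this.fderiv).trans ?_
    simp [mkE, evalAt_mkSm, prρ, prS, mul_comm]

/-- The role of the non-constancy of the equation of state: the common zeros of `p_ρ` and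
`p_S` have empty interior, so that no smooth function but zero is annihilated by both. -/
theorem mkE_annihilator {p : ℝ → ℝ → ℝ} (hp : IsEos D p) (x : smoothAlg (box K D))
    (h1 : mkE K hp.smooth2.dρ * x = 0) (h2 : mkE K hp.smooth2.dS * x = 0) : x = 0 := by
  refine evalAt_ext ?_
  rintro ⟨⟨t, r, ρ, S, U⟩, hz⟩
  rw [map_zero]
  by_contra hne
  have hx : ContinuousOn (ext0 x.1) (box K D) := ContDiffOn.continuousOn x.2
  have hne' : ext0 x.1 (t, r, ρ, S, U) ≠ 0 := by rw [ext0_of_mem _ hz]; exact hne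
  have hN : (fun y : ℝ × ℝ => (t, r, y.1, y.2, U)) ⁻¹' {z | ext0 x.1 z ≠ 0} ∈ nhds (ρ, S) := by
    apply ContinuousAt.preimage_mem_nhds (by fun_prop)
    exact (hx.continuousAt ((box_isOpen K D).mem_nhds hz)).eventually_ne hne'
  obtain ⟨D', hD', -, -, hD⟩ := D.exists_sub_mem hz.2.2.1 hz.2.2.2.1 hN
  obtain ⟨ρ', hρ', S', hS', h⟩ := (hp.mono hD').exists_deriv_ne_zero
  have hz' : (t, r, ρ', S', U) ∈ box K D := ⟨hz.1, hz.2.1, hD'.1 hρ', hD'.2 hS', hz.2.2.2.2⟩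
  have e1 := congrArg (evalAt ⟨_, hz'⟩) h1
  have e2 := congrArg (evalAt ⟨_, hz'⟩) h2
  have h0 : evalAt ⟨_, hz'⟩ x ≠ 0 := by
    have := hD ρ' hρ' S' hS'
    simp only [mem_preimage, mem_ofPred_eq, ext0_of_mem _ hz'] at this
    exact this
  rw [map_mul, map_zero, mkE, evalAt_mkSm] at e1 e2
  rcases h with h | h
  · exact h ((mul_eq_zero.1 e1).resolve_right h0)
  · exact h ((mul_eq_zero.1 e2).resolve_right h0)

/-- A function all of whose partial derivatives but that in `S` vanish depends on `S` only. -/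
theorem evalAt_eq_of_bD_eq_zero {f : smoothAlg (box K D)} (ht : bD K D et f = 0)
    (hr : bD K D er f = 0) (hρ : bD K D eρ f = 0) (hU : bD K D eU f = 0) {z z' : Pt}
    (hz : z ∈ box K D) (hz' : z' ∈ box K D) (hS : bD K D eS f = 0 ∨ z.2.2.2.1 = z'.2.2.2.1) :
    evalAt ⟨z, hz⟩ f = evalAt ⟨z', hz'⟩ f := by
  have hseg : ∀ s ∈ Icc (0 : ℝ) 1, z + s • (z' - z) ∈ box K D := fun s hs =>
    (box_convex K D).add_smul_sub_mem hz hz' hs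
  have hd : ∀ s ∈ Icc (0 : ℝ) 1, HasDerivAt (fun s : ℝ => ext0 f.1 (z + s • (z' - z))) 0 s := by
    intro s hs
    have h1 := (smoothAlg_differentiableAt (box_isOpen K D) f ⟨_, hseg s hs⟩).hasFDerivAt
    have h2 : HasDerivAt (fun s : ℝ => z + s • (z' - z)) (z' - z) s := by
      simpa using ((hasDerivAt_id s).smul_const (z' - z)).const_add z
    have h3 := h1.comp_hasDerivAt s h2
    refine h3.congr_deriv ?_
    have ev : ∀ v, bD K D v f = 0 → fderiv ℝ (ext0 f.1) (z + s • (z' - z)) v = 0 := fun v hv => by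
      have := congrArg (evalAt ⟨_, hseg s hs⟩) hv
      rw [map_zero] at this
      exact this
    rw [clm_pt_apply, ev _ ht, ev _ hr, ev _ hρ, ev _ hU]
    rcases hS with hS | hS
    · rw [ev _ hS]; simp
    · simp [hS]
  have h := constant_of_has_deriv_right_zero (f := fun s : ℝ => ext0 f.1 (z + s • (z' - z)))
    (fun s hs => (hd s hs).continuousAt.continuousWithinAt)
    (fun s hs => (hd s ⟨hs.1, hs.2.le⟩).hasDerivWithinAt) 1 (by simp)
  simp only [one_smul, zero_smul, add_zero, add_sub_cancel] at h
  rw [ext0_of_mem _ hz, ext0_of_mem _ hz'] at h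
  exact h.symm

theorem box_nonempty (K : KinDomain) (D : EosDomain) : (box K D).Nonempty := by
  obtain ⟨t, ht⟩ := K.T.nonempty
  obtain ⟨r, hr⟩ := K.R.nonempty
  obtain ⟨ρ, hρ⟩ := D.I.nonempty
  obtain ⟨S, hS⟩ := D.J.nonempty
  obtain ⟨U, hU⟩ := K.V.nonempty
  exact ⟨(t, r, ρ, S, U), ht, hr, hρ, hS, hU⟩

theorem exists_const_of_bD_eq_zero {f : smoothAlg (box K D)} (ht : bD K D et f = 0)
    (hr : bD K D er f = 0) (hρ : bD K D eρ f = 0) (hS : bD K D eS f = 0)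
    (hU : bD K D eU f = 0) : ∃ c : ℝ, f = algebraMap ℝ _ c := by
  obtain ⟨z₀, hz₀⟩ := box_nonempty K D
  exact ⟨evalAt ⟨z₀, hz₀⟩ f, evalAt_ext fun z => by
    rw [AlgHom.commutes]
    exact evalAt_eq_of_bD_eq_zero ht hr hρ hU z.2 hz₀ (.inl hS)⟩

theorem exists_fun_of_bD_eq_zero {f : smoothAlg (box K D)} (ht : bD K D et f = 0)
    (hr : bD K D er f = 0) (hρ : bD K D eρ f = 0) (hU : bD K D eU f = 0) :
    ∃ F : ℝ → ℝ, ∃ hF : ContDiffOn ℝ ∞ F D.J.carrier, f = mkE K (smooth2_of_S hF) := by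
  obtain ⟨⟨t, r, ρ, S, U⟩, hz₀⟩ := box_nonempty K D
  have hmem : ∀ S' ∈ D.J.carrier, (t, r, ρ, S', U) ∈ box K D := fun S' hS' =>
    ⟨hz₀.1, hz₀.2.1, hz₀.2.2.1, hS', hz₀.2.2.2.2⟩
  refine ⟨fun S' => ext0 f.1 (t, r, ρ, S', U), ?_, evalAt_ext fun z => ?_⟩
  · exact ContDiffOn.comp (f := fun S' : ℝ => ((t, r, ρ, S', U) : Pt)) f.2
      (ContDiff.contDiffOn (by fun_prop)) hmem
  · rw [mkE, evalAt_mkSm]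
    change evalAt z f = ext0 f.1 (t, r, ρ, z.1.2.2.2.1, U)
    rw [ext0_of_mem _ (hmem _ z.2.2.2.2.1)]
    exact evalAt_eq_of_bD_eq_zero ht hr hρ hU z.2 _ (.inr rfl)

end

set_option maxHeartbeats 1000000 in
/-- Every point symmetry has the general form, and its parameters satisfy the reduced equations; the
converse is `isPointSymmetry_symField`. -/
theorem exists_symField {n : ℕ} (hn : 2 ≤ n) {D : EosDomain} {p : ℝ → ℝ → ℝ} (hp : IsEos D p)
    {K : KinDomain} {X : VField} (hX : IsPointSymmetry n p (box K D) X) :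
    ∃ (c₁ c₂ a μ : ℝ) (F g : ℝ → ℝ), IsReduced D p μ F g ∧
      IsReduced D p a (fun _ => 0) (fun _ => n * a) ∧
      EqOn X (symField n c₁ c₂ a μ F g) (box K D) := by
  rw [isPointSymmetry_iff n hp.smooth2] at hX
  obtain ⟨hXs, hX⟩ := hX
  have hpp := hp.smooth2
  have hΩ := box_isOpen K D
  -- the ring elements
  let τ := mkSm (fun z => (X z).1) hXs.fst
  let ξ := mkSm (fun z => (X z).2.1) hXs.snd.fst
  let h := mkSm (fun z => (X z).2.2.1) hXs.snd.snd.fst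
  let σ := mkSm (fun z => (X z).2.2.2.1) hXs.snd.snd.snd.fst
  let η := mkSm (fun z => (X z).2.2.2.2) hXs.snd.snd.snd.snd
  let t : smoothAlg (box K D) := mkSm (fun z => prt z) prt.contDiff.contDiffOn
  let r : smoothAlg (box K D) := mkSm (fun z => prr z) prr.contDiff.contDiffOn
  let ρ : smoothAlg (box K D) := mkSm (fun z => prρ z) prρ.contDiff.contDiffOn
  let U : smoothAlg (box K D) := mkSm (fun z => prU z) prU.contDiff.contDiffOn
  have hDt : ∀ v, bD K D v t = algebraMap ℝ _ v.1 := fun v => dirD_mkSm_clm hΩ prt v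
  have hDr : ∀ v, bD K D v r = algebraMap ℝ _ v.2.1 := fun v => dirD_mkSm_clm hΩ prr v
  have hDρ : ∀ v, bD K D v ρ = algebraMap ℝ _ v.2.2.1 := fun v => dirD_mkSm_clm hΩ prρ v
  have hDU : ∀ v, bD K D v U = algebraMap ℝ _ v.2.2.2.2 := fun v => dirD_mkSm_clm hΩ prU v
  let a := mkE K hpp.dρ
  let b := mkE K hpp.dS
  let c := mkE K hpp.dρ.dρ
  let d := mkE K hpp.dρ.dS
  let e := mkE K hpp.dS.dS
  let m : smoothAlg (box K D) := algebraMap ℝ _ ((n : ℝ) - 1)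
  have ht : ∀ z, evalAt z t = z.1.1 := fun z => rfl
  have hr : ∀ z, evalAt z r = z.1.2.1 := fun z => rfl
  have hρ : ∀ z, evalAt z ρ = z.1.2.2.1 := fun z => rfl
  have hU : ∀ z, evalAt z U = z.1.2.2.2.2 := fun z => rfl
  have ha : ∀ z, evalAt z a = dρ p z.1.2.2.1 z.1.2.2.2.1 := fun z => rfl
  have hb : ∀ z, evalAt z b = dS p z.1.2.2.1 z.1.2.2.2.1 := fun z => rfl
  have hc : ∀ z, evalAt z c = dρ (dρ p) z.1.2.2.1 z.1.2.2.2.1 := fun z => rfl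
  have hd : ∀ z, evalAt z d = dS (dρ p) z.1.2.2.1 z.1.2.2.2.1 := fun z => rfl
  have he : ∀ z, evalAt z e = dS (dS p) z.1.2.2.1 z.1.2.2.2.1 := fun z => rfl
  have hm : ∀ z, evalAt z m = (n : ℝ) - 1 := fun z => (evalAt z).commutes _
  have hξ : ∀ z, evalAt z ξ = (fieldJet X z).ξ := fun z => rfl
  have hh : ∀ z, evalAt z h = (fieldJet X z).h := fun z => rfl
  have hσ : ∀ z, evalAt z σ = (fieldJet X z).σ := fun z => rfl
  have hη : ∀ z, evalAt z η = (fieldJet X z).η := fun z => rfl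
  have hXd : ∀ z : box K D, HasFDerivAt X (fderiv ℝ X z) z := fun z =>
    ((hXs.contDiffAt (hΩ.mem_nhds z.2)).differentiableAt (by simp)).hasFDerivAt
  have vτ : ∀ v z, evalAt z (bD K D v τ) = (fderiv ℝ X z v).1 := fun v z => by
    rw [evalAt_dirD_mkSm, ((hXd z).fst).fderiv]; rfl
  have vξ : ∀ v z, evalAt z (bD K D v ξ) = (fderiv ℝ X z v).2.1 := fun v z => by
    rw [evalAt_dirD_mkSm, ((hXd z).snd.fst).fderiv]; rfl
  have vh : ∀ v z, evalAt z (bD K D v h) = (fderiv ℝ X z v).2.2.1 := fun v z => by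
    rw [evalAt_dirD_mkSm, ((hXd z).snd.snd.fst).fderiv]; rfl
  have vσ : ∀ v z, evalAt z (bD K D v σ) = (fderiv ℝ X z v).2.2.2.1 := fun v z => by
    rw [evalAt_dirD_mkSm, ((hXd z).snd.snd.snd.fst).fderiv]; rfl
  have vη : ∀ v z, evalAt z (bD K D v η) = (fderiv ℝ X z v).2.2.2.2 := fun v z => by
    rw [evalAt_dirD_mkSm, ((hXd z).snd.snd.snd.snd).fderiv]; rfl
  have hρu : IsUnit ρ := isUnit_mkSm _ fun z hz => (D.ρ_pos hz.2.2.1).ne'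
  have hru : IsUnit r := isUnit_mkSm _ fun z hz => (K.pos hz.2.1).ne'
  have hn1 : (n : ℝ) - 1 ≠ 0 := by
    have : (2 : ℝ) ≤ n := by exact_mod_cast hn
    linarith
  have hmu : IsUnit m := (IsUnit.mk0 _ hn1).map (algebraMap ℝ _)
  have hab : ∀ x, a * x = 0 → b * x = 0 → x = 0 := mkE_annihilator hp
  have hred : ∀ x : smoothAlg (box K D), x * x = 0 → x = 0 := fun _ => smoothAlg_eq_zero_of_sq
  have hρ0 : ∀ z : box K D, z.1.2.2.1 ≠ 0 := fun z => (D.ρ_pos z.2.2.2.1).ne'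
  have hr0 : ∀ z : box K D, z.1.2.1 ≠ 0 := fun z => (K.pos z.2.2.1).ne'
  have Q := fun z : box K D => FieldJet.quadratic_coeffs (hρ0 z) (hr0 z) (hX z z.2)
  -- `τ` and `ξ` depend on `t` and `r` only
  obtain ⟨τρ, τS, τU, ξρ, ξS, ξU⟩ : bD K D eρ τ = 0 ∧ bD K D eS τ = 0 ∧ bD K D eU τ = 0 ∧
      bD K D eρ ξ = 0 ∧ bD K D eS ξ = 0 ∧ bD K D eU ξ = 0 := by
    apply tau_xi_of_quadratic (U := U) hρu hab hred <;> refine evalAt_ext fun z => ?_ <;>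
      obtain ⟨q0, q1, q2, q3, q4, q5, q6, q7, q8, q9⟩ := Q z <;>
      simp only [map_mul, map_sub, map_add, map_neg, map_pow, map_zero, hU, hρ, ha, hb, vτ, vξ]
    exacts [q1, q2, q3, q4, q5, q6, q7, q8, q9]
  have σρ : bD K D eρ σ = 0 := evalAt_ext fun z => by
    rw [vσ, map_zero]; exact (Q z).1
  have e0 : ∀ {x : smoothAlg (box K D)}, x = 0 → ∀ z, evalAt z x = 0 := fun hx z => by
    rw [hx, map_zero]
  have W := fun z : box K D => FieldJet.linear_coeffs (hρ0 z) (hr0 z) (hX z z.2)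
    ((vτ _ z).symm.trans (e0 τρ z)) ((vτ _ z).symm.trans (e0 τS z))
    ((vτ _ z).symm.trans (e0 τU z)) ((vξ _ z).symm.trans (e0 ξρ z))
    ((vξ _ z).symm.trans (e0 ξS z)) ((vξ _ z).symm.trans (e0 ξU z))
    ((vσ _ z).symm.trans (e0 σρ z))
  have Da : ∀ v, bD K D v a = algebraMap ℝ _ v.2.2.1 * c + algebraMap ℝ _ v.2.2.2.1 * d :=
    bD_mkE _
  have Db : ∀ v, v.2.2.1 = 0 → v.2.2.2.1 = 0 → bD K D v b = 0 := fun v h1 h2 =>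
    (bD_mkE _ v).trans (by simp [h1, h2])
  have Dc : ∀ v, v.2.2.1 = 0 → v.2.2.2.1 = 0 → bD K D v c = 0 := fun v h1 h2 =>
    (bD_mkE _ v).trans (by simp [h1, h2])
  have Dd : ∀ v, v.2.2.1 = 0 → v.2.2.2.1 = 0 → bD K D v d = 0 := fun v h1 h2 =>
    (bD_mkE _ v).trans (by simp [h1, h2])
  have De : ∀ v, v.2.2.1 = 0 → v.2.2.2.1 = 0 → bD K D v e = 0 := fun v h1 h2 =>
    (bD_mkE _ v).trans (by simp [h1, h2])
  have key := integrate_linear (bD K D) (dirD_comm hΩ) (a := a) (b := b) (c := c) (d := d) (e := e)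
    (ρ := ρ) (r := r) (U := U) (m := m) (τ := τ) (ξ := ξ) (h := h) (σ := σ) (η := η) hρu hru hmu
    hab hred (fun v => (bD K D v).map_algebraMap _)
    (by simp [hDr, et]) (by simp [hDr, er]) (by simp [hDr, eU]) (by simp [hDr, eS])
    (by simp [hDρ, et]) (by simp [hDρ, er]) (by simp [hDρ, eU]) (by simp [hDρ, eS])
    (by simp [hDU, et]) (by simp [hDU, er]) (by simp [hDU, eU]) (by simp [hDU, eS])
    (by simp [hDU, eρ])
    (by simp [Da, et]) (by simp [Da, er]) (by simp [Da, eU]) (by simp [Da, eS])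
    (Db _ rfl rfl) (Db _ rfl rfl) (Db _ rfl rfl) (Dc _ rfl rfl) (Dd _ rfl rfl)
    (De _ rfl rfl) (De _ rfl rfl) (De _ rfl rfl)
    τρ τS τU ξρ ξS ξU
  replace key := by
    refine key ?_ ?_ ?_ ?_ ?_ ?_ ?_ ?_ ?_ ?_ ?_ <;> refine evalAt_ext fun z => ?_ <;>
      obtain ⟨⟨w1, w2, w3⟩, ⟨w4, w5, w6, w7⟩, w8, w9, w10, w11⟩ := W z <;>
      simp only [map_mul, map_sub, map_add, map_neg, map_pow, map_zero, hU, hρ, hr, hm, ha, hb, hc,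
        hd, he, hξ, hh, hσ, hη, vτ, vξ, vh, vσ, vη]
    exacts [w1, w2, w3, w4, w5, w6, w7, w8, w9, w10, w11]
  obtain ⟨⟨τr, τtt⟩, ⟨ξr, ξrr, ξttr⟩, ⟨σt, σr, σU⟩, ⟨hρh, hU0, hr0', ht0⟩, hη', ⟨ua, ub⟩, cρ, cS⟩ :=
    key
  clear W Q
  have hD := dirD_comm hΩ
  have lz : ∀ v x y, bD K D v (x * y) = x * bD K D v y + y * bD K D v x := fun v x y => by
    rw [Derivation.leibniz]; rfl
  have Dalg : ∀ v (x : ℝ), bD K D v (algebraMap ℝ _ x) = 0 := fun v x =>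
    (bD K D v).map_algebraMap x
  have hm1 : 1 + m = algebraMap ℝ _ (n : ℝ) := by
    rw [show 1 + m = algebraMap ℝ _ 1 + algebraMap ℝ _ ((n : ℝ) - 1) by rw [map_one], ← map_add]
    congr 1; ring
  -- integration in `t` and `r`
  obtain ⟨A, hA⟩ : ∃ A : ℝ, bD K D et (bD K D er ξ) = algebraMap ℝ _ A := by
    refine exists_const_of_bD_eq_zero ξttr ?_ ?_ ?_ ?_
    · rw [hD, ξrr, map_zero]
    · rw [hD, hD eρ, ξρ, map_zero, map_zero]
    · rw [hD, hD eS, ξS, map_zero, map_zero]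
    · rw [hD, hD eU, ξU, map_zero, map_zero]
  obtain ⟨c₂, hc₂⟩ : ∃ c₂ : ℝ, bD K D et τ - algebraMap ℝ _ (2 * A) * t = algebraMap ℝ _ c₂ := by
    refine exists_const_of_bD_eq_zero ?_ ?_ ?_ ?_ ?_
    · rw [map_sub, lz, hDt, Dalg, τtt, hA, map_mul, map_ofNat]; simp [et]
    · rw [map_sub, lz, hDt, Dalg, hD, τr, map_zero]; simp [er]
    · rw [map_sub, lz, hDt, Dalg, hD, τρ, map_zero]; simp [eρ]
    · rw [map_sub, lz, hDt, Dalg, hD, τS, map_zero]; simp [eS]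
    · rw [map_sub, lz, hDt, Dalg, hD, τU, map_zero]; simp [eU]
  obtain ⟨c₁, hc₁⟩ : ∃ c₁ : ℝ, τ - algebraMap ℝ _ c₂ * t - algebraMap ℝ _ A * (t * t) =
      algebraMap ℝ _ c₁ := by
    refine exists_const_of_bD_eq_zero ?_ ?_ ?_ ?_ ?_
    · rw [map_sub, map_sub, lz, lz, lz, hDt, Dalg, Dalg, ← hc₂, map_mul, map_ofNat]
      simp [et]; ring
    · rw [map_sub, map_sub, lz, lz, lz, hDt, Dalg, Dalg, τr]; simp [er]
    · rw [map_sub, map_sub, lz, lz, lz, hDt, Dalg, Dalg, τρ]; simp [eρ]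
    · rw [map_sub, map_sub, lz, lz, lz, hDt, Dalg, Dalg, τS]; simp [eS]
    · rw [map_sub, map_sub, lz, lz, lz, hDt, Dalg, Dalg, τU]; simp [eU]
  obtain ⟨B, hB⟩ : ∃ B : ℝ, bD K D er ξ - algebraMap ℝ _ A * t = algebraMap ℝ _ B := by
    refine exists_const_of_bD_eq_zero ?_ ?_ ?_ ?_ ?_
    · rw [map_sub, lz, hDt, Dalg, hA]; simp [et]
    · rw [map_sub, lz, hDt, Dalg, ξrr]; simp [er]
    · rw [map_sub, lz, hDt, Dalg, hD, ξρ, map_zero]; simp [eρ]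
    · rw [map_sub, lz, hDt, Dalg, hD, ξS, map_zero]; simp [eS]
    · rw [map_sub, lz, hDt, Dalg, hD, ξU, map_zero]; simp [eU]
  obtain ⟨F, hF, hσF⟩ := exists_fun_of_bD_eq_zero σt σr σρ σU
  obtain ⟨g, hg, hG⟩ : ∃ g : ℝ → ℝ, ∃ hg : ContDiffOn ℝ ∞ g D.J.carrier,
      bD K D eρ h + algebraMap ℝ _ (n * A) * t = mkE K (smooth2_of_S hg) := by
    refine exists_fun_of_bD_eq_zero ?_ ?_ ?_ ?_
    · rw [map_add, lz, hDt, Dalg, hD, ht0, hA, hm1, map_neg, lz, lz, hDρ, Dalg, Dalg, map_mul]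
      simp [et, eρ]; ring
    · rw [map_add, lz, hDt, Dalg, hD, hr0', map_zero]; simp [er]
    · have h0 : bD K D eρ (bD K D eρ h) = 0 := hρu.mul_right_eq_zero.1 (by
        have := congrArg (bD K D eρ) hρh
        rw [lz, show bD K D eρ ρ = 1 by rw [hDρ]; simp [eρ]] at this
        linear_combination -this)
      rw [map_add, lz, hDt, Dalg, h0]; simp [eρ]
    · rw [map_add, lz, hDt, Dalg, hD, hU0, map_zero]; simp [eU]
  have hσS : ∀ z : box K D, evalAt z (bD K D eS σ) = deriv F z.1.2.2.2.1 := fun z => by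
    rw [hσF, bD_mkE]; simp [eS, mkE, evalAt_mkSm, dS]
  have hhG : h = ρ * (mkE K (smooth2_of_S hg) - algebraMap ℝ _ (n * A) * t) := by
    rw [← hG, add_sub_cancel_right]; exact hρh
  have hhS : ∀ z : box K D, evalAt z (bD K D eS h) = z.1.2.2.1 * deriv g z.1.2.2.2.1 := fun z => by
    rw [hhG, lz, map_sub, lz, bD_mkE, hDt, Dalg, hDρ]
    simp [eS, mkE, evalAt_mkSm, dS, hρ]
  have hFz : ∀ z, evalAt z (mkE K (smooth2_of_S hF)) = F z.1.2.2.2.1 := fun z => rfl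
  have hgz : ∀ z, evalAt z (mkE K (smooth2_of_S hg)) = g z.1.2.2.2.1 := fun z => rfl
  have halg : ∀ z (x : ℝ), evalAt z (algebraMap ℝ (smoothAlg (box K D)) x) = x := fun z x =>
    (evalAt z).commutes x
  have ev : ∀ {x y : smoothAlg (box K D)}, x = y → ∀ z, evalAt z x = evalAt z y :=
    fun hxy z => by rw [hxy]
  have vτt : ∀ z : box K D, evalAt z (bD K D et τ) = c₂ + 2 * A * z.1.1 := fun z => by
    have := ev hc₂ z
    simp only [map_sub, map_mul, halg, ht] at this
    linear_combination this
  have vξr : ∀ z : box K D, evalAt z (bD K D er ξ) = B + A * z.1.1 := fun z => by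
    have := ev hB z
    simp only [map_sub, map_mul, halg, ht] at this
    linear_combination this
  have vξ0 : ∀ z : box K D, evalAt z ξ = (B + A * z.1.1) * z.1.2.1 := fun z => by
    have := ev ξr z
    rw [map_mul, hr, vξr] at this
    rw [this, mul_comm]
  have vh0 : ∀ z : box K D, evalAt z h = z.1.2.2.1 * (g z.1.2.2.2.1 - n * A * z.1.1) := fun z => by
    have := ev hhG z
    simpa only [map_mul, map_sub, halg, hρ, hgz, ht] using this
  have vξt : ∀ z : box K D, evalAt z (bD K D et ξ) = A * z.1.2.1 := fun z => by
    have := congrArg (bD K D et) ξr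
    rw [lz, hDr, hA, show et.2.1 = 0 from rfl, map_zero, mul_zero, add_zero] at this
    have := ev this z
    rw [map_mul, halg, hr] at this
    rw [this, mul_comm]
  obtain ⟨z₀, hz₀⟩ := box_nonempty K D
  have hcρ : ∀ z : box K D, A * (2 * dρ p z.1.2.2.1 z.1.2.2.2.1 -
      n * z.1.2.2.1 * dρ (dρ p) z.1.2.2.1 z.1.2.2.2.1) = 0 := fun z => by
    have := ev cρ z
    simpa only [map_mul, map_sub, map_ofNat, map_zero, halg, hm1, hA, ha, hc, hρ] using this
  have hcS : ∀ z : box K D, A * ((n + 2) * dS p z.1.2.2.1 z.1.2.2.2.1 -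
      n * z.1.2.2.1 * dS (dρ p) z.1.2.2.1 z.1.2.2.2.1) = 0 := fun z => by
    have := ev cS z
    simp only [map_mul, map_sub, map_add, map_ofNat, map_zero, halg, hm1, hA, hb, hd, hρ, hm]
      at this
    linear_combination this
  have hpt : ∀ {ρ S : ℝ}, ρ ∈ D.I.carrier → S ∈ D.J.carrier →
      (z₀.1, z₀.2.1, ρ, S, z₀.2.2.2.2) ∈ box K D := fun hρ hS =>
    ⟨hz₀.1, hz₀.2.1, hρ, hS, hz₀.2.2.2.2⟩
  refine ⟨c₁, c₂, A, B - c₂, F, g, ⟨hF, hg, ?_, ?_⟩,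
    ⟨contDiffOn_const, contDiffOn_const, ?_, ?_⟩, ?_⟩
  · intro ρ' hρ' S hS
    let z : box K D := ⟨_, hpt hρ' hS⟩
    have h1 := ev ua z
    simp only [map_mul, map_sub, map_add, map_ofNat, map_zero, vτt, vξr, ha, hc, hd, hσF, hFz, vh0]
      at h1
    linear_combination h1 - z.1.1 * hcρ z
  · intro ρ' hρ' S hS
    let z : box K D := ⟨_, hpt hρ' hS⟩
    have h1 := ev ub z
    simp only [map_mul, map_sub, map_add, map_ofNat, map_zero, vτt, vξr, ha, hb, he, hd, hσS, vh0,
      hhS, hρ] at h1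
    simp only [hσF, hFz] at h1
    refine mul_left_cancel₀ (D.ρ_pos hρ').ne' ?_
    linear_combination h1 - z.1.1 * ρ' * hcS z
  · intro ρ' hρ' S hS
    linear_combination -hcρ ⟨_, hpt hρ' hS⟩
  · intro ρ' hρ' S hS
    rw [deriv_const, deriv_const]
    linear_combination -hcS ⟨_, hpt hρ' hS⟩
  · intro z hz
    refine Prod.ext ?_ (Prod.ext ?_ (Prod.ext ?_ (Prod.ext ?_ ?_)))
    · have := ev hc₁ ⟨z, hz⟩
      simp only [map_mul, map_sub, halg, ht] at this
      have e1 : evalAt ⟨z, hz⟩ τ = (X z).1 := rfl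
      rw [e1] at this
      simp only [symField]
      linear_combination this
    · refine (vξ0 ⟨z, hz⟩).trans ?_
      simp only [symField]
      ring
    · refine (vh0 ⟨z, hz⟩).trans ?_
      simp only [symField]
      ring
    · exact (ev hσF ⟨z, hz⟩).trans (hFz ⟨z, hz⟩)
    · refine (ev hη' ⟨z, hz⟩).trans ?_
      simp only [map_add, map_sub, map_mul, hU, vτt, vξr, vξt, symField]
      ring

/-! ### The reduced determining equations -/

section
variable {D : EosDomain} {p : ℝ → ℝ → ℝ} {μ ν : ℝ} {F G g k : ℝ → ℝ}

theorem hasDerivAt_reduced_ρ (hp : Smooth2 D p) {ρ S : ℝ} (hρ : ρ ∈ D.I.carrier)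
    (hS : S ∈ D.J.carrier) : HasDerivAt (fun x => F S * dS p x S + g S * x * dρ p x S)
      (F S * dS (dρ p) ρ S + g S * (dρ p ρ S + ρ * dρ (dρ p) ρ S)) ρ := by
  rw [hp.dS_dρ hρ hS]
  refine (((hp.dS.hasDerivAt_ρ hρ hS).const_mul (F S)).add
    (((hasDerivAt_id ρ).const_mul (g S)).mul (hp.dρ.hasDerivAt_ρ hρ hS))).congr_deriv ?_
  simp only [id]; ring

theorem hasDerivAt_reduced_S (hp : Smooth2 D p) (hF : ContDiffOn ℝ ∞ F D.J.carrier)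
    (hg : ContDiffOn ℝ ∞ g D.J.carrier) {ρ S : ℝ} (hρ : ρ ∈ D.I.carrier)
    (hS : S ∈ D.J.carrier) : HasDerivAt (fun s => F s * dS p ρ s + g s * ρ * dρ p ρ s)
      (deriv F S * dS p ρ S + F S * dS (dS p) ρ S + deriv g S * ρ * dρ p ρ S +
        g S * ρ * dS (dρ p) ρ S) S := by
  refine (((smooth_differentiableAt hF hS).hasDerivAt.mul (hp.dS.hasDerivAt_S hρ hS)).add
    (((smooth_differentiableAt hg hS).hasDerivAt.mul_const ρ).mul
      (hp.dρ.hasDerivAt_S hρ hS))).congr_deriv ?_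
  ring

theorem smooth2_reduced (hp : Smooth2 D p) (hF : ContDiffOn ℝ ∞ F D.J.carrier)
    (hg : ContDiffOn ℝ ∞ g D.J.carrier) :
    Smooth2 D (fun ρ S => F S * dS p ρ S + g S * ρ * dρ p ρ S) :=
  ((smooth2_of_S hF).mul hp.dS).add (((smooth2_of_S hg).mul smooth2_ρ).mul hp.dρ)

/-- Cross-differentiation of `d(F p_S + g ρ p_ρ) = (g + 2 μ) dp`. -/
theorem IsReduced.deriv_mul_dρ (h : IsReduced D p μ F g) (hp : Smooth2 D p) {ρ S : ℝ}
    (hρ : ρ ∈ D.I.carrier) (hS : S ∈ D.J.carrier) : deriv g S * dρ p ρ S = 0 := by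
  have hQ := smooth2_reduced hp h.smoothF h.smoothg
  have e1 : ∀ ρ ∈ D.I.carrier, ∀ S ∈ D.J.carrier,
      dρ (fun ρ S => F S * dS p ρ S + g S * ρ * dρ p ρ S) ρ S = (g S + 2 * μ) * dρ p ρ S :=
    fun ρ hρ S hS => by
      refine (hasDerivAt_reduced_ρ hp hρ hS).deriv.trans ?_
      linear_combination h.eqρ ρ hρ S hS
  have e2 : ∀ ρ ∈ D.I.carrier, ∀ S ∈ D.J.carrier,
      dS (fun ρ S => F S * dS p ρ S + g S * ρ * dρ p ρ S) ρ S = (g S + 2 * μ) * dS p ρ S :=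
    fun ρ hρ S hS => by
      refine (hasDerivAt_reduced_S hp h.smoothF h.smoothg hρ hS).deriv.trans ?_
      linear_combination h.eqS ρ hρ S hS
  have key := hQ.dS_dρ hρ hS
  rw [dS_congr e1 hρ hS, dρ_congr e2 hρ hS] at key
  have k1 : dS (fun ρ S => (g S + 2 * μ) * dρ p ρ S) ρ S =
      deriv g S * dρ p ρ S + (g S + 2 * μ) * dS (dρ p) ρ S :=
    (((smooth_differentiableAt h.smoothg hS).hasDerivAt.add_const (2 * μ)).mul
      (hp.dρ.hasDerivAt_S hρ hS)).deriv
  have k2 : dρ (fun ρ S => (g S + 2 * μ) * dS p ρ S) ρ S = (g S + 2 * μ) * dρ (dS p) ρ S :=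
    ((hp.dS.hasDerivAt_ρ hρ hS).const_mul (g S + 2 * μ)).deriv
  rw [k1, k2, hp.dS_dρ hρ hS] at key
  linear_combination key

theorem IsReduced.mono {D' : EosDomain} (h : IsReduced D p μ F g) (hD : D'.Sub D) :
    IsReduced D' p μ F g :=
  ⟨h.smoothF.mono hD.2, h.smoothg.mono hD.2, fun ρ hρ S hS => h.eqρ ρ (hD.1 hρ) S (hD.2 hS),
    fun ρ hρ S hS => h.eqS ρ (hD.1 hρ) S (hD.2 hS)⟩

theorem deriv_congr_on {J : OpenInterval} (h : EqOn F G J.carrier) {S : ℝ} (hS : S ∈ J.carrier) :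
    deriv F S = deriv G S := by
  apply Filter.EventuallyEq.deriv_eq
  filter_upwards [J.isOpen.mem_nhds hS] with x hx using h hx

theorem IsReduced.congr (h : IsReduced D p μ F g) (hF : EqOn G F D.J.carrier)
    (hg : EqOn k g D.J.carrier) : IsReduced D p μ G k :=
  ⟨h.smoothF.congr hF, h.smoothg.congr hg,
    fun ρ hρ S hS => by rw [hF hS, hg hS]; exact h.eqρ ρ hρ S hS,
    fun ρ hρ S hS => by
      rw [hF hS, hg hS, deriv_congr_on hF hS, deriv_congr_on hg hS]; exact h.eqS ρ hρ S hS⟩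

theorem IsReduced.add (h : IsReduced D p μ F g) (h' : IsReduced D p ν G k) :
    IsReduced D p (μ + ν) (fun S => F S + G S) (fun S => g S + k S) :=
  ⟨h.smoothF.add h'.smoothF, h.smoothg.add h'.smoothg,
    fun ρ hρ S hS => by linear_combination h.eqρ ρ hρ S hS + h'.eqρ ρ hρ S hS,
    fun ρ hρ S hS => by
      rw [deriv_fun_add (smooth_differentiableAt h.smoothF hS)
          (smooth_differentiableAt h'.smoothF hS),
        deriv_fun_add (smooth_differentiableAt h.smoothg hS)
          (smooth_differentiableAt h'.smoothg hS)]
      linear_combination h.eqS ρ hρ S hS + h'.eqS ρ hρ S hS⟩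

theorem IsReduced.smul (h : IsReduced D p μ F g) (x : ℝ) :
    IsReduced D p (x * μ) (fun S => x * F S) (fun S => x * g S) :=
  ⟨contDiffOn_const.mul h.smoothF, contDiffOn_const.mul h.smoothg,
    fun ρ hρ S hS => by linear_combination x * h.eqρ ρ hρ S hS,
    fun ρ hρ S hS => by
      rw [deriv_const_mul _ (smooth_differentiableAt h.smoothF hS),
        deriv_const_mul _ (smooth_differentiableAt h.smoothg hS)]
      linear_combination x * h.eqS ρ hρ S hS⟩

theorem isReduced_zero : IsReduced D p 0 (fun _ => 0) (fun _ => 0) :=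
  ⟨contDiffOn_const, contDiffOn_const, fun ρ hρ S hS => by ring, fun ρ hρ S hS => by simp⟩

/-- The first integral of the reduced equations for constant `g`. -/
theorem IsReduced.exists_integral {g₀ : ℝ} (h : IsReduced D p μ F g) (hp : Smooth2 D p)
    (hg : ∀ S ∈ D.J.carrier, g S = g₀) : ∃ C, ∀ ρ ∈ D.I.carrier, ∀ S ∈ D.J.carrier,
      F S * dS p ρ S + g₀ * ρ * dρ p ρ S - (g₀ + 2 * μ) * p ρ S = C := by
  replace h := h.congr (k := fun _ => g₀) (fun _ _ => rfl) fun S hS => (hg S hS).symm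
  refine Smooth2.exists_const ((smooth2_reduced hp h.smoothF h.smoothg).sub
    ((smooth2_const (g₀ + 2 * μ)).mul hp)) (fun ρ hρ S hS => ?_) (fun ρ hρ S hS => ?_)
  · refine ((hasDerivAt_reduced_ρ (F := F) (g := fun _ => g₀) hp hρ hS).sub
      ((hp.hasDerivAt_ρ hρ hS).const_mul _)).deriv.trans ?_
    linear_combination h.eqρ ρ hρ S hS
  · refine ((hasDerivAt_reduced_S hp h.smoothF h.smoothg hρ hS).sub
      ((hp.hasDerivAt_S hρ hS).const_mul _)).deriv.trans ?_
    linear_combination h.eqS ρ hρ S hS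

theorem isReduced_of_integral {g₀ C : ℝ} (hp : Smooth2 D p) (hF : ContDiffOn ℝ ∞ F D.J.carrier)
    (h : ∀ ρ ∈ D.I.carrier, ∀ S ∈ D.J.carrier,
      F S * dS p ρ S + g₀ * ρ * dρ p ρ S - (g₀ + 2 * μ) * p ρ S = C) :
    IsReduced D p μ F (fun _ => g₀) := by
  have hg : ContDiffOn ℝ ∞ (fun _ : ℝ => g₀) D.J.carrier := contDiffOn_const
  refine ⟨hF, hg, fun ρ hρ S hS => ?_, fun ρ hρ S hS => ?_⟩
  · have e1 : dρ (fun ρ S => F S * dS p ρ S + g₀ * ρ * dρ p ρ S - (g₀ + 2 * μ) * p ρ S) ρ S = _ :=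
      ((hasDerivAt_reduced_ρ (F := F) (g := fun _ => g₀) hp hρ hS).sub
      ((hp.hasDerivAt_ρ hρ hS).const_mul (g₀ + 2 * μ))).deriv
    have e2 := dρ_congr (k := fun _ _ => C) h hρ hS
    have e3 : dρ (fun _ _ => C) ρ S = 0 := deriv_const _ _
    linear_combination -e1 + e2 + e3
  · have e1 : dS (fun ρ S => F S * dS p ρ S + g₀ * ρ * dρ p ρ S - (g₀ + 2 * μ) * p ρ S) ρ S = _ :=
      ((hasDerivAt_reduced_S hp hF hg hρ hS).sub
      ((hp.hasDerivAt_S hρ hS).const_mul (g₀ + 2 * μ))).deriv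
    have e2 := dS_congr (k := fun _ _ => C) h hρ hS
    have e3 : dS (fun _ _ => C) ρ S = 0 := deriv_const _ _
    linear_combination -e1 + e2 + e3

/-- The reduced equations for `p = q + const`, from the partial derivatives of `q`. -/
theorem isReduced_of_hasDerivAt {q qρ qS : ℝ → ℝ → ℝ} {p₀ g₀ C : ℝ} (hp : Smooth2 D p)
    (hpq : ∀ ρ ∈ D.I.carrier, ∀ S ∈ D.J.carrier, p ρ S = q ρ S + p₀)
    (hF : ContDiffOn ℝ ∞ F D.J.carrier)
    (h1 : ∀ ρ ∈ D.I.carrier, ∀ S ∈ D.J.carrier, HasDerivAt (fun x => q x S) (qρ ρ S) ρ)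
    (h2 : ∀ ρ ∈ D.I.carrier, ∀ S ∈ D.J.carrier, HasDerivAt (fun s => q ρ s) (qS ρ S) S)
    (h : ∀ ρ ∈ D.I.carrier, ∀ S ∈ D.J.carrier,
      F S * qS ρ S + g₀ * ρ * qρ ρ S - (g₀ + 2 * μ) * q ρ S = C) :
    IsReduced D p μ F (fun _ => g₀) := by
  refine isReduced_of_integral (C := C - (g₀ + 2 * μ) * p₀) hp hF fun ρ hρ S hS => ?_
  have e1 : dρ p ρ S = qρ ρ S :=
    (dρ_congr hpq hρ hS).trans ((h1 ρ hρ S hS).add_const p₀).deriv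
  have e2 : dS p ρ S = qS ρ S :=
    (dS_congr hpq hρ hS).trans ((h2 ρ hρ S hS).add_const p₀).deriv
  rw [e1, e2, hpq ρ hρ S hS]
  linear_combination h ρ hρ S hS

end

/-! ### The listed equations of state and their generators -/

section
variable {D : EosDomain} {κ f : ℝ → ℝ}

theorem Regular.smooth_inv (h : Regular κ D.J) : ContDiffOn ℝ ∞ (fun S => 1 / deriv κ S)
    D.J.carrier := contDiffOn_const.div (smooth_deriv h.1) h.2

theorem Regular.smooth_log (h : Regular κ D.J) : ContDiffOn ℝ ∞ (fun S => 2 * κ S / deriv κ S)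
    D.J.carrier := (contDiffOn_const.mul h.1).div (smooth_deriv h.1) h.2

theorem Regular.hasDerivAt (h : Regular κ D.J) {S : ℝ} (hS : S ∈ D.J.carrier) :
    HasDerivAt κ (deriv κ S) S := (smooth_differentiableAt h.1 hS).hasDerivAt

theorem Regular.values_mem_nhds (h : Regular κ D.J) {ρ S : ℝ} (hρ : ρ ∈ D.I.carrier)
    (hS : S ∈ D.J.carrier) : D.values κ ∈ nhds (κ S * ρ) := by
  have hκ : HasStrictDerivAt (fun s => κ s * ρ) (deriv κ S * ρ) S := by
    have : HasStrictDerivAt κ (deriv κ S) S :=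
      (h.1.contDiffAt (D.J.isOpen.mem_nhds hS)).hasStrictDerivAt (by simp)
    exact this.mul_const ρ
  have h0 : deriv κ S * ρ ≠ 0 := mul_ne_zero (h.2 S hS) (D.ρ_pos hρ).ne'
  rw [← hκ.map_nhds_eq h0, Filter.mem_map]
  filter_upwards [D.J.isOpen.mem_nhds hS] with s hs using ⟨ρ, hρ, s, hs, rfl⟩

theorem smooth2_values (h : Regular κ D.J) (hf : ContDiffOn ℝ ∞ f (D.values κ)) :
    Smooth2 D (fun ρ S => f (κ S * ρ)) :=
  hf.comp ((smooth2_of_S h.1).mul smooth2_ρ) fun x hx => ⟨x.1, hx.1, x.2, hx.2, rfl⟩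

theorem hasDerivAt_values (h : Regular κ D.J) (hf : ContDiffOn ℝ ∞ f (D.values κ)) {ρ S : ℝ}
    (hρ : ρ ∈ D.I.carrier) (hS : S ∈ D.J.carrier) :
    HasDerivAt f (deriv f (κ S * ρ)) (κ S * ρ) :=
  ((hf.contDiffAt (h.values_mem_nhds hρ hS)).differentiableAt (by simp)).hasDerivAt

theorem hasDerivAt_values_ρ (h : Regular κ D.J) (hf : ContDiffOn ℝ ∞ f (D.values κ)) {ρ S : ℝ}
    (hρ : ρ ∈ D.I.carrier) (hS : S ∈ D.J.carrier) :
    HasDerivAt (fun x => f (κ S * x)) (deriv f (κ S * ρ) * κ S) ρ := by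
  have := (hasDerivAt_id ρ).const_mul (κ S)
  rw [mul_one] at this
  exact HasDerivAt.comp (h := fun x => κ S * x) ρ (hasDerivAt_values h hf hρ hS) this

theorem hasDerivAt_values_S (h : Regular κ D.J) (hf : ContDiffOn ℝ ∞ f (D.values κ)) {ρ S : ℝ}
    (hρ : ρ ∈ D.I.carrier) (hS : S ∈ D.J.carrier) :
    HasDerivAt (fun s => f (κ s * ρ)) (deriv f (κ S * ρ) * (deriv κ S * ρ)) S :=
  HasDerivAt.comp (h := fun s => κ s * ρ) S (hasDerivAt_values h hf hρ hS)
    ((h.hasDerivAt hS).mul_const ρ)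

theorem EosDomain.contDiffOn_rpow (D : EosDomain) (q : ℝ) :
    ContDiffOn ℝ ∞ (fun ρ : ℝ => ρ ^ q) D.I.carrier := fun _ hx =>
  (Real.contDiffAt_rpow_const_of_ne (D.ρ_pos hx).ne').contDiffWithinAt

theorem EosDomain.contDiffOn_log (D : EosDomain) : ContDiffOn ℝ ∞ Real.log D.I.carrier :=
  fun _ hx => (Real.contDiffAt_log.2 (D.ρ_pos hx).ne').contDiffWithinAt

theorem hasDerivAt_rpow_one_add {ρ : ℝ} (hρ : 0 < ρ) (q : ℝ) :
    HasDerivAt (fun x : ℝ => x ^ (1 + q)) ((1 + q) * ρ ^ q) ρ := by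
  simpa using Real.hasDerivAt_rpow_const (x := ρ) (p := 1 + q) (.inl hρ.ne')

theorem rpow_one_add {ρ : ℝ} (hρ : 0 < ρ) (q : ℝ) : ρ ^ (1 + q) = ρ * ρ ^ q := by
  rw [Real.rpow_add hρ, Real.rpow_one]

theorem EosCase.Admissible.smooth2 (n : ℕ) {c : EosCase} (h : c.Admissible D) :
    Smooth2 D (c.eos n) := by
  cases c with
  | c1 f => exact h
  | c2 κ f => exact (smooth2_of_S h.1.1).mul (smooth2_of_ρ h.2.1)
  | c3 κ f => exact (smooth2_of_S h.1.1).add (smooth2_of_ρ h.2.1)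
  | c4 κ f q => exact (smooth2_values h.1 h.2.1.1).mul (smooth2_of_ρ (D.contDiffOn_rpow _))
  | c5 κ f k =>
    exact (smooth2_values h.1 h.2.1).add ((smooth2_const k).mul (smooth2_of_ρ D.contDiffOn_log))
  | c6 κ q => exact (smooth2_of_S h.1.1).mul (smooth2_of_ρ (D.contDiffOn_rpow _))
  | c7 κ k =>
    exact (smooth2_of_S h.1.1).add ((smooth2_const k).mul (smooth2_of_ρ D.contDiffOn_log))
  | c8 κ => exact (smooth2_of_S h.1).mul (smooth2_of_ρ (D.contDiffOn_rpow _))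
  | c9 f => exact smooth2_of_ρ h.1.1
  | c10 κ => exact smooth2_of_S h.1
  | c11 k => exact (smooth2_const k).mul (smooth2_of_ρ D.contDiffOn_log)
  | c12 k q => exact (smooth2_const k).mul (smooth2_of_ρ (D.contDiffOn_rpow _))
  | c13 k => exact (smooth2_const k).mul (smooth2_of_ρ (D.contDiffOn_rpow _))

theorem IsInstance.smooth2 {n : ℕ} {c : EosCase} {p : ℝ → ℝ → ℝ} (h : IsInstance n D c p) :
    Smooth2 D p := by
  obtain ⟨h1, p₀, h2⟩ := h
  exact ((h1.smooth2 n).add (smooth2_const p₀)).congr h2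

end

section
variable (n : ℕ)

theorem X1_eq : X1 = symField n 1 0 0 0 (fun _ => 0) (fun _ => 0) := by
  funext ⟨t, r, ρ, S, U⟩; simp [X1, symField]
theorem X2_eq : X2 = symField n 0 1 0 0 (fun _ => 0) (fun _ => 0) := by
  funext ⟨t, r, ρ, S, U⟩; simp [X2, symField]
theorem Xscal_eq (κ : ℝ → ℝ) (q : ℝ) : Xscal κ q =
    symField n 0 0 0 q (fun S => -(2 * κ S / deriv κ S)) (fun _ => 2) := by
  funext ⟨t, r, ρ, S, U⟩; simp [Xscal, symField]
theorem XlogScal_eq (κ : ℝ → ℝ) : XlogScal κ =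
    symField n 0 0 0 1 (fun S => 2 * κ S / deriv κ S) (fun _ => -2) := by
  funext ⟨t, r, ρ, S, U⟩; simp [XlogScal, symField]
theorem Xprod_eq (κ : ℝ → ℝ) : Xprod κ =
    symField n 0 0 0 1 (fun S => 2 * κ S / deriv κ S) (fun _ => 0) := by
  funext ⟨t, r, ρ, S, U⟩; simp [Xprod, symField]
theorem Xsum_eq (κ : ℝ → ℝ) : Xsum κ =
    symField n 0 0 0 0 (fun S => 1 / deriv κ S) (fun _ => 0) := by
  funext ⟨t, r, ρ, S, U⟩; simp [Xsum, symField]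
theorem Xpow_eq (q : ℝ) : Xpow q = symField n 0 0 0 q (fun _ => 0) (fun _ => 2) := by
  funext ⟨t, r, ρ, S, U⟩; simp [Xpow, symField]
theorem Xlog_eq : Xlog = symField n 0 0 0 1 (fun _ => 0) (fun _ => -2) := by
  funext ⟨t, r, ρ, S, U⟩; simp [Xlog, symField]
theorem Xpow'_eq : Xpow' n = symField n 0 0 0 1 (fun _ => 0) (fun _ => n) := by
  funext ⟨t, r, ρ, S, U⟩; simp [Xpow', symField]
theorem Xconf_eq : Xconf n = symField n 0 0 1 0 (fun _ => 0) (fun _ => 0) := by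
  funext ⟨t, r, ρ, S, U⟩; simp [Xconf, symField]; ring
theorem Xent_eq (F : ℝ → ℝ) : Xent F = symField n 0 0 0 0 F (fun _ => 0) := by
  funext ⟨t, r, ρ, S, U⟩; simp [Xent, symField]
theorem XentW_eq (κ F : ℝ → ℝ) : XentW κ F =
    symField n 0 0 0 0 F (fun S => deriv (fun s => F s * deriv κ s) S / deriv κ S) := by
  funext ⟨t, r, ρ, S, U⟩; simp [XentW, symField]

end

section
variable {n : ℕ} {D : EosDomain} {p : ℝ → ℝ → ℝ} {κ f : ℝ → ℝ} {p₀ q k : ℝ}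

theorem isReduced_prod (hp : Smooth2 D p) (hκ : Regular κ D.J) (hf : ContDiffOn ℝ ∞ f D.I.carrier)
    (h : ∀ ρ ∈ D.I.carrier, ∀ S ∈ D.J.carrier, p ρ S = κ S * f ρ + p₀) :
    IsReduced D p 1 (fun S => 2 * κ S / deriv κ S) (fun _ => 0) :=
  isReduced_of_hasDerivAt (C := 0) hp h hκ.smooth_log
    (fun _ hρ S _ => (smooth_differentiableAt hf hρ).hasDerivAt.const_mul (κ S))
    (fun ρ _ _ hS => (hκ.hasDerivAt hS).mul_const (f ρ))
    (fun ρ hρ S hS => by have := hκ.2 S hS; field_simp; ring)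

theorem isReduced_sum (hp : Smooth2 D p) (hκ : Regular κ D.J) (hf : ContDiffOn ℝ ∞ f D.I.carrier)
    (h : ∀ ρ ∈ D.I.carrier, ∀ S ∈ D.J.carrier, p ρ S = κ S + f ρ + p₀) :
    IsReduced D p 0 (fun S => 1 / deriv κ S) (fun _ => 0) :=
  isReduced_of_hasDerivAt (C := 1) hp h hκ.smooth_inv
    (fun _ hρ S _ => (smooth_differentiableAt hf hρ).hasDerivAt.const_add (κ S))
    (fun ρ _ _ hS => (hκ.hasDerivAt hS).add_const (f ρ))
    (fun ρ hρ S hS => by have := hκ.2 S hS; field_simp; ring)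

theorem isReduced_scal (hp : Smooth2 D p) (hκ : Regular κ D.J)
    (hf : ContDiffOn ℝ ∞ f (D.values κ))
    (h : ∀ ρ ∈ D.I.carrier, ∀ S ∈ D.J.carrier, p ρ S = f (κ S * ρ) * ρ ^ (1 + q) + p₀) :
    IsReduced D p q (fun S => -(2 * κ S / deriv κ S)) (fun _ => 2) := by
  refine isReduced_of_hasDerivAt (C := 0) hp h hκ.smooth_log.neg
    (fun ρ hρ S hS =>
      (hasDerivAt_values_ρ hκ hf hρ hS).mul (hasDerivAt_rpow_one_add (D.ρ_pos hρ) q))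
    (fun ρ hρ S hS => (hasDerivAt_values_S hκ hf hρ hS).mul_const (ρ ^ (1 + q)))
    (fun ρ hρ S hS => ?_)
  have := hκ.2 S hS
  simp only [rpow_one_add (D.ρ_pos hρ)]
  field_simp
  ring

theorem isReduced_logScal (hp : Smooth2 D p) (hκ : Regular κ D.J)
    (hf : ContDiffOn ℝ ∞ f (D.values κ))
    (h : ∀ ρ ∈ D.I.carrier, ∀ S ∈ D.J.carrier, p ρ S = f (κ S * ρ) + k * Real.log ρ + p₀) :
    IsReduced D p 1 (fun S => 2 * κ S / deriv κ S) (fun _ => -2) := by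
  refine isReduced_of_hasDerivAt (C := -2 * k) hp h hκ.smooth_log
    (fun ρ hρ S hS => (hasDerivAt_values_ρ hκ hf hρ hS).add
        ((Real.hasDerivAt_log (D.ρ_pos hρ).ne').const_mul k))
    (fun ρ hρ S hS => (hasDerivAt_values_S hκ hf hρ hS).add_const (k * Real.log ρ))
    (fun ρ hρ S hS => ?_)
  have := hκ.2 S hS
  have := (D.ρ_pos hρ).ne'
  field_simp
  ring

theorem isReduced_pow (hp : Smooth2 D p) (hκ : ContDiffOn ℝ ∞ κ D.J.carrier)
    (h : ∀ ρ ∈ D.I.carrier, ∀ S ∈ D.J.carrier, p ρ S = κ S * ρ ^ (1 + q) + p₀) :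
    IsReduced D p q (fun _ => 0) (fun _ => 2) := by
  refine isReduced_of_hasDerivAt (C := 0) hp h contDiffOn_const
    (fun ρ hρ S _ => (hasDerivAt_rpow_one_add (D.ρ_pos hρ) q).const_mul (κ S))
    (fun ρ _ S hS => (smooth_differentiableAt hκ hS).hasDerivAt.mul_const (ρ ^ (1 + q)))
    (fun ρ hρ S hS => ?_)
  rw [rpow_one_add (D.ρ_pos hρ)]
  ring

theorem isReduced_log (hp : Smooth2 D p) (hκ : ContDiffOn ℝ ∞ κ D.J.carrier)
    (h : ∀ ρ ∈ D.I.carrier, ∀ S ∈ D.J.carrier, p ρ S = κ S + k * Real.log ρ + p₀) :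
    IsReduced D p 1 (fun _ => 0) (fun _ => -2) := by
  refine isReduced_of_hasDerivAt (C := -2 * k) hp h contDiffOn_const
    (fun ρ hρ S _ => ((Real.hasDerivAt_log (D.ρ_pos hρ).ne').const_mul k).const_add (κ S))
    (fun ρ _ S hS => (smooth_differentiableAt hκ hS).hasDerivAt.add_const (k * Real.log ρ))
    (fun ρ hρ S hS => ?_)
  have := (D.ρ_pos hρ).ne'
  field_simp
  ring

theorem isReduced_ent {F : ℝ → ℝ} (hp : Smooth2 D p) (hF : ContDiffOn ℝ ∞ F D.J.carrier)
    (h : ∀ ρ ∈ D.I.carrier, ∀ S ∈ D.J.carrier, dS p ρ S = 0) :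
    IsReduced D p 0 F (fun _ => 0) :=
  isReduced_of_integral (C := 0) hp hF fun ρ hρ S hS => by rw [h ρ hρ S hS]; ring

theorem isReduced_conf (hn : n ≠ 0) (hp : Smooth2 D p) (hκ : ContDiffOn ℝ ∞ κ D.J.carrier)
    (h : ∀ ρ ∈ D.I.carrier, ∀ S ∈ D.J.carrier, p ρ S = κ S * ρ ^ (1 + 2 / (n : ℝ)) + p₀) :
    IsReduced D p 1 (fun _ => 0) (fun _ => n * 1) := by
  have hn' : (n : ℝ) ≠ 0 := by exact_mod_cast hn
  have := (isReduced_pow hp hκ h).smul (n / 2)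
  rw [show (n : ℝ) / 2 * (2 / n) = 1 by field_simp] at this
  exact this.congr (fun _ _ => by simp) fun _ _ => by ring

theorem isReduced_entW {F : ℝ → ℝ} (hκ : Regular κ D.J) (hF : ContDiffOn ℝ ∞ F D.J.carrier)
    (h : ∀ ρ ∈ D.I.carrier, ∀ S ∈ D.J.carrier, p ρ S = κ S + p₀) :
    IsReduced D p 0 F (fun S => deriv (fun s => F s * deriv κ s) S / deriv κ S) := by
  have hFκ : ContDiffOn ℝ ∞ (fun s => F s * deriv κ s) D.J.carrier :=
    hF.mul (smooth_deriv hκ.1)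
  have e1 : ∀ ρ ∈ D.I.carrier, ∀ S ∈ D.J.carrier, dρ p ρ S = 0 := fun ρ hρ S hS =>
    (dρ_congr h hρ hS).trans (deriv_const ρ (κ S + p₀))
  have e2 : ∀ ρ ∈ D.I.carrier, ∀ S ∈ D.J.carrier, dS p ρ S = deriv κ S := fun ρ hρ S hS =>
    (dS_congr h hρ hS).trans ((hκ.hasDerivAt hS).add_const p₀).deriv
  have z1 : ∀ ρ ∈ D.I.carrier, ∀ S ∈ D.J.carrier, dρ (dρ p) ρ S = 0 := fun ρ hρ S hS =>
    (dρ_congr (k := fun _ _ => 0) e1 hρ hS).trans (deriv_const _ _)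
  have z2 : ∀ ρ ∈ D.I.carrier, ∀ S ∈ D.J.carrier, dS (dρ p) ρ S = 0 := fun ρ hρ S hS =>
    (dS_congr (k := fun _ _ => 0) e1 hρ hS).trans (deriv_const _ _)
  have z3 : ∀ ρ ∈ D.I.carrier, ∀ S ∈ D.J.carrier, dS (dS p) ρ S = deriv (deriv κ) S :=
    fun ρ hρ S hS => dS_congr (k := fun _ S => deriv κ S) e2 hρ hS
  refine ⟨hF, (smooth_deriv hFκ).div (smooth_deriv hκ.1) hκ.2, fun ρ hρ S hS => ?_,
    fun ρ hρ S hS => ?_⟩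
  · rw [e1 ρ hρ S hS, z1 ρ hρ S hS, z2 ρ hρ S hS]; ring
  · rw [e1 ρ hρ S hS, e2 ρ hρ S hS, z2 ρ hρ S hS, z3 ρ hρ S hS]
    have h0 := hκ.2 S hS
    have hd : deriv (fun s => F s * deriv κ s) S =
        deriv F S * deriv κ S + F S * deriv (deriv κ) S :=
      ((smooth_differentiableAt hF hS).hasDerivAt.mul
        (smooth_differentiableAt (smooth_deriv hκ.1) hS).hasDerivAt).deriv
    rw [hd]
    field_simp
    ring

end

/-- `X` is one of the symmetries of the general form, everywhere and not only on a box. -/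
def IsSymField (n : ℕ) (D : EosDomain) (p : ℝ → ℝ → ℝ) (X : VField) : Prop :=
  ∃ (c₁ c₂ a μ : ℝ) (F g : ℝ → ℝ), IsReduced D p μ F g ∧
    IsReduced D p a (fun _ => 0) (fun _ => n * a) ∧ X = symField n c₁ c₂ a μ F g

theorem isReduced_zero' {n : ℕ} {D : EosDomain} {p : ℝ → ℝ → ℝ} :
    IsReduced D p 0 (fun _ => 0) (fun _ => n * 0) :=
  isReduced_zero.congr (fun _ _ => rfl) fun _ _ => by ring

theorem IsReduced.isSymField {n : ℕ} {D : EosDomain} {p : ℝ → ℝ → ℝ} {μ : ℝ} {F g : ℝ → ℝ}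
    (h : IsReduced D p μ F g) : IsSymField n D p (symField n 0 0 0 μ F g) :=
  ⟨0, 0, 0, μ, F, g, h, isReduced_zero', rfl⟩

theorem isSymField_X1 {n : ℕ} {D : EosDomain} {p : ℝ → ℝ → ℝ} : IsSymField n D p X1 :=
  ⟨1, 0, 0, 0, _, _, isReduced_zero, isReduced_zero', X1_eq n⟩

theorem isSymField_X2 {n : ℕ} {D : EosDomain} {p : ℝ → ℝ → ℝ} : IsSymField n D p X2 :=
  ⟨0, 1, 0, 0, _, _, isReduced_zero, isReduced_zero', X2_eq n⟩

theorem IsSymField.isPointSymmetry {n : ℕ} {D : EosDomain} {p : ℝ → ℝ → ℝ} {X : VField}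
    (h : IsSymField n D p X) (hp : Smooth2 D p) (K : KinDomain) :
    IsPointSymmetry n p (box K D) X := by
  obtain ⟨c₁, c₂, a, μ, F, g, h1, h2, rfl⟩ := h
  exact isPointSymmetry_symField hp K c₁ c₂ h1 h2

theorem dS_eq_zero_of_barotropic {D : EosDomain} {p : ℝ → ℝ → ℝ} {f : ℝ → ℝ} {p₀ : ℝ}
    (h : ∀ ρ ∈ D.I.carrier, ∀ S ∈ D.J.carrier, p ρ S = f ρ + p₀) :
    ∀ ρ ∈ D.I.carrier, ∀ S ∈ D.J.carrier, dS p ρ S = 0 := fun ρ hρ S hS =>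
  (dS_congr (k := fun ρ _ => f ρ + p₀) h hρ hS).trans (deriv_const S (f ρ + p₀))

/-- The listed generators are symmetries. -/
theorem IsInstance.isSymField {n : ℕ} (hn : 2 ≤ n) {D : EosDomain} {p : ℝ → ℝ → ℝ} {c : EosCase}
    (h : IsInstance n D c p) {X : VField} (hX : X ∈ c.generators n D) : IsSymField n D p X := by
  have hp := h.smooth2
  have hn0 : n ≠ 0 := by omega
  obtain ⟨ha, p₀, he⟩ := h
  cases c with
  | c1 f =>
    rcases hX with rfl | rfl
    exacts [isSymField_X1, isSymField_X2]
  | c2 κ f =>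
    rcases hX with rfl | rfl | rfl
    · exact isSymField_X1
    · exact isSymField_X2
    · rw [Xprod_eq n]; exact (isReduced_prod hp ha.1 ha.2.1 he).isSymField
  | c3 κ f =>
    rcases hX with rfl | rfl | rfl
    · exact isSymField_X1
    · exact isSymField_X2
    · rw [Xsum_eq n]; exact (isReduced_sum hp ha.1 ha.2.1 he).isSymField
  | c4 κ f q =>
    rcases hX with rfl | rfl | rfl
    · exact isSymField_X1
    · exact isSymField_X2
    · rw [Xscal_eq n]; exact (isReduced_scal hp ha.1 ha.2.1.1 he).isSymField
  | c5 κ f k =>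
    rcases hX with rfl | rfl | rfl
    · exact isSymField_X1
    · exact isSymField_X2
    · rw [XlogScal_eq n]; exact (isReduced_logScal hp ha.1 ha.2.1 he).isSymField
  | c6 κ q =>
    rcases hX with rfl | rfl | rfl | rfl
    · exact isSymField_X1
    · exact isSymField_X2
    · rw [Xprod_eq n]; exact (isReduced_prod hp ha.1 (D.contDiffOn_rpow _) he).isSymField
    · rw [Xpow_eq n]; exact (isReduced_pow hp ha.1.1 he).isSymField
  | c7 κ k =>
    rcases hX with rfl | rfl | rfl | rfl
    · exact isSymField_X1
    · exact isSymField_X2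
    · rw [Xsum_eq n]
      exact (isReduced_sum hp ha.1 (contDiffOn_const.mul D.contDiffOn_log) he).isSymField
    · rw [Xlog_eq n]; exact (isReduced_log hp ha.1.1 he).isSymField
  | c8 κ =>
    have hc := isReduced_conf hn0 hp ha.1 he
    rcases hX with rfl | rfl | rfl | rfl | rfl
    · exact isSymField_X1
    · exact isSymField_X2
    · rw [Xprod_eq n]; exact (isReduced_prod hp ha (D.contDiffOn_rpow _) he).isSymField
    · rw [Xpow'_eq n]; exact (hc.congr (fun _ _ => rfl) fun _ _ => by ring).isSymField
    · exact ⟨0, 0, 1, 0, _, _, isReduced_zero, hc, Xconf_eq n⟩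
  | c9 f =>
    have hS := dS_eq_zero_of_barotropic he
    rcases hX with (rfl | rfl) | ⟨F, hF, rfl⟩
    · exact isSymField_X1
    · exact isSymField_X2
    · rw [Xent_eq n]; exact (isReduced_ent hp hF hS).isSymField
  | c10 κ =>
    rcases hX with (rfl | rfl | rfl) | ⟨F, hF, rfl⟩
    · exact isSymField_X1
    · exact isSymField_X2
    · rw [Xlog_eq n]
      exact (isReduced_log (k := 0) (p₀ := p₀) hp ha.1 (fun ρ hρ S hS => by
        rw [he ρ hρ S hS]; simp [EosCase.eos])).isSymField
    · rw [XentW_eq n]; exact (isReduced_entW ha hF he).isSymField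
  | c11 k =>
    have hS := dS_eq_zero_of_barotropic he
    rcases hX with (rfl | rfl | rfl) | ⟨F, hF, rfl⟩
    · exact isSymField_X1
    · exact isSymField_X2
    · rw [Xlog_eq n]
      exact (isReduced_log (κ := fun _ => 0) (k := k) (p₀ := p₀) hp contDiffOn_const
        (fun ρ hρ S hS => by rw [he ρ hρ S hS]; simp [EosCase.eos])).isSymField
    · rw [Xent_eq n]; exact (isReduced_ent hp hF hS).isSymField
  | c12 k q =>
    have hS := dS_eq_zero_of_barotropic he
    rcases hX with (rfl | rfl | rfl) | ⟨F, hF, rfl⟩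
    · exact isSymField_X1
    · exact isSymField_X2
    · rw [Xpow_eq n]
      exact (isReduced_pow (κ := fun _ => k) hp contDiffOn_const he).isSymField
    · rw [Xent_eq n]; exact (isReduced_ent hp hF hS).isSymField
  | c13 k =>
    have hS := dS_eq_zero_of_barotropic he
    have hc := isReduced_conf (κ := fun _ => k) hn0 hp contDiffOn_const he
    rcases hX with (rfl | rfl | rfl | rfl) | ⟨F, hF, rfl⟩
    · exact isSymField_X1
    · exact isSymField_X2
    · exact ⟨0, 0, 1, 0, _, _, isReduced_zero, hc, Xconf_eq n⟩
    · rw [Xpow'_eq n]; exact (hc.congr (fun _ _ => rfl) fun _ _ => by ring).isSymField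
    · rw [Xent_eq n]; exact (isReduced_ent hp hF hS).isSymField

/-! ### Spans of vector fields on a box -/

section
variable {Ω : Set Pt} {G H : Set VField} {X Y : VField}

theorem InSpan.congr (h : InSpan Ω G X) (hXY : EqOn Y X Ω) : InSpan Ω G Y := by
  obtain ⟨Z, hZ, hX⟩ := h
  exact ⟨Z, hZ, hXY.trans hX⟩

theorem InSpan.mono (h : InSpan Ω G X) (hG : G ⊆ H) : InSpan Ω H X := by
  obtain ⟨Z, hZ, hX⟩ := h
  exact ⟨Z, Submodule.span_mono hG hZ, hX⟩

theorem inSpan_of_mem (h : X ∈ G) : InSpan Ω G X :=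
  ⟨X, Submodule.subset_span h, fun _ _ => rfl⟩

theorem InSpan.add (h : InSpan Ω G X) (h' : InSpan Ω G Y) : InSpan Ω G (X + Y) := by
  obtain ⟨Z, hZ, hX⟩ := h
  obtain ⟨W, hW, hY⟩ := h'
  exact ⟨Z + W, add_mem hZ hW, fun z hz => by simp [hX hz, hY hz]⟩

theorem InSpan.smul (x : ℝ) (h : InSpan Ω G X) : InSpan Ω G (x • X) := by
  obtain ⟨Z, hZ, hX⟩ := h
  exact ⟨x • Z, Submodule.smul_mem _ _ hZ, fun z hz => by simp [hX hz]⟩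

theorem InSpan.zero : InSpan Ω G 0 := ⟨0, zero_mem _, fun _ _ => rfl⟩

/-- A property of vector fields on `Ω` that is stable under linear combinations passes to spans. -/
theorem InSpan.induction {P : VField → Prop} (h : InSpan Ω G X) (hG : ∀ X ∈ G, P X) (h0 : P 0)
    (hadd : ∀ X Y, P X → P Y → P (X + Y)) (hsmul : ∀ (x : ℝ) X, P X → P (x • X))
    (hcongr : ∀ X Y, P X → EqOn Y X Ω → P Y) : P X := by
  obtain ⟨Z, hZ, hX⟩ := h
  refine hcongr Z X ?_ hX
  clear hX
  induction hZ using Submodule.span_induction with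
  | mem x hx => exact hG x hx
  | zero => exact h0
  | add x y _ _ hx hy => exact hadd x y hx hy
  | smul a x _ hx => exact hsmul a x hx

end

section
variable {n : ℕ} {K : KinDomain} {D : EosDomain}

theorem symField_congr {c₁ c₂ a μ d₁ d₂ b ν : ℝ} {F g G k : ℝ → ℝ} (h1 : c₁ = d₁) (h2 : c₂ = d₂)
    (h3 : a = b) (h4 : μ = ν) (hF : EqOn F G D.J.carrier) (hg : EqOn g k D.J.carrier) :
    EqOn (symField n c₁ c₂ a μ F g) (symField n d₁ d₂ b ν G k) (box K D) := by
  subst h1 h2 h3 h4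
  rintro ⟨t, r, ρ, S, U⟩ ⟨-, -, -, hS, -⟩
  simp only [symField, hF hS, hg hS]

theorem symField_add (c₁ c₂ a μ d₁ d₂ b ν : ℝ) (F g G k : ℝ → ℝ) :
    symField n (c₁ + d₁) (c₂ + d₂) (a + b) (μ + ν) (fun S => F S + G S) (fun S => g S + k S) =
      symField n c₁ c₂ a μ F g + symField n d₁ d₂ b ν G k := by
  funext ⟨t, r, ρ, S, U⟩
  simp only [symField, Pi.add_apply, Prod.mk_add_mk, Prod.mk.injEq]
  refine ⟨?_, ?_, ?_, ?_, ?_⟩ <;> first | trivial | ring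

theorem symField_smul (x c₁ c₂ a μ : ℝ) (F g : ℝ → ℝ) :
    symField n (x * c₁) (x * c₂) (x * a) (x * μ) (fun S => x * F S) (fun S => x * g S) =
      x • symField n c₁ c₂ a μ F g := by
  funext ⟨t, r, ρ, S, U⟩
  simp only [symField, Pi.smul_apply, Prod.smul_mk, Prod.mk.injEq, smul_eq_mul]
  refine ⟨?_, ?_, ?_, ?_, ?_⟩ <;> first | trivial | ring

theorem symField_zero : symField n 0 0 0 0 (fun _ => 0) (fun _ => 0) = 0 := by
  funext ⟨t, r, ρ, S, U⟩
  simp [symField]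

theorem symField_eq_time_add (c₁ c₂ a μ : ℝ) (F g : ℝ → ℝ) :
    symField n c₁ c₂ a μ F g = c₁ • X1 + c₂ • X2 + a • Xconf n + symField n 0 0 0 μ F g := by
  funext ⟨t, r, ρ, S, U⟩
  simp only [symField, X1, X2, Xconf, Pi.add_apply, Pi.smul_apply, Prod.smul_mk, Prod.mk_add_mk,
    Prod.mk.injEq, smul_eq_mul]
  refine ⟨?_, ?_, ?_, ?_, ?_⟩ <;> ring

/-- The span contains `X` if it contains `X1`, `X2` and the remaining part of `X`. -/
theorem inSpan_symField {G : Set VField} (h1 : X1 ∈ G) (h2 : X2 ∈ G) (c₁ c₂ : ℝ) {μ : ℝ}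
    {F g : ℝ → ℝ} (h : InSpan (box K D) G (symField n 0 0 0 μ F g)) :
    InSpan (box K D) G (symField n c₁ c₂ 0 μ F g) := by
  rw [symField_eq_time_add, zero_smul, add_zero]
  exact (((inSpan_of_mem h1).smul c₁).add ((inSpan_of_mem h2).smul c₂)).add h

/-- The parameters of a vector field of the general form are determined by its values. -/
theorem symField_eq_zero {c₁ c₂ a μ : ℝ} {F g : ℝ → ℝ}
    (h : EqOn (symField n c₁ c₂ a μ F g) 0 (box K D)) :
    c₁ = 0 ∧ c₂ = 0 ∧ a = 0 ∧ μ = 0 ∧ (∀ S ∈ D.J.carrier, F S = 0) ∧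
      ∀ S ∈ D.J.carrier, g S = 0 := by
  obtain ⟨⟨t, r, ρ, S, U⟩, ht, hr, hρ, hS, hU⟩ := box_nonempty K D
  dsimp only at ht hr hρ hS hU
  obtain ⟨ε, hε, hball⟩ := Metric.isOpen_iff.1 K.T.isOpen t ht
  obtain ⟨δ, hδ, hball'⟩ := Metric.isOpen_iff.1 K.V.isOpen U hU
  have hT : ∀ x ∈ K.T.carrier, c₁ + c₂ * x + a * x ^ 2 = 0 := fun x hx =>
    congrArg Prod.fst (h (show (x, r, ρ, S, U) ∈ box K D from ⟨hx, hr, hρ, hS, hU⟩))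
  have ht1 : t + ε / 2 ∈ K.T.carrier := hball (by
    rw [Metric.mem_ball, Real.dist_eq, show t + ε / 2 - t = ε / 2 by ring, abs_of_pos] <;> linarith)
  have ht2 : t - ε / 2 ∈ K.T.carrier := hball (by
    rw [Metric.mem_ball, Real.dist_eq, show t - ε / 2 - t = -(ε / 2) by ring, abs_neg,
      abs_of_pos] <;> linarith)
  have hU1 : U + δ / 2 ∈ K.V.carrier := hball' (by
    rw [Metric.mem_ball, Real.dist_eq, show U + δ / 2 - U = δ / 2 by ring, abs_of_pos] <;> linarith)
  have e0 := hT t ht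
  have e1 := hT _ ht1
  have e2 := hT _ ht2
  have ha : a = 0 := by
    have : a * ε ^ 2 = 0 := by linear_combination 2 * (e1 + e2 - 2 * e0)
    simpa [hε.ne'] using this
  subst ha
  have hc2 : c₂ = 0 := by
    have : c₂ * ε = 0 := by linear_combination e1 - e2
    simpa [hε.ne'] using this
  subst hc2
  have hV : ∀ x ∈ K.V.carrier, μ * x = 0 := fun x hx => by
    have : 0 * (r - t * x) + μ * x = 0 := congrArg (fun z : Pt => z.2.2.2.2)
      (h (show (t, r, ρ, S, x) ∈ box K D from ⟨ht, hr, hρ, hS, hx⟩))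
    linarith
  have hμ : μ = 0 := by
    have : μ * δ = 0 := by linear_combination 2 * (hV _ hU1 - hV U hU)
    simpa [hδ.ne'] using this
  refine ⟨by linarith, rfl, rfl, hμ, fun s hs => ?_, fun s hs => ?_⟩
  · exact congrArg (fun z : Pt => z.2.2.2.1)
      (h (show (t, r, ρ, s, U) ∈ box K D from ⟨ht, hr, hρ, hs, hU⟩))
  · have : g s * ρ - n * 0 * (t * ρ) = 0 := congrArg (fun z : Pt => z.2.2.1)
      (h (show (t, r, ρ, s, U) ∈ box K D from ⟨ht, hr, hρ, hs, hU⟩))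
    have h0 := (D.ρ_pos hρ).ne'
    refine (mul_eq_zero.1 (?_ : g s * ρ = 0)).resolve_right h0
    linarith

/-! ### Commutators and Lie algebras -/

theorem symField_lieBracket (c₁ c₂ a μ d₁ d₂ b ν : ℝ) {F g G k : ℝ → ℝ}
    (hF : ContDiffOn ℝ ∞ F D.J.carrier) (hg : ContDiffOn ℝ ∞ g D.J.carrier)
    (hG : ContDiffOn ℝ ∞ G D.J.carrier) (hk : ContDiffOn ℝ ∞ k D.J.carrier) :
    BracketOn (box K D) (symField n c₁ c₂ a μ F g) (symField n d₁ d₂ b ν G k)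
      (symField n (c₁ * d₂ - d₁ * c₂) (2 * (c₁ * b - d₁ * a)) (c₂ * b - d₂ * a)
        (-(c₁ * b - d₁ * a)) (fun S => F S * deriv G S - G S * deriv F S)
        (fun S => F S * deriv k S - G S * deriv g S - n * (c₁ * b - d₁ * a))) := by
  rintro ⟨t, r, ρ, S, U⟩ ⟨-, -, -, hS, -⟩
  simp only [VectorField.lieBracket, symField_hasFDerivAt n c₁ c₂ a μ hF hg t r ρ S U hS,
    symField_hasFDerivAt n d₁ d₂ b ν hG hk t r ρ S U hS]
  simp only [symField, Prod.mk_sub_mk, Prod.mk.injEq]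
  refine ⟨?_, ?_, ?_, ?_, ?_⟩ <;> ring

/-- Two vector fields of the general form commute if `[F ∂_S + g ρ ∂_ρ, G ∂_S + k ρ ∂_ρ] = 0` and
their parts along `X1`, `X2`, `Xconf` commute. -/
theorem symField_bracket_eq_zero {c₁ c₂ a μ d₁ d₂ b ν : ℝ} {F g G k : ℝ → ℝ}
    (hF : ContDiffOn ℝ ∞ F D.J.carrier) (hg : ContDiffOn ℝ ∞ g D.J.carrier)
    (hG : ContDiffOn ℝ ∞ G D.J.carrier) (hk : ContDiffOn ℝ ∞ k D.J.carrier)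
    (h1 : c₁ * d₂ = d₁ * c₂) (h2 : c₁ * b = d₁ * a) (h3 : c₂ * b = d₂ * a)
    (h4 : ∀ S ∈ D.J.carrier, F S * deriv G S = G S * deriv F S)
    (h5 : ∀ S ∈ D.J.carrier, F S * deriv k S = G S * deriv g S) :
    BracketOn (box K D) (symField n c₁ c₂ a μ F g) (symField n d₁ d₂ b ν G k) 0 := by
  refine EqOn.trans (symField_lieBracket c₁ c₂ a μ d₁ d₂ b ν hF hg hG hk) ?_
  rw [← symField_zero (n := n)]
  refine symField_congr (by linarith) (by linarith) (by linarith) (by linarith)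
    (fun S hS => by linarith [h4 S hS]) (fun S hS => ?_)
  rw [h2]; linarith [h5 S hS]

/-- The bracket with a member of a family that acts on `(r, U, ρ)` by scaling and does not involve
`F`, `g` other than by constants. -/
theorem symField_bracket_scaling {c₁ c₂ a μ ν g₀ k₀ : ℝ} {G : ℝ → ℝ}
    (hG : ContDiffOn ℝ ∞ G D.J.carrier) :
    BracketOn (box K D) (symField n 0 0 0 ν G (fun _ => k₀))
      (symField n c₁ c₂ a μ (fun _ => 0) (fun _ => g₀)) 0 :=
  symField_bracket_eq_zero hG contDiffOn_const contDiffOn_const contDiffOn_const (by ring)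
    (by ring) (by ring) (fun S _ => by simp) fun S _ => by simp

theorem lieBracket_X1_X2 : BracketOn (box K D) X1 X2 X1 := by
  rw [X1_eq 0, X2_eq 0]
  refine EqOn.trans (symField_lieBracket (D := D) 1 0 0 0 0 1 0 0 contDiffOn_const contDiffOn_const
    contDiffOn_const contDiffOn_const) (symField_congr (by norm_num) (by norm_num) (by norm_num)
    (by norm_num) (fun _ _ => by norm_num) (fun _ _ => by norm_num))

theorem lieBracket_X1_Xconf : BracketOn (box K D) X1 (Xconf n) ((2 : ℝ) • X2 - Xpow' n) := by
  have : (2 : ℝ) • X2 - Xpow' n = symField n 0 2 0 (-1) (fun _ => 0) (fun _ => -n) := by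
    funext ⟨t, r, ρ, S, U⟩
    simp [X2, Xpow', symField]
    ring
  rw [this, X1_eq n, Xconf_eq]
  refine EqOn.trans (symField_lieBracket (D := D) 1 0 0 0 0 0 1 0 contDiffOn_const contDiffOn_const
    contDiffOn_const contDiffOn_const) (symField_congr (by norm_num) (by norm_num) (by norm_num)
    (by norm_num) (fun _ _ => by norm_num) (fun _ _ => by norm_num))

theorem lieBracket_X2_Xconf : BracketOn (box K D) X2 (Xconf n) (Xconf n) := by
  rw [X2_eq n, Xconf_eq]
  refine EqOn.trans (symField_lieBracket (D := D) 0 1 0 0 0 0 1 0 contDiffOn_const contDiffOn_const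
    contDiffOn_const contDiffOn_const) (symField_congr (by norm_num) (by norm_num) (by norm_num)
    (by norm_num) (fun _ _ => by norm_num) (fun _ _ => by norm_num))

theorem EosCase.Admissible.commutators {c : EosCase} (h : c.Admissible D) :
    c.Commutators n D (box K D) := by
  refine ⟨lieBracket_X1_X2, ?_⟩
  have s0 : ContDiffOn ℝ ∞ (fun _ : ℝ => (0 : ℝ)) D.J.carrier := contDiffOn_const
  cases c with
  | c1 f => trivial
  | c2 κ f =>
    rintro Y (rfl | rfl)
    · rw [Xprod_eq n, X1_eq n]; exact symField_bracket_scaling h.1.smooth_log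
    · rw [Xprod_eq n, X2_eq n]; exact symField_bracket_scaling h.1.smooth_log
  | c3 κ f =>
    rintro Y (rfl | rfl)
    · rw [Xsum_eq n, X1_eq n]; exact symField_bracket_scaling h.1.smooth_inv
    · rw [Xsum_eq n, X2_eq n]; exact symField_bracket_scaling h.1.smooth_inv
  | c4 κ f q =>
    rintro Y (rfl | rfl)
    · rw [Xscal_eq n, X1_eq n]; exact symField_bracket_scaling h.1.smooth_log.neg
    · rw [Xscal_eq n, X2_eq n]; exact symField_bracket_scaling h.1.smooth_log.neg
  | c5 κ f k =>
    rintro Y (rfl | rfl)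
    · rw [XlogScal_eq n, X1_eq n]; exact symField_bracket_scaling h.1.smooth_log
    · rw [XlogScal_eq n, X2_eq n]; exact symField_bracket_scaling h.1.smooth_log
  | c6 κ q =>
    constructor
    · rintro Y (rfl | rfl)
      · rw [Xprod_eq n, X1_eq n]; exact symField_bracket_scaling h.1.smooth_log
      · rw [Xprod_eq n, X2_eq n]; exact symField_bracket_scaling h.1.smooth_log
    · rintro Y (rfl | rfl | rfl)
      · rw [Xpow_eq n, X1_eq n]; exact symField_bracket_scaling s0
      · rw [Xpow_eq n, X2_eq n]; exact symField_bracket_scaling s0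
      · rw [Xpow_eq n, Xprod_eq n]
        exact symField_bracket_eq_zero s0 contDiffOn_const h.1.smooth_log s0 (by ring) (by ring)
          (by ring) (fun S _ => by simp) fun S _ => by simp
  | c7 κ k =>
    constructor
    · rintro Y (rfl | rfl)
      · rw [Xsum_eq n, X1_eq n]; exact symField_bracket_scaling h.1.smooth_inv
      · rw [Xsum_eq n, X2_eq n]; exact symField_bracket_scaling h.1.smooth_inv
    · rintro Y (rfl | rfl | rfl)
      · rw [Xlog_eq n, X1_eq n]; exact symField_bracket_scaling s0
      · rw [Xlog_eq n, X2_eq n]; exact symField_bracket_scaling s0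
      · rw [Xlog_eq n, Xsum_eq n]
        exact symField_bracket_eq_zero s0 contDiffOn_const h.1.smooth_inv s0 (by ring) (by ring)
          (by ring) (fun S _ => by simp) fun S _ => by simp
  | c8 κ =>
    refine ⟨lieBracket_X1_Xconf, lieBracket_X2_Xconf, ?_, ?_⟩
    · rintro Y (rfl | rfl | rfl)
      · rw [Xpow'_eq n, X1_eq n]; exact symField_bracket_scaling s0
      · rw [Xpow'_eq n, X2_eq n]; exact symField_bracket_scaling s0
      · rw [Xpow'_eq n, Xconf_eq n]; exact symField_bracket_scaling s0
    · have h' : Regular κ D.J := h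
      rintro Y (rfl | rfl | rfl | rfl)
      · rw [Xprod_eq n, X1_eq n]; exact symField_bracket_scaling h'.smooth_log
      · rw [Xprod_eq n, X2_eq n]; exact symField_bracket_scaling h'.smooth_log
      · rw [Xprod_eq n, Xconf_eq n]; exact symField_bracket_scaling h'.smooth_log
      · rw [Xprod_eq n, Xpow'_eq n]; exact symField_bracket_scaling h'.smooth_log
  | c9 f =>
    rintro F hF Y (rfl | rfl)
    · rw [Xent_eq n, X1_eq n]; exact symField_bracket_scaling hF
    · rw [Xent_eq n, X2_eq n]; exact symField_bracket_scaling hF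
  | c10 κ =>
    have h' : Regular κ D.J := h
    constructor
    · rintro Y (rfl | rfl)
      · rw [Xlog_eq n, X1_eq n]; exact symField_bracket_scaling s0
      · rw [Xlog_eq n, X2_eq n]; exact symField_bracket_scaling s0
    · intro F hF
      have hg : ContDiffOn ℝ ∞ (fun S => deriv (fun s => F s * deriv κ s) S / deriv κ S)
          D.J.carrier := (smooth_deriv (ContDiffOn.mul hF (smooth_deriv h'.1))).div
            (smooth_deriv h'.1) h'.2
      have key : ∀ c₁ c₂ μ g₀ : ℝ, BracketOn (box K D) (symField n 0 0 0 0 F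
          (fun S => deriv (fun s => F s * deriv κ s) S / deriv κ S))
          (symField n c₁ c₂ 0 μ (fun _ => 0) (fun _ => g₀)) 0 := fun c₁ c₂ μ g₀ =>
        symField_bracket_eq_zero hF hg s0 contDiffOn_const (by ring) (by ring)
          (by ring) (fun S _ => by simp) fun S _ => by simp
      rintro Y (rfl | rfl | rfl)
      · rw [XentW_eq n, X1_eq n]; exact key ..
      · rw [XentW_eq n, X2_eq n]; exact key ..
      · rw [XentW_eq n, Xlog_eq n]; exact key ..
  | c11 k =>
    constructor
    · rintro Y (rfl | rfl)
      · rw [Xlog_eq n, X1_eq n]; exact symField_bracket_scaling s0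
      · rw [Xlog_eq n, X2_eq n]; exact symField_bracket_scaling s0
    · rintro F hF Y (rfl | rfl | rfl)
      · rw [Xent_eq n, X1_eq n]; exact symField_bracket_scaling hF
      · rw [Xent_eq n, X2_eq n]; exact symField_bracket_scaling hF
      · rw [Xent_eq n, Xlog_eq n]; exact symField_bracket_scaling hF
  | c12 k q =>
    constructor
    · rintro Y (rfl | rfl)
      · rw [Xpow_eq n, X1_eq n]; exact symField_bracket_scaling s0
      · rw [Xpow_eq n, X2_eq n]; exact symField_bracket_scaling s0
    · rintro F hF Y (rfl | rfl | rfl)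
      · rw [Xent_eq n, X1_eq n]; exact symField_bracket_scaling hF
      · rw [Xent_eq n, X2_eq n]; exact symField_bracket_scaling hF
      · rw [Xent_eq n, Xpow_eq n]; exact symField_bracket_scaling hF
  | c13 k =>
    refine ⟨lieBracket_X1_Xconf, lieBracket_X2_Xconf, ?_, ?_⟩
    · rintro Y (rfl | rfl | rfl)
      · rw [Xpow'_eq n, X1_eq n]; exact symField_bracket_scaling s0
      · rw [Xpow'_eq n, X2_eq n]; exact symField_bracket_scaling s0
      · rw [Xpow'_eq n, Xconf_eq n]; exact symField_bracket_scaling s0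
    · rintro F hF Y (rfl | rfl | rfl | rfl)
      · rw [Xent_eq n, X1_eq n]; exact symField_bracket_scaling hF
      · rw [Xent_eq n, X2_eq n]; exact symField_bracket_scaling hF
      · rw [Xent_eq n, Xconf_eq n]; exact symField_bracket_scaling hF
      · rw [Xent_eq n, Xpow'_eq n]; exact symField_bracket_scaling hF

end

/-! ### Realizations of the abstract Lie algebras -/

/-- A faithful realization of a Lie algebra `M` by vector fields
`μ (r ∂_r + U ∂_U) + F(S) ∂_S + g(S) ρ ∂_ρ`, all of which commute with `X1`, `X2`. -/
structure Realization (J : OpenInterval) (M : Type) [LieRing M] [LieAlgebra ℝ M] where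
  μ : M →ₗ[ℝ] ℝ
  F : M →ₗ[ℝ] (ℝ → ℝ)
  g : M →ₗ[ℝ] (ℝ → ℝ)
  smoothF : ∀ x : M, ContDiffOn ℝ ∞ (F x) J.carrier
  smoothg : ∀ x : M, ContDiffOn ℝ ∞ (g x) J.carrier
  μ_lie : ∀ x y : M, μ ⁅x, y⁆ = 0
  F_lie : ∀ x y : M, ∀ S ∈ J.carrier,
    F ⁅x, y⁆ S = F x S * deriv (F y) S - F y S * deriv (F x) S
  g_lie : ∀ x y : M, ∀ S ∈ J.carrier,
    g ⁅x, y⁆ S = F x S * deriv (g y) S - F y S * deriv (g x) S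
  faithful : ∀ x : M, μ x = 0 → (∀ S ∈ J.carrier, F x S = 0) →
    (∀ S ∈ J.carrier, g x S = 0) → x = 0

/-- The field of the realization that represents `x`. -/
def Realization.field {J : OpenInterval} {M : Type} [LieRing M] [LieAlgebra ℝ M]
    (R : Realization J M) (n : ℕ) (x : M) : VField := symField n 0 0 0 (R.μ x) (R.F x) (R.g x)

section
variable {n : ℕ} {K : KinDomain} {D : EosDomain} {M : Type} [LieRing M] [LieAlgebra ℝ M]
  {G : Set VField}

/-- It suffices that the generators are in the image of a faithful representation by vector fields,
and that this image is in their span. -/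
theorem spanIsAlgebra_of_linearMap {Ω : Set Pt} {L : Type} [LieRing L] [LieAlgebra ℝ L]
    (Φ : L →ₗ[ℝ] VField) (h1 : ∀ a b : L, BracketOn Ω (Φ a) (Φ b) (Φ ⁅a, b⁆))
    (h2 : ∀ a : L, EqOn (Φ a) 0 Ω → a = 0) (h3 : ∀ X ∈ G, ∃ a, EqOn X (Φ a) Ω)
    (h4 : ∀ a, InSpan Ω G (Φ a)) : SpanIsAlgebra Ω G L := by
  refine ⟨Φ, h1, h2, fun X => ⟨fun h => ?_, fun ⟨a, ha⟩ => (h4 a).congr ha⟩⟩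
  refine h.induction (P := fun X => ∃ a, EqOn X (Φ a) Ω) h3 ⟨0, fun z _ => by simp⟩ ?_ ?_ ?_
  · rintro X Y ⟨a, ha⟩ ⟨b, hb⟩
    exact ⟨a + b, fun z hz => by simp [ha hz, hb hz]⟩
  · rintro x X ⟨a, ha⟩
    exact ⟨x • a, fun z hz => by simp [ha hz]⟩
  · rintro X Y ⟨a, ha⟩ hXY
    exact ⟨a, hXY.trans ha⟩

/-- `X1`, `X2` together with a realization of `M` span `A21 × M`. -/
theorem Realization.spanIsAlgebra_A21 (R : Realization D.J M) (hX1 : X1 ∈ G) (hX2 : X2 ∈ G)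
    (h3 : ∀ X ∈ G, X = X1 ∨ X = X2 ∨ ∃ x, EqOn X (R.field n x) (box K D))
    (h4 : ∀ x, InSpan (box K D) G (R.field n x)) : SpanIsAlgebra (box K D) G (A21 × M) := by
  let Φ : A21 × M →ₗ[ℝ] VField :=
    { toFun := fun x => symField n x.1.1 x.1.2 0 (R.μ x.2) (R.F x.2) (R.g x.2)
      map_add' := fun x y => by
        rw [← symField_add]
        simp only [Prod.fst_add, Prod.snd_add, A21.add_fst, A21.add_snd, map_add, add_zero]
        rfl
      map_smul' := fun x y => by
        rw [RingHom.id_apply, ← symField_smul]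
        simp only [Prod.smul_fst, Prod.smul_snd, A21.smul_fst, A21.smul_snd, map_smul, mul_zero]
        rfl }
  refine spanIsAlgebra_of_linearMap Φ (fun x y => ?_) (fun x hx => ?_) (fun X hX => ?_) fun x => ?_
  · refine EqOn.trans (symField_lieBracket _ _ _ _ _ _ _ _ (R.smoothF _) (R.smoothg _)
      (R.smoothF _) (R.smoothg _)) (symField_congr rfl (?_ : _ = (0 : ℝ)) (by ring) ?_
      (fun S hS => (R.F_lie _ _ S hS).symm) fun S hS => ?_)
    · ring
    · exact (by ring : _ = (0 : ℝ)).trans (R.μ_lie x.2 y.2).symm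
    · exact (by ring : _ = _).trans (R.g_lie x.2 y.2 S hS).symm
  · obtain ⟨e1, e2, -, e4, e5, e6⟩ := symField_eq_zero hx
    exact Prod.ext (A21.ext e1 e2) (R.faithful _ e4 e5 e6)
  · rcases h3 X hX with rfl | rfl | ⟨x, hx⟩
    · refine ⟨(((1, 0) : ℝ × ℝ), 0), fun z _ => ?_⟩
      simp only [Φ, LinearMap.coe_mk, AddHom.coe_mk, map_zero, X1_eq n]
      rfl
    · refine ⟨(((0, 1) : ℝ × ℝ), 0), fun z _ => ?_⟩
      simp only [Φ, LinearMap.coe_mk, AddHom.coe_mk, map_zero, X2_eq n]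
      rfl
    · exact ⟨(0, x), hx⟩
  · exact inSpan_symField hX1 hX2 _ _ (h4 x.2)

theorem Sl2.val_one_one (A : Sl2) : A.1 1 1 = -A.1 0 0 := by
  have h : Matrix.trace A.1 = 0 := A.2
  rw [Matrix.trace_fin_two] at h
  linarith

theorem Sl2.eq_zero {A : Sl2} (h1 : A.1 0 0 = 0) (h2 : A.1 0 1 = 0) (h3 : A.1 1 0 = 0) :
    A = 0 := by
  apply Subtype.ext
  ext i j
  fin_cases i <;> fin_cases j
  · exact h1
  · exact h2
  · exact h3
  · simpa [h1] using Sl2.val_one_one A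

/-- The matrix with rows `(x, y)` and `(z, -x)`. -/
def Sl2.mk (x y z : ℝ) : Sl2 := ⟨!![x, y; z, -x], by
  change Matrix.trace !![x, y; z, -x] = 0
  simp [Matrix.trace_fin_two]⟩

/-- `X1`, `2 X2 - Xpow'`, `Xconf` span a copy of `sl(2, ℝ)`, which commutes with a realization
of `M` with constant functions `g`. -/
theorem Realization.spanIsAlgebra_Sl2 (R : Realization D.J M) (hX1 : X1 ∈ G) (hX2 : X2 ∈ G)
    (hX : Xconf n ∈ G) {w : M} (hw : R.μ w = 1)
    (hwF : ∀ S ∈ D.J.carrier, R.F w S = 0) (hwg : ∀ S ∈ D.J.carrier, R.g w S = n)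
    (h3 : ∀ X ∈ G, X = X1 ∨ X = X2 ∨ X = Xconf n ∨ ∃ x, EqOn X (R.field n x) (box K D))
    (h4 : ∀ x, InSpan (box K D) G (R.field n x)) : SpanIsAlgebra (box K D) G (Sl2 × M) := by
  obtain ⟨Φ, hΦ⟩ : ∃ Φ : Sl2 × M →ₗ[ℝ] VField, ∀ x, Φ x = symField n (x.1.1 0 1)
      (-2 * x.1.1 0 0) (-x.1.1 1 0) (x.1.1 0 0 + R.μ x.2) (R.F x.2)
      (fun S => n * x.1.1 0 0 + R.g x.2 S) := by
    refine ⟨⟨⟨fun x => symField n (x.1.1 0 1) (-2 * x.1.1 0 0) (-x.1.1 1 0)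
      (x.1.1 0 0 + R.μ x.2) (R.F x.2) (fun S => n * x.1.1 0 0 + R.g x.2 S), fun x y => ?_⟩,
      fun x y => ?_⟩, fun _ => rfl⟩
    · have e : ∀ i j, (x + y).1.1 i j = x.1.1 i j + y.1.1 i j := fun _ _ => rfl
      rw [← symField_add]
      simp only [e, Prod.snd_add, map_add]
      congr 1
      · ring
      · ring
      · ring
      · funext S; simp only [Pi.add_apply]; ring
    · have e : ∀ i j, (x • y).1.1 i j = x * y.1.1 i j := fun _ _ => rfl
      dsimp only
      rw [RingHom.id_apply, ← symField_smul]
      simp only [e, Prod.smul_snd, map_smul, smul_eq_mul]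
      congr 1
      · ring
      · ring
      · ring
      · funext S; simp only [Pi.smul_apply, smul_eq_mul]; ring
  refine spanIsAlgebra_of_linearMap Φ (fun x y => ?_) (fun x hx => ?_) (fun X hX => ?_) fun x => ?_
  · have hb := LieAlgebra.SpecialLinear.sl_bracket (Fin 2) ℝ x.1 y.1
    have hx := Sl2.val_one_one x.1
    have hy := Sl2.val_one_one y.1
    have e00 : (⁅x.1, y.1⁆).1 0 0 = x.1.1 0 1 * y.1.1 1 0 - y.1.1 0 1 * x.1.1 1 0 := by
      rw [hb]; simp only [Matrix.sub_apply, Matrix.mul_apply, Fin.sum_univ_two]; ring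
    have e01 : (⁅x.1, y.1⁆).1 0 1 = 2 * (x.1.1 0 0 * y.1.1 0 1 - y.1.1 0 0 * x.1.1 0 1) := by
      rw [hb]; simp only [Matrix.sub_apply, Matrix.mul_apply, Fin.sum_univ_two, hx, hy]; ring
    have e10 : (⁅x.1, y.1⁆).1 1 0 = 2 * (x.1.1 1 0 * y.1.1 0 0 - y.1.1 1 0 * x.1.1 0 0) := by
      rw [hb]; simp only [Matrix.sub_apply, Matrix.mul_apply, Fin.sum_univ_two, hx, hy]; ring
    have hd : ∀ x : Sl2 × M, ∀ S, deriv (fun S => n * x.1.1 0 0 + R.g x.2 S) S =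
        deriv (R.g x.2) S := fun x S => deriv_const_add _
    rw [hΦ, hΦ, hΦ]
    refine EqOn.trans (symField_lieBracket _ _ _ _ _ _ _ _ (R.smoothF _)
      (contDiffOn_const.add (R.smoothg _)) (R.smoothF _) (contDiffOn_const.add (R.smoothg _)))
      (symField_congr ?_ ?_ ?_ ?_ (fun S hS => (R.F_lie x.2 y.2 S hS).symm) fun S hS => ?_)
    · exact (by ring : _ = _).trans e01.symm
    · refine Eq.trans ?_ (congrArg (fun t => -2 * t) e00.symm); ring
    · refine Eq.trans ?_ (congrArg (fun t => -t) e10.symm); ring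
    · refine Eq.trans ?_ (congrArg₂ (fun t s => t + s) e00 (R.μ_lie x.2 y.2)).symm; ring
    · refine Eq.trans ?_ (congrArg₂ (fun t s => (n : ℝ) * t + s) e00 (R.g_lie x.2 y.2 S hS)).symm
      simp only [hd]
      ring
  · rw [hΦ] at hx
    obtain ⟨e1, e2, e3, e4, e5, e6⟩ := symField_eq_zero hx
    have h0 : x.1.1 0 0 = 0 := by linarith
    refine Prod.ext (Sl2.eq_zero h0 e1 (by linarith)) (R.faithful _ ?_ e5 fun S hS => ?_)
    · rw [h0] at e4; linarith
    · have := e6 S hS; rw [h0] at this; linarith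
  · rcases h3 X hX with rfl | rfl | rfl | ⟨x, hx⟩
    · refine ⟨(Sl2.mk 0 1 0, 0), fun z hz => ?_⟩
      rw [X1_eq n, hΦ]
      refine symField_congr (K := K) (D := D) ?_ ?_ ?_ ?_ (fun S _ => ?_) (fun S _ => ?_) hz <;>
        simp [Sl2.mk]
    · refine ⟨(Sl2.mk (-1/2) 0 0, (1/2 : ℝ) • w), fun z hz => ?_⟩
      rw [X2_eq n, hΦ]
      refine symField_congr (K := K) (D := D) ?_ ?_ ?_ ?_ (fun S hS => ?_) (fun S hS => ?_) hz
      · simp [Sl2.mk]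
      · simp [Sl2.mk]; norm_num
      · simp [Sl2.mk]
      · simp [Sl2.mk, hw]; norm_num
      · simp [hwF S hS]
      · simp [Sl2.mk, hwg S hS]; ring
    · refine ⟨(Sl2.mk 0 0 (-1), 0), fun z hz => ?_⟩
      rw [Xconf_eq n, hΦ]
      refine symField_congr (K := K) (D := D) ?_ ?_ ?_ ?_ (fun S _ => ?_) (fun S _ => ?_) hz <;>
        simp [Sl2.mk]
    · refine ⟨(0, x), fun z hz => ?_⟩
      rw [hx hz, hΦ]
      refine symField_congr (K := K) (D := D) ?_ ?_ ?_ ?_ (fun S _ => ?_) (fun S _ => ?_) hz <;>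
        simp
  · have h := ((((inSpan_of_mem (Ω := box K D) hX1).smul (x.1.1 0 1)).add
      ((inSpan_of_mem hX2).smul (-2 * x.1.1 0 0))).add ((inSpan_of_mem hX).smul (-x.1.1 1 0))).add
      (h4 (x.2 + x.1.1 0 0 • w))
    rw [Realization.field, ← symField_eq_time_add] at h
    rw [hΦ]
    refine h.congr (symField_congr rfl rfl rfl ?_ (fun S hS => ?_) fun S hS => ?_)
    · simp [hw]; ring
    · simp [hwF S hS]
    · simp [hwg S hS]; ring

end

/-- The coordinate of an element of `A1`. -/
def A1.coord : A1 →ₗ[ℝ] ℝ := ⟨⟨fun x => x, fun _ _ => rfl⟩, fun _ _ => rfl⟩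

/-- The inclusion of the smooth functions, extended by zero, into all functions. -/
def LineFields.incl (J : OpenInterval) : LineFields J →ₗ[ℝ] (ℝ → ℝ) :=
  ⟨⟨fun F => F.1, fun _ _ => rfl⟩, fun _ _ => rfl⟩

/-- The element of `A1` with a given coordinate. -/
def A1.of (x : ℝ) : A1 := x

theorem A1.coord_of (x : ℝ) : A1.coord (A1.of x) = x := rfl

theorem A1.coord_eq_zero {x : A1} (h : A1.coord x = 0) : x = 0 := h

section
variable {J : OpenInterval}

/-- The span of the single field `μ (r ∂_r + U ∂_U) + F ∂_S + g ρ ∂_ρ` with constant `g`. -/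
def Realization.single (μ g : ℝ) {F : ℝ → ℝ} (hF : ContDiffOn ℝ ∞ F J.carrier)
    (h : μ ≠ 0 ∨ g ≠ 0 ∨ ∃ S ∈ J.carrier, F S ≠ 0) : Realization J A1 where
  μ := μ • A1.coord
  F := A1.coord.smulRight F
  g := A1.coord.smulRight fun _ => g
  smoothF x := contDiffOn_const.mul hF
  smoothg x := contDiffOn_const.mul contDiffOn_const
  μ_lie x y := mul_zero _
  F_lie x y S hS := by
    have e : ∀ x : A1, A1.coord.smulRight F x = fun S => A1.coord x * F S := fun x => rfl
    have e0 : A1.coord ⁅x, y⁆ = 0 := rfl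
    have := smooth_differentiableAt hF hS
    simp only [e, e0, deriv_const_mul _ this]
    ring
  g_lie x y S hS := by
    have e : ∀ x : A1, A1.coord.smulRight (fun _ : ℝ => g) x = fun _ => A1.coord x * g :=
      fun x => rfl
    have e0 : A1.coord ⁅x, y⁆ = 0 := rfl
    simp only [e, e0, deriv_const]
    ring
  faithful x h1 h2 h3 := by
    apply A1.coord_eq_zero
    rcases h with h | h | ⟨S, hS, h⟩
    · exact (mul_eq_zero.1 h1).resolve_left h
    · obtain ⟨S, hS⟩ := J.nonempty
      exact (mul_eq_zero.1 (h3 S hS)).resolve_right h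
    · exact (mul_eq_zero.1 (h2 S hS)).resolve_right h

/-- The span of two commuting fields, the second one without component along `∂_S`. -/
def Realization.pair (μ ν : ℝ) {g : ℝ} (hg : g ≠ 0) {F : ℝ → ℝ}
    (hF : ContDiffOn ℝ ∞ F J.carrier) (h : μ ≠ 0 ∨ ∃ S ∈ J.carrier, F S ≠ 0) :
    Realization J (A1 × A1) where
  μ := (μ • A1.coord).coprod (ν • A1.coord)
  F := (A1.coord ∘ₗ LinearMap.fst ℝ A1 A1).smulRight F
  g := (A1.coord ∘ₗ LinearMap.snd ℝ A1 A1).smulRight fun _ => g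
  smoothF x := contDiffOn_const.mul hF
  smoothg x := contDiffOn_const.mul contDiffOn_const
  μ_lie x y := (by ring : μ * 0 + ν * 0 = 0)
  F_lie x y S hS := by
    have e : ∀ x : A1 × A1, (A1.coord ∘ₗ LinearMap.fst ℝ A1 A1).smulRight F x =
      fun S => A1.coord x.1 * F S := fun x => rfl
    have e0 : A1.coord ⁅x, y⁆.1 = 0 := rfl
    have := smooth_differentiableAt hF hS
    simp only [e, e0, deriv_const_mul _ this]
    ring
  g_lie x y S hS := by
    have e : ∀ x : A1 × A1, (A1.coord ∘ₗ LinearMap.snd ℝ A1 A1).smulRight (fun _ : ℝ => g) x =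
      fun _ => A1.coord x.2 * g := fun x => rfl
    have e0 : A1.coord ⁅x, y⁆.2 = 0 := rfl
    simp only [e, e0, deriv_const]
    ring
  faithful x h1 h2 h3 := by
    have hx2 : A1.coord x.2 = 0 := by
      obtain ⟨S, hS⟩ := J.nonempty
      exact (mul_eq_zero.1 (h3 S hS)).resolve_right hg
    have h1' : μ * A1.coord x.1 + ν * A1.coord x.2 = 0 := h1
    rw [hx2, mul_zero, add_zero] at h1'
    refine Prod.ext (A1.coord_eq_zero ?_) (A1.coord_eq_zero hx2)
    rcases h with h | ⟨S, hS, h⟩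
    · exact (mul_eq_zero.1 h1').resolve_left h
    · exact (mul_eq_zero.1 (h2 S hS)).resolve_right h

/-- The vector fields `F ∂_S`. -/
def Realization.line (J : OpenInterval) : Realization J (LineFields J) where
  μ := 0
  F := LineFields.incl J
  g := 0
  smoothF F := F.2.1
  smoothg _ := contDiffOn_const
  μ_lie _ _ := rfl
  F_lie F G S hS := (wronskian_apply hS).trans (by ring : F.1 S * deriv G.1 S -
    deriv F.1 S * G.1 S = F.1 S * deriv G.1 S - G.1 S * deriv F.1 S)
  g_lie F G S hS := by
    have : deriv (0 : ℝ → ℝ) S = 0 := deriv_const S 0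
    simp [this]
  faithful F _ h _ := LineFields.ext_on h

/-- A dilation together with the vector fields `F ∂_S + γ_F ρ ∂_ρ`, for a cocycle `γ`. -/
def Realization.dilationLine (μ : ℝ) {g : ℝ} (hg : μ ≠ 0 ∨ g ≠ 0)
    (γ : LineFields J →ₗ[ℝ] (ℝ → ℝ)) (hγ : ∀ F, ContDiffOn ℝ ∞ (γ F) J.carrier)
    (hγ' : ∀ F G : LineFields J, ∀ S ∈ J.carrier,
      γ ⁅F, G⁆ S = F.1 S * deriv (γ G) S - G.1 S * deriv (γ F) S) :
    Realization J (A1 × LineFields J) where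
  μ := (μ • A1.coord) ∘ₗ LinearMap.fst ℝ A1 _
  F := LineFields.incl J ∘ₗ LinearMap.snd ℝ A1 _
  g := (A1.coord.smulRight fun _ => g).coprod γ
  smoothF x := x.2.2.1
  smoothg x := (contDiffOn_const.mul contDiffOn_const).add (hγ x.2)
  μ_lie x y := mul_zero μ
  F_lie x y S hS := (wronskian_apply hS).trans (by ring : x.2.1 S * deriv y.2.1 S -
    deriv x.2.1 S * y.2.1 S = x.2.1 S * deriv y.2.1 S - y.2.1 S * deriv x.2.1 S)
  g_lie x y S hS := by
    have e : ∀ x : A1 × LineFields J, ((A1.coord.smulRight fun _ : ℝ => g).coprod γ) x =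
      fun S => A1.coord x.1 * g + γ x.2 S := fun x => rfl
    have e0 : A1.coord ⁅x, y⁆.1 = 0 := rfl
    have e1 : γ ⁅x, y⁆.2 S = _ := hγ' x.2 y.2 S hS
    simp only [e, e0, e1, deriv_const_add, zero_mul, zero_add]
    rfl
  faithful x h1 h2 h3 := by
    have hx2 : x.2 = 0 := LineFields.ext_on h2
    refine Prod.ext (A1.coord_eq_zero ?_) hx2
    rcases hg with h | h
    · exact (mul_eq_zero.1 h1).resolve_left h
    · obtain ⟨S, hS⟩ := J.nonempty
      have h3' : A1.coord x.1 * g + γ x.2 S = 0 := h3 S hS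
      rw [hx2, map_zero] at h3'
      exact (mul_eq_zero.1 (by simpa using h3')).resolve_right h

/-- The extension by zero of a smooth function on the interval. -/
def LineFields.mk {F : ℝ → ℝ} (hF : F ∈ SmoothFun J) : LineFields J :=
  ⟨J.carrier.indicator F, ContDiffOn.congr hF fun _ hx => indicator_of_mem hx _,
    fun _ hx => indicator_of_notMem hx _⟩

end

section
variable {n : ℕ} {K : KinDomain} {D : EosDomain}

theorem Realization.single_field {J : OpenInterval} {μ g : ℝ} {F : ℝ → ℝ}
    (hF : ContDiffOn ℝ ∞ F J.carrier) (h : μ ≠ 0 ∨ g ≠ 0 ∨ ∃ S ∈ J.carrier, F S ≠ 0) (x : A1) :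
    (Realization.single μ g hF h).field n x =
      A1.coord x • symField n 0 0 0 μ F (fun _ => g) := by
  rw [← symField_smul, mul_zero, mul_comm (A1.coord x) μ]
  rfl

theorem Realization.pair_field {J : OpenInterval} {μ ν g : ℝ} (hg : g ≠ 0) {F : ℝ → ℝ}
    (hF : ContDiffOn ℝ ∞ F J.carrier) (h : μ ≠ 0 ∨ ∃ S ∈ J.carrier, F S ≠ 0) (x : A1 × A1) :
    (Realization.pair μ ν hg hF h).field n x =
      A1.coord x.1 • symField n 0 0 0 μ F (fun _ => 0) +
        A1.coord x.2 • symField n 0 0 0 ν (fun _ => 0) (fun _ => g) := by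
  rw [← symField_smul, ← symField_smul, ← symField_add]
  simp only [mul_zero, add_zero, zero_add, mul_comm _ μ, mul_comm _ ν]
  rfl

theorem Realization.dilationLine_field {J : OpenInterval} {μ g : ℝ} (hg : μ ≠ 0 ∨ g ≠ 0)
    (γ : LineFields J →ₗ[ℝ] (ℝ → ℝ)) (hγ : ∀ F, ContDiffOn ℝ ∞ (γ F) J.carrier)
    (hγ' : ∀ F G : LineFields J, ∀ S ∈ J.carrier,
      γ ⁅F, G⁆ S = F.1 S * deriv (γ G) S - G.1 S * deriv (γ F) S) (x : A1 × LineFields J) :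
    (Realization.dilationLine μ hg γ hγ hγ').field n x =
      A1.coord x.1 • symField n 0 0 0 μ (fun _ => 0) (fun _ => g) +
        symField n 0 0 0 0 x.2.1 (γ x.2) := by
  rw [← symField_smul, ← symField_add]
  simp only [mul_zero, add_zero, zero_add, mul_comm _ μ]
  rfl

/-- `X1`, `X2`, a dilation and the fields `F ∂_S + γ_F ρ ∂_ρ`. -/
theorem spanIsAlgebra_dilationLine {μ g : ℝ} (hg : μ ≠ 0 ∨ g ≠ 0)
    (γ : LineFields D.J →ₗ[ℝ] (ℝ → ℝ)) (hγ : ∀ F, ContDiffOn ℝ ∞ (γ F) D.J.carrier)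
    (hγ' : ∀ F G : LineFields D.J, ∀ S ∈ D.J.carrier,
      γ ⁅F, G⁆ S = F.1 S * deriv (γ G) S - G.1 S * deriv (γ F) S)
    {X : VField} (hX : X = symField n 0 0 0 μ (fun _ => 0) (fun _ => g))
    {Z : (ℝ → ℝ) → VField} (hZ : ∀ (F : ℝ → ℝ) (hF : F ∈ SmoothFun D.J),
      EqOn (Z F) (symField n 0 0 0 0 F (γ (LineFields.mk hF))) (box K D)) :
    SpanIsAlgebra (box K D) ({X1, X2, X} ∪ Z '' SmoothFun D.J) (A21 × A1 × LineFields D.J) := by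
  have hmk : ∀ F : LineFields D.J, LineFields.mk (F := F.1) F.2.1 = F := fun F =>
    LineFields.ext_on fun S hS => indicator_of_mem hS _
  refine (Realization.dilationLine μ hg γ hγ hγ').spanIsAlgebra_A21 (n := n) (.inl (.inl rfl))
    (.inl (.inr (.inl rfl))) ?_ fun x => ?_
  · rintro Y ((rfl | rfl | rfl) | ⟨F, hF, rfl⟩)
    · exact .inl rfl
    · exact .inr (.inl rfl)
    · refine .inr (.inr ⟨(A1.of 1, 0), fun z hz => ?_⟩)
      have : symField n 0 0 0 0 ((0 : LineFields D.J).1) (γ 0) = 0 := by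
        rw [map_zero]; exact symField_zero
      simp only [Realization.dilationLine_field, A1.coord_of, one_smul, this, add_zero, hX]
    · refine .inr (.inr ⟨(0, LineFields.mk hF), fun z hz => ?_⟩)
      simp only [Realization.dilationLine_field, map_zero, zero_smul, zero_add]
      exact (hZ F hF hz).trans (symField_congr rfl rfl rfl rfl
        (fun S hS => (indicator_of_mem hS F).symm) (fun _ _ => rfl) hz)
  · rw [Realization.dilationLine_field, ← hX]
    refine ((inSpan_of_mem (.inl (.inr (.inr rfl)))).smul _).add ?_
    refine (inSpan_of_mem (.inr ⟨x.2.1, x.2.2.1, rfl⟩)).congr fun z hz => ?_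
    have := hZ x.2.1 x.2.2.1 hz
    rw [hmk] at this
    exact this.symm

/-- The divergence `(F κ')' / κ'` of `F ∂_S` with respect to `κ'(S) dS`, cut off outside the
interval. -/
def LineFields.divergence {J : OpenInterval} {κ : ℝ → ℝ} (hκ : ContDiffOn ℝ ∞ κ J.carrier) :
    LineFields J →ₗ[ℝ] (ℝ → ℝ) where
  toFun F := J.carrier.indicator fun S => deriv (fun s => F.1 s * deriv κ s) S / deriv κ S
  map_add' F G := by
    funext S
    by_cases hS : S ∈ J.carrier
    · have h0 := smooth_differentiableAt (smooth_deriv hκ) hS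
      have h1 : DifferentiableAt ℝ (fun s => F.1 s * deriv κ s) S :=
        (smooth_differentiableAt F.2.1 hS).mul h0
      have h2 : DifferentiableAt ℝ (fun s => G.1 s * deriv κ s) S :=
        (smooth_differentiableAt G.2.1 hS).mul h0
      have e : deriv (fun s => (F + G).1 s * deriv κ s) S =
          deriv (fun s => F.1 s * deriv κ s) S + deriv (fun s => G.1 s * deriv κ s) S :=
        (congrArg (fun f => deriv f S) (funext fun s => add_mul _ _ _)).trans (deriv_fun_add h1 h2)
      simp only [Pi.add_apply, indicator_of_mem hS, e, add_div]
    · simp [indicator_of_notMem hS]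
  map_smul' x F := by
    funext S
    by_cases hS : S ∈ J.carrier
    · have h1 := (smooth_differentiableAt F.2.1 hS).mul
        (smooth_differentiableAt (smooth_deriv hκ) hS)
      have e : deriv (fun s => (x • F).1 s * deriv κ s) S =
          x * deriv (fun s => F.1 s * deriv κ s) S :=
        (congrArg (fun f => deriv f S) (funext fun s => mul_assoc _ _ _)).trans
          (deriv_const_mul x h1)
      simp only [Pi.smul_apply, smul_eq_mul, RingHom.id_apply, indicator_of_mem hS, e,
        mul_div_assoc]
    · simp [indicator_of_notMem hS]

theorem LineFields.divergence_apply {κ : ℝ → ℝ} {J : OpenInterval} (h : ContDiffOn ℝ ∞ κ J.carrier)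
    (F : LineFields J) {S : ℝ} (hS : S ∈ J.carrier) : LineFields.divergence h F S =
      deriv (fun s => F.1 s * deriv κ s) S / deriv κ S :=
  indicator_of_mem hS fun S => deriv (fun s => F.1 s * deriv κ s) S / deriv κ S

theorem smooth_divergence {κ : ℝ → ℝ} (h : Regular κ D.J) {F : ℝ → ℝ} (hF : F ∈ SmoothFun D.J) :
    ContDiffOn ℝ ∞ (fun S => deriv (fun s => F s * deriv κ s) S / deriv κ S) D.J.carrier :=
  (smooth_deriv (ContDiffOn.mul hF (smooth_deriv h.1))).div (smooth_deriv h.1) h.2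

theorem divergence_eq {κ : ℝ → ℝ} (h : Regular κ D.J) {F : ℝ → ℝ} (hF : F ∈ SmoothFun D.J)
    {S : ℝ} (hS : S ∈ D.J.carrier) : deriv (fun s => F s * deriv κ s) S / deriv κ S =
      deriv F S + F S * (deriv (deriv κ) S / deriv κ S) := by
  have hd : deriv (fun s => F s * deriv κ s) S = deriv F S * deriv κ S + F S * deriv (deriv κ) S :=
    ((smooth_differentiableAt hF hS).hasDerivAt.mul
      (smooth_differentiableAt (smooth_deriv h.1) hS).hasDerivAt).deriv
  have := h.2 S hS
  rw [hd]
  field_simp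

theorem LineFields.divergence_lie {κ : ℝ → ℝ} (h : Regular κ D.J) (F G : LineFields D.J) {S : ℝ}
    (hS : S ∈ D.J.carrier) : LineFields.divergence h.1 ⁅F, G⁆ S =
      F.1 S * deriv (LineFields.divergence h.1 G) S -
        G.1 S * deriv (LineFields.divergence h.1 F) S := by
  have hκ := smooth_deriv h.1
  have hw : ContDiffOn ℝ ∞ (fun S => deriv (deriv κ) S / deriv κ S) D.J.carrier :=
    (smooth_deriv hκ).div hκ h.2
  have e : ∀ F : LineFields D.J, EqOn (LineFields.divergence h.1 F)
      (fun S => deriv F.1 S + F.1 S * (deriv (deriv κ) S / deriv κ S)) D.J.carrier :=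
    fun F S hS => (LineFields.divergence_apply h.1 F hS).trans (divergence_eq h F.2.1 hS)
  have e' : ∀ F : LineFields D.J, deriv (LineFields.divergence h.1 F) S =
      deriv (deriv F.1) S + (deriv F.1 S * (deriv (deriv κ) S / deriv κ S) +
        F.1 S * deriv (fun S => deriv (deriv κ) S / deriv κ S) S) := fun F => by
    rw [deriv_congr_on (e F) hS]
    exact ((smooth_differentiableAt (smooth_deriv F.2.1) hS).hasDerivAt.add
      ((smooth_differentiableAt F.2.1 hS).hasDerivAt.mul
        (smooth_differentiableAt hw hS).hasDerivAt)).deriv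
  rw [e' F, e' G, e _ hS]
  simp only [LineFields.lie_val, deriv_wronskian F.2.1 G.2.1 hS, wronskian_apply hS]
  ring

theorem EosCase.Admissible.algebra {c : EosCase} (hn : n ≠ 0) (h : c.Admissible D) :
    c.Algebra n D (box K D) := by
  have hn' : (n : ℝ) ≠ 0 := by exact_mod_cast hn
  obtain ⟨S₀, hS₀⟩ := D.J.nonempty
  have s0 : ContDiffOn ℝ ∞ (fun _ : ℝ => (0 : ℝ)) D.J.carrier := contDiffOn_const
  have key : ∀ {X : VField} {μ g : ℝ} {F : ℝ → ℝ}
      (_ : ContDiffOn ℝ ∞ F D.J.carrier) (_ : μ ≠ 0 ∨ g ≠ 0 ∨ ∃ S ∈ D.J.carrier, F S ≠ 0)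
      (_ : X = symField n 0 0 0 μ F (fun _ => g)),
      SpanIsAlgebra (box K D) {X1, X2, X} (A21 × A1) := by
    rintro X μ g F hF h0 rfl
    refine (Realization.single μ g hF h0).spanIsAlgebra_A21 (n := n) (.inl rfl) (.inr (.inl rfl))
      ?_ fun x => ?_
    · rintro X (rfl | rfl | rfl)
      · exact .inl rfl
      · exact .inr (.inl rfl)
      · refine .inr (.inr ⟨A1.of 1, fun z _ => ?_⟩)
        simp only [Realization.single_field, A1.coord_of, one_smul]
    · rw [Realization.single_field]; exact (inSpan_of_mem (.inr (.inr rfl))).smul _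
  have key2 : ∀ {X Y : VField} {μ ν g : ℝ} {F : ℝ → ℝ} (_ : ContDiffOn ℝ ∞ F D.J.carrier)
      (_ : μ ≠ 0 ∨ ∃ S ∈ D.J.carrier, F S ≠ 0) (_ : g ≠ 0)
      (_ : X = symField n 0 0 0 μ F (fun _ => 0))
      (_ : Y = symField n 0 0 0 ν (fun _ => 0) (fun _ => g)),
      SpanIsAlgebra (box K D) {X1, X2, X, Y} (A21 × A1 × A1) := by
    rintro X Y μ ν g F hF h0 hg rfl rfl
    refine (Realization.pair μ ν hg hF h0).spanIsAlgebra_A21 (n := n) (.inl rfl) (.inr (.inl rfl))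
      ?_ fun x => ?_
    · rintro X (rfl | rfl | rfl | rfl)
      · exact .inl rfl
      · exact .inr (.inl rfl)
      · refine .inr (.inr ⟨(A1.of 1, 0), fun z _ => ?_⟩)
        simp only [Realization.pair_field, A1.coord_of, one_smul, map_zero, zero_smul, add_zero]
      · refine .inr (.inr ⟨(0, A1.of 1), fun z _ => ?_⟩)
        simp only [Realization.pair_field, A1.coord_of, one_smul, map_zero, zero_smul, zero_add]
    · rw [Realization.pair_field]
      exact ((inSpan_of_mem (.inr (.inr (.inl rfl)))).smul _).add
        ((inSpan_of_mem (.inr (.inr (.inr rfl)))).smul _)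
  have key3 : ∀ {X : VField} {μ g : ℝ} (_ : g ≠ 0)
      (_ : X = symField n 0 0 0 μ (fun _ => 0) (fun _ => g)),
      SpanIsAlgebra (box K D) ({X1, X2, X} ∪ Xent '' SmoothFun D.J)
        (A21 × A1 × LineFields D.J) := by
    intro X μ g hg hX
    refine spanIsAlgebra_dilationLine (.inr hg) 0 (fun _ => contDiffOn_const) (fun F G S hS => ?_)
      hX fun F hF => ?_
    · have : deriv (0 : ℝ → ℝ) S = 0 := deriv_const S 0
      simp [this]
    · rw [Xent_eq n]; exact fun _ _ => rfl
  cases c with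
  | c1 f =>
    obtain ⟨Φ, hΦ⟩ : ∃ Φ : A21 →ₗ[ℝ] VField, ∀ x, Φ x =
        symField n x.1 x.2 0 0 (fun _ => 0) (fun _ => 0) := by
      refine ⟨⟨⟨fun x => symField n x.1 x.2 0 0 (fun _ => 0) (fun _ => 0), fun x y => ?_⟩,
        fun x y => ?_⟩, fun _ => rfl⟩
      · rw [← symField_add]
        simp only [A21.add_fst, A21.add_snd, add_zero]
      · dsimp only
        rw [RingHom.id_apply, ← symField_smul]
        simp only [A21.smul_fst, A21.smul_snd, mul_zero]
    refine spanIsAlgebra_of_linearMap Φ (fun x y => ?_) (fun x hx => ?_) (fun X hX => ?_)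
      fun x => ?_
    · rw [hΦ, hΦ, hΦ]
      refine EqOn.trans (symField_lieBracket _ _ _ _ _ _ _ _ s0 s0 s0 s0)
        (symField_congr rfl (?_ : _ = (0 : ℝ)) (by ring) (by ring) (fun S hS => by simp)
          fun S hS => by simp)
      ring
    · rw [hΦ] at hx
      obtain ⟨e1, e2, -⟩ := symField_eq_zero hx
      exact A21.ext e1 e2
    · rcases hX with rfl | rfl
      · exact ⟨((1, 0) : ℝ × ℝ), fun z _ => by
        rw [X1_eq n]; exact (congrFun (hΦ ((1, 0) : ℝ × ℝ)) z).symm⟩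
      · exact ⟨((0, 1) : ℝ × ℝ), fun z _ => by
        rw [X2_eq n]; exact (congrFun (hΦ ((0, 1) : ℝ × ℝ)) z).symm⟩
    · rw [hΦ]
      exact inSpan_symField (.inl rfl) (.inr rfl) _ _ (by rw [symField_zero]; exact InSpan.zero)
  | c2 κ f => exact key h.1.smooth_log (.inl one_ne_zero) (Xprod_eq n κ)
  | c3 κ f =>
    exact key h.1.smooth_inv (.inr (.inr ⟨S₀, hS₀, one_div_ne_zero (h.1.2 S₀ hS₀)⟩)) (Xsum_eq n κ)
  | c4 κ f q =>
    exact key h.1.smooth_log.neg (.inr (.inl two_ne_zero)) (Xscal_eq n κ q)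
  | c5 κ f k => exact key h.1.smooth_log (.inl one_ne_zero) (XlogScal_eq n κ)
  | c6 κ q => exact key2 h.1.smooth_log (.inl one_ne_zero) two_ne_zero (Xprod_eq n κ) (Xpow_eq n q)
  | c7 κ k =>
    exact key2 h.1.smooth_inv (.inr ⟨S₀, hS₀, one_div_ne_zero (h.1.2 S₀ hS₀)⟩)
      (g := -2) (by norm_num) (Xsum_eq n κ) (Xlog_eq n)
  | c8 κ =>
    have h' : Regular κ D.J := h
    let R := Realization.pair 1 1 hn' h'.smooth_log (.inl one_ne_zero)
    refine R.spanIsAlgebra_Sl2 (n := n) (w := (0, A1.of 1)) (.inl rfl) (.inr (.inl rfl))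
      (.inr (.inr (.inr (.inr rfl)))) ?_ (fun S hS => ?_) (fun S hS => ?_) ?_ fun x => ?_
    · change 1 * (0 : ℝ) + 1 * (1 : ℝ) = 1; ring
    · exact zero_mul _
    · exact one_mul _
    · rintro X (rfl | rfl | rfl | rfl | rfl)
      · exact .inl rfl
      · exact .inr (.inl rfl)
      · refine .inr (.inr (.inr ⟨(A1.of 1, 0), fun z _ => ?_⟩))
        simp only [R, Realization.pair_field, A1.coord_of, one_smul, map_zero, zero_smul, add_zero,
          Xprod_eq n]
      · refine .inr (.inr (.inr ⟨(0, A1.of 1), fun z _ => ?_⟩))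
        simp only [R, Realization.pair_field, A1.coord_of, one_smul, map_zero, zero_smul, zero_add,
          Xpow'_eq n]
      · exact .inr (.inr (.inl rfl))
    · rw [Realization.pair_field, ← Xprod_eq, ← Xpow'_eq]
      exact ((inSpan_of_mem (.inr (.inr (.inl rfl)))).smul _).add
        ((inSpan_of_mem (.inr (.inr (.inr (.inl rfl))))).smul _)
  | c9 f =>
    refine (Realization.line D.J).spanIsAlgebra_A21 (n := n) (.inl (.inl rfl)) (.inl (.inr rfl))
      ?_ fun x => ?_
    · rintro X ((rfl | rfl) | ⟨F, hF, rfl⟩)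
      · exact .inl rfl
      · exact .inr (.inl rfl)
      · refine .inr (.inr ⟨LineFields.mk hF, fun z hz => ?_⟩)
        rw [Xent_eq n]
        exact symField_congr rfl rfl rfl rfl (fun S hS => (indicator_of_mem hS F).symm)
          (fun _ _ => rfl) hz
    · exact (inSpan_of_mem (.inr ⟨x.1, x.2.1, rfl⟩)).congr fun z hz => by rw [Xent_eq n]; rfl
  | c10 κ =>
    have h' : Regular κ D.J := h
    refine spanIsAlgebra_dilationLine (.inl one_ne_zero) (LineFields.divergence h'.1) (fun F => ?_)
      (fun F G S hS => LineFields.divergence_lie h' F G hS) (Xlog_eq n) fun F hF => ?_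
    · exact (smooth_divergence h' F.2.1).congr fun S hS => LineFields.divergence_apply h'.1 F hS
    · rw [XentW_eq n]
      refine symField_congr rfl rfl rfl rfl (fun _ _ => rfl) fun S hS => ?_
      rw [LineFields.divergence_apply h'.1 _ hS]
      congr 1
      exact (deriv_congr_on (J := D.J) (fun s hs => by
        simp only [LineFields.mk, indicator_of_mem hs]) hS)
  | c11 k => exact key3 (g := -2) (by norm_num) (Xlog_eq n)
  | c12 k q => exact key3 two_ne_zero (Xpow_eq n q)
  | c13 k =>
    let R := Realization.dilationLine (J := D.J) 1 (.inr hn') 0 (fun _ => contDiffOn_const)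
      (fun F G S hS => by
        have : deriv (0 : ℝ → ℝ) S = 0 := deriv_const S 0
        simp [this])
    have hz0 : symField n 0 0 0 0 ((0 : LineFields D.J).1) ((0 : LineFields D.J →ₗ[ℝ] (ℝ → ℝ)) 0) =
      0 := symField_zero
    refine R.spanIsAlgebra_Sl2 (n := n) (w := (A1.of 1, 0)) (.inl (.inl rfl))
      (.inl (.inr (.inl rfl))) (.inl (.inr (.inr (.inl rfl)))) ?_ (fun S hS => ?_) (fun S hS => ?_)
      ?_ fun x => ?_
    · exact one_mul _
    · rfl
    · change 1 * (n : ℝ) + 0 = n; ring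
    · rintro X ((rfl | rfl | rfl | rfl) | ⟨F, hF, rfl⟩)
      · exact .inl rfl
      · exact .inr (.inl rfl)
      · exact .inr (.inr (.inl rfl))
      · refine .inr (.inr (.inr ⟨(A1.of 1, 0), fun z _ => ?_⟩))
        simp only [R, Realization.dilationLine_field, A1.coord_of, one_smul, hz0, add_zero,
          Xpow'_eq n]
      · refine .inr (.inr (.inr ⟨(0, LineFields.mk hF), fun z hz => ?_⟩))
        simp only [R, Realization.dilationLine_field, map_zero, zero_smul, zero_add, Xent_eq n]
        exact symField_congr rfl rfl rfl rfl (fun S hS => (indicator_of_mem hS F).symm)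
          (fun _ _ => rfl) hz
    · rw [Realization.dilationLine_field, ← Xpow'_eq]
      refine ((inSpan_of_mem (.inl (.inr (.inr (.inr rfl))))).smul _).add ?_
      exact (inSpan_of_mem (.inr ⟨x.2.1, x.2.2.1, rfl⟩)).congr fun z hz => by
        rw [Xent_eq n]; rfl

end

/-! ### Normal forms of equations of state with a symmetry -/

section
variable {A : OpenInterval} {f : ℝ → ℝ}

theorem OpenInterval.eq_of_hasDerivAt_zero (A : OpenInterval)
    (h : ∀ x ∈ A.carrier, HasDerivAt f 0 x) {x y : ℝ} (hx : x ∈ A.carrier)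
    (hy : y ∈ A.carrier) : f x = f y :=
  A.isOpen.is_const_of_deriv_eq_zero A.convex.isPreconnected
    (fun x hx => (h x hx).differentiableAt.differentiableWithinAt)
    (fun x hx => (h x hx).deriv) hx hy

theorem nonconstSmooth_of_deriv (hf : ContDiffOn ℝ ∞ f A.carrier) {x : ℝ} (hx : x ∈ A.carrier)
    (h : deriv f x ≠ 0) : NonconstSmooth f A.carrier := by
  refine ⟨hf, ?_⟩
  by_contra! hc
  exact h ((deriv_congr_on (G := fun _ => f x) (fun y hy => hc y hy x hx) hx).trans
    (deriv_const _ _))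

theorem contDiffOn_of_hasDerivAt {F : ℝ → ℝ} (hF : ContDiffOn ℝ ∞ F A.carrier)
    (h : ∀ x ∈ A.carrier, HasDerivAt f (F x) x) : ContDiffOn ℝ ∞ f A.carrier :=
  (contDiffOn_infty_iff_deriv_of_isOpen A.isOpen).2
    ⟨fun x hx => (h x hx).differentiableAt.differentiableWithinAt,
      hF.congr fun x hx => (h x hx).deriv⟩

theorem OpenInterval.exists_antideriv {F : ℝ → ℝ} (hF : ContDiffOn ℝ ∞ F A.carrier) :
    ∃ f : ℝ → ℝ, ContDiffOn ℝ ∞ f A.carrier ∧ ∀ x ∈ A.carrier, HasDerivAt f (F x) x := by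
  obtain ⟨a, ha⟩ := A.nonempty
  have h : ∀ x ∈ A.carrier, HasDerivAt (fun u => ∫ y in a..u, F y) (F x) x := fun x hx =>
    intervalIntegral.integral_hasDerivAt_right
      ((hF.continuousOn.mono (A.ordConnected.uIcc_subset ha hx)).intervalIntegrable)
      (hF.continuousOn.stronglyMeasurableAtFilter A.isOpen x hx)
      (hF.continuousOn.continuousAt (A.isOpen.mem_nhds hx))
  exact ⟨_, contDiffOn_of_hasDerivAt hF h, h⟩

/-- A positive `κ` with `F κ' = c κ`. -/
theorem exists_regular {F : ℝ → ℝ} {c : ℝ} (hc : c ≠ 0) (hF : ContDiffOn ℝ ∞ F A.carrier)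
    (h0 : ∀ x ∈ A.carrier, F x ≠ 0) : ∃ κ : ℝ → ℝ, Regular κ A ∧ (∀ x, 0 < κ x) ∧
      ∀ x ∈ A.carrier, HasDerivAt κ (κ x * (c / F x)) x := by
  obtain ⟨u, hu, hu'⟩ := A.exists_antideriv (contDiffOn_const (c := c).div hF h0)
  have hd : ∀ x ∈ A.carrier, HasDerivAt (fun x => Real.exp (u x)) (Real.exp (u x) * (c / F x)) x :=
    fun x hx => (hu' x hx).exp
  refine ⟨fun x => Real.exp (u x), ⟨hu.exp, fun x hx => ?_⟩, fun x => Real.exp_pos _, hd⟩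
  rw [(hd x hx).deriv]
  exact mul_ne_zero (Real.exp_pos _).ne' (div_ne_zero hc (h0 x hx))

end

/-- Both partial derivatives of `p` vanish nowhere on `D`. -/
def Nondegenerate (D : EosDomain) (p : ℝ → ℝ → ℝ) : Prop :=
  ∀ ρ ∈ D.I.carrier, ∀ S ∈ D.J.carrier, dρ p ρ S ≠ 0 ∧ dS p ρ S ≠ 0

theorem Nondegenerate.mono {D D' : EosDomain} {p : ℝ → ℝ → ℝ} (h : Nondegenerate D p)
    (hD : D'.Sub D) : Nondegenerate D' p := fun ρ hρ S hS => h ρ (hD.1 hρ) S (hD.2 hS)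

/-- On `D` and on its sub-domains, `p` is an instance of `c` and `X` is in the span of the
generators of `c`. -/
def Captures (n : ℕ) (D : EosDomain) (p : ℝ → ℝ → ℝ) (c : EosCase) (X : VField) : Prop :=
  ∀ D' : EosDomain, D'.Sub D → IsInstance n D' c p ∧
    ∀ K : KinDomain, InSpan (box K D') (c.generators n D') X

theorem Regular.mono {J J' : OpenInterval} {κ : ℝ → ℝ} (h : Regular κ J)
    (hJ : J'.carrier ⊆ J.carrier) : Regular κ J' := ⟨h.1.mono hJ, fun S hS => h.2 S (hJ hS)⟩

theorem inSpan_symField_of_smul {n : ℕ} {K : KinDomain} {D : EosDomain} {G : Set VField}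
    {X : VField} {x μ ν : ℝ} {F g H k : ℝ → ℝ} (hX : X = symField n 0 0 0 ν H k) (hG : X ∈ G)
    (h1 : μ = x * ν) (h2 : ∀ S ∈ D.J.carrier, F S = x * H S)
    (h3 : ∀ S ∈ D.J.carrier, g S = x * k S) :
    InSpan (box K D) G (symField n 0 0 0 μ F g) := by
  refine ((inSpan_of_mem hG).smul x).congr ?_
  rw [hX, ← symField_smul, mul_zero]
  exact symField_congr rfl rfl rfl h1 h2 h3

section
variable {n : ℕ} {D : EosDomain} {p : ℝ → ℝ → ℝ} {μ : ℝ} {F : ℝ → ℝ}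

/-- `F p_S = 2 μ p + C` with `μ ≠ 0` means that `p` is a product. -/
theorem IsReduced.captures_prod (hp : Smooth2 D p) (hnd : Nondegenerate D p)
    (h : IsReduced D p μ F (fun _ => 0)) (hμ : μ ≠ 0) :
    ∃ c : EosCase, c.number = 2 ∧ Captures n D p c (symField n 0 0 0 μ F (fun _ => 0)) := by
  obtain ⟨ρ₀, hρ₀⟩ := D.I.nonempty
  obtain ⟨S₀, hS₀⟩ := D.J.nonempty
  have hF : ∀ S ∈ D.J.carrier, F S ≠ 0 := fun S hS h0 => by
    have := h.eqρ ρ₀ hρ₀ S hS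
    rw [h0] at this
    exact mul_ne_zero hμ (hnd ρ₀ hρ₀ S hS).1 (by linarith)
  obtain ⟨C, hC⟩ := h.exists_integral hp fun _ _ => rfl
  obtain ⟨κ, hκ, hκ0, hκ'⟩ := exists_regular (c := 2 * μ) (by simpa using hμ) h.smoothF hF
  have h2μ : 2 * μ ≠ 0 := by simpa using hμ
  have hk0 : κ S₀ ≠ 0 := (hκ0 S₀).ne'
  let f : ℝ → ℝ := fun ρ => (p ρ S₀ + C / (2 * μ)) / κ S₀
  have hf : ∀ ρ ∈ D.I.carrier, HasDerivAt f (dρ p ρ S₀ / κ S₀) ρ := fun ρ hρ =>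
    ((hp.hasDerivAt_ρ hρ hS₀).add_const _).div_const _
  have hfs : ContDiffOn ℝ ∞ f D.I.carrier :=
    contDiffOn_of_hasDerivAt ((hp.dρ.slice_ρ hS₀).div_const _) hf
  have hpf : ∀ ρ ∈ D.I.carrier, ∀ S ∈ D.J.carrier, p ρ S = κ S * f ρ + -(C / (2 * μ)) := by
    intro ρ hρ S hS
    have hd : ∀ s ∈ D.J.carrier, HasDerivAt (fun s => (p ρ s + C / (2 * μ)) / κ s) 0 s :=
      fun s hs => by
        refine (((hp.hasDerivAt_S hρ hs).add_const _).div (hκ' s hs) (hκ0 s).ne').congr_deriv ?_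
        have h1 := hF s hs
        have h2 := (hκ0 s).ne'
        have h3 := hC ρ hρ s hs
        field_simp
        linear_combination h3
    have := D.J.eq_of_hasDerivAt_zero hd hS hS₀
    have h4 : p ρ S + C / (2 * μ) = κ S * f ρ := by
      rw [div_eq_iff (hκ0 S).ne'] at this
      rw [this]; ring
    linarith
  refine ⟨.c2 κ f, rfl, fun D' hD' => ⟨⟨⟨hκ.mono hD'.2, ?_⟩, _, fun ρ hρ S hS =>
    hpf ρ (hD'.1 hρ) S (hD'.2 hS)⟩, fun K => ?_⟩⟩
  · obtain ⟨ρ, hρ⟩ := D'.I.nonempty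
    refine nonconstSmooth_of_deriv (hfs.mono hD'.1) hρ ?_
    rw [(hf ρ (hD'.1 hρ)).deriv]
    exact div_ne_zero (hnd ρ (hD'.1 hρ) S₀ hS₀).1 hk0
  · refine inSpan_symField_of_smul (x := μ) (Xprod_eq n κ) (.inr (.inr rfl)) (by ring)
      (fun S hS => ?_) (fun _ _ => by ring)
    have h1 := hF S (hD'.2 hS)
    have h2 := (hκ0 S).ne'
    rw [(hκ' S (hD'.2 hS)).deriv]
    field_simp

/-- `F p_S = C` means that `p` is a sum. -/
theorem IsReduced.captures_sum (hp : Smooth2 D p) (hnd : Nondegenerate D p)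
    (h : IsReduced D p 0 F (fun _ => 0)) (hF : ∃ S ∈ D.J.carrier, F S ≠ 0) :
    ∃ c : EosCase, c.number = 3 ∧ Captures n D p c (symField n 0 0 0 0 F (fun _ => 0)) := by
  obtain ⟨ρ₀, hρ₀⟩ := D.I.nonempty
  obtain ⟨S₀, hS₀, hF₀⟩ := hF
  obtain ⟨C, hC⟩ := h.exists_integral hp fun _ _ => rfl
  have hC' : ∀ ρ ∈ D.I.carrier, ∀ S ∈ D.J.carrier, F S * dS p ρ S = C := fun ρ hρ S hS => by
    linarith [hC ρ hρ S hS]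
  have hC0 : C ≠ 0 := by
    rw [← hC' ρ₀ hρ₀ S₀ hS₀]; exact mul_ne_zero hF₀ (hnd ρ₀ hρ₀ S₀ hS₀).2
  have hF1 : ∀ S ∈ D.J.carrier, F S ≠ 0 := fun S hS h0 => hC0 (by
    rw [← hC' ρ₀ hρ₀ S hS, h0, zero_mul])
  have hκ : Regular (fun S => p ρ₀ S) D.J := ⟨hp.slice_S hρ₀, fun S hS => (hnd ρ₀ hρ₀ S hS).2⟩
  let f : ℝ → ℝ := fun ρ => p ρ S₀ - p ρ₀ S₀
  have hf : ∀ ρ ∈ D.I.carrier, HasDerivAt f (dρ p ρ S₀) ρ := fun ρ hρ =>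
    (hp.hasDerivAt_ρ hρ hS₀).sub_const _
  have hpf : ∀ ρ ∈ D.I.carrier, ∀ S ∈ D.J.carrier, p ρ S = p ρ₀ S + f ρ + 0 := by
    intro ρ hρ S hS
    have hd : ∀ s ∈ D.J.carrier, HasDerivAt (fun s => p ρ s - p ρ₀ s) 0 s :=
      fun s hs => by
        refine ((hp.hasDerivAt_S hρ hs).sub (hp.hasDerivAt_S hρ₀ hs)).congr_deriv ?_
        refine (mul_eq_zero.1 (?_ : F s * (dS p ρ s - dS p ρ₀ s) = 0)).resolve_left (hF1 s hs)
        linarith [hC' ρ hρ s hs, hC' ρ₀ hρ₀ s hs]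
    have := D.J.eq_of_hasDerivAt_zero hd hS hS₀
    simp only [f]
    linarith
  refine ⟨.c3 (fun S => p ρ₀ S) f, rfl, fun D' hD' => ⟨⟨⟨hκ.mono hD'.2, ?_⟩, _, fun ρ hρ S hS =>
    hpf ρ (hD'.1 hρ) S (hD'.2 hS)⟩, fun K => ?_⟩⟩
  · obtain ⟨ρ, hρ⟩ := D'.I.nonempty
    refine nonconstSmooth_of_deriv (contDiffOn_of_hasDerivAt
      ((hp.dρ.slice_ρ hS₀).mono hD'.1) fun ρ hρ => hf ρ (hD'.1 hρ)) hρ ?_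
    rw [(hf ρ (hD'.1 hρ)).deriv]
    exact (hnd ρ (hD'.1 hρ) S₀ hS₀).1
  · refine inSpan_symField_of_smul (x := C) (Xsum_eq n _) (.inr (.inr rfl)) (by ring)
      (fun S hS => ?_) (fun _ _ => by ring)
    rw [mul_one_div, eq_div_iff (hκ.2 S (hD'.2 hS))]
    exact hC' ρ₀ hρ₀ S (hD'.2 hS)

/-- `ρ p_ρ = (1 + q) p + C / 2` means that `p` is `κ(S) ρ ^ (1 + q)` or, for `q = -1`,
`κ(S) + k ln ρ`, up to a constant. -/
theorem IsReduced.eq_pow {q : ℝ} (hp : Smooth2 D p) (hnd : Nondegenerate D p)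
    (h : IsReduced D p q (fun _ => 0) (fun _ => 2)) (hq : q ≠ -1) :
    ∃ κ : ℝ → ℝ, ∃ p₀ : ℝ, Regular κ D.J ∧
      ∀ ρ ∈ D.I.carrier, ∀ S ∈ D.J.carrier, p ρ S = κ S * ρ ^ (1 + q) + p₀ := by
  obtain ⟨ρ₀, hρ₀⟩ := D.I.nonempty
  obtain ⟨C, hC⟩ := h.exists_integral hp fun _ _ => rfl
  have hq' : 1 + q ≠ 0 := fun h => hq (by linarith)
  have hr : ∀ ρ ∈ D.I.carrier, ρ ^ (1 + q) ≠ 0 := fun ρ hρ =>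
    (Real.rpow_pos_of_pos (D.ρ_pos hρ) _).ne'
  let κ : ℝ → ℝ := fun S => (p ρ₀ S + C / (2 + 2 * q)) / ρ₀ ^ (1 + q)
  have hκ : ∀ S ∈ D.J.carrier, HasDerivAt κ (dS p ρ₀ S / ρ₀ ^ (1 + q)) S := fun S hS =>
    ((hp.hasDerivAt_S hρ₀ hS).add_const _).div_const _
  refine ⟨κ, -(C / (2 + 2 * q)), ⟨contDiffOn_of_hasDerivAt
    ((hp.dS.slice_S hρ₀).div_const _) hκ, fun S hS => ?_⟩, fun ρ hρ S hS => ?_⟩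
  · rw [(hκ S hS).deriv]
    exact div_ne_zero (hnd ρ₀ hρ₀ S hS).2 (hr ρ₀ hρ₀)
  · have hd : ∀ x ∈ D.I.carrier,
        HasDerivAt (fun x => (p x S + C / (2 + 2 * q)) / x ^ (1 + q)) 0 x := fun x hx => by
      refine (((hp.hasDerivAt_ρ hx hS).add_const _).div
        (hasDerivAt_rpow_one_add (D.ρ_pos hx) q) (hr x hx)).congr_deriv ?_
      have h3 := hC x hx S hS
      have h4 : C / (2 + 2 * q) * (1 + q) = C / 2 := by field_simp
      rw [rpow_one_add (D.ρ_pos hx), div_eq_zero_iff]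
      left
      linear_combination x ^ q / 2 * h3 - x ^ q * h4
    have := D.I.eq_of_hasDerivAt_zero hd hρ hρ₀
    rw [div_eq_iff (hr ρ hρ)] at this
    simp only [κ]
    linarith

theorem IsReduced.eq_log (hp : Smooth2 D p) (hnd : Nondegenerate D p)
    (h : IsReduced D p (-1) (fun _ => 0) (fun _ => 2)) :
    ∃ κ : ℝ → ℝ, ∃ k : ℝ, Regular κ D.J ∧ k ≠ 0 ∧
      ∀ ρ ∈ D.I.carrier, ∀ S ∈ D.J.carrier, p ρ S = κ S + k * Real.log ρ := by
  obtain ⟨ρ₀, hρ₀⟩ := D.I.nonempty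
  obtain ⟨S₀, hS₀⟩ := D.J.nonempty
  obtain ⟨C, hC⟩ := h.exists_integral hp fun _ _ => rfl
  have hC' : ∀ ρ ∈ D.I.carrier, ∀ S ∈ D.J.carrier, 2 * ρ * dρ p ρ S = C := fun ρ hρ S hS => by
    linarith [hC ρ hρ S hS]
  let κ : ℝ → ℝ := fun S => p ρ₀ S - C / 2 * Real.log ρ₀
  have hκ : ∀ S ∈ D.J.carrier, HasDerivAt κ (dS p ρ₀ S) S := fun S hS =>
    (hp.hasDerivAt_S hρ₀ hS).sub_const _
  refine ⟨κ, C / 2, ⟨contDiffOn_of_hasDerivAt (hp.dS.slice_S hρ₀) hκ, fun S hS => ?_⟩, ?_,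
    fun ρ hρ S hS => ?_⟩
  · rw [(hκ S hS).deriv]; exact (hnd ρ₀ hρ₀ S hS).2
  · rw [← hC' ρ₀ hρ₀ S₀ hS₀]
    have := mul_ne_zero (D.ρ_pos hρ₀).ne' (hnd ρ₀ hρ₀ S₀ hS₀).1
    intro h0; exact this (by linarith)
  · have hd : ∀ x ∈ D.I.carrier, HasDerivAt (fun x => p x S - C / 2 * Real.log x) 0 x :=
      fun x hx => by
        have hx0 := (D.ρ_pos hx).ne'
        refine ((hp.hasDerivAt_ρ hx hS).sub
          ((Real.hasDerivAt_log hx0).const_mul _)).congr_deriv ?_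
        rw [← hC' x hx S hS]
        field_simp
        ring
    have := D.I.eq_of_hasDerivAt_zero hd hρ hρ₀
    simp only [κ]
    linarith

theorem IsReduced.captures_pow {q : ℝ} (hp : Smooth2 D p) (hnd : Nondegenerate D p)
    (h : IsReduced D p q (fun _ => 0) (fun _ => 2)) :
    ∃ c : EosCase, 4 ≤ c.number ∧ c.number ≤ 7 ∧
      Captures n D p c (symField n 0 0 0 q (fun _ => 0) (fun _ => 2)) := by
  by_cases hq : q = -1
  · subst hq
    obtain ⟨κ, k, hκ, hk, he⟩ := h.eq_log hp hnd
    refine ⟨.c7 κ k, by simp [EosCase.number], by simp [EosCase.number],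
      fun D' hD' => ⟨⟨⟨hκ.mono hD'.2, hk⟩, 0, fun ρ hρ S hS =>
        (he ρ (hD'.1 hρ) S (hD'.2 hS)).trans (add_zero _).symm⟩, fun K => ?_⟩⟩
    exact inSpan_symField_of_smul (x := -1) (Xlog_eq n) (.inr (.inr (.inr rfl))) (by ring)
      (fun S hS => by ring) (fun _ _ => by ring)
  · obtain ⟨κ, p₀, hκ, he⟩ := h.eq_pow hp hnd hq
    refine ⟨.c6 κ q, by simp [EosCase.number], by simp [EosCase.number],
      fun D' hD' => ⟨⟨⟨hκ.mono hD'.2, hq⟩, p₀, fun ρ hρ S hS =>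
        he ρ (hD'.1 hρ) S (hD'.2 hS)⟩, fun K => ?_⟩⟩
    exact inSpan_symField_of_smul (x := 1) (Xpow_eq n q) (.inr (.inr (.inr rfl))) (by ring)
      (fun S hS => by ring) (fun _ _ => by ring)

/-- A function that is constant along the curves `κ(S) ρ = const` is a function of `κ(S) ρ`, on a
domain small enough for these curves to stay inside. -/
theorem exists_eq_comp_values {h : ℝ → ℝ → ℝ} {κ : ℝ → ℝ} (hh : Smooth2 D h) (hκ : Regular κ D.J)
    (hκ0 : ∀ S, 0 < κ S) (hd : ∀ ρ ∈ D.I.carrier, ∀ S ∈ D.J.carrier,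
      κ S * dS h ρ S = deriv κ S * ρ * dρ h ρ S) :
    ∃ D' : EosDomain, D'.Sub D ∧ ∃ f : ℝ → ℝ, ContDiffOn ℝ ∞ f (D'.values κ) ∧
      ∀ ρ ∈ D'.I.carrier, ∀ S ∈ D'.J.carrier, h ρ S = f (κ S * ρ) := by
  obtain ⟨ρ₀, hρ₀⟩ := D.I.nonempty
  obtain ⟨S₀, hS₀⟩ := D.J.nonempty
  have hκc : ContinuousAt κ S₀ := hκ.1.continuousOn.continuousAt (D.J.isOpen.mem_nhds hS₀)
  have hc : ContinuousAt (fun x : ℝ × ℝ × ℝ => κ x.2.1 * x.1 / κ x.2.2) (ρ₀, S₀, S₀) := by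
    have h1 : ContinuousAt (fun x : ℝ × ℝ × ℝ => κ x.2.1) (ρ₀, S₀, S₀) :=
      ContinuousAt.comp (f := fun x : ℝ × ℝ × ℝ => x.2.1) hκc (by fun_prop)
    have h2 : ContinuousAt (fun x : ℝ × ℝ × ℝ => κ x.2.2) (ρ₀, S₀, S₀) :=
      ContinuousAt.comp (f := fun x : ℝ × ℝ × ℝ => x.2.2) hκc (by fun_prop)
    exact (h1.mul (by fun_prop)).div h2 (hκ0 S₀).ne'
  have hmem : (fun x : ℝ × ℝ × ℝ => κ x.2.1 * x.1 / κ x.2.2) ⁻¹' D.I.carrier ∈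
      nhds (ρ₀, S₀, S₀) := by
    refine hc (D.I.isOpen.mem_nhds ?_)
    simpa only [mul_div_cancel_left₀ _ (hκ0 S₀).ne'] using hρ₀
  obtain ⟨A, hA, B, hB, hAB⟩ := mem_nhds_prod_iff.1 hmem
  obtain ⟨B1, hB1, B2, hB2, hBB⟩ := mem_nhds_prod_iff.1 hB
  obtain ⟨I', h1, h2, h3⟩ := D.I.exists_around hρ₀ hA
  obtain ⟨J', h4, h5, h6⟩ := D.J.exists_around hS₀ (Filter.inter_mem hB1 hB2)
  have hin : ∀ ρ ∈ I'.carrier, ∀ S ∈ J'.carrier, ∀ s ∈ J'.carrier,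
      κ S * ρ / κ s ∈ D.I.carrier := fun ρ hρ S hS s hs =>
    hAB (show (ρ, S, s) ∈ A ×ˢ B from ⟨h3 hρ, hBB ⟨(h6 hS).1, (h6 hs).2⟩⟩)
  refine ⟨⟨I', J', h2.trans D.pos⟩, ⟨h2, h5⟩, fun x => h (x / κ S₀) S₀, ?_, fun ρ hρ S hS => ?_⟩
  · refine (hh.slice_ρ hS₀).comp (f := fun x => x / κ S₀) (contDiffOn_id.div_const _) ?_
    rintro x ⟨ρ, hρ, S, hS, rfl⟩
    exact hin ρ hρ S hS S₀ h4
  · have hd' : ∀ s ∈ J'.carrier, HasDerivAt (fun s => h (κ S * ρ / κ s) s) 0 s := fun s hs => by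
      have hs' := h5 hs
      have hx := hin ρ hρ S hS s hs
      have e1 : HasDerivAt (fun s => (κ S * ρ / κ s, s))
          (-(κ S * ρ * deriv κ s) / κ s ^ 2, 1) s := by
        refine HasDerivAt.prodMk ?_ (hasDerivAt_id s)
        refine ((hasDerivAt_const s (κ S * ρ)).div (hκ.hasDerivAt hs') (hκ0 s).ne').congr_deriv ?_
        ring
      refine ((hh.differentiableAt hx hs').hasFDerivAt.comp_hasDerivAt
        (f := fun s => (κ S * ρ / κ s, s)) s e1).congr_deriv ?_
      rw [hh.fderiv_apply hx hs']
      have h7 := hd _ hx s hs'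
      have h8 := (hκ0 s).ne'
      dsimp only
      refine (mul_eq_zero.1 (?_ : κ s * _ = 0)).resolve_left h8
      rw [mul_add, mul_one, h7]
      field_simp
      ring
    have := J'.eq_of_hasDerivAt_zero hd' hS h4
    rwa [mul_div_cancel_left₀ _ (hκ0 S).ne'] at this

end

section
variable {n : ℕ} {D : EosDomain} {p : ℝ → ℝ → ℝ} {μ : ℝ} {F : ℝ → ℝ}

theorem nonconstSmooth_values {h : ℝ → ℝ → ℝ} {κ f : ℝ → ℝ} (hf : ContDiffOn ℝ ∞ f (D.values κ))
    (hh : ∀ ρ ∈ D.I.carrier, ∀ S ∈ D.J.carrier, h ρ S = f (κ S * ρ))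
    (h0 : ∀ ρ ∈ D.I.carrier, ∀ S ∈ D.J.carrier, dS h ρ S ≠ 0) :
    NonconstSmooth f (D.values κ) := by
  refine ⟨hf, ?_⟩
  by_contra! hc
  obtain ⟨ρ, hρ⟩ := D.I.nonempty
  obtain ⟨S, hS⟩ := D.J.nonempty
  refine h0 ρ hρ S hS ?_
  refine (deriv_congr_on (J := D.J) (G := fun _ => h ρ S) (fun s hs => ?_) hS).trans
    (deriv_const _ _)
  rw [hh ρ hρ s hs, hh ρ hρ S hS]
  exact hc _ ⟨ρ, hρ, s, hs, rfl⟩ _ ⟨ρ, hρ, S, hS, rfl⟩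

/-- `F p_S + 2 ρ p_ρ = (2 + 2 q) p + C` means that `p` is a scaling form. -/
theorem IsReduced.captures_scal {q : ℝ} (hp : Smooth2 D p) (hnd : Nondegenerate D p)
    (h : IsReduced D p q F (fun _ => 2)) (hF : ∀ S ∈ D.J.carrier, F S ≠ 0) :
    ∃ D' : EosDomain, D'.Sub D ∧ ∃ c : EosCase, 4 ≤ c.number ∧ c.number ≤ 7 ∧
      Captures n D' p c (symField n 0 0 0 q F (fun _ => 2)) := by
  obtain ⟨C, hC⟩ := h.exists_integral hp fun _ _ => rfl
  obtain ⟨κ, hκ, hκ0, hκ'⟩ := exists_regular (c := -2) (by norm_num) h.smoothF hF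
  have hFκ : ∀ S ∈ D.J.carrier, F S = -(2 * κ S / deriv κ S) := fun S hS => by
    have h1 := hF S hS
    have h2 := (hκ0 S).ne'
    rw [(hκ' S hS).deriv]
    field_simp
  by_cases hq : q = -1
  · subst hq
    have hh : Smooth2 D (fun ρ S => p ρ S - C / 2 * Real.log ρ) :=
      hp.sub ((smooth2_const _).mul (smooth2_of_ρ D.contDiffOn_log))
    have e1 : ∀ ρ ∈ D.I.carrier, ∀ S ∈ D.J.carrier,
        dρ (fun ρ S => p ρ S - C / 2 * Real.log ρ) ρ S = dρ p ρ S - C / 2 * ρ⁻¹ :=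
      fun ρ hρ S hS => ((hp.hasDerivAt_ρ hρ hS).sub
        ((Real.hasDerivAt_log (D.ρ_pos hρ).ne').const_mul _)).deriv
    have e2 : ∀ ρ ∈ D.I.carrier, ∀ S ∈ D.J.carrier,
        dS (fun ρ S => p ρ S - C / 2 * Real.log ρ) ρ S = dS p ρ S :=
      fun ρ hρ S hS => ((hp.hasDerivAt_S hρ hS).sub_const _).deriv
    obtain ⟨D', hD', f, hf, hhf⟩ := exists_eq_comp_values hh hκ hκ0 fun ρ hρ S hS => by
      rw [e1 ρ hρ S hS, e2 ρ hρ S hS, (hκ' S hS).deriv]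
      have h1 := hF S hS
      have h2 := (D.ρ_pos hρ).ne'
      have h3 := hC ρ hρ S hS
      field_simp
      linear_combination κ S * h3
    refine ⟨D', hD', .c5 κ f (C / 2), by simp [EosCase.number], by simp [EosCase.number],
      fun D'' hD'' => ⟨⟨⟨(hκ.mono hD'.2).mono hD''.2, ?_⟩, 0, fun ρ hρ S hS => ?_⟩, fun K => ?_⟩⟩
    · refine nonconstSmooth_values (h := fun ρ S => p ρ S - C / 2 * Real.log ρ) (hf.mono ?_)
        (fun ρ hρ S hS => hhf ρ (hD''.1 hρ) S (hD''.2 hS)) fun ρ hρ S hS => ?_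
      · rintro _ ⟨ρ, hρ, S, hS, rfl⟩; exact ⟨ρ, hD''.1 hρ, S, hD''.2 hS, rfl⟩
      · have hD := hD''.trans hD'
        rw [e2 ρ (hD.1 hρ) S (hD.2 hS)]
        exact (hnd ρ (hD.1 hρ) S (hD.2 hS)).2
    · have := hhf ρ (hD''.1 hρ) S (hD''.2 hS)
      simp only [EosCase.eos, ← this]
      ring
    · refine inSpan_symField_of_smul (x := -1) (XlogScal_eq n κ) (.inr (.inr rfl)) (by ring)
        (fun S hS => ?_) (fun _ _ => by ring)
      rw [hFκ S ((hD''.trans hD').2 hS)]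
      ring
  · have hq' : 1 + q ≠ 0 := fun h => hq (by linarith)
    have hh : Smooth2 D (fun ρ S => (p ρ S + C / (2 + 2 * q)) * ρ ^ (-(1 + q))) :=
      (hp.add (smooth2_const _)).mul (smooth2_of_ρ (D.contDiffOn_rpow _))
    have hr : ∀ ρ ∈ D.I.carrier, 0 < ρ ^ (-(1 + q)) := fun ρ hρ =>
      Real.rpow_pos_of_pos (D.ρ_pos hρ) _
    have e1 : ∀ ρ ∈ D.I.carrier, ∀ S ∈ D.J.carrier,
        ρ * dρ (fun ρ S => (p ρ S + C / (2 + 2 * q)) * ρ ^ (-(1 + q))) ρ S =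
          (ρ * dρ p ρ S - (1 + q) * (p ρ S + C / (2 + 2 * q))) * ρ ^ (-(1 + q)) :=
      fun ρ hρ S hS => by
        have e : dρ (fun ρ S => (p ρ S + C / (2 + 2 * q)) * ρ ^ (-(1 + q))) ρ S = _ :=
          (((hp.hasDerivAt_ρ hρ hS).add_const (C / (2 + 2 * q))).mul
          (Real.hasDerivAt_rpow_const (p := -(1 + q)) (.inl (D.ρ_pos hρ).ne'))).deriv
        have e' : ρ ^ (-(1 + q)) = ρ * ρ ^ (-(1 + q) - 1) := by
          rw [Real.rpow_sub_one (D.ρ_pos hρ).ne', mul_div_cancel₀ _ (D.ρ_pos hρ).ne']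
        rw [e]
        linear_combination (1 + q) * (p ρ S + C / (2 + 2 * q)) * e'
    have e2 : ∀ ρ ∈ D.I.carrier, ∀ S ∈ D.J.carrier,
        dS (fun ρ S => (p ρ S + C / (2 + 2 * q)) * ρ ^ (-(1 + q))) ρ S =
          dS p ρ S * ρ ^ (-(1 + q)) :=
      fun ρ hρ S hS => (((hp.hasDerivAt_S hρ hS).add_const _).mul_const _).deriv
    obtain ⟨D', hD', f, hf, hhf⟩ := exists_eq_comp_values hh hκ hκ0 fun ρ hρ S hS => by
      rw [mul_assoc (deriv κ S), e1 ρ hρ S hS, e2 ρ hρ S hS, (hκ' S hS).deriv]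
      have h1 := hF S hS
      have h3 := hC ρ hρ S hS
      have h4 : C / (2 + 2 * q) * (1 + q) = C / 2 := by field_simp
      have h5 : dS p ρ S = -2 / F S * (ρ * dρ p ρ S - (1 + q) * (p ρ S + C / (2 + 2 * q))) := by
        rw [div_mul_eq_mul_div, eq_div_iff h1]
        linear_combination h3 - 2 * h4
      rw [h5]
      ring
    refine ⟨D', hD', .c4 κ f q, by simp [EosCase.number], by simp [EosCase.number],
      fun D'' hD'' => ⟨⟨⟨(hκ.mono hD'.2).mono hD''.2, ?_, hq⟩, -(C / (2 + 2 * q)),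
        fun ρ hρ S hS => ?_⟩, fun K => ?_⟩⟩
    · refine nonconstSmooth_values (h := fun ρ S => (p ρ S + C / (2 + 2 * q)) * ρ ^ (-(1 + q)))
        (hf.mono ?_) (fun ρ hρ S hS => hhf ρ (hD''.1 hρ) S (hD''.2 hS)) fun ρ hρ S hS => ?_
      · rintro _ ⟨ρ, hρ, S, hS, rfl⟩; exact ⟨ρ, hD''.1 hρ, S, hD''.2 hS, rfl⟩
      · have hD := hD''.trans hD'
        rw [e2 ρ (hD.1 hρ) S (hD.2 hS)]
        exact mul_ne_zero (hnd ρ (hD.1 hρ) S (hD.2 hS)).2 (hr ρ (hD.1 hρ)).ne'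
    · have hD := hD''.trans hD'
      have := hhf ρ (hD''.1 hρ) S (hD''.2 hS)
      simp only [EosCase.eos, ← this]
      rw [mul_assoc, ← Real.rpow_add (D.ρ_pos (hD.1 hρ)), neg_add_cancel, Real.rpow_zero]
      ring
    · refine inSpan_symField_of_smul (x := 1) (Xscal_eq n κ q) (.inr (.inr rfl)) (by ring)
        (fun S hS => ?_) (fun _ _ => by ring)
      rw [hFκ S ((hD''.trans hD').2 hS)]
      ring

theorem Captures.congr_smul {c : EosCase} {x ν : ℝ} {G g k : ℝ → ℝ}
    (h : Captures n D p c (symField n 0 0 0 ν G k)) (h1 : μ = x * ν)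
    (h2 : ∀ S ∈ D.J.carrier, F S = x * G S) (h3 : ∀ S ∈ D.J.carrier, g S = x * k S) :
    Captures n D p c (symField n 0 0 0 μ F g) := fun D' hD' => ⟨(h D' hD').1, fun K => by
  refine (((h D' hD').2 K).smul x).congr ?_
  rw [← symField_smul, mul_zero]
  exact symField_congr rfl rfl rfl h1 (fun S hS => h2 S (hD'.2 hS)) fun S hS => h3 S (hD'.2 hS)⟩

/-- A symmetry with `g ≠ 0` forces, on a sub-domain, one of the scaling forms of `p`: the reduced
equation then prescribes the growth of `p` along a flow that moves `ρ`, and `κ(S) ρ` or, if `F = 0`,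
`S` is constant along this flow. -/
theorem IsReduced.captures_scaling {g₀ : ℝ} (hp : Smooth2 D p) (hnd : Nondegenerate D p)
    (h : IsReduced D p μ F (fun _ => g₀)) (hg : g₀ ≠ 0) :
    ∃ D' : EosDomain, D'.Sub D ∧ ∃ c : EosCase, 4 ≤ c.number ∧ c.number ≤ 7 ∧
      Captures n D' p c (symField n 0 0 0 μ F (fun _ => g₀)) := by
  have h' := (h.smul (2 / g₀)).congr (k := fun _ => 2) (fun _ _ => rfl) fun _ _ => by field_simp
  by_cases hF : ∃ S ∈ D.J.carrier, F S ≠ 0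
  · obtain ⟨S₀, hS₀, hF₀⟩ := hF
    obtain ⟨J', h1, h2, h3⟩ := D.J.exists_around hS₀
      ((h.smoothF.continuousOn.continuousAt (D.J.isOpen.mem_nhds hS₀)).eventually_ne hF₀)
    have hD := D.withJ_sub h2
    obtain ⟨D', hD', c, hc, hc', hcap⟩ := (h'.mono hD).captures_scal (n := n) (hp.mono hD)
      (hnd.mono hD) fun S hS => mul_ne_zero (div_ne_zero two_ne_zero hg) (h3 hS)
    exact ⟨D', hD'.trans hD, c, hc, hc', hcap.congr_smul (x := g₀ / 2) (by field_simp)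
      (fun _ _ => by field_simp) fun _ _ => by field_simp⟩
  · push Not at hF
    have h'' := h'.congr (G := fun _ => 0) (k := fun _ => 2) (fun S hS => by simp [hF S hS])
      fun _ _ => rfl
    obtain ⟨c, hc, hc', hcap⟩ := h''.captures_pow (n := n) hp hnd
    exact ⟨D, .refl D, c, hc, hc', hcap.congr_smul (x := g₀ / 2) (by field_simp)
      (fun S hS => by rw [hF S hS, mul_zero]) fun _ _ => by field_simp⟩

/-- Every symmetry that fixes `ρ` is accounted for by an equation of state of the form
`κ(S) f(ρ)` or `κ(S) + f(ρ)`. -/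
theorem IsReduced.captures_isopycnic (hp : Smooth2 D p) (hnd : Nondegenerate D p)
    (h : IsReduced D p μ F (fun _ => 0)) (h0 : μ ≠ 0 ∨ ∃ S ∈ D.J.carrier, F S ≠ 0) :
    ∃ c : EosCase, ((μ ≠ 0 ∧ c.number = 2) ∨ (μ = 0 ∧ c.number = 3)) ∧
      Captures n D p c (symField n 0 0 0 μ F (fun _ => 0)) := by
  by_cases hμ : μ = 0
  · subst hμ
    obtain ⟨c, hc, hcap⟩ := h.captures_sum (n := n) hp hnd (h0.resolve_left (by simp))
    exact ⟨c, .inr ⟨rfl, hc⟩, hcap⟩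
  · obtain ⟨c, hc, hcap⟩ := h.captures_prod (n := n) hp hnd hμ
    exact ⟨c, .inl ⟨hμ, hc⟩, hcap⟩

/-- The conformal symmetry occurs for `p = κ(S) ρ ^ (1 + 2 / n)` only. -/
theorem captures_conf {a : ℝ} (hn : n ≠ 0) (hp : Smooth2 D p) (hnd : Nondegenerate D p)
    (h : IsReduced D p a (fun _ => 0) (fun _ => n * a)) (ha : a ≠ 0) :
    ∃ κ : ℝ → ℝ, Captures n D p (.c8 κ) (Xconf n) := by
  have hn' : (n : ℝ) ≠ 0 := by exact_mod_cast hn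
  have h' := (h.smul (2 / (n * a))).congr (G := fun _ => 0) (k := fun _ => 2)
    (fun _ _ => by simp) fun _ _ => by field_simp
  rw [show 2 / (n * a) * a = 2 / (n : ℝ) by field_simp] at h'
  have : 2 / (n : ℝ) > 0 := by positivity
  obtain ⟨κ, p₀, hκ, he⟩ := h'.eq_pow hp hnd (by linarith)
  exact ⟨κ, fun D' hD' => ⟨⟨hκ.mono hD'.2, p₀, fun ρ hρ S hS => he ρ (hD'.1 hρ) S (hD'.2 hS)⟩,
    fun K => inSpan_of_mem (.inr (.inr (.inr (.inr rfl))))⟩⟩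

end

/-! ### All symmetries of the equations of state with many symmetries -/

theorem IsSymField.add {n : ℕ} {D : EosDomain} {p : ℝ → ℝ → ℝ} {X Y : VField}
    (hX : IsSymField n D p X) (hY : IsSymField n D p Y) : IsSymField n D p (X + Y) := by
  obtain ⟨c₁, c₂, a, μ, F, g, h1, h2, rfl⟩ := hX
  obtain ⟨d₁, d₂, b, ν, G, k, h3, h4, rfl⟩ := hY
  exact ⟨_, _, _, _, _, _, h1.add h3, (h2.add h4).congr (fun _ _ => by simp) fun _ _ => by ring,
    (symField_add ..).symm⟩

theorem IsSymField.smul {n : ℕ} {D : EosDomain} {p : ℝ → ℝ → ℝ} {X : VField}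
    (hX : IsSymField n D p X) (x : ℝ) : IsSymField n D p (x • X) := by
  obtain ⟨c₁, c₂, a, μ, F, g, h1, h2, rfl⟩ := hX
  exact ⟨_, _, _, _, _, _, h1.smul x, (h2.smul x).congr (fun _ _ => by simp) fun _ _ => by ring,
    (symField_smul ..).symm⟩

theorem isSymField_zero {n : ℕ} {D : EosDomain} {p : ℝ → ℝ → ℝ} : IsSymField n D p 0 := by
  have := (isReduced_zero (D := D) (p := p)).isSymField (n := n)
  rwa [symField_zero] at this

theorem isPointSymmetry_of_inSpan {n : ℕ} {D : EosDomain} {p : ℝ → ℝ → ℝ} {K : KinDomain}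
    {G : Set VField} {X : VField} (hp : Smooth2 D p) (hG : ∀ X ∈ G, IsSymField n D p X)
    (h : InSpan (box K D) G X) : IsPointSymmetry n p (box K D) X := by
  obtain ⟨Y, hY, hXY⟩ := h.induction (P := fun X => ∃ Y, IsSymField n D p Y ∧ EqOn X Y (box K D))
    (fun X hX => ⟨X, hG X hX, fun _ _ => rfl⟩) ⟨0, isSymField_zero, fun _ _ => rfl⟩
    (fun X Y ⟨X', h1, h2⟩ ⟨Y', h3, h4⟩ => ⟨X' + Y', h1.add h3, fun z hz => by
      simp [h2 hz, h4 hz]⟩)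
    (fun x X ⟨X', h1, h2⟩ => ⟨x • X', h1.smul x, fun z hz => by simp [h2 hz]⟩)
    (fun X Y ⟨X', h1, h2⟩ h3 => ⟨X', h1, h3.trans h2⟩)
  exact (hY.isPointSymmetry hp K).congr hp hXY

theorem inSpan_symField_of_parts {n : ℕ} {K : KinDomain} {D : EosDomain} {G : Set VField}
    (h1 : X1 ∈ G) (h2 : X2 ∈ G) (c₁ c₂ : ℝ) {a μ : ℝ} {F g : ℝ → ℝ}
    (ha : a = 0 ∨ InSpan (box K D) G (Xconf n))
    (h : InSpan (box K D) G (symField n 0 0 0 μ F g)) :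
    InSpan (box K D) G (symField n c₁ c₂ a μ F g) := by
  rw [symField_eq_time_add]
  refine ((((inSpan_of_mem h1).smul c₁).add ((inSpan_of_mem h2).smul c₂)).add ?_).add h
  rcases ha with rfl | ha
  · rw [zero_smul]; exact InSpan.zero
  · exact ha.smul a

theorem EosCase.X1_mem (n : ℕ) (D : EosDomain) (c : EosCase) : X1 ∈ c.generators n D := by
  cases c <;> simp [EosCase.generators]

theorem EosCase.X2_mem (n : ℕ) (D : EosDomain) (c : EosCase) : X2 ∈ c.generators n D := by
  cases c <;> simp [EosCase.generators]

/-- To find all symmetries it suffices to treat those of the form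
`μ (r ∂_r + U ∂_U) + F ∂_S + g ρ ∂_ρ` and the conformal one. -/
theorem symmetriesAre_of_reduced {n : ℕ} (hn : 2 ≤ n) {D : EosDomain} {p : ℝ → ℝ → ℝ}
    {K : KinDomain} {G : Set VField} (hp : IsEos D p) (hG : ∀ X ∈ G, IsSymField n D p X)
    (h1 : X1 ∈ G) (h2 : X2 ∈ G)
    (h : ∀ μ F g, IsReduced D p μ F g → InSpan (box K D) G (symField n 0 0 0 μ F g))
    (ha : ∀ a, IsReduced D p a (fun _ => 0) (fun _ => n * a) →
      a = 0 ∨ InSpan (box K D) G (Xconf n)) : SymmetriesAre n p (box K D) G := by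
  refine fun X => ⟨fun hX => ?_, isPointSymmetry_of_inSpan hp.smooth2 hG⟩
  obtain ⟨c₁, c₂, a, μ, F, g, h3, h4, h5⟩ := exists_symField hn hp hX
  exact (inSpan_symField_of_parts h1 h2 c₁ c₂ (ha a h4) (h μ F g h3)).congr h5

section
variable {n : ℕ} {D : EosDomain} {p : ℝ → ℝ → ℝ} {μ : ℝ} {F g : ℝ → ℝ}

/-- `g` is constant as soon as `p_ρ` vanishes identically on no sub-domain. -/
theorem IsReduced.exists_const (h : IsReduced D p μ F g) (hp : Smooth2 D p)
    (hd : ∀ D' : EosDomain, D'.Sub D → ∃ ρ ∈ D'.I.carrier, ∃ S ∈ D'.J.carrier, dρ p ρ S ≠ 0) :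
    ∃ g₀, ∀ S ∈ D.J.carrier, g S = g₀ := by
  obtain ⟨S₀, hS₀⟩ := D.J.nonempty
  refine ⟨g S₀, fun S hS => D.J.eq_of_hasDerivAt_zero (fun s hs => ?_) hS hS₀⟩
  have hg := (smooth_differentiableAt h.smoothg hs).hasDerivAt
  by_contra hne
  have h0 : deriv g s ≠ 0 := fun h0 => hne (h0 ▸ hg)
  obtain ⟨J', h1, h2, h3⟩ := D.J.exists_around hs 
    (((smooth_deriv h.smoothg).continuousOn.continuousAt (D.J.isOpen.mem_nhds hs)).eventually_ne h0)
  obtain ⟨ρ, hρ, s', hs', h4⟩ := hd _ (D.withJ_sub h2)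
  exact mul_ne_zero (h3 hs') h4 (h.deriv_mul_dρ hp hρ (h2 hs'))

theorem IsReduced.pow_relation {κ : ℝ → ℝ} {q p₀ : ℝ} (h : IsReduced D p μ F g)
    (hκ : ContDiffOn ℝ ∞ κ D.J.carrier) (hq : q ≠ -1)
    (hpe : ∀ ρ ∈ D.I.carrier, ∀ S ∈ D.J.carrier, p ρ S = κ S * ρ ^ (1 + q) + p₀) :
    (∀ ρ ∈ D.I.carrier, ∀ S ∈ D.J.carrier, dρ p ρ S = (1 + q) * κ S * ρ ^ q) ∧
    ∀ S ∈ D.J.carrier, F S * deriv κ S = (2 * μ - q * g S) * κ S := by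
  have e1 : ∀ ρ ∈ D.I.carrier, ∀ S ∈ D.J.carrier, dρ p ρ S = (1 + q) * κ S * ρ ^ q :=
    fun ρ hρ S hS => (dρ_congr hpe hρ hS).trans
      ((((hasDerivAt_rpow_one_add (D.ρ_pos hρ) q).const_mul (κ S)).add_const p₀).deriv.trans
        (by ring))
  refine ⟨e1, fun S hS => ?_⟩
  obtain ⟨ρ, hρ⟩ := D.I.nonempty
  have hρ0 := D.ρ_pos hρ
  have e2 : dρ (dρ p) ρ S = (1 + q) * κ S * (q * ρ ^ (q - 1)) :=
    (dρ_congr (k := fun ρ S => (1 + q) * κ S * ρ ^ q) e1 hρ hS).trans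
      ((Real.hasDerivAt_rpow_const (.inl hρ0.ne')).const_mul _).deriv
  have e3 : dS (dρ p) ρ S = (1 + q) * deriv κ S * ρ ^ q :=
    (dS_congr (k := fun ρ S => (1 + q) * κ S * ρ ^ q) e1 hρ hS).trans
      (((smooth_differentiableAt hκ hS).hasDerivAt.const_mul (1 + q)).mul_const _).deriv
  have h1 := h.eqρ ρ hρ S hS
  have h2 := Real.rpow_pos_of_pos hρ0 q
  rw [e1 ρ hρ S hS, e2, e3, Real.rpow_sub_one hρ0.ne'] at h1
  have h3 : (1 + q) * ρ ^ q ≠ 0 := mul_ne_zero (fun h => hq (by linarith)) h2.ne'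
  refine mul_left_cancel₀ h3 ?_
  field_simp at h1
  linear_combination h1

theorem IsReduced.log_relation {κ : ℝ → ℝ} {k p₀ : ℝ} (h : IsReduced D p μ F g) (hk : k ≠ 0)
    (hpe : ∀ ρ ∈ D.I.carrier, ∀ S ∈ D.J.carrier, p ρ S = κ S + k * Real.log ρ + p₀) :
    ∀ S ∈ D.J.carrier, g S = -2 * μ := by
  intro S hS
  have e1 : ∀ ρ ∈ D.I.carrier, ∀ S ∈ D.J.carrier, dρ p ρ S = k * ρ⁻¹ :=
    fun ρ hρ S hS => (dρ_congr hpe hρ hS).trans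
      ((((Real.hasDerivAt_log (D.ρ_pos hρ).ne').const_mul k).const_add (κ S)).add_const p₀).deriv
  obtain ⟨ρ, hρ⟩ := D.I.nonempty
  have hρ0 := (D.ρ_pos hρ).ne'
  have e2 : dρ (dρ p) ρ S = k * -(ρ ^ 2)⁻¹ :=
    (dρ_congr (k := fun ρ S => k * ρ⁻¹) e1 hρ hS).trans
      ((hasDerivAt_inv hρ0).const_mul _).deriv
  have e3 : dS (dρ p) ρ S = 0 :=
    (dS_congr (k := fun ρ S => k * ρ⁻¹) e1 hρ hS).trans (deriv_const S (k * ρ⁻¹))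
  have h1 := h.eqρ ρ hρ S hS
  rw [e1 ρ hρ S hS, e2, e3] at h1
  have h2 : k * ρ⁻¹ * (g S + 2 * μ) = 0 := by
    have : g S * ρ * (k * -(ρ ^ 2)⁻¹) = -(k * ρ⁻¹ * g S) := by field_simp
    rw [this] at h1
    linarith
  have h3 := (mul_eq_zero.1 h2).resolve_left (mul_ne_zero hk (inv_ne_zero hρ0))
  linarith

theorem Regular.exists_ne_zero {J : OpenInterval} {κ : ℝ → ℝ} (h : Regular κ J) :
    ∃ S ∈ J.carrier, κ S ≠ 0 := by
  by_contra! hc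
  obtain ⟨S, hS⟩ := J.nonempty
  exact h.2 S hS ((deriv_congr_on (G := fun _ => 0) hc hS).trans (deriv_const _ _))

/-- A function `f` for which `ρ f'' = m f'` does not satisfy the conditions of case 9. -/
theorem not_admissible_of_homogeneous {f : ℝ → ℝ} {m : ℝ} (h : (EosCase.c9 f).Admissible D)
    (hm : ∀ ρ ∈ D.I.carrier, ρ * deriv (deriv f) ρ = m * deriv f ρ) : False := by
  obtain ⟨⟨hf, x, hx, y, hy, hxy⟩, h2⟩ := h
  have hd : ∀ ρ ∈ D.I.carrier, HasDerivAt (fun x => x * deriv f x)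
      (deriv f ρ + m * deriv f ρ) ρ := fun ρ hρ => by
    refine ((hasDerivAt_id ρ).mul
      (smooth_differentiableAt (smooth_deriv hf) hρ).hasDerivAt).congr_deriv ?_
    rw [← hm ρ hρ]; simp [id]
  by_cases hm1 : 1 + m = 0
  · obtain ⟨ρ, hρ, h3⟩ := (h2 D.I Subset.rfl).1
    refine h3 ((hd ρ hρ).deriv.trans ?_)
    linear_combination deriv f ρ * hm1
  · have hc : ∀ ρ ∈ D.I.carrier, HasDerivAt (fun x => x * deriv f x - (1 + m) * f x) 0 ρ :=
      fun ρ hρ => by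
        refine ((hd ρ hρ).sub ((smooth_differentiableAt hf hρ).hasDerivAt.const_mul _)).congr_deriv
          ?_
        ring
    set C := (x * deriv f x - (1 + m) * f x) / (1 + m) with hC
    have hC' : ∀ ρ ∈ D.I.carrier, ρ * deriv f ρ = (1 + m) * (f ρ + C) := fun ρ hρ => by
      have := D.I.eq_of_hasDerivAt_zero hc hρ hx
      rw [hC, mul_add, mul_div_cancel₀ _ hm1]
      linarith
    have : ∃ z ∈ D.I.carrier, f z + C ≠ 0 := by
      by_contra! h0
      exact hxy (by linarith [h0 x hx, h0 y hy])
    obtain ⟨z, hz, hz0⟩ := this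
    obtain ⟨I', h3, h4, h5⟩ := D.I.exists_around hz
      (((hf.continuousOn.continuousAt (D.I.isOpen.mem_nhds hz)).add_const C).eventually_ne hz0)
    obtain ⟨ρ, hρ, h6⟩ := (h2 I' h4).2 C fun ρ hρ => h5 hρ
    refine h6 ((deriv_congr_on (G := fun _ => 1 + m) (fun s hs => ?_) hρ).trans (deriv_const _ _))
    change s * deriv f s / (f s + C) = 1 + m
    rw [div_eq_iff (h5 hs), hC' s (h4 hs)]

theorem IsReduced.barotropic_relation {f : ℝ → ℝ} {p₀ : ℝ} (h : IsReduced D p μ F g)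
    (hf : (EosCase.c9 f).Admissible D)
    (hpe : ∀ ρ ∈ D.I.carrier, ∀ S ∈ D.J.carrier, p ρ S = f ρ + p₀) :
    μ = 0 ∧ ∀ S ∈ D.J.carrier, g S = 0 := by
  have hfs := hf.1.1
  have e1 : ∀ ρ ∈ D.I.carrier, ∀ S ∈ D.J.carrier, dρ p ρ S = deriv f ρ :=
    fun ρ hρ S hS => (dρ_congr hpe hρ hS).trans
      ((smooth_differentiableAt hfs hρ).hasDerivAt.add_const p₀).deriv
  have e2 : ∀ ρ ∈ D.I.carrier, ∀ S ∈ D.J.carrier, dρ (dρ p) ρ S = deriv (deriv f) ρ :=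
    fun ρ hρ S hS => dρ_congr (k := fun ρ S => deriv f ρ) e1 hρ hS
  have e3 : ∀ ρ ∈ D.I.carrier, ∀ S ∈ D.J.carrier, dS (dρ p) ρ S = 0 := fun ρ hρ S hS =>
    (dS_congr (k := fun ρ S => deriv f ρ) e1 hρ hS).trans (deriv_const S (deriv f ρ))
  have hne : ∃ ρ ∈ D.I.carrier, deriv f ρ ≠ 0 := by
    by_contra! h0
    obtain ⟨-, x, hx, y, hy, hxy⟩ := hf.1
    exact hxy (D.I.eq_of_hasDerivAt_zero (fun z hz => by
      have := (smooth_differentiableAt hfs hz).hasDerivAt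
      rwa [h0 z hz] at this) hx hy)
  have key : ∀ ρ ∈ D.I.carrier, ∀ S ∈ D.J.carrier,
      g S * (ρ * deriv (deriv f) ρ) = 2 * μ * deriv f ρ := fun ρ hρ S hS => by
    have := h.eqρ ρ hρ S hS
    rw [e1 ρ hρ S hS, e2 ρ hρ S hS, e3 ρ hρ S hS] at this
    linarith
  have hg : ∀ S ∈ D.J.carrier, g S = 0 := fun S hS => by
    by_contra h0
    refine not_admissible_of_homogeneous (m := 2 * μ / g S) hf fun ρ hρ => ?_
    rw [div_mul_eq_mul_div, eq_div_iff h0, ← key ρ hρ S hS]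
    ring
  refine ⟨?_, hg⟩
  obtain ⟨ρ, hρ, h0⟩ := hne
  obtain ⟨S, hS⟩ := D.J.nonempty
  have := key ρ hρ S hS
  rw [hg S hS, zero_mul] at this
  have := (mul_eq_zero.1 this.symm).resolve_right h0
  linarith

theorem IsReduced.isochoric_relation {κ : ℝ → ℝ} {p₀ : ℝ} (h : IsReduced D p μ F g)
    (hκ : Regular κ D.J)
    (hpe : ∀ ρ ∈ D.I.carrier, ∀ S ∈ D.J.carrier, p ρ S = κ S + p₀) :
    ∀ S ∈ D.J.carrier, g S = deriv (fun s => F s * deriv κ s) S / deriv κ S - 2 * μ := by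
  intro S hS
  obtain ⟨ρ, hρ⟩ := D.I.nonempty
  have e1 : ∀ ρ ∈ D.I.carrier, ∀ S ∈ D.J.carrier, dρ p ρ S = 0 := fun ρ hρ S hS =>
    (dρ_congr hpe hρ hS).trans (deriv_const ρ (κ S + p₀))
  have e2 : ∀ ρ ∈ D.I.carrier, ∀ S ∈ D.J.carrier, dS p ρ S = deriv κ S := fun ρ hρ S hS =>
    (dS_congr hpe hρ hS).trans ((hκ.hasDerivAt hS).add_const p₀).deriv
  have e3 : dS (dρ p) ρ S = 0 :=
    (dS_congr (k := fun _ _ => 0) e1 hρ hS).trans (deriv_const _ _)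
  have e4 : dS (dS p) ρ S = deriv (deriv κ) S :=
    dS_congr (k := fun _ S => deriv κ S) e2 hρ hS
  have h1 := h.eqS ρ hρ S hS
  have h0 := hκ.2 S hS
  rw [e1 ρ hρ S hS, e2 ρ hρ S hS, e3, e4] at h1
  rw [divergence_eq hκ h.smoothF hS]
  field_simp
  linarith

/-- The generators of the cases 6 to 13 are all symmetries, save for the conformal one in the
cases 6 and 12. -/
theorem symmetriesAre_of_six_le (hn : 2 ≤ n) {K : KinDomain} {c : EosCase} (hp : IsEos D p)
    (hc : 6 ≤ c.number) (hi : IsInstance n D c p)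
    (h6 : ∀ κ, c ≠ .c6 κ (2 / n)) (h12 : ∀ k, c ≠ .c12 k (2 / n)) :
    SymmetriesAre n p (box K D) (c.generators n D) := by
  have hn0 : (n : ℝ) > 0 := by have : 0 < n := by omega
                               exact_mod_cast this
  have hps := hp.smooth2
  have hpos : 2 / (n : ℝ) > 0 := by positivity
  have hq8 : 2 / (n : ℝ) ≠ -1 := by linarith
  obtain ⟨S₀, hS₀⟩ := D.J.nonempty
  refine symmetriesAre_of_reduced hn hp (fun X hX => hi.isSymField hn hX) (c.X1_mem n D)
    (c.X2_mem n D) (fun μ F g h => ?_) (fun a h => ?_)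
  · obtain ⟨ha, p₀, he⟩ := hi
    have key : ∀ {κ q}, Regular κ D.J → q ≠ -1 →
        (∀ ρ ∈ D.I.carrier, ∀ S ∈ D.J.carrier, p ρ S = κ S * ρ ^ (1 + q) + p₀) →
        ∃ g₀, (∀ S ∈ D.J.carrier, g S = g₀) ∧
          ∀ S ∈ D.J.carrier, F S = (2 * μ - q * g₀) / 2 * (2 * κ S / deriv κ S) := by
      intro κ q hκ hq he
      obtain ⟨h1, h2⟩ := h.pow_relation hκ.1 hq he
      obtain ⟨g₀, hg⟩ := h.exists_const hps fun D' hD' => by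
        obtain ⟨S, hS, h3⟩ := (hκ.mono hD'.2).exists_ne_zero
        obtain ⟨ρ, hρ⟩ := D'.I.nonempty
        refine ⟨ρ, hρ, S, hS, ?_⟩
        rw [h1 ρ (hD'.1 hρ) S (hD'.2 hS)]
        exact mul_ne_zero (mul_ne_zero (fun h => hq (by linarith)) h3)
          (Real.rpow_pos_of_pos (D'.ρ_pos hρ) _).ne'
      refine ⟨g₀, hg, fun S hS => ?_⟩
      have h3 := h2 S hS
      have h4 := hκ.2 S hS
      rw [hg S hS] at h3
      field_simp
      linear_combination h3
    cases c with
    | c6 κ q =>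
      obtain ⟨g₀, hg, hF⟩ := key ha.1 ha.2 he
      have i1 := inSpan_symField_of_smul (K := K) (D := D) (x := (2 * μ - q * g₀) / 2)
        (μ := (2 * μ - q * g₀) / 2) (Xprod_eq n κ) (G := (EosCase.c6 κ q).generators n D)
        (.inr (.inr (.inl rfl))) (by ring) hF (fun _ _ => (mul_zero _).symm)
      have i2 := inSpan_symField_of_smul (K := K) (D := D) (x := g₀ / 2)
        (μ := g₀ / 2 * q) (Xpow_eq n q) (G := (EosCase.c6 κ q).generators n D)
        (.inr (.inr (.inr rfl))) (by ring) (fun _ _ => (mul_zero _).symm)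
        (g := g) (fun S hS => by rw [hg S hS]; ring)
      refine (i1.add i2).congr ?_
      rw [← symField_add]
      exact symField_congr (by ring) (by ring) (by ring) (by ring) (fun _ _ => by ring)
        fun _ _ => by ring
    | c7 κ k =>
      have hg := h.log_relation (κ := κ) ha.2 he
      obtain ⟨C, hC⟩ := (h.congr (k := fun _ => -2 * μ) (fun _ _ => rfl) fun S hS =>
        (hg S hS).symm).exists_integral hps fun _ _ => rfl
      have hF : ∀ S ∈ D.J.carrier, F S = (C + 2 * μ * k) * (1 / deriv κ S) := fun S hS => by
        obtain ⟨ρ, hρ⟩ := D.I.nonempty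
        have hρ0 := (D.ρ_pos hρ).ne'
        have e1 : dρ p ρ S = k * ρ⁻¹ := (dρ_congr he hρ hS).trans
          ((((Real.hasDerivAt_log hρ0).const_mul k).const_add (κ S)).add_const p₀).deriv
        have e2 : dS p ρ S = deriv κ S := (dS_congr he hρ hS).trans
          (((ha.1.hasDerivAt hS).add_const (k * Real.log ρ)).add_const p₀).deriv
        have h0 := ha.1.2 S hS
        have h1 := hC ρ hρ S hS
        rw [e1, e2] at h1
        have h2 : ρ * ρ⁻¹ = 1 := mul_inv_cancel₀ hρ0
        field_simp
        linear_combination h1 + 2 * μ * k * h2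
      have i1 := inSpan_symField_of_smul (K := K) (D := D) (x := C + 2 * μ * k)
        (μ := 0) (Xsum_eq n κ) (G := (EosCase.c7 κ k).generators n D)
        (.inr (.inr (.inl rfl))) (by ring) hF (fun _ _ => (mul_zero _).symm)
      have i2 := inSpan_symField_of_smul (K := K) (D := D) (x := μ)
        (μ := μ) (Xlog_eq n) (G := (EosCase.c7 κ k).generators n D)
        (.inr (.inr (.inr rfl))) (by ring) (fun _ _ => (mul_zero _).symm) (fun _ _ => rfl)
      refine (i1.add i2).congr ?_
      rw [← symField_add]
      exact symField_congr (by ring) (by ring) (by ring) (by ring) (fun _ _ => by ring)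
        fun S hS => by rw [hg S hS]; ring
    | c8 κ =>
      obtain ⟨g₀, hg, hF⟩ := key ha hq8 he
      have i1 := inSpan_symField_of_smul (K := K) (D := D) (x := (2 * μ - 2 / n * g₀) / 2)
        (μ := (2 * μ - 2 / n * g₀) / 2) (Xprod_eq n κ) (G := (EosCase.c8 κ).generators n D)
        (.inr (.inr (.inl rfl))) (by ring) hF (fun _ _ => (mul_zero _).symm)
      have i2 := inSpan_symField_of_smul (K := K) (D := D) (x := g₀ / n)
        (μ := g₀ / n) (g := g) (Xpow'_eq n) (G := (EosCase.c8 κ).generators n D)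
        (.inr (.inr (.inr (.inl rfl)))) (by ring) (fun _ _ => (mul_zero _).symm)
        (fun S hS => by rw [hg S hS]; field_simp)
      refine (i1.add i2).congr ?_
      rw [← symField_add]
      exact symField_congr (by ring) (by ring) (by ring) (by ring) (fun _ _ => by ring)
        fun _ _ => by ring
    | c9 f =>
      obtain ⟨rfl, hg⟩ := h.barotropic_relation ha he
      refine (inSpan_of_mem (.inr ⟨F, h.smoothF, rfl⟩)).congr ?_
      rw [Xent_eq n]
      exact symField_congr rfl rfl rfl rfl (fun _ _ => rfl) hg
    | c10 κ =>
      have hg := h.isochoric_relation ha he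
      refine (((inSpan_of_mem (.inl (.inr (.inr rfl)))).smul μ).add
        (inSpan_of_mem (.inr ⟨F, h.smoothF, rfl⟩))).congr ?_
      rw [XentW_eq n, Xlog_eq n, ← symField_smul, ← symField_add]
      exact symField_congr (by ring) (by ring) (by ring) (by ring) (fun _ _ => by ring)
        fun S hS => by rw [hg S hS]; ring
    | c11 k =>
      have hg := h.log_relation (κ := fun _ => 0) (p₀ := p₀) ha fun ρ hρ S hS => by
        rw [he ρ hρ S hS]; simp [EosCase.eos]
      refine (((inSpan_of_mem (.inl (.inr (.inr rfl)))).smul μ).add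
        (inSpan_of_mem (.inr ⟨F, h.smoothF, rfl⟩))).congr ?_
      rw [Xent_eq n, Xlog_eq n, ← symField_smul, ← symField_add]
      exact symField_congr (by ring) (by ring) (by ring) (by ring) (fun _ _ => by ring)
        fun S hS => by rw [hg S hS]; ring
    | c12 k q =>
      obtain ⟨h1, h2⟩ := h.pow_relation (κ := fun _ => k) contDiffOn_const ha.2 he
      obtain ⟨g₀, hg⟩ := h.exists_const hps fun D' hD' => by
        obtain ⟨S, hS⟩ := D'.J.nonempty
        obtain ⟨ρ, hρ⟩ := D'.I.nonempty
        refine ⟨ρ, hρ, S, hS, ?_⟩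
        rw [h1 ρ (hD'.1 hρ) S (hD'.2 hS)]
        exact mul_ne_zero (mul_ne_zero (fun h => ha.2 (by linarith)) ha.1)
          (Real.rpow_pos_of_pos (D'.ρ_pos hρ) _).ne'
      have h3 := h2 S₀ hS₀
      rw [deriv_const, mul_zero, hg S₀ hS₀] at h3
      have h4 := (mul_eq_zero.1 h3.symm).resolve_right ha.1
      refine (((inSpan_of_mem (.inl (.inr (.inr rfl)))).smul (g₀ / 2)).add
        (inSpan_of_mem (.inr ⟨F, h.smoothF, rfl⟩))).congr ?_
      rw [Xent_eq n, Xpow_eq n, ← symField_smul, ← symField_add]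
      exact symField_congr (by ring) (by ring) (by ring) (by linarith) (fun _ _ => by ring)
        fun S hS => by rw [hg S hS]; ring
    | c13 k =>
      obtain ⟨h1, h2⟩ := h.pow_relation (κ := fun _ => k) contDiffOn_const hq8 he
      have hg : ∀ S ∈ D.J.carrier, g S = n * μ := fun S hS => by
        have h3 := h2 S hS
        rw [deriv_const, mul_zero] at h3
        have h4 := (mul_eq_zero.1 h3.symm).resolve_right ha
        field_simp at h4
        linarith
      refine (((inSpan_of_mem (.inl (.inr (.inr (.inr rfl))))).smul μ).add
        (inSpan_of_mem (.inr ⟨F, h.smoothF, rfl⟩))).congr ?_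
      rw [Xent_eq n, Xpow'_eq n, ← symField_smul, ← symField_add]
      exact symField_congr (by ring) (by ring) (by ring) (by ring) (fun _ _ => by ring)
        fun S hS => by rw [hg S hS]; ring
    | _ => simp [EosCase.number] at hc
  · obtain ⟨ha, p₀, he⟩ := hi
    have hlog : (n : ℝ) * a = -2 * a → a = 0 := fun h => by
      have : (n + 2) * a = 0 := by linarith
      exact (mul_eq_zero.1 this).resolve_left (by positivity)
    have hpow : ∀ {q : ℝ}, q ≠ 2 / n → 2 * a - q * (n * a) = 0 → a = 0 := fun {q} hq h => by
      have : (2 - q * (n : ℝ)) * a = 0 := by linarith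
      refine (mul_eq_zero.1 this).resolve_left fun h0 => hq ?_
      rw [eq_div_iff hn0.ne']
      linarith
    cases c with
    | c6 κ q =>
      obtain ⟨-, h2⟩ := h.pow_relation ha.1.1 ha.2 he
      obtain ⟨S, hS, h3⟩ := ha.1.exists_ne_zero
      have h4 := h2 S hS
      rw [zero_mul] at h4
      exact .inl (hpow (fun h => h6 κ (by rw [h])) ((mul_eq_zero.1 h4.symm).resolve_right h3))
    | c7 κ k => exact .inl (hlog (h.log_relation (κ := κ) ha.2 he S₀ hS₀))
    | c8 κ => exact .inr (inSpan_of_mem (.inr (.inr (.inr (.inr rfl)))))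
    | c9 f => exact .inl (h.barotropic_relation ha he).1
    | c10 κ =>
      have h1 := h.isochoric_relation ha he S₀ hS₀
      simp only [zero_mul, deriv_const, zero_div] at h1
      exact .inl (hlog (by linarith))
    | c11 k =>
      exact .inl (hlog (h.log_relation (κ := fun _ => 0) (p₀ := p₀) ha (fun ρ hρ S hS => by
        rw [he ρ hρ S hS]; simp [EosCase.eos]) S₀ hS₀))
    | c12 k q =>
      obtain ⟨-, h2⟩ := h.pow_relation (κ := fun _ => k) contDiffOn_const ha.2 he
      have h4 := h2 S₀ hS₀
      rw [zero_mul] at h4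
      exact .inl (hpow (fun h => h12 k (by rw [h])) ((mul_eq_zero.1 h4.symm).resolve_right ha.1))
    | c13 k => exact .inr (inSpan_of_mem (.inl (.inr (.inr (.inl rfl)))))
    | _ => simp [EosCase.number] at hc

end

/-! ### Degenerate equations of state -/

section
variable {n : ℕ} {D : EosDomain} {p : ℝ → ℝ → ℝ}

/-- An equation of state that depends on the density only is, on a sub-domain, one of the
barotropic cases. -/
theorem exists_barotropic (n : ℕ) (hp : IsEos D p)
    (hS : ∀ ρ ∈ D.I.carrier, ∀ S ∈ D.J.carrier, dS p ρ S = 0) :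
    ∃ D' : EosDomain, D'.Sub D ∧ ∃ c : EosCase, 9 ≤ c.number ∧ (∀ k, c ≠ .c12 k (2 / n)) ∧
      ∀ D'' : EosDomain, D''.Sub D' → IsInstance n D'' c p := by
  obtain ⟨S₀, hS₀⟩ := D.J.nonempty
  let f : ℝ → ℝ := fun ρ => p ρ S₀
  have hf : ContDiffOn ℝ ∞ f D.I.carrier := hp.smooth2.slice_ρ hS₀
  have hpf : ∀ ρ ∈ D.I.carrier, ∀ S ∈ D.J.carrier, p ρ S = f ρ := fun ρ hρ S hS' =>
    hp.smooth2.eq_of_dS_eq_zero hS hρ hS' hS₀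
  have hnc : ∀ I' : OpenInterval, I'.carrier ⊆ D.I.carrier → NonconstSmooth f I'.carrier :=
    fun I' hI => by
      refine ⟨hf.mono hI, ?_⟩
      obtain ⟨x, hx, S, hS1, y, hy, S', hS2, h⟩ := hp.2 ⟨I', D.J, hI.trans D.pos⟩ ⟨hI, Subset.rfl⟩
      exact ⟨x, hx, y, hy, by rwa [hpf x (hI hx) S hS1, hpf y (hI hy) S' hS2] at h⟩
  by_cases hlog : ∃ I' : OpenInterval, I'.carrier ⊆ D.I.carrier ∧
      ∀ ρ ∈ I'.carrier, deriv (fun x => x * deriv f x) ρ = 0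
  · obtain ⟨I', hI, h0⟩ := hlog
    have hf' := hf.mono hI
    obtain ⟨ρ₀, hρ₀⟩ := I'.nonempty
    have hpos : ∀ ρ ∈ I'.carrier, 0 < ρ := fun ρ hρ => D.pos (hI hρ)
    set k := ρ₀ * deriv f ρ₀ with hk
    have h1 : ∀ ρ ∈ I'.carrier, ρ * deriv f ρ = k := fun ρ hρ =>
      I'.eq_of_hasDerivAt_zero (f := fun x => x * deriv f x) (fun x hx => by
        have := ((hasDerivAt_id x).mul
          (smooth_differentiableAt (smooth_deriv hf') hx).hasDerivAt).differentiableAt.hasDerivAt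
        exact (h0 x hx) ▸ this) hρ hρ₀
    have h2 : ∀ ρ ∈ I'.carrier, f ρ = k * Real.log ρ + (f ρ₀ - k * Real.log ρ₀) := fun ρ hρ => by
      have := I'.eq_of_hasDerivAt_zero (f := fun x => f x - k * Real.log x) (fun x hx => by
        refine ((smooth_differentiableAt hf' hx).hasDerivAt.sub
          ((Real.hasDerivAt_log (hpos x hx).ne').const_mul k)).congr_deriv ?_
        rw [← h1 x hx]
        have := (hpos x hx).ne'
        field_simp
        ring) hρ hρ₀
      linarith
    have hk0 : k ≠ 0 := fun hk0 => by
      obtain ⟨-, x, hx, y, hy, hxy⟩ := hnc I' hI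
      rw [h2 x hx, h2 y hy, hk0] at hxy
      exact hxy (by ring)
    exact ⟨⟨I', D.J, hI.trans D.pos⟩, ⟨hI, Subset.rfl⟩, .c11 k, by simp [EosCase.number],
      by simp, fun D'' hD'' => ⟨hk0, _, fun ρ hρ S hS' =>
        (hpf ρ (hI (hD''.1 hρ)) S (hD''.2 hS')).trans (h2 ρ (hD''.1 hρ))⟩⟩
  by_cases hpow : ∃ I' : OpenInterval, I'.carrier ⊆ D.I.carrier ∧ ∃ C : ℝ,
      (∀ ρ ∈ I'.carrier, f ρ + C ≠ 0) ∧
        ∀ ρ ∈ I'.carrier, deriv (fun x => x * deriv f x / (f x + C)) ρ = 0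
  · obtain ⟨I', hI, C, hC, h0⟩ := hpow
    have hf' := hf.mono hI
    obtain ⟨ρ₀, hρ₀⟩ := I'.nonempty
    have hpos : ∀ ρ ∈ I'.carrier, 0 < ρ := fun ρ hρ => D.pos (hI hρ)
    set m := ρ₀ * deriv f ρ₀ / (f ρ₀ + C) with hm
    have h1 : ∀ ρ ∈ I'.carrier, ρ * deriv f ρ = m * (f ρ + C) := fun ρ hρ => by
      rw [← div_eq_iff (hC ρ hρ)]
      refine I'.eq_of_hasDerivAt_zero (f := fun x => x * deriv f x / (f x + C)) (fun x hx => ?_)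
        hρ hρ₀
      have := (((hasDerivAt_id x).mul (smooth_differentiableAt (smooth_deriv hf')
        hx).hasDerivAt).div ((smooth_differentiableAt hf' hx).hasDerivAt.add_const C)
        (hC x hx)).differentiableAt.hasDerivAt
      exact (h0 x hx) ▸ this
    set k := (f ρ₀ + C) * ρ₀ ^ (-m) with hk
    have h2 : ∀ ρ ∈ I'.carrier, f ρ = k * ρ ^ m + -C := fun ρ hρ => by
      have := I'.eq_of_hasDerivAt_zero (f := fun x => (f x + C) * x ^ (-m)) (fun x hx => by
        refine (((smooth_differentiableAt hf' hx).hasDerivAt.add_const C).mul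
          (Real.hasDerivAt_rpow_const (p := -m) (.inl (hpos x hx).ne'))).congr_deriv ?_
        have h3 := (hpos x hx).ne'
        rw [Real.rpow_sub_one h3]
        have h4 := h1 x hx
        field_simp
        linear_combination x ^ (-m) * h4) hρ hρ₀
      have h5 : ρ ^ (-m) * ρ ^ m = 1 := by
        rw [← Real.rpow_add (hpos ρ hρ), neg_add_cancel, Real.rpow_zero]
      have h6 : (f ρ + C) * ρ ^ (-m) = k := this
      linear_combination -(f ρ + C) * h5 + ρ ^ m * h6
    have hk0 : k ≠ 0 := mul_ne_zero (hC ρ₀ hρ₀) (Real.rpow_pos_of_pos (hpos ρ₀ hρ₀) _).ne'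
    have hm0 : m - 1 ≠ -1 := fun hm0 => by
      obtain ⟨-, x, hx, y, hy, hxy⟩ := hnc I' hI
      have : m = 0 := by linarith
      rw [h2 x hx, h2 y hy, this] at hxy
      simp at hxy
    have hm1 : 1 + (m - 1) = m := by ring
    refine ⟨⟨I', D.J, hI.trans D.pos⟩, ⟨hI, Subset.rfl⟩, ?_⟩
    by_cases hq : m - 1 = 2 / n
    · refine ⟨.c13 k, by simp [EosCase.number], by simp, fun D'' hD'' => ⟨hk0, -C,
        fun ρ hρ S hS' => (hpf ρ (hI (hD''.1 hρ)) S (hD''.2 hS')).trans ?_⟩⟩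
      rw [h2 ρ (hD''.1 hρ)]
      simp only [EosCase.eos, ← hq, hm1]
    · refine ⟨.c12 k (m - 1), by simp [EosCase.number], by simp [hq], fun D'' hD'' =>
        ⟨⟨hk0, hm0⟩, -C, fun ρ hρ S hS' => (hpf ρ (hI (hD''.1 hρ)) S (hD''.2 hS')).trans ?_⟩⟩
      rw [h2 ρ (hD''.1 hρ)]
      simp only [EosCase.eos, hm1]
  · push Not at hlog hpow
    exact ⟨D, .refl D, .c9 f, by simp [EosCase.number], by simp, fun D'' hD'' =>
      ⟨⟨hnc _ hD''.1, fun I' hI => ⟨hlog I' (hI.trans hD''.1),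
        fun C hC => hpow I' (hI.trans hD''.1) C hC⟩⟩, 0, fun ρ hρ S hS' =>
          (hpf ρ (hD''.1 hρ) S (hD''.2 hS')).trans (add_zero _).symm⟩⟩

/-- On a sub-domain, an equation of state is non-degenerate or depends on one of `ρ`, `S` only. -/
theorem IsEos.nondegenerate_or (n : ℕ) (hp : IsEos D p) :
    (∃ D' : EosDomain, D'.Sub D ∧ Nondegenerate D' p) ∨
    ∃ D' : EosDomain, D'.Sub D ∧ ∃ c : EosCase, 9 ≤ c.number ∧ (∀ k, c ≠ .c12 k (2 / n)) ∧
      ∀ D'' : EosDomain, D''.Sub D' → IsInstance n D'' c p := by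
  rcases hp.smooth2.dρ.exists_sub_ne_zero_or with ⟨D₁, hD₁, h1⟩ | h1
  · have hp₁ := hp.mono hD₁
    rcases hp₁.smooth2.dS.exists_sub_ne_zero_or with ⟨D₂, hD₂, h2⟩ | h2
    · exact .inl ⟨D₂, hD₂.trans hD₁, fun ρ hρ S hS =>
        ⟨h1 ρ (hD₂.1 hρ) S (hD₂.2 hS), h2 ρ hρ S hS⟩⟩
    · obtain ⟨D', hD', h⟩ := exists_barotropic n hp₁ h2
      exact .inr ⟨D', hD'.trans hD₁, h⟩
  · right
    obtain ⟨ρ₁, hρ₁, S₁, hS₁, h2⟩ := hp.exists_deriv_ne_zero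
    obtain ⟨D', hD', hρ', hS', h3⟩ := hp.smooth2.dS.exists_sub_ne_zero hρ₁ hS₁
      (h2.resolve_left (not_not.2 (h1 ρ₁ hρ₁ S₁ hS₁)))
    refine ⟨D', hD', .c10 fun S => p ρ₁ S, by simp [EosCase.number], by simp, fun D'' hD'' =>
      ⟨⟨hp.smooth2.slice_S hρ₁ |>.mono (hD''.trans hD').2, fun S hS => h3 ρ₁ hρ' S (hD''.2 hS)⟩, 0,
        fun ρ hρ S hS => ?_⟩⟩
    have hD := hD''.trans hD'
    exact (hp.smooth2.eq_of_dρ_eq_zero h1 (hD.1 hρ) hρ₁ (hD.2 hS)).trans (add_zero _).symm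

/-! ### Completeness -/

theorem isInstance_c1 (hp : Smooth2 D p) : IsInstance n D (.c1 p) p :=
  ⟨hp, 0, fun _ _ _ _ => (add_zero _).symm⟩

/-- The union of the generators of all cases of which `p` is an instance. -/
def instanceGenerators (n : ℕ) (D : EosDomain) (p : ℝ → ℝ → ℝ) : Set VField :=
  ⋃ c ∈ {c : EosCase | IsInstance n D c p}, c.generators n D

theorem subset_instanceGenerators {c : EosCase} (h : IsInstance n D c p) :
    c.generators n D ⊆ instanceGenerators n D p := fun _ hX => mem_biUnion h hX

theorem isSymField_instanceGenerators (hn : 2 ≤ n) :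
    ∀ X ∈ instanceGenerators n D p, IsSymField n D p X := fun X hX => by
  obtain ⟨c, hc, hX⟩ := mem_iUnion₂.1 hX
  exact IsInstance.isSymField hn hc hX

theorem Captures.inSpan {c : EosCase} {X : VField} {D' : EosDomain} (h : Captures n D p c X)
    (hD : D'.Sub D) (K : KinDomain) : InSpan (box K D') (instanceGenerators n D' p) X :=
  ((h D' hD).2 K).mono (subset_instanceGenerators (h D' hD).1)

theorem inSpan_of_isopycnic {μ : ℝ} {F g : ℝ → ℝ} (hp : Smooth2 D p) (hnd : Nondegenerate D p)
    (h : IsReduced D p μ F g) (hg : ∀ S ∈ D.J.carrier, g S = 0) (K : KinDomain) :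
    InSpan (box K D) (instanceGenerators n D p) (symField n 0 0 0 μ F g) := by
  by_cases h0 : μ ≠ 0 ∨ ∃ S ∈ D.J.carrier, F S ≠ 0
  · obtain ⟨c, -, hc⟩ := (h.congr (k := fun _ => 0) (fun _ _ => rfl)
      fun S hS => (hg S hS).symm).captures_isopycnic (n := n) hp hnd h0
    exact (hc.inSpan (.refl D) K).congr (symField_congr rfl rfl rfl rfl (fun _ _ => rfl) hg)
  · push Not at h0
    refine InSpan.zero.congr ?_
    rw [← symField_zero (n := n)]
    exact symField_congr rfl rfl rfl h0.1 h0.2 hg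

theorem Nondegenerate.exists_const {μ : ℝ} {F g : ℝ → ℝ} (hnd : Nondegenerate D p)
    (hp : Smooth2 D p) (h : IsReduced D p μ F g) : ∃ g₀, ∀ S ∈ D.J.carrier, g S = g₀ :=
  h.exists_const hp fun D' hD' => by
    obtain ⟨ρ, hρ⟩ := D'.I.nonempty
    obtain ⟨S, hS⟩ := D'.J.nonempty
    exact ⟨ρ, hρ, S, hS, (hnd ρ (hD'.1 hρ) S (hD'.2 hS)).1⟩

/-- Every domain has a sub-domain on which the symmetries are exactly those accounted for by the
cases. If some sub-domain has a symmetry with `g ≠ 0`, it is captured on a smaller one, and all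
other symmetries are reduced to `g = 0` by subtracting a multiple of it. -/
theorem exists_symmetriesAre_instanceGenerators (hn : 2 ≤ n) (hp : IsEos D p) :
    ∃ D' : EosDomain, D'.Sub D ∧ ∀ K : KinDomain,
      SymmetriesAre n p (box K D') (instanceGenerators n D' p) := by
  rcases hp.nondegenerate_or n with ⟨D₁, hD₁, hnd⟩ | ⟨D₁, hD₁, c, hc, hc', hi⟩
  · have key : ∃ D₂ : EosDomain, D₂.Sub D₁ ∧ ∀ K : KinDomain, ∀ μ F g, IsReduced D₂ p μ F g →
        InSpan (box K D₂) (instanceGenerators n D₂ p) (symField n 0 0 0 μ F g) := by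
      have hp₁ := hp.mono hD₁
      by_cases hex : ∃ D₂ : EosDomain, D₂.Sub D₁ ∧ ∃ (μ : ℝ) (F : ℝ → ℝ) (g₀ : ℝ), g₀ ≠ 0 ∧
        IsReduced D₂ p μ F (fun _ => g₀)
      · obtain ⟨D₂, hD₂, ν, G, g₀, hg₀, h⟩ := hex
        have hp₂ := hp₁.mono hD₂
        obtain ⟨D₃, hD₃, c, -, -, hc⟩ := h.captures_scaling (n := n) hp₂.smooth2 (hnd.mono hD₂) hg₀
        have hp₃ := hp₂.mono hD₃
        have hnd₃ := (hnd.mono hD₂).mono hD₃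
        refine ⟨D₃, hD₃.trans hD₂, fun K μ F g h' => ?_⟩
        obtain ⟨k, hk⟩ := hnd₃.exists_const hp₃.smooth2 h'
        have h1 := inSpan_of_isopycnic (n := n) hp₃.smooth2 hnd₃
          (h'.add ((h.mono hD₃).smul (-(k / g₀)))) (fun S hS => by rw [hk S hS]; field_simp; ring) K
        refine (h1.add ((hc.inSpan (.refl D₃) K).smul (k / g₀))).congr ?_
        rw [← symField_smul, ← symField_add]
        exact symField_congr (by ring) (by ring) (by ring) (by ring) (fun _ _ => by ring)
          fun _ _ => by ring
      · push Not at hex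
        refine ⟨D₁, .refl D₁, fun K μ F g h => ?_⟩
        obtain ⟨k, hk⟩ := hnd.exists_const hp₁.smooth2 h
        have h' := h.congr (k := fun _ => k) (fun _ _ => rfl) fun S hS => (hk S hS).symm
        refine inSpan_of_isopycnic hp₁.smooth2 hnd h (fun S hS => ?_) K
        by_contra h0
        exact hex D₁ (.refl D₁) μ F k (by rwa [hk S hS] at h0) h'
    obtain ⟨D₂, hD₂, h⟩ := key
    have hD := hD₂.trans hD₁
    have hp₂ := hp.mono hD
    have hi := isInstance_c1 (n := n) hp₂.smooth2
    refine ⟨D₂, hD, fun K => symmetriesAre_of_reduced hn hp₂ (isSymField_instanceGenerators hn)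
      (subset_instanceGenerators hi (EosCase.X1_mem ..))
      (subset_instanceGenerators hi (EosCase.X2_mem ..)) (h K) fun a ha => ?_⟩
    by_cases ha0 : a = 0
    · exact .inl ha0
    · obtain ⟨κ, hκ⟩ := captures_conf (by omega) hp₂.smooth2 (hnd.mono hD₂) ha ha0
      exact .inr (hκ.inSpan (.refl D₂) K)
  · refine ⟨D₁, hD₁, fun K X => ⟨fun hX => ?_, isPointSymmetry_of_inSpan (hp.mono hD₁).smooth2
      (isSymField_instanceGenerators hn)⟩⟩
    have hi' := hi D₁ (.refl D₁)
    exact ((symmetriesAre_of_six_le hn (hp.mono hD₁) (by omega) hi'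
      (fun κ h => by simp [h, EosCase.number] at hc) hc' X).1 hX).mono
        (subset_instanceGenerators hi')

/-! ### Maximality -/

theorem EosCase.three_le_size {c : EosCase} (h : c.number ≠ 1) : 3 ≤ c.size := by
  cases c <;> simp_all [EosCase.number, EosCase.size]

/-- On all sub-domains of `D`, `p` is an instance of no case other than the cases 1 and `i`. -/
def OnlyCase (n : ℕ) (D : EosDomain) (p : ℝ → ℝ → ℝ) (i : ℕ) : Prop :=
  ∀ D' : EosDomain, D'.Sub D → ∀ c : EosCase, IsInstance n D' c p → c.number = 1 ∨ c.number = i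

section
variable {i : ℕ}

theorem OnlyCase.exists_nondegenerate (hno : OnlyCase n D p i) (hi : i ≤ 5) (hp : IsEos D p)
    {D' : EosDomain} (hD : D'.Sub D) : ∃ D'' : EosDomain, D''.Sub D' ∧ Nondegenerate D'' p := by
  rcases (hp.mono hD).nondegenerate_or n with h | ⟨D₁, hD₁, c, hc, -, h⟩
  · exact h
  · rcases hno D₁ (hD₁.trans hD) c (h D₁ (.refl D₁)) with h | h <;> omega

/-- `g` is constant, and zero unless the scaling forms are allowed. -/
theorem OnlyCase.isReduced_const (hno : OnlyCase n D p i) (hi : i ≤ 5) (hp : IsEos D p)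
    {μ : ℝ} {F g : ℝ → ℝ} (h : IsReduced D p μ F g) :
    ∃ g₀, (∀ S ∈ D.J.carrier, g S = g₀) ∧ (i ≤ 3 → g₀ = 0) := by
  obtain ⟨g₀, hg⟩ := h.exists_const hp.smooth2 fun D' hD' => by
    obtain ⟨D'', hD'', hnd⟩ := hno.exists_nondegenerate hi hp hD'
    obtain ⟨ρ, hρ⟩ := D''.I.nonempty
    obtain ⟨S, hS⟩ := D''.J.nonempty
    exact ⟨ρ, hD''.1 hρ, S, hD''.2 hS, (hnd ρ hρ S hS).1⟩
  refine ⟨g₀, hg, fun hi3 => ?_⟩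
  by_contra h0
  obtain ⟨D₁, hD₁, hnd⟩ := hno.exists_nondegenerate hi hp (.refl D)
  obtain ⟨D₂, hD₂, c, h1, h2, hc⟩ := ((h.mono hD₁).congr (k := fun _ => g₀) (fun _ _ => rfl)
    fun S hS => (hg S (hD₁.2 hS)).symm).captures_scaling (n := n) (hp.mono hD₁).smooth2 hnd h0
  rcases hno D₂ (hD₂.trans hD₁) c (hc D₂ (.refl D₂)).1 with h | h <;> omega

/-- A symmetry that fixes `ρ` vanishes unless products or sums are allowed. -/
theorem OnlyCase.isReduced_isopycnic (hno : OnlyCase n D p i) (hi : i ≤ 5) (hp : IsEos D p)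
    {μ : ℝ} {F g : ℝ → ℝ} (h : IsReduced D p μ F g) (hg : ∀ S ∈ D.J.carrier, g S = 0) :
    (i ≠ 2 → μ = 0) ∧ (i ≠ 3 → μ = 0 → ∀ S ∈ D.J.carrier, F S = 0) := by
  have h' := h.congr (k := fun _ => 0) (fun _ _ => rfl) fun S hS => (hg S hS).symm
  constructor
  · intro hi2
    by_contra h0
    obtain ⟨D₁, hD₁, hnd⟩ := hno.exists_nondegenerate hi hp (.refl D)
    obtain ⟨c, h1, hc⟩ := (h'.mono hD₁).captures_prod (n := n) (hp.mono hD₁).smooth2 hnd h0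
    rcases hno D₁ hD₁ c (hc D₁ (.refl D₁)).1 with h | h <;> omega
  · rintro hi3 rfl S hS
    by_contra h0
    obtain ⟨J', h1, h2, h3⟩ := D.J.exists_around hS
      ((h.smoothF.continuousOn.continuousAt (D.J.isOpen.mem_nhds hS)).eventually_ne h0)
    have hD := D.withJ_sub h2
    obtain ⟨D₁, hD₁, hnd⟩ := hno.exists_nondegenerate hi hp hD
    have hD' := hD₁.trans hD
    obtain ⟨s, hs⟩ := D₁.J.nonempty
    obtain ⟨c, h4, hc⟩ := (h'.mono hD').captures_sum (n := n) (hp.mono hD').smooth2 hnd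
      ⟨s, hs, h3 (hD₁.2 hs)⟩
    rcases hno D₁ hD' c (hc D₁ (.refl D₁)).1 with h | h <;> omega

theorem OnlyCase.isReduced_conf_eq_zero (hno : OnlyCase n D p i) (hi : i ≤ 5) (hn : n ≠ 0)
    (hp : IsEos D p) {a : ℝ}
    (h : IsReduced D p a (fun _ => 0) (fun _ => n * a)) : a = 0 := by
  by_contra h0
  obtain ⟨D₁, hD₁, hnd⟩ := hno.exists_nondegenerate hi hp (.refl D)
  obtain ⟨κ, hκ⟩ := captures_conf hn (hp.mono hD₁).smooth2 hnd (h.mono hD₁) h0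
  rcases hno D₁ hD₁ _ (hκ D₁ (.refl D₁)).1 with h | h
  · simp [EosCase.number] at h
  · simp only [EosCase.number] at h; omega

end

/-- An equation of state that is, on every sub-domain, an instance of case 1 only. -/
theorem symmetriesAre_of_general (hn : 2 ≤ n) (hp : IsEos D p) {K : KinDomain}
    (hno : ∀ D' : EosDomain, D'.Sub D → ∀ c : EosCase, IsInstance n D' c p → c.number = 1) :
    SymmetriesAre n p (box K D) {X1, X2} := by
  have hno' : OnlyCase n D p 1 := fun D' hD' c hc => .inl (hno D' hD' c hc)
  refine symmetriesAre_of_reduced hn hp ?_ (.inl rfl) (.inr rfl) (fun μ F g h => ?_) fun a h =>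
    .inl (hno'.isReduced_conf_eq_zero (by omega) (by omega) hp h)
  · rintro X (rfl | rfl)
    exacts [isSymField_X1, isSymField_X2]
  · obtain ⟨g₀, hg, h0⟩ := hno'.isReduced_const (by omega) hp h
    rw [h0 (by omega)] at hg
    obtain ⟨h1, h2⟩ := hno'.isReduced_isopycnic (by omega) hp h hg
    refine InSpan.zero.congr ?_
    rw [← symField_zero (n := n)]
    exact symField_congr rfl rfl rfl (h1 (by omega)) (h2 (by omega) (h1 (by omega))) hg

/-- In the cases `2` to `5`, a multiple of the listed generator is subtracted from a given symmetry
so that the difference is one of those that the absence of other cases excludes. -/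
theorem IsGenericInstance.symmetriesAre (hn : 2 ≤ n) (hp : IsEos D p) {K : KinDomain}
    {c : EosCase} (h : IsGenericInstance n D c p) :
    SymmetriesAre n p (box K D) (c.generators n D) := by
  obtain ⟨hi, hgen⟩ := h
  have hn0 : n ≠ 0 := by omega
  by_cases h6 : 6 ≤ c.number
  · refine symmetriesAre_of_six_le hn hp h6 hi ?_ ?_
    · rintro κ rfl
      have := hgen D (.refl D) (.c8 κ) ⟨hi.1.1, hi.2⟩ (by simp [EosCase.number])
      simp [EosCase.size] at this
    · rintro k rfl
      have := hgen D (.refl D) (.c13 k) ⟨hi.1.1, hi.2⟩ (by simp [EosCase.number])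
      simp [EosCase.size] at this
  have h5 : c.number ≤ 5 := by omega
  have hno : OnlyCase n D p c.number := fun D' hD' c' hc' => by
    by_contra! h
    have h1 := hgen D' hD' c' hc' h.2
    have h2 := EosCase.three_le_size h.1
    have h3 : c.size ≤ 3 := by cases c <;> simp_all [EosCase.number, EosCase.size]
    omega
  have hps := hp.smooth2
  have hconf := fun a => hno.isReduced_conf_eq_zero (a := a) h5 hn0 hp
  by_cases h1 : c.number = 1
  · have := symmetriesAre_of_general (K := K) hn hp fun D' hD' c' hc' => by
      have := hno D' hD' c' hc'
      omega
    cases c <;> simp_all [EosCase.number, EosCase.generators]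
  refine symmetriesAre_of_reduced hn hp (fun X hX => hi.isSymField hn hX) (c.X1_mem n D)
    (c.X2_mem n D) (fun μ F g h => ?_) fun a ha => .inl (hconf a ha)
  obtain ⟨ha, p₀, he⟩ := hi
  obtain ⟨g₀, hg, h0⟩ := hno.isReduced_const h5 hp h
  cases c with
  | c2 κ f =>
    rw [h0 (by simp [EosCase.number])] at hg
    have h' := h.add ((isReduced_prod hps ha.1 ha.2.1 he).smul (-μ))
    have h1 := (hno.isReduced_isopycnic h5 hp h' fun S hS => by rw [hg S hS]; ring).2
      (by simp [EosCase.number]) (by ring)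
    exact inSpan_symField_of_smul (x := μ) (Xprod_eq n κ) (.inr (.inr rfl)) (by ring)
      (fun S hS => by linarith [h1 S hS]) (fun S hS => by rw [hg S hS]; ring)
  | c3 κ f =>
    rw [h0 (by simp [EosCase.number])] at hg
    have hμ := (hno.isReduced_isopycnic h5 hp h hg).1 (by simp [EosCase.number])
    subst hμ
    obtain ⟨C, hC⟩ := h.exists_integral hps hg
    obtain ⟨ρ, hρ⟩ := D.I.nonempty
    refine inSpan_symField_of_smul (x := C) (Xsum_eq n κ) (.inr (.inr rfl)) (by ring)
      (fun S hS => ?_) (fun S hS => by rw [hg S hS]; ring)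
    have e : dS p ρ S = deriv κ S := (dS_congr he hρ hS).trans
      (((ha.1.hasDerivAt hS).add_const (f ρ)).add_const p₀).deriv
    have h1 := hC ρ hρ S hS
    rw [e] at h1
    have h2 := ha.1.2 S hS
    field_simp
    linarith
  | c4 κ f q =>
    have h' := h.add ((isReduced_scal hps ha.1 ha.2.1.1 he).smul (-(g₀ / 2)))
    obtain ⟨h1, h2⟩ := hno.isReduced_isopycnic h5 hp h' fun S hS => by rw [hg S hS]; ring
    have h1 := h1 (by simp [EosCase.number])
    have h2 := h2 (by simp [EosCase.number]) h1
    exact inSpan_symField_of_smul (x := g₀ / 2) (Xscal_eq n κ q) (.inr (.inr rfl)) (by linarith)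
      (fun S hS => by linarith [h2 S hS]) (fun S hS => by rw [hg S hS]; ring)
  | c5 κ f k =>
    have h' := h.add ((isReduced_logScal hps ha.1 ha.2.1 he).smul (g₀ / 2))
    obtain ⟨h1, h2⟩ := hno.isReduced_isopycnic h5 hp h' fun S hS => by rw [hg S hS]; ring
    have h1 := h1 (by simp [EosCase.number])
    have h2 := h2 (by simp [EosCase.number]) h1
    exact inSpan_symField_of_smul (x := -(g₀ / 2)) (XlogScal_eq n κ) (.inr (.inr rfl))
      (by linarith) (fun S hS => by linarith [h2 S hS]) (fun S hS => by rw [hg S hS]; ring)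
  | _ => simp_all [EosCase.number]

end

/-! ### Exceptional equations of state -/

section
variable {n : ℕ} {D : EosDomain} {p : ℝ → ℝ → ℝ}

theorem EosDomain.nonconst_log (D : EosDomain) {k : ℝ} (hk : k ≠ 0) :
    NonconstSmooth (fun ρ => k * Real.log ρ) D.I.carrier := by
  obtain ⟨ρ, hρ⟩ := D.I.nonempty
  refine nonconstSmooth_of_deriv (contDiffOn_const.mul D.contDiffOn_log) hρ ?_
  have h0 := (D.ρ_pos hρ).ne'
  rw [((Real.hasDerivAt_log h0).const_mul k).deriv]
  exact mul_ne_zero hk (inv_ne_zero h0)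

theorem EosDomain.nonconst_rpow (D : EosDomain) {k q : ℝ} (hk : k ≠ 0) (hq : q ≠ -1) :
    NonconstSmooth (fun ρ => k * ρ ^ (1 + q)) D.I.carrier := by
  obtain ⟨ρ, hρ⟩ := D.I.nonempty
  refine nonconstSmooth_of_deriv (contDiffOn_const.mul (D.contDiffOn_rpow _)) hρ ?_
  rw [((hasDerivAt_rpow_one_add (D.ρ_pos hρ) q).const_mul k).deriv]
  exact mul_ne_zero hk (mul_ne_zero (fun h => hq (by linarith))
    (Real.rpow_pos_of_pos (D.ρ_pos hρ) _).ne')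

theorem two_div_ne_neg_one (n : ℕ) : 2 / (n : ℝ) ≠ -1 := by
  have : 0 ≤ 2 / (n : ℝ) := by positivity
  linarith

theorem IsInstance.isExceptional {c : EosCase} (h : IsInstance n D c p) (hc : c.number ≠ 1) :
    IsExceptional n D p := by
  obtain ⟨ha, p₀, he⟩ := h
  refine ⟨p₀, c.eos n, he, ?_⟩
  cases c with
  | c1 f => exact (hc rfl).elim
  | c2 κ f => exact .inl ⟨κ, f, ha.1, ha.2, rfl⟩
  | c3 κ f => exact .inr (.inl ⟨κ, f, ha.1, ha.2, by funext ρ S; exact add_comm _ _⟩)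
  | c4 κ f q => exact .inr (.inr (.inl ⟨κ, f, q, ha.1, ha.2.1, ha.2.2, rfl⟩))
  | c5 κ f k => exact .inr (.inr (.inr (.inl ⟨κ, f, k, ha.1, ha.2, rfl⟩)))
  | c6 κ q =>
    refine .inl ⟨κ, fun ρ => ρ ^ (1 + q), ha.1, ?_, rfl⟩
    simpa using D.nonconst_rpow one_ne_zero ha.2
  | c7 κ k => exact .inr (.inl ⟨κ, _, ha.1, D.nonconst_log ha.2, by funext ρ S; exact add_comm _ _⟩)
  | c8 κ => exact .inr (.inr (.inr (.inr (.inr (.inl ⟨κ, ha, rfl⟩)))))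
  | c9 f => exact .inr (.inr (.inr (.inr (.inl ⟨f, ha.1, rfl⟩))))
  | c10 κ => exact .inr (.inr (.inr (.inr (.inr (.inr ⟨κ, ha, rfl⟩)))))
  | c11 k => exact .inr (.inr (.inr (.inr (.inl ⟨_, D.nonconst_log ha, rfl⟩))))
  | c12 k q => exact .inr (.inr (.inr (.inr (.inl ⟨_, D.nonconst_rpow ha.1 ha.2, rfl⟩))))
  | c13 k =>
    exact .inr (.inr (.inr (.inr (.inl ⟨_, D.nonconst_rpow ha (two_div_ne_neg_one n), rfl⟩))))

/-- A combination of `X1` and `X2` moves neither `ρ` nor `S` nor `U`. -/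
theorem symField_not_inSpan {K : KinDomain} {μ : ℝ} {F g : ℝ → ℝ}
    (h : InSpan (box K D) {X1, X2} (symField n 0 0 0 μ F g)) :
    μ = 0 ∧ (∀ S ∈ D.J.carrier, F S = 0) ∧ ∀ S ∈ D.J.carrier, g S = 0 := by
  obtain ⟨c₁, c₂, h1⟩ := h.induction (P := fun X => ∃ c₁ c₂,
    EqOn X (symField n c₁ c₂ 0 0 (fun _ => 0) (fun _ => 0)) (box K D))
    (by
      rintro X (rfl | rfl)
      · exact ⟨1, 0, fun z _ => by rw [X1_eq n]⟩
      · exact ⟨0, 1, fun z _ => by rw [X2_eq n]⟩)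
    ⟨0, 0, fun z _ => by rw [symField_zero]⟩
    (fun X Y ⟨c₁, c₂, h1⟩ ⟨d₁, d₂, h2⟩ => ⟨c₁ + d₁, c₂ + d₂, fun z hz => by
      have := symField_add (n := n) c₁ c₂ 0 0 d₁ d₂ 0 0 (fun _ => 0) (fun _ => 0) (fun _ => 0)
        (fun _ => 0)
      simp only [add_zero] at this
      rw [this, Pi.add_apply, Pi.add_apply, h1 hz, h2 hz]⟩)
    (fun x X ⟨c₁, c₂, h1⟩ => ⟨x * c₁, x * c₂, fun z hz => by
      have := symField_smul (n := n) x c₁ c₂ 0 0 (fun _ => 0) (fun _ => 0)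
      simp only [mul_zero] at this
      rw [this, Pi.smul_apply, Pi.smul_apply, h1 hz]⟩)
    (fun X Y ⟨c₁, c₂, h1⟩ h2 => ⟨c₁, c₂, h2.trans h1⟩)
  have h2 : EqOn (symField n (0 + -1 * c₁) (0 + -1 * c₂) (0 + -1 * 0) (μ + -1 * 0)
      (fun S => F S + -1 * 0) (fun S => g S + -1 * 0)) 0 (box K D) := fun z hz => by
    rw [symField_add, symField_smul, Pi.add_apply, h1 hz]
    simp
  obtain ⟨-, -, -, e1, e2, e3⟩ := symField_eq_zero h2
  exact ⟨by linarith, fun S hS => by linarith [e2 S hS], fun S hS => by linarith [e3 S hS]⟩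

theorem IsExceptional.exists_symmetry (hn : n ≠ 0) (h : IsExceptional n D p) (hp : Smooth2 D p)
    (K : KinDomain) : ∃ X : VField, IsPointSymmetry n p (box K D) X ∧
      ¬ InSpan (box K D) {X1, X2} X := by
  obtain ⟨S₀, hS₀⟩ := D.J.nonempty
  have key : ∀ μ F g, IsReduced D p μ F g →
      (μ ≠ 0 ∨ (∃ S ∈ D.J.carrier, F S ≠ 0) ∨ ∃ S ∈ D.J.carrier, g S ≠ 0) →
      ∃ X : VField, IsPointSymmetry n p (box K D) X ∧ ¬ InSpan (box K D) {X1, X2} X := by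
    intro μ F g hr h0
    refine ⟨_, (hr.isSymField (n := n)).isPointSymmetry hp K, fun hs => ?_⟩
    obtain ⟨h1, h2, h3⟩ := symField_not_inSpan hs
    rcases h0 with h0 | ⟨S, hS, h0⟩ | ⟨S, hS, h0⟩
    exacts [h0 h1, h0 (h2 S hS), h0 (h3 S hS)]
  obtain ⟨p₀, g, he, h⟩ := h
  rcases h with ⟨κ, f, hκ, hf, rfl⟩ | ⟨κ, f, hκ, hf, rfl⟩ | ⟨κ, f, q, hκ, hf, -, rfl⟩ |
    ⟨κ, f, k, hκ, hf, rfl⟩ | ⟨f, -, rfl⟩ | ⟨κ, hκ, rfl⟩ | ⟨κ, hκ, rfl⟩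
  · exact key _ _ _ (isReduced_prod hp hκ hf.1 he) (.inl one_ne_zero)
  · refine key _ _ _ (isReduced_sum (p₀ := p₀) hp hκ hf.1 fun ρ hρ S hS => ?_)
      (.inr (.inl ⟨S₀, hS₀, one_div_ne_zero (hκ.2 S₀ hS₀)⟩))
    rw [he ρ hρ S hS, add_comm (κ S)]
  · exact key _ _ _ (isReduced_scal hp hκ hf.1 he) (.inr (.inr ⟨S₀, hS₀, two_ne_zero⟩))
  · exact key _ _ _ (isReduced_logScal hp hκ hf.1 he) (.inl one_ne_zero)
  · exact key _ (fun _ => 1) _ (isReduced_ent hp contDiffOn_const (dS_eq_zero_of_barotropic he))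
      (.inr (.inl ⟨S₀, hS₀, one_ne_zero⟩))
  · exact key _ _ _ (isReduced_conf hn hp hκ.1 he) (.inl one_ne_zero)
  · refine key _ _ _ (isReduced_log (κ := κ) (k := 0) (p₀ := p₀) hp hκ.1 fun ρ hρ S hS => ?_)
      (.inl one_ne_zero)
    rw [he ρ hρ S hS]; ring

/-! ### Examples -/

theorem isEos_of_deriv (hp : Smooth2 D p) (h : ∀ ρ ∈ D.I.carrier, ∀ S ∈ D.J.carrier,
    dρ p ρ S ≠ 0 ∨ dS p ρ S ≠ 0) : IsEos D p := by
  refine ⟨hp, fun D' hD' => ?_⟩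
  by_contra! hc
  obtain ⟨ρ, hρ⟩ := D'.I.nonempty
  obtain ⟨S, hS⟩ := D'.J.nonempty
  rcases h ρ (hD'.1 hρ) S (hD'.2 hS) with h | h
  · exact h ((dρ_congr (D := D') (k := fun _ _ => p ρ S)
      (fun x hx s hs => hc x hx s hs ρ hρ S hS) hρ hS).trans (deriv_const _ _))
  · exact h ((dS_congr (D := D') (k := fun _ _ => p ρ S)
      (fun x hx s hs => hc x hx s hs ρ hρ S hS) hρ hS).trans (deriv_const _ _))

/-- What the examples use of the fact that `p` is an instance of a case: symmetries and derivatives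
that distinguish the equations of state of a case. -/
def EosCase.Footprint (n : ℕ) (D : EosDomain) (p : ℝ → ℝ → ℝ) : EosCase → Prop
  | c1 _ => True
  | c2 _ _ => ∃ F, IsReduced D p 1 F (fun _ => 0)
  | c3 _ _ => (∃ F, IsReduced D p 0 F (fun _ => 0) ∧ ∃ S ∈ D.J.carrier, F S ≠ 0) ∧
      ∀ ρ ∈ D.I.carrier, ∀ S ∈ D.J.carrier, dS p ρ S ≠ 0
  | c4 _ _ q => q ≠ -1 ∧ ∃ F, IsReduced D p q F (fun _ => 2)
  | c5 _ _ _ => ∃ F, IsReduced D p 1 F (fun _ => -2)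
  | c6 _ q => q ≠ -1 ∧ IsReduced D p q (fun _ => 0) (fun _ => 2) ∧
      ∀ ρ ∈ D.I.carrier, ∀ S ∈ D.J.carrier, dS p ρ S ≠ 0
  | c7 _ _ => IsReduced D p 1 (fun _ => 0) (fun _ => -2) ∧
      ∀ ρ ∈ D.I.carrier, ∀ S ∈ D.J.carrier, dρ p ρ S ≠ 0 ∧ dS p ρ S ≠ 0
  | c8 _ => IsReduced D p 1 (fun _ => 0) (fun _ => n) ∧
      ∀ ρ ∈ D.I.carrier, ∀ S ∈ D.J.carrier, dS p ρ S ≠ 0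
  | c9 _ => ∀ ρ ∈ D.I.carrier, ∀ S ∈ D.J.carrier, dS p ρ S = 0
  | c10 _ => IsReduced D p 1 (fun _ => 0) (fun _ => -2) ∧
      ∀ ρ ∈ D.I.carrier, ∀ S ∈ D.J.carrier, dρ p ρ S = 0 ∧ dS p ρ S ≠ 0
  | c11 _ => IsReduced D p 1 (fun _ => 0) (fun _ => -2) ∧
      ∀ ρ ∈ D.I.carrier, ∀ S ∈ D.J.carrier, dS p ρ S = 0
  | c12 _ q => q ≠ -1 ∧ IsReduced D p q (fun _ => 0) (fun _ => 2) ∧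
      ∀ ρ ∈ D.I.carrier, ∀ S ∈ D.J.carrier, dS p ρ S = 0
  | c13 _ => IsReduced D p 1 (fun _ => 0) (fun _ => n) ∧
      ∀ ρ ∈ D.I.carrier, ∀ S ∈ D.J.carrier, dS p ρ S = 0

theorem IsInstance.footprint {c : EosCase} (hn : n ≠ 0) (h : IsInstance n D c p) :
    c.Footprint n D p := by
  have hp := h.smooth2
  obtain ⟨ha, p₀, he⟩ := h
  obtain ⟨S₀, hS₀⟩ := D.J.nonempty
  have hpow : ∀ {κ : ℝ → ℝ} {q : ℝ}, Regular κ D.J →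
      (∀ ρ ∈ D.I.carrier, ∀ S ∈ D.J.carrier, p ρ S = κ S * ρ ^ (1 + q) + p₀) →
      ∀ ρ ∈ D.I.carrier, ∀ S ∈ D.J.carrier, dS p ρ S ≠ 0 := fun hκ he ρ hρ S hS => by
    rw [(dS_congr he hρ hS).trans (((hκ.hasDerivAt hS).mul_const _).add_const p₀).deriv]
    exact mul_ne_zero (hκ.2 S hS) (Real.rpow_pos_of_pos (D.ρ_pos hρ) _).ne'
  have hconf : ∀ {κ : ℝ → ℝ}, ContDiffOn ℝ ∞ κ D.J.carrier →
      (∀ ρ ∈ D.I.carrier, ∀ S ∈ D.J.carrier, p ρ S = κ S * ρ ^ (1 + 2 / (n : ℝ)) + p₀) →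
      IsReduced D p 1 (fun _ => 0) (fun _ => n) := fun hκ he =>
    (isReduced_conf hn hp hκ he).congr (fun _ _ => rfl) fun _ _ => (mul_one _).symm
  cases c with
  | c1 f => trivial
  | c2 κ f => exact ⟨_, isReduced_prod hp ha.1 ha.2.1 he⟩
  | c3 κ f =>
    refine ⟨⟨_, isReduced_sum hp ha.1 ha.2.1 he, S₀, hS₀, one_div_ne_zero (ha.1.2 S₀ hS₀)⟩,
      fun ρ hρ S hS => ?_⟩
    rw [(dS_congr he hρ hS).trans (((ha.1.hasDerivAt hS).add_const (f ρ)).add_const p₀).deriv]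
    exact ha.1.2 S hS
  | c4 κ f q => exact ⟨ha.2.2, _, isReduced_scal hp ha.1 ha.2.1.1 he⟩
  | c5 κ f k => exact ⟨_, isReduced_logScal hp ha.1 ha.2.1 he⟩
  | c6 κ q => exact ⟨ha.2, isReduced_pow hp ha.1.1 he, hpow ha.1 he⟩
  | c7 κ k =>
    refine ⟨isReduced_log hp ha.1.1 he, fun ρ hρ S hS => ⟨?_, ?_⟩⟩
    · have h0 := (D.ρ_pos hρ).ne'
      rw [(dρ_congr he hρ hS).trans
        ((((Real.hasDerivAt_log h0).const_mul k).const_add (κ S)).add_const p₀).deriv]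
      exact mul_ne_zero ha.2 (inv_ne_zero h0)
    · rw [(dS_congr he hρ hS).trans
        (((ha.1.hasDerivAt hS).add_const (k * Real.log ρ)).add_const p₀).deriv]
      exact ha.1.2 S hS
  | c8 κ => exact ⟨hconf ha.1 he, hpow ha he⟩
  | c9 f => exact dS_eq_zero_of_barotropic he
  | c10 κ =>
    have ha' : Regular κ D.J := ha
    refine ⟨isReduced_log (κ := κ) (k := 0) (p₀ := p₀) hp ha.1 fun ρ hρ S hS => by
      rw [he ρ hρ S hS]; simp [EosCase.eos], fun ρ hρ S hS => ⟨?_, ?_⟩⟩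
    · exact (dρ_congr he hρ hS).trans (deriv_const ρ (κ S + p₀))
    · rw [(dS_congr he hρ hS).trans ((ha'.hasDerivAt hS).add_const p₀).deriv]
      exact ha.2 S hS
  | c11 k =>
    exact ⟨isReduced_log (κ := fun _ => 0) (k := k) (p₀ := p₀) hp contDiffOn_const
      fun ρ hρ S hS => by rw [he ρ hρ S hS]; simp [EosCase.eos], dS_eq_zero_of_barotropic he⟩
  | c12 k q =>
    exact ⟨ha.2, isReduced_pow (κ := fun _ => k) hp contDiffOn_const he,
      dS_eq_zero_of_barotropic he⟩
  | c13 k => exact ⟨hconf (κ := fun _ => k) contDiffOn_const he, dS_eq_zero_of_barotropic he⟩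

theorem OpenInterval.quadratic_eq_zero (A : OpenInterval) {a b c : ℝ}
    (h : ∀ x ∈ A.carrier, a + b * x + c * x ^ 2 = 0) : a = 0 ∧ b = 0 ∧ c = 0 := by
  obtain ⟨x, hx⟩ := A.nonempty
  obtain ⟨ε, hε, hball⟩ := Metric.isOpen_iff.1 A.isOpen x hx
  have e1 := h _ (hball (show x + ε / 2 ∈ _ by
    rw [Metric.mem_ball, Real.dist_eq, show x + ε / 2 - x = ε / 2 by ring,
      abs_of_pos] <;> linarith))
  have e2 := h _ (hball (show x - ε / 2 ∈ _ by
    rw [Metric.mem_ball, Real.dist_eq, show x - ε / 2 - x = -(ε / 2) by ring, abs_neg,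
      abs_of_pos] <;> linarith))
  have e0 := h x hx
  have hc : c = 0 := by
    have : c * ε ^ 2 = 0 := by linear_combination 2 * (e1 + e2 - 2 * e0)
    simpa [hε.ne'] using this
  subst hc
  have hb : b = 0 := by
    have : b * ε = 0 := by linear_combination e1 - e2
    simpa [hε.ne'] using this
  subst hb
  exact ⟨by linarith, rfl, rfl⟩

/-- The reduced equations for a polynomial of degree three in the density. -/
theorem IsReduced.cubic_relation {μ : ℝ} {F g A B C E A' B' C' : ℝ → ℝ} (h : IsReduced D p μ F g)
    (hA : ∀ S ∈ D.J.carrier, HasDerivAt A (A' S) S) (hB : ∀ S ∈ D.J.carrier, HasDerivAt B (B' S) S)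
    (hC : ∀ S ∈ D.J.carrier, HasDerivAt C (C' S) S)
    (he : ∀ ρ ∈ D.I.carrier, ∀ S ∈ D.J.carrier,
      p ρ S = E S + A S * ρ + B S * ρ ^ 2 + C S * ρ ^ 3) :
    ∀ S ∈ D.J.carrier, F S * A' S = 2 * μ * A S ∧ F S * B' S = (2 * μ - g S) * B S ∧
      F S * C' S = (2 * μ - 2 * g S) * C S := by
  intro S hS
  have e1 : ∀ ρ ∈ D.I.carrier, ∀ S ∈ D.J.carrier,
      dρ p ρ S = A S + 2 * B S * ρ + 3 * C S * ρ ^ 2 := fun ρ hρ S hS => by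
    refine (dρ_congr he hρ hS).trans (HasDerivAt.deriv ?_)
    refine (((((hasDerivAt_id ρ).const_mul (A S)).const_add (E S)).add
      ((hasDerivAt_pow 2 ρ).const_mul (B S))).add
      ((hasDerivAt_pow 3 ρ).const_mul (C S))).congr_deriv ?_
    norm_num
    ring
  have e2 : ∀ ρ ∈ D.I.carrier, dρ (dρ p) ρ S = 2 * B S + 6 * C S * ρ := fun ρ hρ => by
    refine (dρ_congr (k := fun ρ S => A S + 2 * B S * ρ + 3 * C S * ρ ^ 2) e1 hρ hS).trans
      (HasDerivAt.deriv ?_)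
    refine ((((hasDerivAt_id ρ).const_mul (2 * B S)).const_add (A S)).add
      ((hasDerivAt_pow 2 ρ).const_mul (3 * C S))).congr_deriv ?_
    norm_num
    ring
  have e3 : ∀ ρ ∈ D.I.carrier, dS (dρ p) ρ S = A' S + 2 * B' S * ρ + 3 * C' S * ρ ^ 2 :=
    fun ρ hρ => by
      refine (dS_congr (k := fun ρ S => A S + 2 * B S * ρ + 3 * C S * ρ ^ 2) e1 hρ hS).trans
        (HasDerivAt.deriv ?_)
      exact ((hA S hS).add (((hB S hS).const_mul 2).mul_const ρ)).add
        (((hC S hS).const_mul 3).mul_const (ρ ^ 2))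
  obtain ⟨h1, h2, h3⟩ := D.I.quadratic_eq_zero (a := F S * A' S - 2 * μ * A S)
    (b := 2 * (F S * B' S - (2 * μ - g S) * B S))
    (c := 3 * (F S * C' S - (2 * μ - 2 * g S) * C S)) fun ρ hρ => by
      have := h.eqρ ρ hρ S hS
      rw [e1 ρ hρ S hS, e2 ρ hρ, e3 ρ hρ] at this
      linear_combination this
  exact ⟨by linarith, by linarith, by linarith⟩

end

section
variable {n : ℕ}

/-- The interval `(0, ∞)`. -/
def halfLine : OpenInterval := ⟨Ioi 0, isOpen_Ioi, ⟨1, mem_Ioi.2 one_pos⟩, ordConnected_Ioi⟩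

/-- The domain of all `ρ > 0`, `S > 0`. -/
def quadrant : EosDomain := ⟨halfLine, halfLine, Subset.rfl⟩

theorem regular_id : Regular (fun S => S) halfLine :=
  ⟨contDiffOn_id, fun S _ => by simp⟩

theorem mem_halfLine {x : ℝ} : x ∈ halfLine.carrier ↔ 0 < x := Iff.rfl

theorem nonconstSmooth_add_sq {s : Set ℝ} (h1 : (1 : ℝ) ∈ s) (h2 : (2 : ℝ) ∈ s) :
    NonconstSmooth (fun x => x + x ^ 2) s :=
  ⟨by fun_prop, 1, h1, 2, h2, by norm_num⟩

theorem mem_values_id {x : ℝ} (hx : 0 < x) : x ∈ quadrant.values fun S => S :=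
  ⟨x, hx, 1, mem_halfLine.2 one_pos, (one_mul x).symm⟩

/-- To realize a case on `quadrant` by its own equation of state, with the other cases excluded
through their footprints. -/
theorem EosCase.occurs {c : EosCase} {i : ℕ} (hi : c.number = i) (hn : n ≠ 0)
    (ha : c.Admissible quadrant)
    (hd : ∀ ρ : ℝ, 0 < ρ → ∀ S : ℝ, 0 < S →
      dρ (c.eos n) ρ S ≠ 0 ∨ dS (c.eos n) ρ S ≠ 0)
    (h : ∀ D : EosDomain, D.Sub quadrant → ∀ c' : EosCase, c'.Footprint n D (c.eos n) →
      c'.number ≠ c.number → c'.size < c.size) :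
    ∃ (D : EosDomain) (p : ℝ → ℝ → ℝ) (c : EosCase), c.number = i ∧ IsEos D p ∧
      IsGenericInstance n D c p :=
  ⟨quadrant, c.eos n, c, hi, isEos_of_deriv (ha.smooth2 n) hd,
    ⟨ha, 0, fun _ _ _ _ => (add_zero _).symm⟩,
    fun D hD c' hc' => h D hD c' (hc'.footprint hn)⟩

/-- Realization of the cases `1` to `5`: there `R S μ (F S) (g S)` stands for the relations that
the reduced equations impose on symmetries. -/
theorem EosCase.occurs_of_relation {c : EosCase} {i : ℕ} (hi : c.number = i)
    (hn : n ≠ 0) (ha : c.Admissible quadrant)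
    (hd : ∀ ρ : ℝ, 0 < ρ → ∀ S : ℝ, 0 < S → dρ (c.eos n) ρ S ≠ 0 ∧ dS (c.eos n) ρ S ≠ 0)
    (R : ℝ → ℝ → ℝ → ℝ → Prop)
    (hR : ∀ D : EosDomain, D.Sub quadrant → ∀ μ F g, IsReduced D (c.eos n) μ F g →
      ∀ S ∈ D.J.carrier, R S μ (F S) (g S))
    (h2 : i ≠ 2 → ∀ S x : ℝ, 0 < S → ¬ R S 1 x 0)
    (h3 : i ≠ 3 → ∀ S x : ℝ, 0 < S → x ≠ 0 → ¬ R S 0 x 0)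
    (h4 : i ≠ 4 → ∀ S x q : ℝ, 0 < S → q ≠ -1 → ¬ R S q x 2)
    (h5 : i ≠ 5 → ∀ S x : ℝ, 0 < S → ¬ R S 1 x (-2))
    (h6 : ∀ S q : ℝ, 0 < S → q ≠ -1 → ¬ R S q 0 2)
    (h7 : ∀ S : ℝ, 0 < S → ¬ R S 1 0 (-2))
    (h8 : ∀ S : ℝ, 0 < S → ¬ R S 1 0 n) :
    ∃ (D : EosDomain) (p : ℝ → ℝ → ℝ) (c : EosCase), c.number = i ∧ IsEos D p ∧
      IsGenericInstance n D c p := by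
  refine EosCase.occurs hi hn ha (fun ρ hρ S hS => .inl (hd ρ hρ S hS).1) fun D hD c' hf hc' => ?_
  have hR := hR D hD
  obtain ⟨ρ, hρ⟩ := D.I.nonempty
  obtain ⟨S, hS⟩ := D.J.nonempty
  have hJ : ∀ S ∈ D.J.carrier, 0 < S := fun S hS => hD.2 hS
  have hd0 := hd ρ (hD.1 hρ) S (hD.2 hS)
  rw [hi] at hc'
  cases c' with
  | c1 f => exact EosCase.three_le_size (hi ▸ hc'.symm)
  | c2 κ f =>
    obtain ⟨F, hr⟩ := hf
    exact absurd (hR _ _ _ hr S hS) (h2 hc'.symm S _ (hJ S hS))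
  | c3 κ f =>
    obtain ⟨⟨F, hr, S', hS', h0⟩, -⟩ := hf
    exact absurd (hR _ _ _ hr S' hS') (h3 hc'.symm S' _ (hJ S' hS') h0)
  | c4 κ f q =>
    obtain ⟨hq, F, hr⟩ := hf
    exact absurd (hR _ _ _ hr S hS) (h4 hc'.symm S _ q (hJ S hS) hq)
  | c5 κ f k =>
    obtain ⟨F, hr⟩ := hf
    exact absurd (hR _ _ _ hr S hS) (h5 hc'.symm S _ (hJ S hS))
  | c6 κ q => exact absurd (hR _ _ _ hf.2.1 S hS) (h6 S q (hJ S hS) hf.1)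
  | c7 κ k => exact absurd (hR _ _ _ hf.1 S hS) (h7 S (hJ S hS))
  | c8 κ => exact absurd (hR _ _ _ hf.1 S hS) (h8 S (hJ S hS))
  | c9 f => exact absurd (hf ρ hρ S hS) hd0.2
  | c10 κ => exact absurd (hf.2 ρ hρ S hS).1 hd0.1
  | c11 k => exact absurd (hf.2 ρ hρ S hS) hd0.2
  | c12 k q => exact absurd (hf.2.2 ρ hρ S hS) hd0.2
  | c13 k => exact absurd (hf.2 ρ hρ S hS) hd0.2

theorem dρ_eq {p : ℝ → ℝ → ℝ} {p' ρ S : ℝ} (h : HasDerivAt (fun x => p x S) p' ρ) :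
    dρ p ρ S = p' := h.deriv

theorem dS_eq {p : ℝ → ℝ → ℝ} {p' ρ S : ℝ} (h : HasDerivAt (fun s => p ρ s) p' S) :
    dS p ρ S = p' := h.deriv

theorem hasDerivAt_sq (x : ℝ) : HasDerivAt (fun x : ℝ => x ^ 2) (2 * x) x := by
  simpa using hasDerivAt_pow 2 x

theorem hasDerivAt_cube (x : ℝ) : HasDerivAt (fun x : ℝ => x ^ 3) (3 * x ^ 2) x := by
  simpa using hasDerivAt_pow 3 x

/-- The derivatives of `E + A ρ + B ρ² + C ρ³`. -/
theorem deriv_cubic {p : ℝ → ℝ → ℝ} {A B C E : ℝ → ℝ} {A' B' C' E' ρ S : ℝ} (hρ : 0 < ρ)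
    (hS : 0 < S) (hA : HasDerivAt A A' S) (hB : HasDerivAt B B' S)
    (hC : HasDerivAt C C' S) (hE : HasDerivAt E E' S)
    (he : ∀ ρ : ℝ, 0 < ρ → ∀ S : ℝ, 0 < S → p ρ S = E S + A S * ρ + B S * ρ ^ 2 + C S * ρ ^ 3) :
    dρ p ρ S = A S + 2 * B S * ρ + 3 * C S * ρ ^ 2 ∧
      dS p ρ S = E' + A' * ρ + B' * ρ ^ 2 + C' * ρ ^ 3 := by
  constructor
  · rw [dρ_congr (D := quadrant) (fun ρ hρ S hS => he ρ hρ S hS) hρ hS]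
    refine dρ_eq ((((((hasDerivAt_id ρ).const_mul (A S)).const_add (E S)).add
      ((hasDerivAt_sq ρ).const_mul (B S))).add
      ((hasDerivAt_cube ρ).const_mul (C S))).congr_deriv ?_)
    ring
  · rw [dS_congr (D := quadrant) (fun ρ hρ S hS => he ρ hρ S hS) hρ hS]
    exact dS_eq (((hE.add (hA.mul_const ρ)).add (hB.mul_const _)).add (hC.mul_const _))

/-- Realization of the cases `1` to `5` by a polynomial of degree three in the density. -/
theorem EosCase.occurs_of_cubic {c : EosCase} {i : ℕ} (hi : c.number = i)
    (hn : n ≠ 0) (ha : c.Admissible quadrant) (A B C E : ℝ → ℝ) {A' B' C' E' : ℝ → ℝ}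
    (hA : ∀ S, HasDerivAt A (A' S) S) (hB : ∀ S, HasDerivAt B (B' S) S)
    (hC : ∀ S, HasDerivAt C (C' S) S) (hE : ∀ S, HasDerivAt E (E' S) S)
    (he : ∀ ρ : ℝ, 0 < ρ → ∀ S : ℝ, 0 < S →
      c.eos n ρ S = E S + A S * ρ + B S * ρ ^ 2 + C S * ρ ^ 3)
    (hd : ∀ ρ : ℝ, 0 < ρ → ∀ S : ℝ, 0 < S → 0 < A S + 2 * B S * ρ + 3 * C S * ρ ^ 2 ∧
      0 < E' S + A' S * ρ + B' S * ρ ^ 2 + C' S * ρ ^ 3)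
    (h : ∀ S μ F g : ℝ, 0 < S → F * A' S = 2 * μ * A S → F * B' S = (2 * μ - g) * B S →
      F * C' S = (2 * μ - 2 * g) * C S →
      (μ = 1 ∧ g = 0 → i = 2) ∧ (μ = 0 ∧ g = 0 ∧ F ≠ 0 → i = 3) ∧
      (μ ≠ -1 ∧ g = 2 → i = 4 ∧ F ≠ 0) ∧ (μ = 1 ∧ g = -2 → i = 5 ∧ F ≠ 0) ∧
      (μ = 1 → F ≠ 0 ∨ g ≠ n)) :
    ∃ (D : EosDomain) (p : ℝ → ℝ → ℝ) (c : EosCase), c.number = i ∧ IsEos D p ∧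
      IsGenericInstance n D c p := by
  refine EosCase.occurs_of_relation hi hn ha (fun ρ hρ S hS => ?_)
    (fun S μ F g => F * A' S = 2 * μ * A S ∧ F * B' S = (2 * μ - g) * B S ∧
      F * C' S = (2 * μ - 2 * g) * C S)
    (fun D hD μ F g hr => hr.cubic_relation (fun S _ => hA S) (fun S _ => hB S)
      (fun S _ => hC S) fun ρ hρ S hS => he ρ (hD.1 hρ) S (hD.2 hS))
    (fun h0 S x hS hR => h0 ((h S _ _ _ hS hR.1 hR.2.1 hR.2.2).1 ⟨rfl, rfl⟩))
    (fun h0 S x hS hx hR => h0 ((h S _ _ _ hS hR.1 hR.2.1 hR.2.2).2.1 ⟨rfl, rfl, hx⟩))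
    (fun h0 S x q hS hq hR => h0 ((h S _ _ _ hS hR.1 hR.2.1 hR.2.2).2.2.1 ⟨hq, rfl⟩).1)
    (fun h0 S x hS hR => h0 ((h S _ _ _ hS hR.1 hR.2.1 hR.2.2).2.2.2.1 ⟨rfl, rfl⟩).1)
    (fun S q hS hq hR => ((h S _ _ _ hS hR.1 hR.2.1 hR.2.2).2.2.1 ⟨hq, rfl⟩).2 rfl)
    (fun S hS hR => ((h S _ _ _ hS hR.1 hR.2.1 hR.2.2).2.2.2.1 ⟨rfl, rfl⟩).2 rfl)
    (fun S hS hR => by simpa using (h S _ _ _ hS hR.1 hR.2.1 hR.2.2).2.2.2.2 rfl)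
  obtain ⟨h1, h2⟩ := deriv_cubic hρ hS (hA S) (hB S) (hC S) (hE S) he
  rw [h1, h2]
  exact ⟨(hd ρ hρ S hS).1.ne', (hd ρ hρ S hS).2.ne'⟩

theorem general_occurs (hn : n ≠ 0) :
    ∃ (D : EosDomain) (p : ℝ → ℝ → ℝ) (c : EosCase), c.number = 1 ∧ IsEos D p ∧
      IsGenericInstance n D c p := by
  refine EosCase.occurs_of_cubic (c := .c1 fun ρ S => S * ρ + S ^ 2 * ρ ^ 2 + S * ρ ^ 3) rfl
    hn (by simp only [EosCase.Admissible]; fun_prop) (fun S => S) (fun S => S ^ 2)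
    (fun S => S) (fun _ => 0) hasDerivAt_id hasDerivAt_sq hasDerivAt_id
    (fun S => hasDerivAt_const S 0) (fun ρ hρ S hS => by simp [EosCase.eos])
    (fun ρ hρ S hS => ⟨by positivity, by positivity⟩) fun S μ F g hS h1 h2 h3 => ?_
  have e1 : F = 2 * μ * S := by linarith
  have e2 : g = -2 * μ := mul_right_cancel₀ (pow_pos hS 2).ne' (by
    rw [e1] at h2; linear_combination h2)
  have e3 : μ = 0 := by
    have : μ * S = 0 := by rw [e1, e2] at h3; linear_combination -h3 / 4
    exact (mul_eq_zero.1 this).resolve_right hS.ne'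
  subst e3
  simp_all

theorem prod_occurs (hn : n ≠ 0) :
    ∃ (D : EosDomain) (p : ℝ → ℝ → ℝ) (c : EosCase), c.number = 2 ∧ IsEos D p ∧
      IsGenericInstance n D c p := by
  refine EosCase.occurs_of_cubic (c := .c2 (fun S => S) fun ρ => ρ + ρ ^ 2) rfl
    hn ⟨regular_id, nonconstSmooth_add_sq (mem_halfLine.2 one_pos)
      (mem_halfLine.2 two_pos)⟩ (fun S => S) (fun S => S)
    (fun _ => 0) (fun _ => 0) hasDerivAt_id hasDerivAt_id (fun S => hasDerivAt_const S 0)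
    (fun S => hasDerivAt_const S 0) (fun ρ hρ S hS => by simp only [EosCase.eos]; ring)
    (fun ρ hρ S hS => ⟨by positivity, by positivity⟩) fun S μ F g hS h1 h2 h3 => ?_
  have e1 : F = 2 * μ * S := by linarith
  have e2 : g = 0 := mul_right_cancel₀ hS.ne' (by rw [e1] at h2; linear_combination h2)
  have hn' : (0 : ℝ) ≠ n := by exact_mod_cast hn.symm
  subst e1 e2
  simp_all

theorem sum_occurs (hn : n ≠ 0) :
    ∃ (D : EosDomain) (p : ℝ → ℝ → ℝ) (c : EosCase), c.number = 3 ∧ IsEos D p ∧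
      IsGenericInstance n D c p := by
  refine EosCase.occurs_of_cubic (c := .c3 (fun S => S) fun ρ => ρ + ρ ^ 2) rfl
    hn ⟨regular_id, nonconstSmooth_add_sq (mem_halfLine.2 one_pos)
      (mem_halfLine.2 two_pos)⟩ (fun _ => 1) (fun _ => 1)
    (fun _ => 0) (fun S => S) (fun S => hasDerivAt_const S 1) (fun S => hasDerivAt_const S 1)
    (fun S => hasDerivAt_const S 0) hasDerivAt_id (fun ρ hρ S hS => by
      simp only [EosCase.eos]; ring)
    (fun ρ hρ S hS => ⟨by positivity, by positivity⟩) fun S μ F g hS h1 h2 h3 => ?_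
  have e1 : μ = 0 := by linarith
  have e2 : g = 0 := by linarith
  subst e1 e2
  simp

theorem scal_occurs (hn : n ≠ 0) :
    ∃ (D : EosDomain) (p : ℝ → ℝ → ℝ) (c : EosCase), c.number = 4 ∧ IsEos D p ∧
      IsGenericInstance n D c p := by
  refine EosCase.occurs_of_cubic (c := .c4 (fun S => S) (fun x => x + x ^ 2) 0) rfl
    hn ⟨regular_id, nonconstSmooth_add_sq (mem_values_id one_pos)
      (mem_values_id two_pos), by norm_num⟩ (fun _ => 0) (fun S => S)
    (fun S => S ^ 2) (fun _ => 0) (fun S => hasDerivAt_const S 0) hasDerivAt_id hasDerivAt_sq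
    (fun S => hasDerivAt_const S 0) (fun ρ hρ S hS => by
      simp only [EosCase.eos, add_zero, Real.rpow_one]; ring)
    (fun ρ hρ S hS => ⟨by positivity, by positivity⟩) fun S μ F g hS h1 h2 h3 => ?_
  have e1 : F = (2 * μ - g) * S := by linarith
  have e2 : μ = 0 := mul_right_cancel₀ (pow_pos hS 2).ne' (by
    rw [e1] at h3; linear_combination h3 / 2)
  subst e1 e2
  refine ⟨by simp, by simp_all, fun h => ⟨rfl, ?_⟩, by simp, by simp⟩
  rw [h.2]
  exact mul_ne_zero (by norm_num) hS.ne'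

theorem logScal_occurs (hn : n ≠ 0) :
    ∃ (D : EosDomain) (p : ℝ → ℝ → ℝ) (c : EosCase), c.number = 5 ∧ IsEos D p ∧
      IsGenericInstance n D c p := by
  refine EosCase.occurs_of_cubic (c := .c5 (fun S => S) (fun x => x + x ^ 2) 0) rfl
    hn ⟨regular_id, nonconstSmooth_add_sq (mem_values_id one_pos)
      (mem_values_id two_pos)⟩ (fun S => S) (fun S => S ^ 2)
    (fun _ => 0) (fun _ => 0) hasDerivAt_id hasDerivAt_sq (fun S => hasDerivAt_const S 0)
    (fun S => hasDerivAt_const S 0) (fun ρ hρ S hS => by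
      simp only [EosCase.eos]; ring)
    (fun ρ hρ S hS => ⟨by positivity, by positivity⟩) fun S μ F g hS h1 h2 h3 => ?_
  have e1 : F = 2 * μ * S := by linarith
  have e2 : g = -2 * μ := mul_right_cancel₀ (pow_pos hS 2).ne' (by
    rw [e1] at h2; linear_combination h2)
  subst e1 e2
  refine ⟨fun h => by linarith [h.1, h.2], fun h => absurd (by rw [h.1]; ring) h.2.2,
    fun h => absurd (by linarith [h.2]) h.1, fun h => ⟨rfl, ?_⟩, fun h => .inl ?_⟩
  · rw [h.1]
    exact mul_ne_zero (by norm_num) hS.ne'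
  · rw [h]
    exact mul_ne_zero (by norm_num) hS.ne'

theorem pow_occurs (hn : 2 ≤ n) :
    ∃ (D : EosDomain) (p : ℝ → ℝ → ℝ) (c : EosCase), c.number = 6 ∧ IsEos D p ∧
      IsGenericInstance n D c p := by
  have hdS : ∀ ρ : ℝ, 0 < ρ → ∀ S : ℝ,
      dS ((EosCase.c6 (fun S => S) 2).eos n) ρ S ≠ 0 := fun ρ hρ S => by
    rw [dS_eq ((hasDerivAt_id S).mul_const _), one_mul]
    exact (Real.rpow_pos_of_pos hρ _).ne'
  -- the exponent is chosen such that `2 ≠ 2 / n`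
  refine EosCase.occurs (c := .c6 (fun S => S) 2) rfl (by omega) ⟨regular_id, by norm_num⟩
    (fun ρ hρ S _ => .inr (hdS ρ hρ S)) fun D hD c' hf hc' => ?_
  have hrel : ∀ {μ F g}, IsReduced D _ μ F g → (∀ ρ ∈ D.I.carrier, ∀ S ∈ D.J.carrier,
      dρ ((EosCase.c6 (fun S => S) 2).eos n) ρ S = (1 + 2) * S * ρ ^ (2 : ℝ)) ∧
      ∀ S ∈ D.J.carrier, F S * deriv (fun S => S) S = (2 * μ - 2 * g S) * S := fun hr =>
    hr.pow_relation (κ := fun S => S) (q := 2) (p₀ := 0) contDiffOn_id (by norm_num)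
      fun ρ _ S _ => (add_zero _).symm
  obtain ⟨ρ, hρ⟩ := D.I.nonempty
  obtain ⟨S, hS⟩ := D.J.nonempty
  have hS0 : 0 < S := hD.2 hS
  have hdS := hdS ρ (hD.1 hρ) S
  have hn' : (2 : ℝ) ≤ n := by exact_mod_cast hn
  cases c' with
  | c6 κ q => exact absurd rfl hc'
  | c7 κ k => nlinarith [(hrel hf.1).2 S hS]
  | c8 κ => nlinarith [(hrel hf.1).2 S hS]
  | c10 κ =>
    have h1 := (hrel hf.1).1 ρ hρ S hS
    rw [(hf.2 ρ hρ S hS).1] at h1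
    have := Real.rpow_pos_of_pos (D.ρ_pos hρ) 2
    exact absurd h1.symm (by positivity)
  | c11 k => exact absurd (hf.2 ρ hρ S hS) hdS
  | c12 k q => exact absurd (hf.2.2 ρ hρ S hS) hdS
  | c13 k => exact absurd (hf.2 ρ hρ S hS) hdS
  | _ => simp [EosCase.size]

theorem log_occurs (hn : n ≠ 0) :
    ∃ (D : EosDomain) (p : ℝ → ℝ → ℝ) (c : EosCase), c.number = 7 ∧ IsEos D p ∧
      IsGenericInstance n D c p := by
  have hdS : ∀ ρ S : ℝ, dS ((EosCase.c7 (fun S => S) 1).eos n) ρ S ≠ 0 := fun ρ S => by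
    rw [dS_eq ((hasDerivAt_id S).add_const _)]
    exact one_ne_zero
  refine EosCase.occurs (c := .c7 (fun S => S) 1) rfl hn ⟨regular_id, one_ne_zero⟩
    (fun ρ _ S _ => .inr (hdS ρ S)) fun D hD c' hf hc' => ?_
  obtain ⟨ρ, hρ⟩ := D.I.nonempty
  obtain ⟨S, hS⟩ := D.J.nonempty
  have hrel : ∀ {μ F g}, IsReduced D _ μ F g → g S = -2 * μ := fun hr =>
    hr.log_relation (κ := fun S => S) (k := 1) (p₀ := 0) one_ne_zero
      (fun ρ _ S _ => (add_zero _).symm) S hS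
  have hdS := hdS ρ S
  have hn' : (0 : ℝ) ≤ n := n.cast_nonneg
  cases c' with
  | c6 κ q => exact absurd (by linarith [hrel hf.2.1]) hf.1
  | c7 κ k => exact absurd rfl hc'
  | c8 κ => linarith [hrel hf.1]
  | c10 κ =>
    have h1 := (hf.2 ρ hρ S hS).1
    have h0 := (D.ρ_pos hρ).ne'
    rw [dρ_eq (((Real.hasDerivAt_log h0).const_mul 1).const_add S), one_mul] at h1
    exact absurd h1 (inv_ne_zero h0)
  | c11 k => exact absurd (hf.2 ρ hρ S hS) hdS
  | c12 k q => exact absurd (hf.2.2 ρ hρ S hS) hdS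
  | c13 k => exact absurd (hf.2 ρ hρ S hS) hdS
  | _ => simp [EosCase.size]

theorem conf_occurs (hn : n ≠ 0) :
    ∃ (D : EosDomain) (p : ℝ → ℝ → ℝ) (c : EosCase), c.number = 8 ∧ IsEos D p ∧
      IsGenericInstance n D c p := by
  have hdS : ∀ ρ : ℝ, 0 < ρ → ∀ S : ℝ,
      dS ((EosCase.c8 fun S => S).eos n) ρ S ≠ 0 := fun ρ hρ S => by
    rw [dS_eq ((hasDerivAt_id S).mul_const _), one_mul]
    exact (Real.rpow_pos_of_pos hρ _).ne'
  refine EosCase.occurs (c := .c8 fun S => S) rfl hn regular_id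
    (fun ρ hρ S _ => .inr (hdS ρ hρ S)) fun D hD c' hf hc' => ?_
  obtain ⟨ρ, hρ⟩ := D.I.nonempty
  obtain ⟨S, hS⟩ := D.J.nonempty
  cases c' with
  | c8 κ => exact absurd rfl hc'
  | c13 k => exact absurd (hf.2 ρ hρ S hS) (hdS ρ (hD.1 hρ) S)
  | _ => simp [EosCase.size]

/-- The function `ρ + ρ²` is neither logarithmic nor a power function, up to constants. -/
theorem admissible_add_sq (D : EosDomain) : (EosCase.c9 fun ρ => ρ + ρ ^ 2).Admissible D := by
  have hf : ∀ x : ℝ, HasDerivAt (fun ρ : ℝ => ρ + ρ ^ 2) (1 + 2 * x) x := fun x =>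
    (hasDerivAt_id x).add (hasDerivAt_sq x)
  have hf' : deriv (fun ρ : ℝ => ρ + ρ ^ 2) = fun x => 1 + 2 * x := funext fun x => (hf x).deriv
  have hg : ∀ x : ℝ, HasDerivAt (fun x : ℝ => x * (1 + 2 * x)) (1 + 4 * x) x := fun x =>
    ((hasDerivAt_id x).mul (((hasDerivAt_id x).const_mul 2).const_add 1)).congr_deriv (by
      simp only [id]; ring)
  obtain ⟨ρ₀, hρ₀⟩ := D.I.nonempty
  refine ⟨nonconstSmooth_of_deriv (by fun_prop) hρ₀ ?_, fun I' hI' => ⟨?_, fun C hC => ?_⟩⟩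
  · have : 0 < ρ₀ := D.pos hρ₀
    rw [hf']
    positivity
  · obtain ⟨ρ, hρ⟩ := I'.nonempty
    have : 0 < ρ := D.pos (hI' hρ)
    refine ⟨ρ, hρ, ?_⟩
    rw [hf', (hg ρ).deriv]
    positivity
  · by_contra! h
    -- the numerator of the derivative of `ρ f' / (f + C)` is `ρ² + 4 C ρ + C`
    have := I'.quadratic_eq_zero (a := C) (b := 4 * C) (c := 1) fun x hx => by
      have h1 : deriv (fun x => x * (1 + 2 * x) / (x + x ^ 2 + C)) x = _ :=
        ((hg x).div ((hf x).add_const C) (hC x hx)).deriv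
      have h2 := h x hx
      rw [hf', h1, div_eq_zero_iff] at h2
      have h2 := h2.resolve_right (pow_ne_zero 2 (hC x hx))
      linear_combination h2
    exact one_ne_zero this.2.2

theorem barotropic_occurs (hn : n ≠ 0) :
    ∃ (D : EosDomain) (p : ℝ → ℝ → ℝ) (c : EosCase), c.number = 9 ∧ IsEos D p ∧
      IsGenericInstance n D c p := by
  have hdS : ∀ ρ S : ℝ, dS ((EosCase.c9 fun ρ => ρ + ρ ^ 2).eos n) ρ S = 0 := fun ρ S =>
    deriv_const S _
  refine EosCase.occurs (c := .c9 fun ρ => ρ + ρ ^ 2) rfl hn (admissible_add_sq _)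
    (fun ρ hρ S _ => .inl ?_) fun D hD c' hf hc' => ?_
  · have : dρ ((EosCase.c9 fun ρ => ρ + ρ ^ 2).eos n) ρ S = 1 + 2 * ρ :=
      dρ_eq ((hasDerivAt_id ρ).add (hasDerivAt_sq ρ))
    rw [this]
    positivity
  obtain ⟨ρ, hρ⟩ := D.I.nonempty
  obtain ⟨S, hS⟩ := D.J.nonempty
  have hrel : ∀ {μ F g}, IsReduced D _ μ F g → μ = 0 ∧ g S = 0 := fun hr =>
    (hr.barotropic_relation (p₀ := 0) (admissible_add_sq D)
      fun ρ _ S _ => (add_zero _).symm).imp_right fun h => h S hS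
  cases c' with
  | c1 f => simp [EosCase.size]
  | c2 κ f => exact absurd (hrel hf.choose_spec).1 one_ne_zero
  | c3 κ f => exact absurd (hdS ρ S) (hf.2 ρ hρ S hS)
  | c4 κ f q => exact absurd (hrel hf.2.choose_spec).2 two_ne_zero
  | c5 κ f k => exact absurd (hrel hf.choose_spec).1 one_ne_zero
  | c6 κ q => exact absurd (hrel hf.2.1).2 two_ne_zero
  | c7 κ k => exact absurd (hrel hf.1).1 one_ne_zero
  | c8 κ => exact absurd (hrel hf.1).1 one_ne_zero
  | c9 f => exact absurd rfl hc'
  | c10 κ => exact absurd (hrel hf.1).1 one_ne_zero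
  | c11 k => exact absurd (hrel hf.1).1 one_ne_zero
  | c12 k q => exact absurd (hrel hf.2.1).2 two_ne_zero
  | c13 k => exact absurd (hrel hf.1).1 one_ne_zero

theorem isochoric_occurs (hn : n ≠ 0) :
    ∃ (D : EosDomain) (p : ℝ → ℝ → ℝ) (c : EosCase), c.number = 10 ∧ IsEos D p ∧
      IsGenericInstance n D c p := by
  have hdS : ∀ ρ S : ℝ, dS ((EosCase.c10 fun S => S).eos n) ρ S ≠ 0 := fun ρ S => by
    rw [dS_eq (hasDerivAt_id S)]
    exact one_ne_zero
  refine EosCase.occurs (c := .c10 fun S => S) rfl hn regular_id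
    (fun ρ _ S _ => .inr (hdS ρ S)) fun D hD c' hf hc' => ?_
  obtain ⟨ρ, hρ⟩ := D.I.nonempty
  obtain ⟨S, hS⟩ := D.J.nonempty
  have hrel : ∀ {μ g}, IsReduced D _ μ (fun _ => 0) g → g S = -2 * μ := fun {μ g} hr => by
    rw [hr.isochoric_relation (κ := fun S => S) (p₀ := 0)
      ⟨contDiffOn_id, fun S _ => by simp⟩ (fun ρ _ S _ => (add_zero _).symm) S hS]
    simp
  have hdS := hdS ρ S
  have hn' : (0 : ℝ) ≤ n := n.cast_nonneg
  cases c' with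
  | c6 κ q => exact absurd (by linarith [hrel hf.2.1]) hf.1
  | c7 κ k => exact absurd (deriv_const ρ S) (hf.2 ρ hρ S hS).1
  | c8 κ => linarith [hrel hf.1]
  | c10 κ => exact absurd rfl hc'
  | c11 k => exact absurd (hf.2 ρ hρ S hS) hdS
  | c12 k q => exact absurd (hf.2.2 ρ hρ S hS) hdS
  | c13 k => exact absurd (hf.2 ρ hρ S hS) hdS
  | _ => simp [EosCase.size]

theorem barotropicLog_occurs (hn : n ≠ 0) :
    ∃ (D : EosDomain) (p : ℝ → ℝ → ℝ) (c : EosCase), c.number = 11 ∧ IsEos D p ∧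
      IsGenericInstance n D c p := by
  have hdS : ∀ ρ S : ℝ, dS ((EosCase.c11 1).eos n) ρ S = 0 := fun ρ S => deriv_const S _
  refine EosCase.occurs (c := .c11 1) rfl hn one_ne_zero
    (fun ρ hρ S _ => .inl ?_) fun D hD c' hf hc' => ?_
  · rw [dρ_eq ((Real.hasDerivAt_log hρ.ne').const_mul 1)]
    positivity
  obtain ⟨ρ, hρ⟩ := D.I.nonempty
  obtain ⟨S, hS⟩ := D.J.nonempty
  have hrel : ∀ {μ F g}, IsReduced D ((EosCase.c11 1).eos n) μ F g → g S = -2 * μ := fun hr =>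
    hr.log_relation (κ := fun _ => 0) (k := 1) (p₀ := 0) one_ne_zero
      (fun ρ _ S _ => by simp [EosCase.eos]) S hS
  have hdS := hdS ρ S
  have hn' : (0 : ℝ) ≤ n := n.cast_nonneg
  cases c' with
  | c6 κ q => exact absurd hdS (hf.2.2 ρ hρ S hS)
  | c7 κ k => exact absurd hdS (hf.2 ρ hρ S hS).2
  | c8 κ => exact absurd hdS (hf.2 ρ hρ S hS)
  | c10 κ => exact absurd hdS (hf.2 ρ hρ S hS).2
  | c11 k => exact absurd rfl hc'
  | c12 k q => exact absurd (by linarith [hrel hf.2.1]) hf.1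
  | c13 k => linarith [hrel hf.1]
  | _ => simp [EosCase.size]

theorem barotropicPow_occurs (hn : 2 ≤ n) :
    ∃ (D : EosDomain) (p : ℝ → ℝ → ℝ) (c : EosCase), c.number = 12 ∧ IsEos D p ∧
      IsGenericInstance n D c p := by
  have hdS : ∀ ρ S : ℝ, dS ((EosCase.c12 1 2).eos n) ρ S = 0 := fun ρ S => deriv_const S _
  -- the exponent is chosen such that `2 ≠ 2 / n`
  refine EosCase.occurs (c := .c12 1 2) rfl (by omega) ⟨one_ne_zero, by norm_num⟩
    (fun ρ hρ S _ => .inl ?_) fun D hD c' hf hc' => ?_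
  · rw [dρ_eq ((hasDerivAt_rpow_one_add hρ 2).const_mul 1)]
    positivity
  obtain ⟨ρ, hρ⟩ := D.I.nonempty
  obtain ⟨S, hS⟩ := D.J.nonempty
  have hrel : ∀ {μ F g}, IsReduced D _ μ F g → 2 * μ - 2 * g S = 0 := fun hr => by
    have := (hr.pow_relation (κ := fun _ => 1) (q := 2) (p₀ := 0) contDiffOn_const (by norm_num)
      fun ρ _ S _ => (add_zero _).symm).2 S hS
    simpa using this.symm
  have hdS := hdS ρ S
  have hn' : (2 : ℝ) ≤ n := by exact_mod_cast hn
  cases c' with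
  | c6 κ q => exact absurd hdS (hf.2.2 ρ hρ S hS)
  | c7 κ k => exact absurd hdS (hf.2 ρ hρ S hS).2
  | c8 κ => exact absurd hdS (hf.2 ρ hρ S hS)
  | c10 κ => exact absurd hdS (hf.2 ρ hρ S hS).2
  | c11 k => linarith [hrel hf.1]
  | c12 k q => exact absurd rfl hc'
  | c13 k => linarith [hrel hf.1]
  | _ => simp [EosCase.size]

theorem barotropicConf_occurs (hn : n ≠ 0) :
    ∃ (D : EosDomain) (p : ℝ → ℝ → ℝ) (c : EosCase), c.number = 13 ∧ IsEos D p ∧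
      IsGenericInstance n D c p := by
  refine EosCase.occurs (c := .c13 1) rfl hn one_ne_zero
    (fun ρ hρ S _ => .inl ?_) fun D hD c' hf hc' => ?_
  · rw [dρ_eq ((hasDerivAt_rpow_one_add hρ _).const_mul 1)]
    positivity
  obtain ⟨ρ, hρ⟩ := D.I.nonempty
  obtain ⟨S, hS⟩ := D.J.nonempty
  cases c' with
  | c8 κ => exact absurd (deriv_const S _) (hf.2 ρ hρ S hS)
  | c13 k => exact absurd rfl hc'
  | _ => simp [EosCase.size]

theorem exists_generic_instance (hn : 2 ≤ n) {i : ℕ} (hi : i ∈ Finset.Icc 1 13) :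
    ∃ (D : EosDomain) (p : ℝ → ℝ → ℝ) (c : EosCase), c.number = i ∧ IsEos D p ∧
      IsGenericInstance n D c p := by
  have hn0 : n ≠ 0 := by omega
  obtain ⟨h1, h13⟩ := Finset.mem_Icc.1 hi
  interval_cases i
  exacts [general_occurs hn0, prod_occurs hn0, sum_occurs hn0, scal_occurs hn0, logScal_occurs hn0,
    pow_occurs hn, log_occurs hn0, conf_occurs hn0, barotropic_occurs hn0, isochoric_occurs hn0,
    barotropicLog_occurs hn0, barotropicPow_occurs hn, barotropicConf_occurs hn0]

end

end RadialEuler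

end

open RadialEuler in
theorem theorem1 (n : ℕ) (hn : 2 ≤ n) :
    -- (i), (ii): a general equation of state has only the symmetries spanned by `X1`, `X2`;
    -- further ones exist for the exceptional equations of state, and only for these
    (∀ (D : EosDomain) (p : ℝ → ℝ → ℝ) (K : KinDomain), IsEos D p →
      IsPointSymmetry n p (box K D) X1 ∧ IsPointSymmetry n p (box K D) X2 ∧
      ((∀ D' : EosDomain, D'.Sub D → ¬ IsExceptional n D' p) →
        SymmetriesAre n p (box K D) {X1, X2}) ∧
      (IsExceptional n D p →
        ∃ X : VField, IsPointSymmetry n p (box K D) X ∧ ¬ InSpan (box K D) {X1, X2} X)) ∧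
    -- (iii) in each case the listed generators are symmetries, with the listed commutators and
    -- the listed algebra
    (∀ (D : EosDomain) (p : ℝ → ℝ → ℝ) (K : KinDomain) (c : EosCase), IsInstance n D c p →
      (∀ X ∈ c.generators n D, IsPointSymmetry n p (box K D) X) ∧
      c.Commutators n D (box K D) ∧ c.Algebra n D (box K D)) ∧
    -- (iii) the listed algebra is the full symmetry algebra, unless the equation of state
    -- specializes to another case with as many symmetries
    (∀ (D : EosDomain) (p : ℝ → ℝ → ℝ) (K : KinDomain) (c : EosCase), IsEos D p →
      IsGenericInstance n D c p → SymmetriesAre n p (box K D) (c.generators n D)) ∧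
    -- (iii) each case occurs
    (∀ i ∈ Finset.Icc 1 13, ∃ (D : EosDomain) (p : ℝ → ℝ → ℝ) (c : EosCase), c.number = i ∧
      IsEos D p ∧ IsGenericInstance n D c p) ∧
    -- (iii) completeness: near a generic point, all symmetries of any equation of state are
    -- linear combinations of the listed generators of the cases of which it is an instance
    (∀ (D : EosDomain) (p : ℝ → ℝ → ℝ), IsEos D p →
      ∃ D' : EosDomain, D'.Sub D ∧ ∀ K : KinDomain,
        SymmetriesAre n p (box K D')
          (⋃ c ∈ {c : EosCase | IsInstance n D' c p}, c.generators n D')) := by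
  have hn0 : n ≠ 0 := by omega
  refine ⟨fun D p K hp => ⟨isSymField_X1.isPointSymmetry hp.smooth2 K,
      isSymField_X2.isPointSymmetry hp.smooth2 K, fun hno => ?_,
      fun h => h.exists_symmetry hn0 hp.smooth2 K⟩,
    fun D p K c h => ⟨fun X hX => (h.isSymField hn hX).isPointSymmetry h.smooth2 K,
      h.1.commutators, h.1.algebra hn0⟩,
    fun D p K c hp h => h.symmetriesAre hn hp,
    fun i hi => exists_generic_instance hn hi,
    fun D p hp => exists_symmetriesAre_instanceGenerators hn hp⟩
  refine symmetriesAre_of_general hn hp fun D' hD' c hc => ?_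
  by_contra hc1
  exact hno D' hD' (hc.isExceptional hc1)
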